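/- Let $\mathcal F$ be the symmetric Fock space over $L^2(\mathbb R^3\times\{1,2\})$ with vacuum $|0\rangle$, and on $L^2(\mathbb R^3)\otimes\mathcal F$ consider the self-adjoint operator $$T=(p+\sqrt\alpha\,A(x))^2+H_f,\qquad p=-i\nabla_x,$$ (the operator of the closed quadratic form $\|(p+\sqrt\alpha A(x))\Psi\|^2+\|H_f^{1/2}\Psi\|^2$ on the form domain of $p^2+H_f$), where $A(x)=D(x)+D^*(x)$, $$D(x)=\sum_{\lambda=1,2}\int_{\mathbb R^3}G^\lambda(k)\,a_\lambda(k)e^{ik\cdot x}\,dk,\qquad G^\lambda(k)=\frac{\mathbf 1(|k|\le\Lambda)}{2\pi|k|^{1/2}}\,\varepsilon_\lambda(k),$$ with $\varepsilon_1(k),\varepsilon_2(k)\in\mathbb R^3$ orthonormal and perpendicular to $k$ (and measurable in $k$), and $$H_f=\sum_\lambda\int|k|\,a^*_\lambda(k)a_\lambda(k)\,dk,\qquad P_f=\sum_\lambda\int k\,a^*_\lambda(k)a_\lambda(k)\,dk.$$ Let $\Sigma_\alpha=\inf\operatorname{spec}T$ and, with $D=D(0)$, $$\mathcal E_0=\langle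 0|\,D\cdot D\,[P_f^2+H_f]^{-1}D^*\cdot D^*\,|0\rangle .$$ Then there are constants $C>0$ and $\alpha_0>0$, independent of $\alpha$, of $\Lambda$ and of the choice of the polarization vectors, such that for all $\Lambda>0$ and all $0<\alpha<\alpha_0$ $$\bigl|\Sigma_\alpha-\alpha\pi^{-1}\Lambda^2+\alpha^2\mathcal E_0\bigr|\le C\alpha^3\Lambda^4 .$$ -/

import Mathlib

open MeasureTheory
open scoped ContDiff ComplexConjugate

noncomputable section

namespace PauliFierz

/-- Physical space and momentum space `ℝ³`. -/
abbrev R3 : Type := EuclideanSpace ℝ (Fin 3)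

/-- The label `(k, λ)` of one photon: momentum `k` and polarization index `λ`. -/
abbrev Mode : Type := R3 × Fin 2

/-- `∑_λ ∫ dk` on one-photon labels. -/
def modeMeasure : Measure Mode := (volume : Measure R3).prod Measure.count

instance : SigmaFinite modeMeasure := by
  unfold modeMeasure; infer_instance

/-- The measure `∑_{λ₁,…,λₙ} ∫ dk₁ ⋯ dkₙ` on `n`-photon labels. -/
def photonMeasure (n : ℕ) : Measure (Fin n → Mode) := Measure.pi fun _ => modeMeasure

instance (n : ℕ) : SigmaFinite (photonMeasure n) := by
  unfold photonMeasure; infer_instance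

/-- The measure `∑_λ ∫ dx dk₁ ⋯ dkₙ` for one particle and `n` photons. -/
def sectorMeasure (n : ℕ) : Measure (R3 × (Fin n → Mode)) :=
  (volume : Measure R3).prod (photonMeasure n)

/-- Relabelling of the photons by a permutation. -/
def permute {n : ℕ} (σ : Equiv.Perm (Fin n)) (q : R3 × (Fin n → Mode)) :
    R3 × (Fin n → Mode) := (q.1, fun i => q.2 (σ i))

theorem measurePreserving_permute {n : ℕ} (σ : Equiv.Perm (Fin n)) :
    MeasurePreserving (permute σ) (sectorMeasure n) (sectorMeasure n) := by
  have h : MeasurePreserving (fun K : Fin n → Mode => fun i => K (σ i))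
      (photonMeasure n) (photonMeasure n) := by
    have h0 := measurePreserving_piCongrLeft (α := fun _ : Fin n => Mode)
      (fun _ : Fin n => modeMeasure) σ.symm
    have e : (MeasurableEquiv.piCongrLeft (fun _ : Fin n => Mode) σ.symm :
        (Fin n → Mode) → (Fin n → Mode)) = fun K => fun i => K (σ i) := by
      funext K i
      have := MeasurableEquiv.piCongrLeft_apply_apply (β := fun _ : Fin n => Mode) σ.symm K (σ i)
      simpa using this
    rw [e] at h0
    exact h0
  exact (MeasurePreserving.id (volume : Measure R3)).prod h

/-- The `n`-photon sector `L²(ℝ³) ⊗ Sym^n L²(ℝ³ × {1,2})`: square-integrable functions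
`ψₙ(x, k₁, …, kₙ; λ₁, …, λₙ)` invariant under permutations of the photons. -/
def Sector (n : ℕ) : Submodule ℂ (Lp ℂ 2 (sectorMeasure n)) :=
  ⨅ σ : Equiv.Perm (Fin n), LinearMap.eqLocus
    (Lp.compMeasurePreservingₗᵢ ℂ (permute σ) (measurePreserving_permute σ)).toLinearMap
    LinearMap.id

/-- The Hilbert space `L²(ℝ³) ⊗ 𝓕`, with `𝓕` the symmetric Fock space of photons. -/
abbrev StateSpace : Type := lp (fun n : ℕ => Sector n) 2

/-- The `n`-photon component `ψₙ(x, K)` of a state. -/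
def comp (Ψ : StateSpace) (n : ℕ) (x : R3) (K : Fin n → Mode) : ℂ :=
  ((Ψ n : Sector n) : Lp ℂ 2 (sectorMeasure n)) (x, K)

/-- Two orthonormal polarization vectors perpendicular to `k`, depending measurably on `k`. -/
structure IsPolarization (ε : R3 → Fin 2 → R3) : Prop where
  measurable : Measurable ε
  orthonormal : ∀ k, k ≠ 0 → Orthonormal ℝ (ε k)
  transverse : ∀ k, k ≠ 0 → ∀ l, inner ℝ k (ε k l) = 0

/-- The coupling function `G^λ(k) = χ(|k|) / (2π |k|^{1/2}) ε_λ(k)`, `j`-th coordinate, with the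
sharp ultraviolet cutoff `χ(|k|) = 1` for `|k| ≤ Λ` and `0` otherwise. -/
def coupling (ε : R3 → Fin 2 → R3) (Λ : ℝ) (j : Fin 3) (q : Mode) : ℝ :=
  (if ‖q.1‖ ≤ Λ then 1 else 0) / (2 * Real.pi * Real.sqrt ‖q.1‖) * ε q.1 q.2 j

/-- The phase `e^{i k·x}`. -/
def phase (x : R3) (q : Mode) : ℂ := Complex.exp (Complex.I * (inner ℝ q.1 x : ℝ))

/-- `D_j(x) = ∑_λ ∫ G^λ_j(k) a_λ(k) e^{ikx} dk` from `n + 1` photons to `n` photons. -/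
def annihilate (ε : R3 → Fin 2 → R3) (Λ : ℝ) (j : Fin 3) (x : R3) {n : ℕ}
    (f : (Fin (n + 1) → Mode) → ℂ) (K : Fin n → Mode) : ℂ :=
  (Real.sqrt (n + 1) : ℂ) *
    ∫ q, (coupling ε Λ j q : ℂ) * phase x q * f (Fin.cons q K) ∂modeMeasure

/-- `D_j(x)^* = ∑_λ ∫ G^λ_j(k) a_λ(k)^* e^{-ikx} dk` from `n` photons to `n + 1` photons. -/
def create (ε : R3 → Fin 2 → R3) (Λ : ℝ) (j : Fin 3) (x : R3) {n : ℕ}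
    (f : (Fin n → Mode) → ℂ) (K : Fin (n + 1) → Mode) : ℂ :=
  (Real.sqrt (n + 1) : ℂ)⁻¹ *
    ∑ i, (coupling ε Λ j (K i) : ℂ) * conj (phase x (K i)) * f (i.removeNth K)

/-- `A_j(x) = D_j(x) + D_j(x)^*` acting on a sequence of photon wave functions. -/
def vectorPotential (ε : R3 → Fin 2 → R3) (Λ : ℝ) (j : Fin 3) (x : R3)
    (f : ∀ n : ℕ, (Fin n → Mode) → ℂ) : ∀ n : ℕ, (Fin n → Mode) → ℂ
  | 0, K => annihilate ε Λ j x (f 1) K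
  | n + 1, K => annihilate ε Λ j x (f (n + 2)) K + create ε Λ j x (f n) K

/-- The eigenvalue `|k₁| + ⋯ + |kₙ|` of the field energy `H_f`. -/
def fieldEnergy {n : ℕ} (K : Fin n → Mode) : ℝ := ∑ i, ‖(K i).1‖

/-- The eigenvalue `k₁ + ⋯ + kₙ` of the field momentum `P_f`. -/
def fieldMomentum {n : ℕ} (K : Fin n → Mode) : R3 := ∑ i, (K i).1

/-- `Ψ` is in the domain of `p_j = -i ∂/∂x_j` and `p_j Ψ = Φ`: for almost all photon variables,
the derivative holds in the weak sense on `ℝ³`. -/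
def IsMomentum (j : Fin 3) (Ψ Φ : StateSpace) : Prop :=
  ∀ n : ℕ, ∀ᵐ K ∂(photonMeasure n), ∀ φ : R3 → ℂ, ContDiff ℝ ∞ φ → HasCompactSupport φ →
    ∫ x, comp Φ n x K * φ x =
      Complex.I * ∫ x, comp Ψ n x K * fderiv ℝ φ x (EuclideanSpace.single j 1)

/-- `Ψ` is in the domain of `H_f^{1/2}` and `H_f^{1/2} Ψ = Φ`. -/
def IsSqrtFieldEnergy (Ψ Φ : StateSpace) : Prop :=
  ∀ n : ℕ, ∀ᵐ q ∂(sectorMeasure n),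
    comp Φ n q.1 q.2 = (Real.sqrt (fieldEnergy q.2) : ℂ) * comp Ψ n q.1 q.2

/-- `A_j(x) Ψ = Φ`, for `Ψ` in the domain of `H_f^{1/2}` (where the integrals converge absolutely
at almost every point). -/
def IsVectorPotential (ε : R3 → Fin 2 → R3) (Λ : ℝ) (j : Fin 3) (Ψ Φ : StateSpace) : Prop :=
  ∀ n : ℕ, ∀ᵐ q ∂(sectorMeasure n),
    comp Φ n q.1 q.2 = vectorPotential ε Λ j q.1 (fun m => comp Ψ m q.1) n q.2

/-- `(p_j + √α A_j(x)) Ψ = Φ`. -/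
def IsKinetic (ε : R3 → Fin 2 → R3) (Λ α : ℝ) (j : Fin 3) (Ψ Φ : StateSpace) : Prop :=
  ∃ M B : StateSpace, IsMomentum j Ψ M ∧ IsVectorPotential ε Λ j Ψ B ∧
    Φ = M + (Real.sqrt α : ℂ) • B

/-- `Ψ` is in the form domain of `p² + H_f`, with `(p + √α A(x)) Ψ = V` and `H_f^{1/2} Ψ = F`. -/
def IsFormData (ε : R3 → Fin 2 → R3) (Λ α : ℝ) (Ψ : StateSpace) (V : Fin 3 → StateSpace)
    (F : StateSpace) : Prop :=
  IsSqrtFieldEnergy Ψ F ∧ ∀ j, IsKinetic ε Λ α j Ψ (V j)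

/-- The graph of the self-energy operator `T = (p + √α A(x))² + H_f`, the self-adjoint operator
of the closed quadratic form `‖(p + √α A(x)) Ψ‖² + ‖H_f^{1/2} Ψ‖²` on the form domain of
`p² + H_f`: a pair `(Ψ, η)` is in the graph if `Ψ` is in the form domain and the sesquilinear form
satisfies `t(Φ, Ψ) = ⟪Φ, η⟫` for all `Φ` in the form domain; then `T Ψ = η`. On the domain of
`p² + H_f` this is the operator sum of the squares `(p_j + √α A_j(x))²` and `H_f`. -/
def selfEnergyGraph (ε : R3 → Fin 2 → R3) (Λ α : ℝ) : Set (StateSpace × StateSpace) :=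
  {p | ∃ V F, IsFormData ε Λ α p.1 V F ∧ ∀ Φ W E, IsFormData ε Λ α Φ W E →
    ∑ j, inner ℂ (W j) (V j) + inner ℂ E F = inner ℂ Φ p.2}

/-- The spectrum of the operator `T` with graph `g`: the complement of the set of those `z` for
which `T - z` is a bijection from the domain of `T` onto the Hilbert space with bounded inverse
`R`. -/
def graphSpectrum (g : Set (StateSpace × StateSpace)) : Set ℂ :=
  {z | ¬ ∃ R : StateSpace →L[ℂ] StateSpace, ∀ Ψ η, (Ψ, η + z • Ψ) ∈ g ↔ R η = Ψ}

/-- The set of real points of the spectrum of `T` (all of it, as `T` is self-adjoint). -/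
def selfEnergySpectrum (ε : R3 → Fin 2 → R3) (Λ α : ℝ) : Set ℝ :=
  {E | (E : ℂ) ∈ graphSpectrum (selfEnergyGraph ε Λ α)}

/-- The vacuum `|0⟩`. -/
def vacuum : (Fin 0 → Mode) → ℂ := fun _ => 1

/-- The two-photon wave function of `D^* · D^* |0⟩`, with `D^* = D^*(0)`. -/
def pairState (ε : R3 → Fin 2 → R3) (Λ : ℝ) (K : Fin 2 → Mode) : ℂ :=
  ∑ j, create ε Λ j 0 (create ε Λ j 0 vacuum) K

/-- `[P_f² + H_f]⁻¹` on `n ≥ 1` photons. -/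
def freeResolvent {n : ℕ} (f : (Fin n → Mode) → ℂ) (K : Fin n → Mode) : ℂ :=
  ((‖fieldMomentum K‖ ^ 2 + fieldEnergy K : ℝ) : ℂ)⁻¹ * f K

/-- `𝓔₀ = ⟨0| D · D [P_f² + H_f]⁻¹ D^* · D^* |0⟩`, with `D = D(0)`. -/
def secondOrderEnergy (ε : R3 → Fin 2 → R3) (Λ : ℝ) : ℂ :=
  ∑ j, annihilate ε Λ j 0 (annihilate ε Λ j 0 (freeResolvent (pairState ε Λ))) Fin.elim0

end PauliFierz

end

/-! The operator is that of a closed form, so its spectrum begins at the infimum of the Rayleigh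
quotients (`isGLB_formOperator_spectrum`), and matching lower bounds and trial states are enough.
Write M = pΨ, F = H_f^{1/2}Ψ, Y = DΨ, X = D^*Ψ. Transversality (p commutes with A after contraction)
and the commutation relation D D^* = ‖G‖² + D^* D turn the form into ‖M‖² + ‖F‖² + α(2‖Y‖² +
(Λ²/π)‖Ψ‖² + 2 Re⟨X, Y⟩) + 4√α Re⟨M, Y⟩ (`sum_norm_kinetic_sq`). The constant gives the first order
αΛ²/π; the second order comes from ⟨X, Y⟩ = ⟨D^*·D^*Ψ, Ψ⟩.

Lower bound. Let Θ be Ψ with an additional photon pair of amplitude φ(q,q') = G(q)·G(q') / (|q+q'|²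
+ |q| + |q'|), which is [P_f² + H_f]⁻¹ D^*·D^* on the vacuum, but created only where both photons
are harder than all photons already present. Up to errors of size Λ(‖M‖² + ‖F‖²), ⟨D^*·D^*Ψ, Ψ⟩ is
the free form p² + H_f between Θ and Ψ. Completing the square yields the free energy of Ψ + αΘ minus
α² times that of Θ, and the latter is at most (1 + αΛ)𝓔₀‖Ψ‖² plus small terms
(`pair_free_energy_le`).

The restriction to hard pairs removes every dependence on the photon number. A hard pair can be
recognised in the final configuration up to its order, so the operator creating it is bounded
uniformly in the number of photons, with the sharp constant (`norm_pairOp_sq_le`). What is dropped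
has a photon softer than the energy h of the other photons; such pairs have weight O(Λ²h), so the
dropped part is form bounded by H_f (`norm_sum_inner_creation_annihilation_sub_le`).

The term 4√α Re⟨M, Y⟩ is expanded around Ψ + αΘ. Young's inequality covers everything except
α^{5/2}⟨pΘ, DΘ⟩, for which the overlap of two pair states with one photon annihilated is estimated
by a Schur type argument (`norm_inner_pairOp_annihilation_le`). For αΛ ≤ 1/1000 the errors are
absorbed by the free energy of Ψ + αΘ, up to O(α³Λ⁴) (`energy_lower_bound`).

Upper bound. The trial state is ψ⊗|0⟩ - αΘ with ψ slowly varying (`exists_trial_state`); its cross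
terms vanish because the photon numbers differ. If αΛ > 1/1000, all three terms of the expansion are
themselves O(α³Λ⁴), and vacuum states suffice. -/

open MeasureTheory
open scoped ContDiff ComplexConjugate

noncomputable section

/-! ### Closed quadratic forms: bottom of the spectrum and Rayleigh quotients. -/

section FormSpectrum

open scoped InnerProductSpace
open ContinuousLinearMap

variable {H E : Type*} [NormedAddCommGroup H] [InnerProductSpace ℂ H]
  [NormedAddCommGroup E] [InnerProductSpace ℂ E]

/-- The operator of the quadratic form `‖v‖²`, `(Ψ, v) ∈ 𝒢`. -/
def formOperator (𝒢 : Submodule ℂ (WithLp 2 (H × E))) : Set (H × H) :=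
  {p | ∃ v, WithLp.toLp 2 (p.1, v) ∈ 𝒢 ∧
    ∀ Φ w, WithLp.toLp 2 (Φ, w) ∈ 𝒢 → inner ℂ w v = inner ℂ Φ p.2}

/-- Cauchy–Schwarz for the nonnegative form q(Φ) = ‖w‖² - m‖Φ‖². Polarised at Φ and RΦ it gives
‖Φ‖², so ‖Φ‖⁴ ≤ q(Φ) q(RΦ), while q(RΦ) = ⟨RΦ, Φ⟩ ≤ ‖R‖‖Φ‖². Hence a bound m with resolvent R is not
the best one. -/
theorem formOperator_lower_bound_of_resolvent {H E : Type*} [NormedAddCommGroup H]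
    [InnerProductSpace ℂ H] [NormedAddCommGroup E] [InnerProductSpace ℂ E]
    (𝒢 : Submodule ℂ (WithLp 2 (H × E))) (m : ℝ)
    (hm : ∀ Ψ v, WithLp.toLp 2 (Ψ, v) ∈ 𝒢 → m * ‖Ψ‖ ^ 2 ≤ ‖v‖ ^ 2)
    (R : H →L[ℂ] H) (hR : ∀ Ψ η, (Ψ, η + (m : ℂ) • Ψ) ∈ formOperator 𝒢 ↔ R η = Ψ)
    (Φ : H) (w : E) (hΦ : WithLp.toLp 2 (Φ, w) ∈ 𝒢) :
    ‖Φ‖ ^ 2 ≤ ‖R‖ * (‖w‖ ^ 2 - m * ‖Φ‖ ^ 2) := by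
  obtain ⟨v, hv, hv'⟩ := (hR (R Φ) Φ).2 rfl
  have h1 := hv' Φ w hΦ
  have h2 := hv' _ v hv
  simp only [inner_add_right, inner_smul_right] at h1 h2
  -- This is q(RΦ - tΦ) ≥ 0; the discriminant of this quadratic in t gives Cauchy–Schwarz.
  have key : ∀ t : ℝ, 0 ≤ (‖w‖ ^ 2 - m * ‖Φ‖ ^ 2) * (t * t) + (-2 * ‖Φ‖ ^ 2) * t
      + (‖v‖ ^ 2 - m * ‖R Φ‖ ^ 2) := by
    intro t
    have hmem : WithLp.toLp 2 (R Φ - (t : ℂ) • Φ, v - (t : ℂ) • w) ∈ 𝒢 := by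
      have := 𝒢.sub_mem hv (𝒢.smul_mem (t : ℂ) hΦ)
      exact this
    have h := hm _ _ hmem
    rw [@norm_sub_sq ℂ, @norm_sub_sq ℂ, inner_smul_right, inner_smul_right, norm_smul, norm_smul,
      ← inner_conj_symm v w, ← inner_conj_symm (R Φ) Φ, h1] at h
    have e1 : (inner ℂ Φ Φ : ℂ) = ((‖Φ‖ ^ 2 : ℝ) : ℂ) := by
      rw [inner_self_eq_norm_sq_to_K]; norm_cast
    rw [e1] at h
    have e2 : RCLike.re ((t : ℂ) * (starRingEnd ℂ) (((‖Φ‖ ^ 2 : ℝ) : ℂ) + m * inner ℂ Φ (R Φ)))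
        = t * ‖Φ‖ ^ 2 + m * t * (inner ℂ Φ (R Φ) : ℂ).re := by
      generalize (inner ℂ Φ (R Φ) : ℂ) = c
      simp [-Complex.ofReal_pow]; ring
    have e3 : RCLike.re ((t : ℂ) * (starRingEnd ℂ) (inner ℂ Φ (R Φ)))
        = t * (inner ℂ Φ (R Φ) : ℂ).re := by
      generalize (inner ℂ Φ (R Φ) : ℂ) = c
      simp
    rw [e2, e3] at h
    have e4 : ‖(t : ℂ)‖ ^ 2 = t * t := by
      rw [Complex.norm_real, Real.norm_eq_abs, sq_abs, sq]
    rw [mul_pow, mul_pow, e4] at h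
    linarith
  have hd := discrim_le_zero key
  rw [discrim] at hd
  have h3 : ‖v‖ ^ 2 - m * ‖R Φ‖ ^ 2 ≤ ‖R‖ * ‖Φ‖ ^ 2 := by
    have e1 : (inner ℂ v v : ℂ) = ((‖v‖ ^ 2 : ℝ) : ℂ) := by
      rw [inner_self_eq_norm_sq_to_K]; norm_cast
    have e2 : (inner ℂ (R Φ) (R Φ) : ℂ) = ((‖R Φ‖ ^ 2 : ℝ) : ℂ) := by
      rw [inner_self_eq_norm_sq_to_K]; norm_cast
    have h4 : (‖v‖ ^ 2 - m * ‖R Φ‖ ^ 2) = (inner ℂ (R Φ) Φ : ℂ).re := by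
      rw [e1, e2] at h2
      have := congrArg Complex.re h2
      simp only [Complex.ofReal_re, Complex.add_re, Complex.re_ofReal_mul] at this
      linarith
    rw [h4]
    calc (inner ℂ (R Φ) Φ : ℂ).re ≤ ‖(inner ℂ (R Φ) Φ : ℂ)‖ := Complex.re_le_norm _
      _ ≤ ‖R Φ‖ * ‖Φ‖ := norm_inner_le_norm _ _
      _ ≤ ‖R‖ * ‖Φ‖ * ‖Φ‖ := by gcongr; exact R.le_opNorm Φ
      _ = _ := by ring
  have h5 := hm _ _ hΦ
  have h6 : (‖Φ‖ ^ 2) * ‖Φ‖ ^ 2 ≤ (‖R‖ * (‖w‖ ^ 2 - m * ‖Φ‖ ^ 2)) * ‖Φ‖ ^ 2 := by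
    have h7 : (‖w‖ ^ 2 - m * ‖Φ‖ ^ 2) * (‖v‖ ^ 2 - m * ‖R Φ‖ ^ 2)
      ≤ (‖w‖ ^ 2 - m * ‖Φ‖ ^ 2) * (‖R‖ * ‖Φ‖ ^ 2) :=
        mul_le_mul_of_nonneg_left h3 (by linarith)
    linarith
  rcases eq_or_lt_of_le (sq_nonneg ‖Φ‖) with h0 | h0
  · rw [← h0] at h5 ⊢
    exact mul_nonneg (norm_nonneg _) (by linarith)
  · exact le_of_mul_le_mul_right h6 h0

/-- Lax–Milgram on the graph 𝒢, a Hilbert space because it is closed: the form minus z is coercive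
in the graph norm, so its operator A is invertible and R = ιH A⁻¹ ιH^*. -/
theorem formOperator_exists_resolvent [CompleteSpace H] [CompleteSpace E]
    (𝒢 : Submodule ℂ (WithLp 2 (H × E)))
    (hcl : IsClosed (𝒢 : Set (WithLp 2 (H × E)))) (m : ℝ) (hm0 : 0 ≤ m)
    (hm : ∀ Ψ v, WithLp.toLp 2 (Ψ, v) ∈ 𝒢 → m * ‖Ψ‖ ^ 2 ≤ ‖v‖ ^ 2) (z : ℝ) (hz : z < m) :
    ∃ R : H →L[ℂ] H, ∀ Ψ η, (Ψ, η + (z : ℂ) • Ψ) ∈ formOperator 𝒢 ↔ R η = Ψ := by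
  have : CompleteSpace 𝒢 := hcl.completeSpace_coe
  let ιH : 𝒢 →L[ℂ] H := (WithLp.fstL 2 ℂ H E).comp 𝒢.subtypeL
  let ιE : 𝒢 →L[ℂ] E := (WithLp.sndL 2 ℂ H E).comp 𝒢.subtypeL
  have hιH : ∀ x : 𝒢, ιH x = (x : WithLp 2 (H × E)).fst := fun x => rfl
  have hιE : ∀ x : 𝒢, ιE x = (x : WithLp 2 (H × E)).snd := fun x => rfl
  have hx' : ∀ x : 𝒢, WithLp.toLp 2 (ιH x, ιE x) ∈ 𝒢 := fun x => x.2
  let A : 𝒢 →L[ℂ] 𝒢 := (adjoint ιE).comp ιE - (z : ℂ) • (adjoint ιH).comp ιH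
  have hA : ∀ x y : 𝒢, inner ℂ x (A y) = inner ℂ (ιE x) (ιE y) - z * inner ℂ (ιH x) (ιH y) := by
    intro x y
    simp [A, inner_sub_right, inner_smul_right, adjoint_inner_right]
  have hnorm : ∀ x : 𝒢, ‖x‖ ^ 2 = ‖ιH x‖ ^ 2 + ‖ιE x‖ ^ 2 := by
    intro x
    rw [hιH, hιE, ← WithLp.prod_norm_sq_eq_of_L2]; rfl
  -- For b ≥ m a the quotient (b - z a)/(a + b) is monotone in b and runs between (m - z)/(m + 1),
  -- at b = m a, and 1, as b → ∞. The constant lies below both.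
  obtain ⟨c, hc0, hc⟩ : ∃ c : ℝ, 0 < c ∧ ∀ a b : ℝ, 0 ≤ a → m * a ≤ b → c * (a + b) ≤ b - z * a := by
    refine ⟨(m - z) / (m + 1 + |z|), by have := abs_nonneg z; apply div_pos <;> linarith, ?_⟩
    intro a b ha hab
    have h1 := abs_nonneg z
    rw [div_mul_eq_mul_div, div_le_iff₀ (by linarith)]
    have h2 := neg_abs_le z
    have h3 : 0 ≤ (b - m * a) * (1 + |z| + z) := mul_nonneg (by linarith) (by linarith)
    have h4 : 0 ≤ (m - z) * (a * |z|) := mul_nonneg (by linarith) (by positivity)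
    nlinarith
  have hunit : IsUnit A := by
    refine ContinuousLinearMap.isUnit_of_forall_le_norm_inner_map A (c := ⟨c, hc0.le⟩) hc0 ?_
    intro x
    rw [norm_inner_symm]
    have h1 : (inner ℂ x (A x) : ℂ).re = ‖ιE x‖ ^ 2 - z * ‖ιH x‖ ^ 2 := by
      rw [hA, inner_self_eq_norm_sq_to_K, inner_self_eq_norm_sq_to_K]
      simp only [Complex.coe_algebraMap, Complex.sub_re, Complex.re_ofReal_mul]
      norm_cast
    have h2 := hc (‖ιH x‖ ^ 2) (‖ιE x‖ ^ 2) (by positivity) (hm _ _ (hx' x))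
    calc ‖x‖ ^ 2 * c = c * (‖ιH x‖ ^ 2 + ‖ιE x‖ ^ 2) := by rw [hnorm]; ring
      _ ≤ _ := h2
      _ = _ := h1.symm
      _ ≤ _ := Complex.re_le_norm _
  obtain ⟨u, hu⟩ := hunit
  have hu1 : ∀ y, A ((↑u⁻¹ : 𝒢 →L[ℂ] 𝒢) y) = y := by
    intro y
    rw [← hu, ← mul_apply_eq_comp, Units.mul_inv, one_apply_eq_self]
  have hu2 : ∀ y, (↑u⁻¹ : 𝒢 →L[ℂ] 𝒢) (A y) = y := by
    intro y
    rw [← hu, ← mul_apply_eq_comp, Units.inv_mul, one_apply_eq_self]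
  refine ⟨ιH.comp ((↑u⁻¹ : 𝒢 →L[ℂ] 𝒢).comp (adjoint ιH)), ?_⟩
  intro Ψ η
  -- The weak equation for (T - z) y = η, tested on the whole graph, is the operator equation A y =
  -- ιH^* η.
  have hiff : ∀ y : 𝒢, (∀ x : 𝒢, inner ℂ (ιE x) (ιE y) = inner ℂ (ιH x) (η + (z : ℂ) • ιH y)) ↔
      A y = adjoint ιH η := by
    intro y
    constructor
    · intro h
      refine ext_inner_left ℂ fun x => ?_
      rw [hA, adjoint_inner_right, h x, inner_add_right, inner_smul_right]; ring
    · intro h x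
      have := hA x y
      rw [h, adjoint_inner_right] at this
      rw [inner_add_right, inner_smul_right, this]; ring
  constructor
  · rintro ⟨v, hv, hv'⟩
    have h := (hiff ⟨_, hv⟩).1 (fun x => hv' _ _ (hx' x))
    change ιH ((↑u⁻¹ : 𝒢 →L[ℂ] 𝒢) (adjoint ιH η)) = Ψ
    rw [← h, hu2]; rfl
  · intro h
    change ιH ((↑u⁻¹ : 𝒢 →L[ℂ] 𝒢) (adjoint ιH η)) = Ψ at h
    have h3 := (hiff ((↑u⁻¹ : 𝒢 →L[ℂ] 𝒢) (adjoint ιH η))).2 (hu1 _)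
    rw [h] at h3
    refine ⟨ιE ((↑u⁻¹ : 𝒢 →L[ℂ] 𝒢) (adjoint ιH η)), ?_, ?_⟩
    · have := hx' ((↑u⁻¹ : 𝒢 →L[ℂ] 𝒢) (adjoint ιH η))
      rwa [h] at this
    · intro Φ w hw
      exact h3 ⟨_, hw⟩

/-- The infimum of the quadratic form is the infimum of the spectrum of its operator. -/
theorem isGLB_formOperator_spectrum [CompleteSpace H] [CompleteSpace E]
    (𝒢 : Submodule ℂ (WithLp 2 (H × E)))
    (hcl : IsClosed (𝒢 : Set (WithLp 2 (H × E)))) (m : ℝ) (hm0 : 0 ≤ m)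
    (hm : ∀ Ψ v, WithLp.toLp 2 (Ψ, v) ∈ 𝒢 → m * ‖Ψ‖ ^ 2 ≤ ‖v‖ ^ 2)
    (hm' : ∀ δ > 0, ∃ Ψ v, WithLp.toLp 2 (Ψ, v) ∈ 𝒢 ∧ Ψ ≠ 0 ∧ ‖v‖ ^ 2 ≤ (m + δ) * ‖Ψ‖ ^ 2) :
    IsGLB {z : ℝ | ¬ ∃ R : H →L[ℂ] H, ∀ Ψ η, (Ψ, η + (z : ℂ) • Ψ) ∈ formOperator 𝒢 ↔ R η = Ψ}
      m := by
  constructor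
  · intro z hz
    by_contra! h
    exact hz (formOperator_exists_resolvent 𝒢 hcl m hm0 hm z h)
  · intro b hb
    refine hb ?_
    rintro ⟨R, hR⟩
    -- With this δ a near minimiser satisfies ‖Ψ‖² ≤ ‖R‖ δ ‖Ψ‖² ≤ ‖Ψ‖²/2, which is absurd.
    obtain ⟨Ψ, v, hΨ, h0, hle⟩ := hm' (1 / (2 * (‖R‖ + 1))) (by positivity)
    have h1 := formOperator_lower_bound_of_resolvent 𝒢 m hm R hR Ψ v hΨ
    have h2 : 0 < ‖Ψ‖ ^ 2 := by positivity
    have h3 : ‖R‖ * (‖v‖ ^ 2 - m * ‖Ψ‖ ^ 2) ≤ ‖R‖ * (1 / (2 * (‖R‖ + 1)) * ‖Ψ‖ ^ 2) := by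
      gcongr; linarith
    have h4 : ‖R‖ * (1 / (2 * (‖R‖ + 1)) * ‖Ψ‖ ^ 2) = (‖R‖ / (‖R‖ + 1)) * (‖Ψ‖ ^ 2 / 2) := by
      field_simp
    have h5 : ‖R‖ / (‖R‖ + 1) ≤ 1 := by
      rw [div_le_one (by positivity)]; linarith
    have h6 := mul_le_mul_of_nonneg_right h5 (by positivity : 0 ≤ ‖Ψ‖ ^ 2 / 2)
    linarith

end FormSpectrum

namespace PauliFierz

/-! ### The weak momentum operator on L²(ℝ³) and its symmetry. -/

section

open Filter Topology

/-- `-i ∂_j f = g` in the weak sense. -/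
def WeakMomentum (j : Fin 3) (f g : R3 → ℂ) : Prop :=
  ∀ φ : R3 → ℂ, ContDiff ℝ ∞ φ → HasCompactSupport φ →
    ∫ x, g x * φ x = Complex.I * ∫ x, f x * fderiv ℝ φ x (EuclideanSpace.single j 1)

theorem integrable_mul_of_memLp_two {X : Type*} [MeasurableSpace X] {μ : Measure X} {f g : X → ℂ}
    (hf : MemLp f 2 μ) (hg : MemLp g 2 μ) : Integrable (fun x => f x * g x) μ :=
  MemLp.integrable_mul hf hg

theorem memLp_two_of_test {φ : R3 → ℂ} (h : ContDiff ℝ ∞ φ) (hc : HasCompactSupport φ) :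
    MemLp φ 2 volume :=
  h.continuous.memLp_of_hasCompactSupport hc

theorem hasCompactSupport_fderiv_apply {φ : R3 → ℂ} (hc : HasCompactSupport φ) (v : R3) :
    HasCompactSupport fun x => fderiv ℝ φ x v :=
  HasCompactSupport.fderiv_apply ℝ hc v

theorem contDiff_fderiv_apply {φ : R3 → ℂ} (h : ContDiff ℝ ∞ φ) (v : R3) :
    ContDiff ℝ ∞ fun x => fderiv ℝ φ x v :=
  (h.fderiv_right (m := ∞) le_rfl).clm_apply contDiff_const

theorem memLp_two_fderiv_of_test {φ : R3 → ℂ} (h : ContDiff ℝ ∞ φ) (hc : HasCompactSupport φ)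
    (v : R3) : MemLp (fun x => fderiv ℝ φ x v) 2 volume :=
  memLp_two_of_test (contDiff_fderiv_apply h v) (hasCompactSupport_fderiv_apply hc v)

theorem WeakMomentum.congr_ae {j : Fin 3} {f g f' g' : R3 → ℂ} (h : WeakMomentum j f g)
    (hf : f =ᵐ[volume] f') (hg : g =ᵐ[volume] g') : WeakMomentum j f' g' := by
  intro φ h1 h2
  have e1 : ∫ x, g' x * φ x = ∫ x, g x * φ x :=
    integral_congr_ae (hg.mono fun x hx => by simp only [hx])
  have e2 : ∫ x, f' x * fderiv ℝ φ x (EuclideanSpace.single j 1)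
      = ∫ x, f x * fderiv ℝ φ x (EuclideanSpace.single j 1) :=
    integral_congr_ae (hf.mono fun x hx => by simp only [hx])
  rw [e1, e2, h φ h1 h2]

theorem WeakMomentum.const_mul {j : Fin 3} {f g : R3 → ℂ} (h : WeakMomentum j f g) (c : ℂ) :
    WeakMomentum j (fun x => c * f x) (fun x => c * g x) := by
  intro φ h1 h2
  simp only [mul_assoc, integral_const_mul]
  rw [h φ h1 h2]; ring

theorem WeakMomentum.add {j : Fin 3} {f g f' g' : R3 → ℂ} (h : WeakMomentum j f g)
    (h' : WeakMomentum j f' g') (hf : MemLp f 2 volume) (hg : MemLp g 2 volume)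
    (hf' : MemLp f' 2 volume) (hg' : MemLp g' 2 volume) :
    WeakMomentum j (fun x => f x + f' x) (fun x => g x + g' x) := by
  intro φ h1 h2
  have t1 := memLp_two_of_test h1 h2
  have t2 := memLp_two_fderiv_of_test h1 h2 (EuclideanSpace.single j 1)
  simp only [add_mul]
  rw [integral_add (integrable_mul_of_memLp_two hg t1) (integrable_mul_of_memLp_two hg' t1),
    integral_add (integrable_mul_of_memLp_two hf t2) (integrable_mul_of_memLp_two hf' t2),
    h φ h1 h2, h' φ h1 h2]; ring

theorem WeakMomentum.sum {j : Fin 3} {ι : Type*} (s : Finset ι) {f g : ι → R3 → ℂ}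
    (h : ∀ i ∈ s, WeakMomentum j (f i) (g i)) (hf : ∀ i ∈ s, MemLp (f i) 2 volume)
    (hg : ∀ i ∈ s, MemLp (g i) 2 volume) :
    WeakMomentum j (fun x => ∑ i ∈ s, f i x) (fun x => ∑ i ∈ s, g i x) := by
  intro φ h1 h2
  have t1 := memLp_two_of_test h1 h2
  have t2 := memLp_two_fderiv_of_test h1 h2 (EuclideanSpace.single j 1)
  simp only [Finset.sum_mul]
  rw [integral_finsetSum _ fun i hi => integrable_mul_of_memLp_two (hg i hi) t1,
    integral_finsetSum _ fun i hi => integrable_mul_of_memLp_two (hf i hi) t2, Finset.mul_sum]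
  exact Finset.sum_congr rfl fun i hi => h i hi φ h1 h2

theorem contDiff_conj_phase (q : Mode) : ContDiff ℝ ∞ fun x : R3 => conj (phase x q) := by
  have h : ContDiff ℝ ∞ fun x : R3 => phase x q := by
    unfold phase
    have h1 : ContDiff ℝ ∞ fun x : R3 => (inner ℝ q.1 x : ℝ) := (innerSL ℝ q.1).contDiff
    have h2 : ContDiff ℝ ∞ fun x : R3 => ((inner ℝ q.1 x : ℝ) : ℂ) :=
      Complex.ofRealCLM.contDiff.comp h1
    exact (contDiff_const.mul h2).cexp
  exact Complex.conjCLE.contDiff.comp h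

theorem norm_phase (x : R3) (q : Mode) : ‖phase x q‖ = 1 := by
  unfold phase
  rw [mul_comm]; exact Complex.norm_exp_ofReal_mul_I _

theorem conj_phase (x : R3) (q : Mode) :
    conj (phase x q) = Complex.exp (-(Complex.I * (inner ℝ q.1 x : ℝ))) := by
  unfold phase
  rw [← Complex.exp_conj, map_mul, Complex.conj_I, Complex.conj_ofReal, neg_mul]

theorem conj_phase_mul_phase (x : R3) (q : Mode) : conj (phase x q) * phase x q = 1 := by
  rw [mul_comm, Complex.mul_conj, Complex.normSq_eq_norm_sq, norm_phase]; simp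

theorem fderiv_conj_phase (q : Mode) (x : R3) (j : Fin 3) :
    fderiv ℝ (fun x : R3 => conj (phase x q)) x (EuclideanSpace.single j 1)
      = -(Complex.I * q.1 j) * conj (phase x q) := by
  have h1 : HasFDerivAt (fun x : R3 => (inner ℝ q.1 x : ℝ)) (innerSL ℝ q.1) x :=
    (innerSL ℝ q.1).hasFDerivAt
  have h2 : HasFDerivAt (fun x : R3 => -(Complex.I * ((inner ℝ q.1 x : ℝ) : ℂ)))
      (-(Complex.I • (Complex.ofRealCLM.comp (innerSL ℝ q.1)))) x := by
    have := (Complex.ofRealCLM.hasFDerivAt (x := (inner ℝ q.1 x : ℝ))).comp x h1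
    exact (this.const_mul Complex.I).neg
  have h3 := h2.cexp
  have e : (fun x : R3 => conj (phase x q))
      = fun x => Complex.exp (-(Complex.I * (inner ℝ q.1 x : ℝ))) := by
    funext y; exact conj_phase y q
  rw [e, h3.fderiv]
  have : (inner ℝ q.1 (EuclideanSpace.single j (1 : ℝ)) : ℝ) = q.1 j := by
    rw [EuclideanSpace.inner_single_right]; simp
  rw [conj_phase]
  simp [this]
  ring

/-- Testing against φ here is testing the hypothesis against e^{-iq·x}φ, again a test function; the
derivative of the phase supplies the shift by q_j. -/
theorem WeakMomentum.conj_phase_mul {j : Fin 3} {f g : R3 → ℂ} (h : WeakMomentum j f g)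
    (hf : MemLp f 2 volume) (hg : MemLp g 2 volume) (q : Mode) :
    WeakMomentum j (fun x => conj (phase x q) * f x)
      (fun x => conj (phase x q) * (g x - q.1 j * f x)) := by
  intro φ h1 h2
  have t1 : ContDiff ℝ ∞ fun x => conj (phase x q) * φ x := (contDiff_conj_phase q).mul h1
  have t2 : HasCompactSupport fun x => conj (phase x q) * φ x := h2.mul_left
  have key := h _ t1 t2
  have hd : ∀ x, fderiv ℝ (fun x => conj (phase x q) * φ x) x (EuclideanSpace.single j 1)
      = conj (phase x q) * fderiv ℝ φ x (EuclideanSpace.single j 1)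
        + -(Complex.I * q.1 j) * (conj (phase x q) * φ x) := by
    intro x
    rw [fderiv_fun_mul ((contDiff_conj_phase q).differentiable (by simp) x)
      (h1.differentiable (by simp) x)]
    simp only [add_apply, smul_apply, fderiv_conj_phase,
      smul_eq_mul]
    ring
  simp only [hd, mul_add] at key
  have m1 : MemLp (fun x => conj (phase x q) * φ x) 2 volume := memLp_two_of_test t1 t2
  have m2 : MemLp (fun x => conj (phase x q) * fderiv ℝ φ x (EuclideanSpace.single j 1)) 2
      volume :=
    memLp_two_of_test ((contDiff_conj_phase q).mul (contDiff_fderiv_apply h1 _))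
      (hasCompactSupport_fderiv_apply h2 _).mul_left
  rw [integral_add (integrable_mul_of_memLp_two hf m2)
    (integrable_mul_of_memLp_two hf (m1.const_mul _))] at key
  have e1 : ∫ x, f x * (-(Complex.I * q.1 j) * (conj (phase x q) * φ x))
      = -(Complex.I * q.1 j) * ∫ x, f x * (conj (phase x q) * φ x) := by
    rw [← integral_const_mul]; congr 1; funext x; ring
  have e2 : ∫ x, conj (phase x q) * (g x - q.1 j * f x) * φ x
      = (∫ x, g x * (conj (phase x q) * φ x))
        - q.1 j * ∫ x, f x * (conj (phase x q) * φ x) := by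
    rw [← integral_const_mul, ← integral_sub (integrable_mul_of_memLp_two hg m1)
      ((integrable_mul_of_memLp_two hf m1).const_mul _)]
    congr 1; funext x; ring
  have e3 : ∫ x, conj (phase x q) * f x * fderiv ℝ φ x (EuclideanSpace.single j 1)
      = ∫ x, f x * (conj (phase x q) * fderiv ℝ φ x (EuclideanSpace.single j 1)) := by
    congr 1; funext x; ring
  rw [e2, e3, key, e1]
  linear_combination (-(q.1 j : ℂ) * ∫ x, f x * (conj (phase x q) * φ x)) * Complex.I_sq

theorem inner_toLp_eq {X : Type*} [MeasurableSpace X] {μ : Measure X} {f g : X → ℂ}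
    (hf : MemLp f 2 μ) (hg : MemLp g 2 μ) :
    inner ℂ (hf.toLp f) (hg.toLp g) = ∫ x, conj (f x) * g x ∂μ := by
  rw [L2.inner_def]
  refine integral_congr_ae ?_
  filter_upwards [hf.coeFn_toLp, hg.coeFn_toLp] with x h1 h2
  rw [h1, h2, RCLike.inner_apply]; ring

theorem inner_eq_integral {X : Type*} [MeasurableSpace X] {μ : Measure X} (f g : Lp ℂ 2 μ) :
    inner ℂ f g = ∫ x, conj (f x) * g x ∂μ := by
  rw [L2.inner_def]
  refine integral_congr_ae (.of_forall fun x => ?_)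
  simp only [RCLike.inner_apply]; ring

/-- Translation by `v` on `L²(ℝ³)`. -/
def translate (v : R3) : Lp ℂ 2 (volume : Measure R3) →ₗᵢ[ℂ] Lp ℂ 2 (volume : Measure R3) :=
  Lp.compMeasurePreservingₗᵢ ℂ (fun x => x + v) (measurePreserving_add_right volume v)

theorem translate_ae (v : R3) (f : Lp ℂ 2 (volume : Measure R3)) :
    translate v f =ᵐ[volume] fun x => f (x + v) :=
  Lp.coeFn_compMeasurePreserving f (measurePreserving_add_right volume v)

theorem translate_toLp (v : R3) {f : R3 → ℂ} (hf : MemLp f 2 volume) :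
    translate v (hf.toLp f)
      = (hf.comp_measurePreserving (measurePreserving_add_right volume v)).toLp _ :=
  Lp.toLp_compMeasurePreserving hf (measurePreserving_add_right volume v)

theorem inner_translate (v : R3) (f g : Lp ℂ 2 (volume : Measure R3)) :
    inner ℂ (translate v f) g = inner ℂ f (translate (-v) g) := by
  have h : translate v (translate (-v) g) = g := by
    apply Lp.ext
    have h1 := translate_ae v (translate (-v) g)
    have h2 := (measurePreserving_add_right (volume : Measure R3) v).quasiMeasurePreserving.ae
      (translate_ae (-v) g)
    filter_upwards [h1, h2] with x e1 e2
    rw [e1, e2]; simp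
  rw [← (translate v).inner_map_map f, h]

/-- The difference quotient against a fixed `f` that is weakly differentiable. -/
theorem hasDerivAt_inner_translate {j : Fin 3} {f g : R3 → ℂ} (h : WeakMomentum j f g)
    (hf : MemLp f 2 volume) {φ : R3 → ℂ} (h1 : ContDiff ℝ ∞ φ)
    (h2 : HasCompactSupport φ) (t : ℝ) :
    HasDerivAt (fun t : ℝ => ∫ x, f x * φ (x + t • EuclideanSpace.single j 1))
      (-(Complex.I * ∫ x, g x * φ (x + t • EuclideanSpace.single j 1))) t := by
  set e : R3 := EuclideanSpace.single j 1
  have hlf : LocallyIntegrable f volume := hf.locallyIntegrable (by norm_num)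
  -- The integral is the convolution of f with the reflected test function, evaluated at -t e_j, so
  -- it is differentiable in t without further estimates.
  have hc : HasCompactSupport fun x => φ (-x) := h2.comp_homeomorph (Homeomorph.neg R3)
  have hcd : ContDiff ℝ 1 fun x => φ (-x) := (h1.of_le (by simp)).comp contDiff_neg
  have h3 := hc.hasFDerivAt_convolution_right (ContinuousLinearMap.mul ℝ ℂ) hlf hcd (-(t • e))
  have h4 : HasDerivAt (fun t : ℝ => -(t • e)) (-e) t := by
    have := ((hasDerivAt_id t).smul_const e).neg
    rw [one_smul] at this
    exact this
  have h5 := h3.comp_hasDerivAt t h4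
  have hd : ∀ (s : ℝ) (x : R3), fderiv ℝ (fun x => φ (x + s • e)) x e = fderiv ℝ φ (x + s • e) e := by
    intro s x
    rw [fderiv_comp_add_right]
  have hshift : ContDiff ℝ ∞ fun x => φ (x + t • e) := h1.comp (contDiff_id.add contDiff_const)
  have hshiftc : HasCompactSupport fun x => φ (x + t • e) :=
    h2.comp_homeomorph (Homeomorph.addRight (t • e))
  have hw := h _ hshift hshiftc
  have hfun : (fun t : ℝ => ∫ x, f x * φ (x + t • e)) =
      convolution f (fun x => φ (-x)) (ContinuousLinearMap.mul ℝ ℂ) volume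
        ∘ fun t : ℝ => -(t • e) := by
    funext s
    simp only [Function.comp, convolution, ContinuousLinearMap.mul_apply']
    congr 1; funext x; congr 2; abel
  rw [hfun]
  refine h5.congr_deriv ?_
  rw [hw, ← mul_assoc, Complex.I_mul_I]
  simp only [neg_mul, one_mul, neg_neg]
  rw [convolution_precompR_apply]
  · simp only [convolution, ContinuousLinearMap.mul_apply']
    congr 1; funext x
    have h6 : fderiv ℝ (fun x => φ (-x)) (-(t • e) - x) = -fderiv ℝ φ (-(-(t • e) - x)) := by
      have h7 := (h1.differentiable (by simp) (-(-(t • e) - x))).hasFDerivAt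
      have h8 := h7.comp (-(t • e) - x) (hasFDerivAt_id (-(t • e) - x)).neg
      have h9 := h8.fderiv
      simp only [Function.comp_def] at h9
      rw [h9]; ext; simp
    rw [hd, h6]
    simp only [neg_apply, map_neg, neg_neg]
    congr 3; abel
  · exact hlf
  · exact hc.fderiv ℝ
  · exact hcd.continuous_fderiv (by simp)

theorem inner_translate_test {j : Fin 3} {w : R3 → ℂ} (hm : MemLp w 2 volume)
    {ψ : Lp ℂ 2 (volume : Measure R3)} (hψ : ψ = hm.toLp w) (u : Lp ℂ 2 (volume : Measure R3))
    (s : ℝ) : inner ℂ (translate (s • EuclideanSpace.single j 1) ψ) u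
      = ∫ x, u x * conj (w (x + s • EuclideanSpace.single j 1)) := by
  rw [inner_eq_integral, hψ, translate_toLp]
  refine integral_congr_ae ?_
  filter_upwards [MemLp.coeFn_toLp (hm.comp_measurePreserving (measurePreserving_add_right volume
    (s • EuclideanSpace.single j (1 : ℝ))))] with x hx
  rw [hx, mul_comm]; rfl

/-- For test functions ψ this is the mean value inequality, the derivative in t being at most
‖g‖‖ψ‖; density extends it to L². It bounds the difference quotients uniformly. -/
theorem norm_inner_translate_sub_le {j : Fin 3} {f g : Lp ℂ 2 (volume : Measure R3)}
    (h : WeakMomentum j f g) (ψ : Lp ℂ 2 (volume : Measure R3)) (t : ℝ) :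
    ‖(inner ℂ (translate (t • EuclideanSpace.single j 1) ψ - ψ) f : ℂ)‖ ≤ |t| * (‖g‖ * ‖ψ‖) := by
  refine isClosed_property (p := fun ψ : Lp ℂ 2 (volume : Measure R3) =>
    ‖(inner ℂ (translate (t • EuclideanSpace.single j 1) ψ - ψ) f : ℂ)‖ ≤ |t| * (‖g‖ * ‖ψ‖))
    (Lp.dense_hasCompactSupport_contDiff (F := ℂ) (E := R3) (p := 2) (μ := volume) (by simp)).denseRange_val
    (isClosed_le (by fun_prop) (by fun_prop)) ?_ ψ
  rintro ⟨ψ, w, hw, hwc, hwd⟩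
  simp only
  have hwc' : HasCompactSupport fun x => conj (w x) := hwc.comp_left (by simp)
  have hwd' : ContDiff ℝ ∞ fun x => conj (w x) := Complex.conjCLE.contDiff.comp hwd
  have hm := memLp_two_of_test hwd hwc
  have hψ : ψ = hm.toLp w := by
    apply Lp.ext; exact hw.trans hm.coeFn_toLp.symm
  have hder := fun s => hasDerivAt_inner_translate h (Lp.memLp f) hwd' hwc' s
  have hval := fun u s => inner_translate_test (j := j) hm hψ u s
  have hb : ∀ s : ℝ, ‖-(Complex.I * ∫ x, g x * conj (w (x + s • EuclideanSpace.single j 1)))‖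
      ≤ ‖g‖ * ‖ψ‖ := by
    intro s
    rw [← hval, norm_neg, norm_mul, Complex.norm_I, one_mul]
    refine (norm_inner_le_norm _ _).trans ?_
    rw [LinearIsometry.norm_map, mul_comm]
  have := Convex.norm_image_sub_le_of_norm_hasDerivWithin_le (s := Set.univ)
    (fun s _ => (hder s).hasDerivWithinAt) (fun s _ => hb s) convex_univ (Set.mem_univ 0)
    (Set.mem_univ t)
  rw [← hval f t, ← hval f 0] at this
  have h0 : translate ((0 : ℝ) • EuclideanSpace.single j (1 : ℝ)) ψ = ψ := by
    apply Lp.ext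
    refine (translate_ae _ _).trans (.of_forall fun x => by simp)
  rw [h0, ← inner_sub_left, sub_zero, Real.norm_eq_abs] at this
  linarith

/-- Convergence holds on the dense set of test functions, and the difference quotients are uniformly
bounded, so it holds for all ψ. -/
theorem tendsto_inner_translate {j : Fin 3} {f g : Lp ℂ 2 (volume : Measure R3)}
    (h : WeakMomentum j f g) (ψ : Lp ℂ 2 (volume : Measure R3)) :
    Tendsto (fun t : ℝ => (t : ℂ)⁻¹ *
      inner ℂ (translate (t • EuclideanSpace.single j 1) ψ - ψ) f) (𝓝[≠] 0)
      (𝓝 (-(Complex.I * inner ℂ ψ g))) := by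
  rw [Metric.tendsto_nhds]
  intro δ hδ
  have hdense := Lp.dense_hasCompactSupport_contDiff (F := ℂ) (E := R3) (p := 2) (μ := volume)
    (by simp)
  -- The approximation error enters twice, in the quotient and in the limit, each time with at most
  -- δ/4.
  obtain ⟨ψ', hψ', w, hw, hwc, hwd⟩ := Metric.dense_iff.1 hdense ψ (δ / (4 * (‖g‖ + 1)))
    (by positivity)
  have hwc' : HasCompactSupport fun x => conj (w x) := hwc.comp_left (by simp)
  have hwd' : ContDiff ℝ ∞ fun x => conj (w x) := Complex.conjCLE.contDiff.comp hwd
  have hm := memLp_two_of_test hwd hwc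
  have hψ : ψ' = hm.toLp w := by
    apply Lp.ext; exact hw.trans hm.coeFn_toLp.symm
  have hval := fun u s => inner_translate_test (j := j) hm hψ u s
  have h0 : translate ((0 : ℝ) • EuclideanSpace.single j (1 : ℝ)) ψ' = ψ' := by
    apply Lp.ext
    refine (translate_ae _ _).trans (.of_forall fun x => by simp)
  have hder := hasDerivAt_inner_translate h (Lp.memLp f) hwd' hwc' 0
  rw [hasDerivAt_iff_tendsto_slope, ← hval g 0, h0] at hder
  have hev := Metric.tendsto_nhds.1 hder (δ / 4) (by positivity)
  filter_upwards [hev, self_mem_nhdsWithin] with t ht ht0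
  have ht0' : t ≠ 0 := ht0
  rw [slope_def_module, ← hval f t, ← hval f 0, h0, ← inner_sub_left, sub_zero,
    Complex.real_smul, dist_eq_norm, Complex.ofReal_inv] at ht
  rw [dist_eq_norm]
  rw [Metric.mem_ball, dist_comm, dist_eq_norm] at hψ'
  have e1 := norm_inner_translate_sub_le h (ψ - ψ') t
  have e2 : ‖(t : ℂ)⁻¹ * inner ℂ (translate (t • EuclideanSpace.single j 1) (ψ - ψ')
      - (ψ - ψ')) f‖ ≤ ‖g‖ * ‖ψ - ψ'‖ := by
    rw [norm_mul, norm_inv, Complex.norm_real, Real.norm_eq_abs, inv_mul_le_iff₀ (by positivity)]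
    exact e1
  have e3 : ‖-(Complex.I * inner ℂ (ψ - ψ') g : ℂ)‖ ≤ ‖g‖ * ‖ψ - ψ'‖ := by
    rw [norm_neg, norm_mul, Complex.norm_I, one_mul, mul_comm]
    exact norm_inner_le_norm _ _
  have e4 : ‖g‖ * ‖ψ - ψ'‖ < δ / 4 := by
    have : ‖g‖ * ‖ψ - ψ'‖ ≤ (‖g‖ + 1) * ‖ψ - ψ'‖ := by gcongr; linarith
    have h5 : (‖g‖ + 1) * ‖ψ - ψ'‖ < (‖g‖ + 1) * (δ / (4 * (‖g‖ + 1))) := by gcongr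
    have h6 : (‖g‖ + 1) * (δ / (4 * (‖g‖ + 1))) = δ / 4 := by field_simp
    linarith
  have e5 : (t : ℂ)⁻¹ * inner ℂ (translate (t • EuclideanSpace.single j 1) ψ - ψ) f
        - -(Complex.I * inner ℂ ψ g)
      = ((t : ℂ)⁻¹ * inner ℂ (translate (t • EuclideanSpace.single j 1) ψ' - ψ') f
        - -(Complex.I * inner ℂ ψ' g))
        + ((t : ℂ)⁻¹ * inner ℂ (translate (t • EuclideanSpace.single j 1) (ψ - ψ')
          - (ψ - ψ')) f) - -(Complex.I * inner ℂ (ψ - ψ') g) := by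
    simp only [map_sub, inner_sub_left]; ring
  rw [e5]
  have := norm_sub_le (((t : ℂ)⁻¹ * inner ℂ (translate (t • EuclideanSpace.single j 1) ψ' - ψ') f
        - -(Complex.I * inner ℂ ψ' g))
        + ((t : ℂ)⁻¹ * inner ℂ (translate (t • EuclideanSpace.single j 1) (ψ - ψ')
          - (ψ - ψ')) f)) (-(Complex.I * inner ℂ (ψ - ψ') g))
  have h7 := norm_add_le ((t : ℂ)⁻¹ * inner ℂ (translate (t • EuclideanSpace.single j 1) ψ' - ψ') f
        - -(Complex.I * inner ℂ ψ' g))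
        ((t : ℂ)⁻¹ * inner ℂ (translate (t • EuclideanSpace.single j 1) (ψ - ψ')
          - (ψ - ψ')) f)
  linarith

/-- Neither f nor f' may serve as a test function for the other. Instead both sides are limits of
difference quotients of translations, and moving a translation by t to the other factor makes it a
translation by -t. -/
theorem WeakMomentum.inner_symm {j : Fin 3} {f g f' g' : Lp ℂ 2 (volume : Measure R3)}
    (h : WeakMomentum j f g) (h' : WeakMomentum j f' g') :
    (inner ℂ f' g : ℂ) = inner ℂ g' f := by
  have h1 := tendsto_inner_translate h f'
  have h2 := tendsto_inner_translate h' f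
  have hneg : Tendsto (fun t : ℝ => -t) (𝓝[≠] 0) (𝓝[≠] 0) := by
    refine tendsto_nhdsWithin_iff.2 ⟨?_, ?_⟩
    · exact (tendsto_nhdsWithin_of_tendsto_nhds (by simpa using (continuous_neg (G := ℝ)).tendsto 0))
    · filter_upwards [self_mem_nhdsWithin] with t ht using by simpa using ht
  have h3 := (((Complex.continuous_conj.tendsto _).comp (h2.comp hneg))).neg
  have h4 := tendsto_nhds_unique h1 (h3.congr fun t => ?_)
  · rw [← inner_conj_symm g' f]
    simp only [map_neg, map_mul, Complex.conj_I, neg_mul, neg_neg] at h4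
    have := mul_left_cancel₀ Complex.I_ne_zero (show Complex.I * inner ℂ f' g
      = Complex.I * conj (inner ℂ f g') by linear_combination -h4)
    exact this
  · simp only [Function.comp, inner_sub_left, map_mul, map_inv₀, Complex.conj_ofReal, map_sub,
      inner_conj_symm, Complex.ofReal_neg, map_neg]
    rw [inner_translate, neg_smul]; ring

theorem WeakMomentum.integral_symm {j : Fin 3} {f g f' g' : R3 → ℂ}
    (h : WeakMomentum j f g) (h' : WeakMomentum j f' g') (hf : MemLp f 2 volume)
    (hg : MemLp g 2 volume) (hf' : MemLp f' 2 volume) (hg' : MemLp g' 2 volume) :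
    ∫ x, conj (f' x) * g x = ∫ x, conj (g' x) * f x := by
  rw [← inner_toLp_eq hf' hg, ← inner_toLp_eq hg' hf]
  exact (h.congr_ae hf.coeFn_toLp.symm hg.coeFn_toLp.symm).inner_symm
    (h'.congr_ae hf'.coeFn_toLp.symm hg'.coeFn_toLp.symm)

theorem tendsto_integral_mul_of_eLpNorm {X : Type*} [MeasurableSpace X] {μ : Measure X}
    {f : ℕ → X → ℂ} {g φ : X → ℂ} (hf : ∀ k, MemLp (f k) 2 μ) (hg : MemLp g 2 μ)
    (hφ : MemLp φ 2 μ) (h : Tendsto (fun k => eLpNorm (f k - g) 2 μ) atTop (𝓝 0)) :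
    Tendsto (fun k => ∫ x, f k x * φ x ∂μ) atTop (𝓝 (∫ x, g x * φ x ∂μ)) := by
  have h1 := (Lp.tendsto_Lp_iff_tendsto_eLpNorm'' f hf g hg).2 h
  have hφ' : MemLp (fun x => conj (φ x)) 2 μ := hφ.star
  have h2 := (tendsto_const_nhds (x := hφ'.toLp _)).inner (𝕜 := ℂ) h1
  simp only [inner_toLp_eq, Complex.conj_conj] at h2
  simpa only [mul_comm] using h2

theorem WeakMomentum.of_tendsto {j : Fin 3} {f g : ℕ → R3 → ℂ} {f' g' : R3 → ℂ}
    (h : ∀ k, WeakMomentum j (f k) (g k)) (hf : ∀ k, MemLp (f k) 2 volume)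
    (hg : ∀ k, MemLp (g k) 2 volume) (hf' : MemLp f' 2 volume) (hg' : MemLp g' 2 volume)
    (h1 : Tendsto (fun k => eLpNorm (f k - f') 2 volume) atTop (𝓝 0))
    (h2 : Tendsto (fun k => eLpNorm (g k - g') 2 volume) atTop (𝓝 0)) :
    WeakMomentum j f' g' := by
  intro φ t1 t2
  have e1 := tendsto_integral_mul_of_eLpNorm hg hg' (memLp_two_of_test t1 t2) h2
  have e2 := (tendsto_integral_mul_of_eLpNorm hf hf'
    (memLp_two_fderiv_of_test t1 t2 (EuclideanSpace.single j 1)) h1).const_mul Complex.I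
  exact tendsto_nhds_unique e1 (e2.congr fun k => (h k φ t1 t2).symm)

theorem WeakMomentum.of_contDiff (j : Fin 3) {f : R3 → ℂ} (h : ContDiff ℝ ∞ f)
    (hc : HasCompactSupport f) :
    WeakMomentum j f fun x => -(Complex.I * fderiv ℝ f x (EuclideanSpace.single j 1)) := by
  intro φ t1 t2
  have m1 := memLp_two_of_test h hc
  have m2 := memLp_two_of_test t1 t2
  have m3 := memLp_two_fderiv_of_test h hc (EuclideanSpace.single j 1)
  have m4 := memLp_two_fderiv_of_test t1 t2 (EuclideanSpace.single j 1)
  rw [integral_mul_fderiv_eq_neg_fderiv_mul_of_integrable (integrable_mul_of_memLp_two m3 m2)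
    (integrable_mul_of_memLp_two m1 m4) (integrable_mul_of_memLp_two m1 m2)
    (fun x _ => h.differentiable (by simp) x) (fun x _ => t1.differentiable (by simp) x),
    mul_neg, ← neg_mul, ← integral_const_mul]
  congr 1; funext x; ring

end

/-! ### Photon configurations, extraction of photons and symmetric wave functions. -/

section

/-- One particle and `n` photons. -/
abbrev Point (n : ℕ) : Type := R3 × (Fin n → Mode)

instance (n : ℕ) : SigmaFinite (sectorMeasure n) := by
  unfold sectorMeasure; infer_instance

variable {n : ℕ}

/-- Single out the `i`-th photon. -/
def extract (i : Fin (n + 1)) (z : Point (n + 1)) : Mode × Point n :=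
  (z.2 i, (z.1, i.removeNth z.2))

/-- Insert a photon in front. -/
def adjoin (y : Mode × Point n) : Point (n + 1) := (y.2.1, Fin.cons y.1 y.2.2)

/-- Single out two photons. -/
def extractPair (p : Fin (n + 2) × Fin (n + 1)) (z : Point (n + 2)) : Mode × Mode × Point n :=
  (z.2 p.1, extract p.2 (extract p.1 z).2)

/-- Insert two photons in front. -/
def adjoinPair (y : Mode × Mode × Point n) : Point (n + 2) := adjoin (y.1, adjoin y.2)

/-- Two photon labels and a point. -/
def pairMeasure (n : ℕ) : Measure (Mode × Mode × Point n) :=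
  modeMeasure.prod (modeMeasure.prod (sectorMeasure n))

theorem measurePreserving_extract (i : Fin (n + 1)) :
    MeasurePreserving (extract i) (sectorMeasure (n + 1))
      (modeMeasure.prod (sectorMeasure n)) := by
  have h1 : MeasurePreserving (fun K : Fin (n + 1) → Mode => (K i, i.removeNth K))
      (photonMeasure (n + 1)) (modeMeasure.prod (photonMeasure n)) :=
    measurePreserving_piFinSuccAbove (fun _ : Fin (n + 1) => modeMeasure) i
  have h2 : MeasurePreserving (fun z : R3 × (Fin (n + 1) → Mode) =>
      (z.1, (z.2 i, i.removeNth z.2))) (sectorMeasure (n + 1))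
      ((volume : Measure R3).prod (modeMeasure.prod (photonMeasure n))) :=
    (MeasurePreserving.id (volume : Measure R3)).prod h1
  have h3 := (measurePreserving_prodAssoc (volume : Measure R3) modeMeasure (photonMeasure n)).symm
  have h4 : MeasurePreserving (Prod.map Prod.swap id)
      (((volume : Measure R3).prod modeMeasure).prod (photonMeasure n))
      ((modeMeasure.prod (volume : Measure R3)).prod (photonMeasure n)) :=
    (Measure.measurePreserving_swap (μ := (volume : Measure R3)) (ν := modeMeasure)).prod
      (MeasurePreserving.id (photonMeasure n))
  have h5 := measurePreserving_prodAssoc modeMeasure (volume : Measure R3) (photonMeasure n)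
  exact h5.comp (h4.comp (h3.comp h2))

theorem adjoin_eq_comp : ∀ y : Mode × Point n, extract 0 (adjoin y) = y := by
  rintro ⟨q, x, K⟩
  simp [extract, adjoin]

theorem adjoin_extract_zero (z : Point (n + 1)) : adjoin (extract 0 z) = z := by
  obtain ⟨x, K⟩ := z
  simp only [extract, adjoin, Fin.removeNth_zero]
  rw [Fin.cons_self_tail]

theorem measurable_extract (i : Fin (n + 1)) : Measurable (extract (n := n) i) :=
  (measurePreserving_extract i).measurable

theorem measurable_adjoin : Measurable (adjoin (n := n)) := by
  refine measurable_snd.fst.prodMk ?_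
  refine measurable_pi_iff.2 fun i => ?_
  refine Fin.cases ?_ (fun l => ?_) i
  · simpa using measurable_fst
  · simp only [Fin.cons_succ]
    exact (measurable_pi_apply l).comp measurable_snd.snd

/-- `extract 0` as a measurable equivalence. -/
def extractEquiv (n : ℕ) : Point (n + 1) ≃ᵐ Mode × Point n where
  toFun := extract 0
  invFun := adjoin
  left_inv := adjoin_extract_zero
  right_inv := adjoin_eq_comp
  measurable_toFun := measurable_extract 0
  measurable_invFun := measurable_adjoin

theorem measurePreserving_adjoin :
    MeasurePreserving (adjoin (n := n)) (modeMeasure.prod (sectorMeasure n))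
      (sectorMeasure (n + 1)) :=
  MeasurePreserving.symm (extractEquiv n) (measurePreserving_extract 0)

theorem measurePreserving_extractPair (p : Fin (n + 2) × Fin (n + 1)) :
    MeasurePreserving (extractPair p) (sectorMeasure (n + 2)) (pairMeasure n) :=
  ((MeasurePreserving.id modeMeasure).prod (measurePreserving_extract p.2)).comp
    (measurePreserving_extract p.1)

theorem measurePreserving_adjoinPair :
    MeasurePreserving (adjoinPair (n := n)) (pairMeasure n) (sectorMeasure (n + 2)) :=
  measurePreserving_adjoin.comp
    ((MeasurePreserving.id modeMeasure).prod measurePreserving_adjoin)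

/-- Bringing photon i to the front is a cyclic permutation, hence invisible to symmetric functions;
the relations of `extract` and `adjoin` used later rest on this. -/
theorem adjoin_extract (i : Fin (n + 1)) (z : Point (n + 1)) :
    adjoin (extract i z) = permute i.cycleRange.symm z := by
  obtain ⟨x, K⟩ := z
  simp only [extract, adjoin, permute, Prod.mk.injEq, true_and]
  funext l
  refine Fin.cases ?_ (fun m => ?_) l
  · simp [Fin.cycleRange_symm_zero]
  · simp [Fin.cycleRange_symm_succ, Fin.removeNth]

/-- A permutation carries the photons other than i to those other than σ i; τ is this bijection in
the order preserving labelling of both complements. -/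
theorem exists_extract_permute (i : Fin (n + 1)) (σ : Equiv.Perm (Fin (n + 1))) :
    ∃ τ : Equiv.Perm (Fin n), ∀ z : Point (n + 1),
      extract i (permute σ z) = ((extract (σ i) z).1, permute τ (extract (σ i) z).2) := by
  let e1 := finSuccAboveEquiv i
  let e2 := finSuccAboveEquiv (σ i)
  let m : {x // x ≠ i} ≃ {x // x ≠ σ i} := σ.subtypeEquiv fun a => by simp
  refine ⟨e1.trans (m.trans e2.symm), fun z => ?_⟩
  simp only [extract, permute, Prod.mk.injEq, true_and]
  funext l
  have h2 : e2 (e2.symm (m (e1 l))) = m (e1 l) := e2.apply_symm_apply _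
  have h3 : σ (i.succAbove l) = (σ i).succAbove (e2.symm (m (e1 l))) := by
    change _ = (e2 (e2.symm (m (e1 l))) : Fin (n + 1))
    rw [h2]; rfl
  exact congrArg z.2 h3

theorem adjoin_permute (q : Mode) (τ : Equiv.Perm (Fin n)) (z : Point n) :
    adjoin (q, permute τ z) = permute (Equiv.Perm.decomposeFin.symm (0, τ)) (adjoin (q, z)) := by
  simp only [adjoin, permute, Prod.mk.injEq, true_and]
  funext l
  refine Fin.cases ?_ (fun m => ?_) l
  · simp
  · simp

/-- Photon wave functions that are invariant under permutations at every point. -/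
def IsSymm (u : Point n → ℂ) : Prop := ∀ σ z, u (permute σ z) = u z

theorem IsSymm.adjoin_extract {u : Point (n + 1) → ℂ} (h : IsSymm u) (i : Fin (n + 1))
    (z : Point (n + 1)) : u (adjoin (extract i z)) = u z := by
  rw [PauliFierz.adjoin_extract, h]

theorem IsSymm.adjoinPair_extractPair {u : Point (n + 2) → ℂ} (h : IsSymm u)
    (p : Fin (n + 2) × Fin (n + 1)) (z : Point (n + 2)) :
    u (adjoinPair (extractPair p z)) = u z := by
  rw [adjoinPair, extractPair, PauliFierz.adjoin_extract, adjoin_permute, h]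
  exact h.adjoin_extract p.1 z

theorem IsSymm.adjoin {u : Point (n + 1) → ℂ} (h : IsSymm u) (q : Mode) :
    IsSymm fun z : Point n => u (adjoin (q, z)) := by
  intro σ z
  simp only
  rw [adjoin_permute, h]

theorem IsSymm.sum_extract {h : Mode × Point n → ℂ} (hh : ∀ q, IsSymm fun z => h (q, z)) :
    IsSymm fun z => ∑ i, h (extract i z) := by
  intro σ z
  simp only
  rw [← Equiv.sum_comp σ fun i => h (extract i z)]
  refine Finset.sum_congr rfl fun i _ => ?_
  obtain ⟨τ, hτ⟩ := exists_extract_permute i σ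
  rw [hτ]
  exact hh _ τ _

theorem IsSymm.sum_extractPair {h : Mode × Mode × Point n → ℂ}
    (hh : ∀ q q', IsSymm fun z => h (q, q', z)) :
    IsSymm fun z => ∑ p, h (extractPair p z) := by
  have := IsSymm.sum_extract (n := n + 1) (h := fun y => ∑ l, h (y.1, extract l y.2))
    fun q => IsSymm.sum_extract (h := fun y => h (q, y)) fun q' => hh q q'
  intro σ z
  simp only [Fintype.sum_prod_type]
  exact this σ z

/-- A symmetric square-integrable wave function of `n` photons. -/
structure IsWave (u : Point n → ℂ) : Prop where
  measurable : Measurable u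
  symm : IsSymm u
  memLp : MemLp u 2 (sectorMeasure n)

theorem IsWave.toLp_mem {u : Point n → ℂ} (h : IsWave u) : h.memLp.toLp u ∈ Sector n := by
  rw [Sector, Submodule.mem_iInf]
  intro σ
  rw [LinearMap.mem_eqLocus]
  have : (Lp.compMeasurePreservingₗᵢ ℂ (permute σ) (measurePreserving_permute σ))
      (h.memLp.toLp u) = h.memLp.toLp u := by
    change Lp.compMeasurePreserving (permute σ) (measurePreserving_permute σ) (h.memLp.toLp u) = _
    rw [Lp.toLp_compMeasurePreserving]
    congr 1
    funext z
    exact h.symm σ z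
  exact this

/-- The element of the `n`-photon sector given by a wave function. -/
def IsWave.toSector {u : Point n → ℂ} (h : IsWave u) : Sector n := ⟨_, h.toLp_mem⟩

/-- The function underlying an element of the `n`-photon sector. -/
abbrev sectorFn (ψ : Sector n) : Point n → ℂ := ((ψ : Lp ℂ 2 (sectorMeasure n)) : Point n → ℂ)

/-- `ψ` is the class of the symmetric wave function `u`. -/
structure Represents (ψ : Sector n) (u : Point n → ℂ) : Prop where
  wave : IsWave u
  ae_eq : sectorFn ψ =ᵐ[sectorMeasure n] u

theorem IsWave.represents {u : Point n → ℂ} (h : IsWave u) : Represents h.toSector u :=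
  ⟨h, h.memLp.coeFn_toLp⟩

theorem Represents.eq {ψ ψ' : Sector n} {u v : Point n → ℂ} (h : Represents ψ u)
    (h' : Represents ψ' v) (huv : u =ᵐ[sectorMeasure n] v) : ψ = ψ' :=
  Subtype.ext (Lp.ext (h.ae_eq.trans (huv.trans h'.ae_eq.symm)))

theorem sectorFn_permute_ae (ψ : Sector n) (σ : Equiv.Perm (Fin n)) :
    (fun z => sectorFn ψ (permute σ z)) =ᵐ[sectorMeasure n] sectorFn ψ := by
  have h : (ψ : Lp ℂ 2 (sectorMeasure n)) ∈ ⨅ σ : Equiv.Perm (Fin n), LinearMap.eqLocus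
    (Lp.compMeasurePreservingₗᵢ ℂ (permute σ) (measurePreserving_permute σ)).toLinearMap
    LinearMap.id := ψ.2
  rw [Submodule.mem_iInf] at h
  have h1 := h σ
  rw [LinearMap.mem_eqLocus] at h1
  have h2 : Lp.compMeasurePreserving (permute σ) (measurePreserving_permute σ)
    (ψ : Lp ℂ 2 (sectorMeasure n)) = ψ := h1
  have h3 := Lp.coeFn_compMeasurePreserving (ψ : Lp ℂ 2 (sectorMeasure n))
    (measurePreserving_permute σ)
  rw [h2] at h3
  exact h3.symm

theorem permute_permute (σ τ : Equiv.Perm (Fin n)) (z : Point n) :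
    permute σ (permute τ z) = permute (τ * σ) z := rfl

/-- Elements of the sector are symmetric only almost everywhere for each permutation. Averaging over
the finite group gives a measurable representative symmetric at every point. -/
theorem exists_represents (ψ : Sector n) : ∃ u : Point n → ℂ, Represents ψ u := by
  have hv : Measurable (sectorFn ψ) :=
    (Lp.stronglyMeasurable (ψ : Lp ℂ 2 (sectorMeasure n))).measurable
  let u : Point n → ℂ := fun z => (Fintype.card (Equiv.Perm (Fin n)) : ℂ)⁻¹ *
    ∑ σ, sectorFn ψ (permute σ z)
  have hu : sectorFn ψ =ᵐ[sectorMeasure n] u := by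
    have h : ∀ᵐ z ∂(sectorMeasure n), ∀ σ : Equiv.Perm (Fin n),
      sectorFn ψ (permute σ z) = sectorFn ψ z := ae_all_iff.2 fun σ => sectorFn_permute_ae ψ σ
    filter_upwards [h] with z hz
    simp only [u, hz, Finset.sum_const, Finset.card_univ, nsmul_eq_mul]
    rw [inv_mul_cancel_left₀]
    exact_mod_cast Fintype.card_ne_zero
  refine ⟨u, ⟨?_, ?_, ?_⟩, hu⟩
  · exact (Finset.measurable_sum _ fun σ _ =>
      hv.comp (measurePreserving_permute σ).measurable).const_mul _
  · intro τ z
    simp only [u, permute_permute]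
    congr 1
    exact Equiv.sum_comp (Equiv.mulLeft τ) fun σ => sectorFn ψ (permute σ z)
  · exact (memLp_congr_ae hu).1 (Lp.memLp _)

theorem Represents.inner_eq {u v : Point n → ℂ} {ψ ψ' : Sector n}
    (h : Represents ψ u) (h' : Represents ψ' v) :
    inner ℂ ψ ψ' = ∫ z, conj (u z) * v z ∂(sectorMeasure n) := by
  change inner ℂ (ψ : Lp ℂ 2 (sectorMeasure n)) (ψ' : Lp ℂ 2 (sectorMeasure n)) = _
  rw [inner_eq_integral]
  refine integral_congr_ae ?_
  filter_upwards [h.ae_eq, h'.ae_eq] with z h1 h2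
  exact congrArg₂ (fun a b => conj a * b) h1 h2

theorem eLpNorm_two_sq {X : Type*} [MeasurableSpace X] {μ : Measure X} (u : X → ℂ) :
    eLpNorm u 2 μ ^ 2 = ∫⁻ z, ‖u z‖ₑ ^ 2 ∂μ := by
  have := eLpNorm_nnreal_pow_eq_lintegral (f := u) (μ := μ) (p := 2) (by simp)
  simpa using this

theorem memLp_two_iff {X : Type*} [MeasurableSpace X] {μ : Measure X} {u : X → ℂ}
    (hu : Measurable u) : MemLp u 2 μ ↔ ∫⁻ z, ‖u z‖ₑ ^ 2 ∂μ < ⊤ := by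
  rw [← eLpNorm_two_sq, MemLp]
  simp [hu.aestronglyMeasurable, ENNReal.pow_lt_top_iff]

theorem Represents.norm_sq_eq {u : Point n → ℂ} {ψ : Sector n} (h : Represents ψ u) :
    ENNReal.ofReal (‖ψ‖ ^ 2) = ∫⁻ z, ‖u z‖ₑ ^ 2 ∂(sectorMeasure n) := by
  have h1 : ‖ψ‖ = (eLpNorm u 2 (sectorMeasure n)).toReal := by
    rw [← eLpNorm_congr_ae h.ae_eq]; rfl
  rw [h1, ENNReal.ofReal_pow ENNReal.toReal_nonneg,
    ENNReal.ofReal_toReal h.wave.memLp.eLpNorm_ne_top, eLpNorm_two_sq]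

end

/-! ### The coupling function and its radial integrals. -/

section

/-- The size `χ(|k|) / (2π |k|^{1/2})` of the coupling. -/
def amp (Λ : ℝ) (q : Mode) : ℝ :=
  (if ‖q.1‖ ≤ Λ then 1 else 0) / (2 * Real.pi * Real.sqrt ‖q.1‖)

theorem amp_nonneg (Λ : ℝ) (q : Mode) : 0 ≤ amp Λ q := by
  unfold amp; split_ifs <;> positivity

theorem measurable_amp (Λ : ℝ) : Measurable (amp Λ) := by
  unfold amp
  refine Measurable.div (Measurable.ite ?_ measurable_const measurable_const) (by fun_prop)
  exact measurableSet_le (by fun_prop) measurable_const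

theorem amp_eq_zero_of_norm_eq_zero (Λ : ℝ) {q : Mode} (h : ‖q.1‖ = 0) : amp Λ q = 0 := by
  simp [amp, h]

theorem coupling_eq (ε : R3 → Fin 2 → R3) (Λ : ℝ) (j : Fin 3) (q : Mode) :
    coupling ε Λ j q = amp Λ q * ε q.1 q.2 j := rfl

theorem sum_coupling_sq {ε : R3 → Fin 2 → R3} (hε : IsPolarization ε) (Λ : ℝ) (q : Mode) :
    ∑ j, coupling ε Λ j q ^ 2 = amp Λ q ^ 2 := by
  by_cases h : q.1 = 0
  -- At k = 0 nothing is known about the polarization vectors, but division by zero makes the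
  -- amplitude vanish there.
  · simp [coupling_eq, amp_eq_zero_of_norm_eq_zero Λ (by simp [h] : ‖q.1‖ = 0)]
  · have h1 := (hε.orthonormal q.1 h).1 q.2
    have h2 := EuclideanSpace.norm_sq_eq (ε q.1 q.2)
    rw [h1] at h2
    simp only [Real.norm_eq_abs, sq_abs] at h2
    simp only [coupling_eq, mul_pow, ← Finset.mul_sum, ← h2]; simp

theorem abs_coupling_le {ε : R3 → Fin 2 → R3} (hε : IsPolarization ε) (Λ : ℝ) (j : Fin 3)
    (q : Mode) : |coupling ε Λ j q| ≤ amp Λ q := by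
  apply abs_le_of_sq_le_sq _ (amp_nonneg Λ q)
  rw [← sum_coupling_sq hε]
  exact Finset.single_le_sum (f := fun j => coupling ε Λ j q ^ 2) (fun _ _ => sq_nonneg _)
    (Finset.mem_univ j)

theorem measurable_coupling {ε : R3 → Fin 2 → R3} (hε : IsPolarization ε) (Λ : ℝ) (j : Fin 3) :
    Measurable (coupling ε Λ j) := by
  have h1 : Measurable fun q : Mode => ε q.1 q.2 :=
    measurable_from_prod_countable_left fun l => (measurable_pi_apply l).comp hε.measurable
  have h2 : Measurable fun q : Mode => ε q.1 q.2 j :=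
    (EuclideanSpace.proj (𝕜 := ℝ) j).continuous.measurable.comp h1
  exact (measurable_amp Λ).mul h2

/-- The amplitude `∑_j G_j(q) G_j(q')` of pair creation. -/
def pairAmp (ε : R3 → Fin 2 → R3) (Λ : ℝ) (q q' : Mode) : ℝ :=
  ∑ j, coupling ε Λ j q * coupling ε Λ j q'

theorem abs_pairAmp_le {ε : R3 → Fin 2 → R3} (hε : IsPolarization ε) (Λ : ℝ) (q q' : Mode) :
    |pairAmp ε Λ q q'| ≤ amp Λ q * amp Λ q' := by
  apply abs_le_of_sq_le_sq _ (mul_nonneg (amp_nonneg Λ q) (amp_nonneg Λ q'))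
  rw [mul_pow, ← sum_coupling_sq hε, ← sum_coupling_sq hε]
  exact Finset.sum_mul_sq_le_sq_mul_sq _ _ _

theorem measurable_pairAmp {ε : R3 → Fin 2 → R3} (hε : IsPolarization ε) (Λ : ℝ) :
    Measurable fun p : Mode × Mode => pairAmp ε Λ p.1 p.2 := by
  unfold pairAmp
  exact Finset.measurable_sum _ fun j _ =>
    ((measurable_coupling hε Λ j).comp measurable_fst).mul
      ((measurable_coupling hε Λ j).comp measurable_snd)

theorem transverse_coupling {ε : R3 → Fin 2 → R3} (hε : IsPolarization ε) (Λ : ℝ) (q : Mode) :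
    ∑ j, coupling ε Λ j q * q.1 j = 0 := by
  by_cases h : q.1 = 0
  · simp [h]
  · have h1 := hε.transverse q.1 h q.2
    rw [PiLp.inner_apply] at h1
    simp only [RCLike.inner_apply, conj_trivial] at h1
    simp only [coupling_eq, mul_assoc, ← Finset.mul_sum, h1, mul_zero]

/-- 8π is the area 4π of the unit sphere times the two polarizations. -/
theorem integral_mode_radial (f : ℝ → ℝ) :
    ∫ q : Mode, f ‖q.1‖ ∂modeMeasure = 8 * Real.pi * ∫ y in Set.Ioi (0 : ℝ), y ^ 2 * f y := by
  unfold modeMeasure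
  rw [integral_fun_fst (fun k : R3 => f ‖k‖), integral_fun_norm_addHaar (volume : Measure R3) f]
  have h2 : (Measure.count : Measure (Fin 2)).real Set.univ = 2 := by
    simp [Measure.real]
  have h3 : (volume : Measure R3).real (Metric.ball 0 1) = Real.pi * 4 / 3 := by
    rw [Measure.real, EuclideanSpace.volume_ball_fin_three]
    simp [ENNReal.toReal_ofReal (by positivity : 0 ≤ Real.pi * 4 / 3)]
  rw [h2, h3, finrank_euclideanSpace_fin]
  simp only [smul_eq_mul, nsmul_eq_mul]
  push_cast; ring

theorem integrable_mode_radial {f : ℝ → ℝ}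
    (h : IntegrableOn (fun y => y ^ 2 * f y) (Set.Ioi 0)) :
    Integrable (fun q : Mode => f ‖q.1‖) modeMeasure := by
  have h1 : Integrable (fun k : R3 => f ‖k‖) volume := by
    rw [integrable_fun_norm_addHaar (volume : Measure R3) (f := f), finrank_euclideanSpace_fin]
    exact h
  exact h1.comp_fst _

theorem amp_sq_radial (Λ y : ℝ) (hy : 0 < y) :
    y ^ 2 * ((if y ≤ Λ then 1 else 0) / (2 * Real.pi * Real.sqrt y)) ^ 2
      = (Set.Ioc 0 Λ).indicator (fun y => (4 * Real.pi ^ 2)⁻¹ * y) y := by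
  rw [div_pow, mul_pow, Real.sq_sqrt hy.le, Set.indicator_apply]
  by_cases h : y ≤ Λ
  · simp only [h, Set.mem_Ioc, hy, and_self, if_true]; field_simp; norm_num
  · simp [h]

theorem amp_sq_div_radial (Λ y : ℝ) (hy : 0 < y) :
    y ^ 2 * (((if y ≤ Λ then 1 else 0) / (2 * Real.pi * Real.sqrt y)) ^ 2 / y)
      = (Set.Ioc 0 Λ).indicator (fun _ => (4 * Real.pi ^ 2)⁻¹) y := by
  rw [← mul_div_assoc, amp_sq_radial Λ y hy]
  by_cases h : y ∈ Set.Ioc 0 Λ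
  · simp only [Set.indicator_of_mem h]; field_simp
  · simp [h]

theorem integrable_amp_sq (Λ : ℝ) : Integrable (fun q => amp Λ q ^ 2) modeMeasure := by
  refine integrable_mode_radial
    (f := fun y => ((if y ≤ Λ then 1 else 0) / (2 * Real.pi * Real.sqrt y)) ^ 2) ?_
  refine IntegrableOn.congr_fun ?_ (fun y hy => (amp_sq_radial Λ y hy).symm) measurableSet_Ioi
  refine Integrable.integrableOn ?_
  rw [integrable_indicator_iff measurableSet_Ioc]
  exact (continuous_const.mul continuous_id).integrableOn_Ioc

theorem integrable_amp_sq_div (Λ : ℝ) :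
    Integrable (fun q => amp Λ q ^ 2 / ‖q.1‖) modeMeasure := by
  refine integrable_mode_radial
    (f := fun y => ((if y ≤ Λ then 1 else 0) / (2 * Real.pi * Real.sqrt y)) ^ 2 / y) ?_
  refine IntegrableOn.congr_fun ?_ (fun y hy => (amp_sq_div_radial Λ y hy).symm) measurableSet_Ioi
  refine Integrable.integrableOn ?_
  rw [integrable_indicator_iff measurableSet_Ioc]
  exact continuous_const.integrableOn_Ioc

/-- The value of D·D^* in the vacuum, hence the coefficient of α in the expansion: 8π · (4π²)⁻¹ ·
Λ²/2. -/
theorem integral_amp_sq {Λ : ℝ} (hΛ : 0 < Λ) :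
    ∫ q, amp Λ q ^ 2 ∂modeMeasure = Λ ^ 2 / Real.pi := by
  have h := integral_mode_radial
    (fun y => ((if y ≤ Λ then 1 else 0) / (2 * Real.pi * Real.sqrt y)) ^ 2)
  refine h.trans ?_
  rw [setIntegral_congr_fun measurableSet_Ioi (fun y hy => amp_sq_radial Λ y hy),
    setIntegral_indicator measurableSet_Ioc,
    Set.inter_eq_self_of_subset_right Set.Ioc_subset_Ioi_self,
    ← intervalIntegral.integral_of_le hΛ.le, intervalIntegral.integral_const_mul, integral_id]
  field_simp; ring

theorem integral_amp_sq_div {Λ : ℝ} (hΛ : 0 < Λ) :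
    ∫ q, amp Λ q ^ 2 / ‖q.1‖ ∂modeMeasure = 2 * Λ / Real.pi := by
  have h := integral_mode_radial
    (fun y => ((if y ≤ Λ then 1 else 0) / (2 * Real.pi * Real.sqrt y)) ^ 2 / y)
  refine h.trans ?_
  rw [setIntegral_congr_fun measurableSet_Ioi (fun y hy => amp_sq_div_radial Λ y hy),
    setIntegral_indicator measurableSet_Ioc,
    Set.inter_eq_self_of_subset_right Set.Ioc_subset_Ioi_self,
    ← intervalIntegral.integral_of_le hΛ.le, intervalIntegral.integral_const]
  simp only [smul_eq_mul]
  field_simp; ring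

theorem lintegral_amp_sq {Λ : ℝ} (hΛ : 0 < Λ) :
    ∫⁻ q, ENNReal.ofReal (amp Λ q) ^ 2 ∂modeMeasure = ENNReal.ofReal (Λ ^ 2 / Real.pi) := by
  rw [← integral_amp_sq hΛ, ofReal_integral_eq_lintegral_ofReal (integrable_amp_sq Λ)
    (.of_forall fun q => sq_nonneg _)]
  simp only [ENNReal.ofReal_pow (amp_nonneg Λ _)]

/-- `amp / |k|^{1/2}`. -/
def ampDiv (Λ : ℝ) (q : Mode) : ℝ := amp Λ q / Real.sqrt ‖q.1‖

theorem ampDiv_nonneg (Λ : ℝ) (q : Mode) : 0 ≤ ampDiv Λ q :=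
  div_nonneg (amp_nonneg Λ q) (Real.sqrt_nonneg _)

theorem measurable_ampDiv (Λ : ℝ) : Measurable (ampDiv Λ) :=
  (measurable_amp Λ).div (by fun_prop)

theorem ampDiv_sq (Λ : ℝ) (q : Mode) : ampDiv Λ q ^ 2 = amp Λ q ^ 2 / ‖q.1‖ := by
  rw [ampDiv, div_pow, Real.sq_sqrt (norm_nonneg _)]

theorem ampDiv_mul_sqrt (Λ : ℝ) (q : Mode) : ampDiv Λ q * Real.sqrt ‖q.1‖ = amp Λ q := by
  by_cases h : ‖q.1‖ = 0
  · simp [ampDiv, amp_eq_zero_of_norm_eq_zero Λ h]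
  · rw [ampDiv, div_mul_cancel₀]
    exact (Real.sqrt_pos.2 (lt_of_le_of_ne (norm_nonneg _) (Ne.symm h))).ne'

theorem lintegral_ampDiv_sq {Λ : ℝ} (hΛ : 0 < Λ) :
    ∫⁻ q, ENNReal.ofReal (ampDiv Λ q) ^ 2 ∂modeMeasure = ENNReal.ofReal (2 * Λ / Real.pi) := by
  rw [← integral_amp_sq_div hΛ, ofReal_integral_eq_lintegral_ofReal (integrable_amp_sq_div Λ)
    (.of_forall fun q => by positivity)]
  simp only [← ENNReal.ofReal_pow (ampDiv_nonneg Λ _), ampDiv_sq]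

theorem memLp_coupling {ε : R3 → Fin 2 → R3} (hε : IsPolarization ε) (Λ : ℝ) (j : Fin 3) :
    MemLp (fun q => (coupling ε Λ j q : ℂ)) 2 modeMeasure := by
  have h1 : MemLp (amp Λ) 2 modeMeasure :=
    (memLp_two_iff_integrable_sq (measurable_amp Λ).aestronglyMeasurable).2 (integrable_amp_sq Λ)
  refine h1.of_le (Complex.measurable_ofReal.comp (measurable_coupling hε Λ j)).aestronglyMeasurable
    (.of_forall fun q => ?_)
  rw [Complex.norm_real, Real.norm_eq_abs, Real.norm_eq_abs, abs_of_nonneg (amp_nonneg Λ q)]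
  exact abs_coupling_le hε Λ j q

theorem integrable_coupling_sq {ε : R3 → Fin 2 → R3} (hε : IsPolarization ε) (Λ : ℝ)
    (j : Fin 3) : Integrable (fun q => coupling ε Λ j q ^ 2) modeMeasure := by
  refine (integrable_amp_sq Λ).mono' ((measurable_coupling hε Λ j).pow_const 2).aestronglyMeasurable
    (.of_forall fun q => ?_)
  rw [Real.norm_eq_abs, abs_pow]
  exact pow_le_pow_left₀ (abs_nonneg _) (abs_coupling_le hε Λ j q) 2

theorem sum_integral_coupling_sq {ε : R3 → Fin 2 → R3} (hε : IsPolarization ε) {Λ : ℝ}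
    (hΛ : 0 < Λ) : ∑ j, ∫ q, coupling ε Λ j q ^ 2 ∂modeMeasure = Λ ^ 2 / Real.pi := by
  rw [← integral_finsetSum _ fun j _ => integrable_coupling_sq hε Λ j, ← integral_amp_sq hΛ]
  simp only [sum_coupling_sq hε]

theorem lintegral_mul_sq_le {X : Type*} [MeasurableSpace X] {μ : Measure X} {f g : X → ENNReal}
    (hf : AEMeasurable f μ) (hg : AEMeasurable g μ) :
    (∫⁻ x, f x * g x ∂μ) ^ 2 ≤ (∫⁻ x, f x ^ 2 ∂μ) * ∫⁻ x, g x ^ 2 ∂μ := by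
  have h := ENNReal.lintegral_mul_le_Lp_mul_Lq μ Real.HolderConjugate.two_two hf hg
  have h2 := pow_le_pow_left₀ (by simp) h 2
  refine h2.trans (le_of_eq ?_)
  rw [mul_pow, ← ENNReal.rpow_natCast, ← ENNReal.rpow_natCast, ← ENNReal.rpow_mul,
    ← ENNReal.rpow_mul]
  norm_num

end

/-! ### Symmetrization of one photon or two photons with the rest. -/

section

variable {n : ℕ}

section Symmetrization

variable {A Z T : Type*} [Fintype A] [MeasurableSpace Z] [MeasurableSpace T] {μ : Measure Z}
  {ν : Measure T} {s : A → Z → T}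

theorem lintegral_sum_comp (hs : ∀ a, MeasurePreserving (s a) μ ν) {F : T → ENNReal}
    (hF : Measurable F) :
    ∫⁻ z, ∑ a, F (s a z) ∂μ = Fintype.card A * ∫⁻ y, F y ∂ν := by
  have hm : ∀ a ∈ (Finset.univ : Finset A), Measurable fun z => F (s a z) :=
    fun a _ => hF.comp (hs a).measurable
  rw [lintegral_finsetSum _ hm]
  simp only [fun a => (hs a).lintegral_comp hF, Finset.sum_const, Finset.card_univ, nsmul_eq_mul]

/-- All summands have the same integral, since v does not see which photons were singled out and
each extraction preserves the measure. -/
theorem integral_conj_sum_comp_mul (hs : ∀ a, MeasurePreserving (s a) μ ν) {J : T → Z}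
    {v : Z → ℂ} (hv : ∀ a z, v (J (s a z)) = v z) {h : T → ℂ} (hh : MemLp h 2 ν)
    (hvJ : MemLp (fun y => v (J y)) 2 ν) :
    ∫ z, conj (∑ a, h (s a z)) * v z ∂μ
      = Fintype.card A * ∫ y, conj (h y) * v (J y) ∂ν := by
  have hint : Integrable (fun y => conj (h y) * v (J y)) ν :=
    integrable_mul_of_memLp_two hh.star hvJ
  have e : ∀ z, conj (∑ a, h (s a z)) * v z
      = ∑ a, (fun y => conj (h y) * v (J y)) (s a z) := by
    intro z
    simp only [map_sum, Finset.sum_mul, hv]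
  have hint' : ∀ a ∈ (Finset.univ : Finset A),
      Integrable (fun z => (fun y => conj (h y) * v (J y)) (s a z)) μ :=
    fun a _ => (hs a).integrable_comp_of_integrable hint
  rw [integral_congr_ae (.of_forall e), integral_finsetSum _ hint']
  have e2 : ∀ a, ∫ z, (fun y => conj (h y) * v (J y)) (s a z) ∂μ
      = ∫ y, conj (h y) * v (J y) ∂ν := by
    intro a
    rw [← (hs a).map_eq, integral_map (hs a).measurable.aemeasurable]
    rw [(hs a).map_eq]; exact hint.aestronglyMeasurable
  simp only [e2, Finset.sum_const, Finset.card_univ, nsmul_eq_mul]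

/-- Cauchy–Schwarz over the nonvanishing terms only. Counting these instead of all terms is what
makes hard pair creation bounded independently of the photon number. -/
theorem enorm_sum_sq_le (a : A → ℂ) (N : ℕ) (hN : (Finset.univ.filter fun x => a x ≠ 0).card ≤ N) :
    ‖∑ x, a x‖ₑ ^ 2 ≤ N * ∑ x, ‖a x‖ₑ ^ 2 := by
  classical
  set S := Finset.univ.filter fun x => a x ≠ 0
  have h1 : ∑ x, a x = ∑ x ∈ S, a x := by
    rw [Finset.sum_filter_ne_zero]
  have h2 : ‖∑ x, a x‖ ^ 2 ≤ N * ∑ x, ‖a x‖ ^ 2 := by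
    rw [h1]
    calc ‖∑ x ∈ S, a x‖ ^ 2 ≤ (∑ x ∈ S, ‖a x‖) ^ 2 := by
          gcongr; exact norm_sum_le _ _
      _ ≤ S.card * ∑ x ∈ S, ‖a x‖ ^ 2 := sq_sum_le_card_mul_sum_sq
      _ ≤ N * ∑ x, ‖a x‖ ^ 2 := by
          gcongr
          exact Finset.subset_univ S
  have h3 := ENNReal.ofReal_le_ofReal h2
  rw [ENNReal.ofReal_mul (by positivity), ENNReal.ofReal_natCast,
    ENNReal.ofReal_sum_of_nonneg (fun _ _ => by positivity),
    ENNReal.ofReal_pow (norm_nonneg _)] at h3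
  simpa only [ENNReal.ofReal_pow (norm_nonneg _), ofReal_norm] using h3

theorem lintegral_enorm_sum_comp_sq_le (hs : ∀ a, MeasurePreserving (s a) μ ν) {h : T → ℂ}
    (hm : Measurable h) (N : ℕ)
    (hN : ∀ z, (Finset.univ.filter fun a => h (s a z) ≠ 0).card ≤ N) :
    ∫⁻ z, ‖∑ a, h (s a z)‖ₑ ^ 2 ∂μ ≤ N * (Fintype.card A * ∫⁻ y, ‖h y‖ₑ ^ 2 ∂ν) := by
  have hm' : Measurable fun z => ∑ a, ‖h (s a z)‖ₑ ^ 2 :=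
    Finset.measurable_sum _ fun a _ => (hm.enorm.pow_const 2).comp (hs a).measurable
  rw [← lintegral_sum_comp hs (hm.enorm.pow_const 2), ← lintegral_const_mul _ hm']
  exact lintegral_mono fun z => enorm_sum_sq_le _ N (hN z)

end Symmetrization

/-- The symmetric wave function of `n + 1` photons made from one photon and `n` photons. -/
def symOne (h : Mode × Point n → ℂ) (z : Point (n + 1)) : ℂ :=
  (Real.sqrt (n + 1) : ℂ)⁻¹ * ∑ i, h (extract i z)

/-- The symmetric wave function of `n + 2` photons made from two photons and `n` photons. -/
def symPair (h : Mode × Mode × Point n → ℂ) (z : Point (n + 2)) : ℂ :=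
  ((Real.sqrt (n + 1) : ℂ) * (Real.sqrt (n + 2) : ℂ))⁻¹ * ∑ p, h (extractPair p z)

theorem ofReal_sqrt_mul_self {x : ℝ} (hx : 0 ≤ x) :
    (Real.sqrt x : ℂ) * (Real.sqrt x : ℂ) = (x : ℂ) := by
  rw [← Complex.ofReal_mul, Real.mul_self_sqrt hx]

theorem sqrt_succ_ne_zero (n : ℕ) : (Real.sqrt (n + 1) : ℂ) ≠ 0 := by
  rw [Complex.ofReal_ne_zero]; positivity

theorem sqrt_succ_succ_ne_zero (n : ℕ) : (Real.sqrt (n + 2) : ℂ) ≠ 0 := by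
  rw [Complex.ofReal_ne_zero]; positivity

theorem integral_conj_symOne_mul {h : Mode × Point n → ℂ} {v : Point (n + 1) → ℂ}
    (hh : MemLp h 2 (modeMeasure.prod (sectorMeasure n))) (hv : IsWave v) :
    ∫ z, conj (symOne h z) * v z ∂(sectorMeasure (n + 1))
      = (Real.sqrt (n + 1) : ℂ) *
        ∫ y, conj (h y) * v (adjoin y) ∂(modeMeasure.prod (sectorMeasure n)) := by
  have h1 := integral_conj_sum_comp_mul measurePreserving_extract hv.symm.adjoin_extract hh
    (hv.memLp.comp_measurePreserving measurePreserving_adjoin)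
  have e : ∀ z, conj (symOne h z) * v z
      = (Real.sqrt (n + 1) : ℂ)⁻¹ * (conj (∑ i, h (extract i z)) * v z) := by
    intro z
    rw [symOne, map_mul, map_inv₀, Complex.conj_ofReal, mul_assoc]
  simp only [e]
  rw [integral_const_mul, h1, ← mul_assoc]
  congr 1
  have h2 := ofReal_sqrt_mul_self (x := (n : ℝ) + 1) (by positivity)
  rw [Fintype.card_fin, inv_mul_eq_iff_eq_mul₀ (sqrt_succ_ne_zero n), h2]
  push_cast; rfl

theorem integral_conj_symPair_mul {h : Mode × Mode × Point n → ℂ} {v : Point (n + 2) → ℂ}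
    (hh : MemLp h 2 (pairMeasure n)) (hv : IsWave v) :
    ∫ z, conj (symPair h z) * v z ∂(sectorMeasure (n + 2))
      = (Real.sqrt (n + 1) : ℂ) * (Real.sqrt (n + 2) : ℂ) *
        ∫ y, conj (h y) * v (adjoinPair y) ∂(pairMeasure n) := by
  have h1 := integral_conj_sum_comp_mul measurePreserving_extractPair
    hv.symm.adjoinPair_extractPair hh
    (hv.memLp.comp_measurePreserving measurePreserving_adjoinPair)
  have e : ∀ z, conj (symPair h z) * v z
      = ((Real.sqrt (n + 1) : ℂ) * (Real.sqrt (n + 2) : ℂ))⁻¹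
        * (conj (∑ i, h (extractPair i z)) * v z) := by
    intro z
    rw [symPair, map_mul, map_inv₀, map_mul, Complex.conj_ofReal, Complex.conj_ofReal, mul_assoc]
  simp only [e]
  rw [integral_const_mul, h1, ← mul_assoc]
  congr 1
  have h2 := ofReal_sqrt_mul_self (x := (n : ℝ) + 1) (by positivity)
  have h3 := ofReal_sqrt_mul_self (x := (n : ℝ) + 2) (by positivity)
  rw [Fintype.card_prod, Fintype.card_fin, Fintype.card_fin,
    inv_mul_eq_iff_eq_mul₀ (mul_ne_zero (sqrt_succ_ne_zero n) (sqrt_succ_succ_ne_zero n)),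
    mul_mul_mul_comm, h2, h3]
  push_cast; ring

theorem enorm_inv_sqrt_sq (x : ℝ) (hx : 0 < x) :
    ‖(Real.sqrt x : ℂ)⁻¹‖ₑ ^ 2 * ENNReal.ofReal x = 1 := by
  rw [← ofReal_norm, ← ENNReal.ofReal_pow (norm_nonneg _), norm_inv, Complex.norm_real,
    ← ENNReal.ofReal_mul (by positivity), Real.norm_of_nonneg (Real.sqrt_nonneg _), inv_pow,
    Real.sq_sqrt hx.le, inv_mul_cancel₀ hx.ne', ENNReal.ofReal_one]

theorem lintegral_symOne_sq_le {h : Mode × Point n → ℂ} (hm : Measurable h) :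
    ∫⁻ z, ‖symOne h z‖ₑ ^ 2 ∂(sectorMeasure (n + 1))
      ≤ (n + 1 : ℕ) * ∫⁻ y, ‖h y‖ₑ ^ 2 ∂(modeMeasure.prod (sectorMeasure n)) := by
  simp only [symOne, enorm_mul, mul_pow]
  rw [lintegral_const_mul]
  · refine (mul_le_mul_right (lintegral_enorm_sum_comp_sq_le measurePreserving_extract hm (n + 1)
      fun z => (Finset.card_le_univ _).trans (by simp)) _).trans (le_of_eq ?_)
    rw [Fintype.card_fin, ← mul_assoc, mul_left_comm, ← mul_assoc, ← mul_assoc]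
    congr 1
    have := enorm_inv_sqrt_sq (n + 1) (by positivity)
    have e : ENNReal.ofReal ((n : ℝ) + 1) = ((n + 1 : ℕ) : ENNReal) := by
      rw [← ENNReal.ofReal_natCast]; push_cast; rfl
    rw [e] at this
    rw [mul_assoc, this, mul_one]
  · exact (Finset.measurable_sum _ fun i _ => hm.comp (measurable_extract i)).enorm.pow_const 2

/-- The (n+1)(n+2) ordered pairs contribute equal integrals and cancel the normalization; only the
overlap number 2 is left. -/
theorem lintegral_symPair_sq_le {h : Mode × Mode × Point n → ℂ} (hm : Measurable h)
    (hN : ∀ z, (Finset.univ.filter fun p => h (extractPair p z) ≠ 0).card ≤ 2) :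
    ∫⁻ z, ‖symPair h z‖ₑ ^ 2 ∂(sectorMeasure (n + 2))
      ≤ 2 * ∫⁻ y, ‖h y‖ₑ ^ 2 ∂(pairMeasure n) := by
  simp only [symPair, enorm_mul, mul_pow]
  rw [lintegral_const_mul]
  · refine (mul_le_mul_right (lintegral_enorm_sum_comp_sq_le measurePreserving_extractPair hm 2 hN)
      _).trans (le_of_eq ?_)
    rw [Fintype.card_prod, Fintype.card_fin, Fintype.card_fin, mul_left_comm, Nat.cast_ofNat,
      ← mul_assoc _ _ (lintegral _ _)]
    have h1 := enorm_inv_sqrt_sq (n + 1) (by positivity)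
    have h2 := enorm_inv_sqrt_sq (n + 2) (by positivity)
    have e1 : ENNReal.ofReal ((n : ℝ) + 1) = ((n + 1 : ℕ) : ENNReal) := by
      rw [← ENNReal.ofReal_natCast]; push_cast; rfl
    have e2 : ENNReal.ofReal ((n : ℝ) + 2) = ((n + 2 : ℕ) : ENNReal) := by
      rw [← ENNReal.ofReal_natCast]; push_cast; rfl
    rw [e1] at h1
    rw [e2] at h2
    rw [mul_inv, enorm_mul, mul_pow, Nat.cast_mul, mul_comm ((n + 1 + 1 : ℕ) : ENNReal),
      mul_mul_mul_comm, h1, h2, one_mul, one_mul]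
  · exact (Finset.measurable_sum _ fun p _ =>
      hm.comp (measurePreserving_extractPair p).measurable).enorm.pow_const 2

theorem measurable_symOne {h : Mode × Point n → ℂ} (hm : Measurable h) : Measurable (symOne h) :=
  (Finset.measurable_sum _ fun i _ => hm.comp (measurable_extract i)).const_mul _

theorem measurable_symPair {h : Mode × Mode × Point n → ℂ} (hm : Measurable h) :
    Measurable (symPair h) :=
  (Finset.measurable_sum _ fun p _ =>
    hm.comp (measurePreserving_extractPair p).measurable).const_mul _

theorem isWave_symOne {h : Mode × Point n → ℂ} (hm : Measurable h)
    (hs : ∀ q, IsSymm fun z => h (q, z)) (hh : MemLp h 2 (modeMeasure.prod (sectorMeasure n))) :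
    IsWave (symOne h) := by
  refine ⟨measurable_symOne hm, fun σ z => ?_, ?_⟩
  · exact congrArg (fun c => (Real.sqrt (n + 1) : ℂ)⁻¹ * c) (IsSymm.sum_extract hs σ z)
  · rw [memLp_two_iff (measurable_symOne hm)]
    refine (lintegral_symOne_sq_le hm).trans_lt ?_
    exact ENNReal.mul_lt_top (by simp) ((memLp_two_iff hm).1 hh)

theorem isWave_symPair {h : Mode × Mode × Point n → ℂ} (hm : Measurable h)
    (hs : ∀ q q', IsSymm fun z => h (q, q', z)) (hh : MemLp h 2 (pairMeasure n)) :
    IsWave (symPair h) := by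
  refine ⟨measurable_symPair hm, fun σ z => ?_, ?_⟩
  · exact congrArg (fun c => ((Real.sqrt (n + 1) : ℂ) * (Real.sqrt (n + 2) : ℂ))⁻¹ * c)
      (IsSymm.sum_extractPair hs σ z)
  · refine MemLp.const_mul ?_ _
    exact memLp_finsetSum _ fun p _ =>
      hh.comp_measurePreserving (measurePreserving_extractPair p)

theorem memLp_mul_prod {X Y : Type*} [MeasurableSpace X] [MeasurableSpace Y] {μ : Measure X}
    {ν : Measure Y} [SFinite μ] [SFinite ν] {f : X → ℂ} {u : Y → ℂ} (hfm : Measurable f)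
    (hum : Measurable u) (hf : MemLp f 2 μ) (hu : MemLp u 2 ν) :
    MemLp (fun y : X × Y => f y.1 * u y.2) 2 (μ.prod ν) := by
  have hm : Measurable fun y : X × Y => f y.1 * u y.2 :=
    (hfm.comp measurable_fst).mul (hum.comp measurable_snd)
  rw [memLp_two_iff hm]
  simp only [enorm_mul, mul_pow]
  rw [lintegral_prod_mul (hfm.enorm.pow_const 2).aemeasurable (hum.enorm.pow_const 2).aemeasurable]
  exact ENNReal.mul_lt_top ((memLp_two_iff hfm).1 hf) ((memLp_two_iff hum).1 hu)

theorem measurable_phase_comp {X : Type*} [MeasurableSpace X] {f : X → R3} {g : X → Mode}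
    (hf : Measurable f) (hg : Measurable g) : Measurable fun y => phase (f y) (g y) := by
  unfold phase
  have h1 : Measurable fun y => inner ℝ (g y).1 (f y) := Measurable.inner hg.fst hf
  have h2 : Measurable fun y => ((inner ℝ (g y).1 (f y) : ℝ) : ℂ) := h1.complex_ofReal
  exact (h2.const_mul Complex.I).cexp

theorem measurable_coupling_comp {ε : R3 → Fin 2 → R3} (hε : IsPolarization ε) {Λ : ℝ}
    (j : Fin 3) {X : Type*} [MeasurableSpace X] {g : X → Mode} (hg : Measurable g) :
    Measurable fun y => (coupling ε Λ j (g y) : ℂ) := by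
  have h : Measurable fun y => coupling ε Λ j (g y) := (measurable_coupling hε Λ j).comp hg
  exact h.complex_ofReal

instance (n : ℕ) : CompleteSpace (Sector n) := by
  suffices h : IsClosed (Sector n : Set (Lp ℂ 2 (sectorMeasure n))) from h.completeSpace_coe
  have : (Sector n : Set (Lp ℂ 2 (sectorMeasure n))) = ⋂ σ : Equiv.Perm (Fin n),
      {ψ | Lp.compMeasurePreservingₗᵢ ℂ (permute σ) (measurePreserving_permute σ) ψ = ψ} := by
    ext ψ
    simp only [Sector, Submodule.coe_iInf, Set.mem_iInter]
    rfl
  rw [this]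
  exact isClosed_iInter fun σ => isClosed_eq (LinearIsometry.continuous _) continuous_id

end

/-! ### Creation and annihilation as operations on wave functions. -/

section

variable {n : ℕ}

/-- The function `G_j(q) e^{-iq·x} u(z)`. -/
def creationKernel (ε : R3 → Fin 2 → R3) (Λ : ℝ) (j : Fin 3) (u : Point n → ℂ)
    (y : Mode × Point n) : ℂ :=
  (coupling ε Λ j y.1 : ℂ) * conj (phase y.2.1 y.1) * u y.2

/-- `D_j^* u` as a function of all variables. -/
def creationFn (ε : R3 → Fin 2 → R3) (Λ : ℝ) (j : Fin 3) (u : Point n → ℂ) : Point (n + 1) → ℂ :=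
  symOne (creationKernel ε Λ j u)

/-- `D_j v` as a function of all variables. -/
def annihFn (ε : R3 → Fin 2 → R3) (Λ : ℝ) (j : Fin 3) (v : Point (n + 1) → ℂ) (z : Point n) : ℂ :=
  (Real.sqrt (n + 1) : ℂ) *
    ∫ q, (coupling ε Λ j q : ℂ) * phase z.1 q * v (adjoin (q, z)) ∂modeMeasure

theorem ae_of_ae_adjoin {p : Point (n + 1) → Prop} (h : ∀ᵐ z ∂(sectorMeasure (n + 1)), p z) :
    ∀ᵐ z ∂(sectorMeasure n), ∀ᵐ q ∂modeMeasure, p (adjoin (q, z)) := by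
  have h1 := measurePreserving_adjoin.quasiMeasurePreserving.ae h
  have h2 := (Measure.measurePreserving_swap (μ := sectorMeasure n)
    (ν := modeMeasure)).quasiMeasurePreserving.ae h1
  exact Measure.ae_ae_of_ae_prod h2

theorem ae_extract {p : Mode × Point n → Prop}
    (h : ∀ᵐ y ∂(modeMeasure.prod (sectorMeasure n)), p y) (i : Fin (n + 1)) :
    ∀ᵐ z ∂(sectorMeasure (n + 1)), p (extract i z) :=
  (measurePreserving_extract i).quasiMeasurePreserving.ae h

theorem ae_extract_snd {p : Point n → Prop} (h : ∀ᵐ z ∂(sectorMeasure n), p z)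
    (i : Fin (n + 1)) : ∀ᵐ z ∂(sectorMeasure (n + 1)), p (extract i z).2 :=
  ae_extract (p := fun y => p y.2) (Measure.quasiMeasurePreserving_snd.ae h) i

theorem creationFn_congr_ae (ε : R3 → Fin 2 → R3) (Λ : ℝ) (j : Fin 3) {u u' : Point n → ℂ}
    (h : u =ᵐ[sectorMeasure n] u') :
    creationFn ε Λ j u =ᵐ[sectorMeasure (n + 1)] creationFn ε Λ j u' := by
  have h1 : ∀ᵐ z ∂(sectorMeasure (n + 1)), ∀ i : Fin (n + 1),
      u (extract i z).2 = u' (extract i z).2 := ae_all_iff.2 fun i => ae_extract_snd h i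
  filter_upwards [h1] with z hz
  simp only [creationFn, symOne, creationKernel, hz]

theorem annihFn_congr_ae (ε : R3 → Fin 2 → R3) (Λ : ℝ) (j : Fin 3) {v v' : Point (n + 1) → ℂ}
    (h : v =ᵐ[sectorMeasure (n + 1)] v') :
    annihFn ε Λ j v =ᵐ[sectorMeasure n] annihFn ε Λ j v' := by
  filter_upwards [ae_of_ae_adjoin h] with z hz
  simp only [annihFn]
  congr 1
  exact integral_congr_ae (hz.mono fun q hq => by simp only [hq])

theorem lintegral_adjoin_symm {F : Mode × Point n → ENNReal} (hF : Measurable F) :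
    ∫⁻ z, ∫⁻ q, F (q, z) ∂modeMeasure ∂(sectorMeasure n)
      = ∫⁻ y, F y ∂(modeMeasure.prod (sectorMeasure n)) :=
  (lintegral_prod_symm' F hF).symm

theorem fieldEnergy_nonneg (K : Fin n → Mode) : 0 ≤ fieldEnergy K :=
  Finset.sum_nonneg fun _ _ => norm_nonneg _

theorem measurable_fieldEnergy : Measurable (fieldEnergy (n := n)) := by
  unfold fieldEnergy
  exact Finset.measurable_sum _ fun i _ => ((measurable_pi_apply i).fst).norm

theorem fieldEnergy_extract (i : Fin (n + 1)) (z : Point (n + 1)) :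
    fieldEnergy z.2 = ‖(extract i z).1.1‖ + fieldEnergy (extract i z).2.2 := by
  simp only [fieldEnergy, extract, Fin.removeNth]
  exact Fin.sum_univ_succAbove _ i

/-- Integrals against a one-photon weight, for a symmetric wave function. -/
theorem lintegral_weight_adjoin {v : Point (n + 1) → ℂ} (hv : Measurable v) (hs : IsSymm v)
    {w : Mode × Point n → ENNReal} (hw : Measurable w) :
    (n + 1 : ℕ) * ∫⁻ y, w y * ‖v (adjoin y)‖ₑ ^ 2 ∂(modeMeasure.prod (sectorMeasure n))
      = ∫⁻ z, (∑ i, w (extract i z)) * ‖v z‖ₑ ^ 2 ∂(sectorMeasure (n + 1)) := by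
  have h := lintegral_sum_comp (measurePreserving_extract (n := n))
    (F := fun y => w y * ‖v (adjoin y)‖ₑ ^ 2)
    (hw.mul ((hv.comp measurable_adjoin).enorm.pow_const 2))
  rw [Fintype.card_fin] at h
  rw [← h]
  refine lintegral_congr fun z => ?_
  simp only [hs.adjoin_extract, Finset.sum_mul]

/-- By symmetry, n + 1 times the energy of one photon is the total energy; in this way the number of
photons disappears from the estimates. -/
theorem lintegral_norm_adjoin {v : Point (n + 1) → ℂ} (hv : Measurable v) (hs : IsSymm v) :
    (n + 1 : ℕ) * ∫⁻ y, ENNReal.ofReal ‖y.1.1‖ * ‖v (adjoin y)‖ₑ ^ 2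
        ∂(modeMeasure.prod (sectorMeasure n))
      = ∫⁻ z, ENNReal.ofReal (fieldEnergy z.2) * ‖v z‖ₑ ^ 2 ∂(sectorMeasure (n + 1)) := by
  rw [lintegral_weight_adjoin hv hs (w := fun y => ENNReal.ofReal ‖y.1.1‖) (by fun_prop)]
  refine lintegral_congr fun z => ?_
  rw [fieldEnergy, ENNReal.ofReal_sum_of_nonneg fun _ _ => norm_nonneg _]
  rfl

section Bounds

variable {ε : R3 → Fin 2 → R3} {Λ : ℝ}

theorem measurable_creationKernel (hε : IsPolarization ε) (j : Fin 3) {u : Point n → ℂ} (hu : Measurable u) :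
    Measurable (creationKernel ε Λ j u) := by
  unfold creationKernel
  refine Measurable.mul (Measurable.mul ?_ ?_) (hu.comp measurable_snd)
  · exact measurable_coupling_comp hε j measurable_fst
  · exact Complex.continuous_conj.measurable.comp
      (measurable_phase_comp (measurable_fst.comp measurable_snd) measurable_fst)

theorem memLp_creationKernel (hε : IsPolarization ε) (j : Fin 3) {u : Point n → ℂ} (hu : IsWave u) :
    MemLp (creationKernel ε Λ j u) 2 (modeMeasure.prod (sectorMeasure n)) := by
  have h := memLp_mul_prod (f := fun q => (coupling ε Λ j q : ℂ)) (u := u)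
    (measurable_coupling_comp hε j measurable_id)
    hu.measurable (memLp_coupling hε Λ j) hu.memLp
  refine h.mono (measurable_creationKernel hε j hu.measurable).aestronglyMeasurable
    (.of_forall fun y => le_of_eq ?_)
  simp only [creationKernel, norm_mul, RCLike.norm_conj, norm_phase, mul_one]

theorem isWave_creationFn (hε : IsPolarization ε) (j : Fin 3) {u : Point n → ℂ} (hu : IsWave u) :
    IsWave (creationFn ε Λ j u) := by
  refine isWave_symOne (measurable_creationKernel hε j hu.measurable) (fun q σ z => ?_)
    (memLp_creationKernel hε j hu)
  simp only [creationKernel]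
  rw [hu.symm]; rfl

theorem measurable_annih_integrand (hε : IsPolarization ε) (j : Fin 3) {v : Point (n + 1) → ℂ} (hv : Measurable v) :
    Measurable fun y : Mode × Point n =>
      (coupling ε Λ j y.1 : ℂ) * phase y.2.1 y.1 * v (adjoin y) := by
  refine Measurable.mul (Measurable.mul ?_ ?_) (hv.comp measurable_adjoin)
  · exact measurable_coupling_comp hε j measurable_fst
  · exact measurable_phase_comp (measurable_fst.comp measurable_snd) measurable_fst

theorem measurable_annihFn (hε : IsPolarization ε) (j : Fin 3) {v : Point (n + 1) → ℂ} (hv : Measurable v) :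
    Measurable (annihFn ε Λ j v) := by
  unfold annihFn
  have h := (measurable_annih_integrand (Λ := Λ) hε j hv).stronglyMeasurable
  exact (h.integral_prod_left' (μ := modeMeasure)).measurable.const_mul _

theorem enorm_annihFn_le (hε : IsPolarization ε) (j : Fin 3) (v : Point (n + 1) → ℂ) (z : Point n) :
    ‖annihFn ε Λ j v z‖ₑ ≤ ‖(Real.sqrt (n + 1) : ℂ)‖ₑ *
      ∫⁻ q, ENNReal.ofReal (amp Λ q) * ‖v (adjoin (q, z))‖ₑ ∂modeMeasure := by
  rw [annihFn, enorm_mul]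
  gcongr
  refine (enorm_integral_le_lintegral_enorm _).trans (lintegral_mono fun q => ?_)
  rw [enorm_mul, enorm_mul]
  gcongr
  have h1 : ‖phase z.1 q‖ₑ = 1 := by rw [← ofReal_norm, norm_phase]; simp
  rw [h1, mul_one, ← ofReal_norm, Complex.norm_real]
  exact ENNReal.ofReal_le_ofReal (abs_coupling_le hε Λ j q)

theorem enorm_sqrt_sq (x : ℝ) (hx : 0 ≤ x) : ‖(Real.sqrt x : ℂ)‖ₑ ^ 2 = ENNReal.ofReal x := by
  rw [← ofReal_norm, ← ENNReal.ofReal_pow (norm_nonneg _), Complex.norm_real,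
    Real.norm_of_nonneg (Real.sqrt_nonneg _), Real.sq_sqrt hx]

/-- Cauchy–Schwarz in the annihilated photon, with the amplitude factored as a b. The choice a =
amp/|k|^{1/2}, b = |k|^{1/2} leads to bounds by H_f. -/
theorem lintegral_sq_lintegral_le {v : Point (n + 1) → ℂ} (hv : Measurable v)
    {c a b : Mode → ENNReal} (ha : Measurable a) (hb : Measurable b) (hab : ∀ q, c q ≤ a q * b q) :
    ∫⁻ z, (∫⁻ q, c q * ‖v (adjoin (q, z))‖ₑ ∂modeMeasure) ^ 2 ∂(sectorMeasure n)
      ≤ (∫⁻ q, a q ^ 2 ∂modeMeasure) * ∫⁻ y, b y.1 ^ 2 * ‖v (adjoin y)‖ₑ ^ 2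
        ∂(modeMeasure.prod (sectorMeasure n)) := by
  have hm : Measurable fun y : Mode × Point n => b y.1 ^ 2 * ‖v (adjoin y)‖ₑ ^ 2 :=
    ((hb.comp measurable_fst).pow_const 2).mul ((hv.comp measurable_adjoin).enorm.pow_const 2)
  rw [← lintegral_adjoin_symm hm, ← lintegral_const_mul _ hm.lintegral_prod_left']
  refine lintegral_mono fun z => ?_
  have hvz : Measurable fun q : Mode => ‖v (adjoin (q, z))‖ₑ :=
    (hv.comp (measurable_adjoin.comp (measurable_id.prodMk measurable_const))).enorm
  calc (∫⁻ q, c q * ‖v (adjoin (q, z))‖ₑ ∂modeMeasure) ^ 2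
      ≤ (∫⁻ q, a q * (b q * ‖v (adjoin (q, z))‖ₑ) ∂modeMeasure) ^ 2 := by
        refine pow_le_pow_left₀ (by simp) (lintegral_mono fun q => ?_) 2
        rw [← mul_assoc]
        exact mul_le_mul_left (hab q) _
    _ ≤ (∫⁻ q, a q ^ 2 ∂modeMeasure) * ∫⁻ q, (b q * ‖v (adjoin (q, z))‖ₑ) ^ 2 ∂modeMeasure :=
        lintegral_mul_sq_le ha.aemeasurable (hb.mul hvz).aemeasurable
    _ = _ := by simp only [mul_pow]

theorem lintegral_annihFn_sq_le (hε : IsPolarization ε) (j : Fin 3) {v : Point (n + 1) → ℂ}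
    (hv : Measurable v) {a b : Mode → ENNReal} (ha : Measurable a) (hb : Measurable b)
    (hab : ∀ q, ENNReal.ofReal (amp Λ q) ≤ a q * b q) :
    ∫⁻ z, ‖annihFn ε Λ j v z‖ₑ ^ 2 ∂(sectorMeasure n)
      ≤ (∫⁻ q, a q ^ 2 ∂modeMeasure) * ((n + 1 : ℕ) * ∫⁻ y, b y.1 ^ 2 * ‖v (adjoin y)‖ₑ ^ 2
        ∂(modeMeasure.prod (sectorMeasure n))) := by
  have e1 : ((n + 1 : ℕ) : ENNReal) = ‖(Real.sqrt (n + 1) : ℂ)‖ₑ ^ 2 := by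
    rw [enorm_sqrt_sq _ (by positivity), ← ENNReal.ofReal_natCast]; push_cast; rfl
  rw [mul_left_comm, e1]
  refine le_trans ?_ (mul_le_mul_right (lintegral_sq_lintegral_le hv ha hb hab) _)
  rw [← lintegral_const_mul' _ _ (by simp)]
  refine lintegral_mono fun z => ?_
  rw [← mul_pow]
  exact pow_le_pow_left₀ (by simp) (enorm_annihFn_le hε j v z) 2

theorem lintegral_sq_lintegral_amp_le (hΛ : 0 < Λ) {v : Point (n + 1) → ℂ}
    (hv : Measurable v) (hs : IsSymm v) :
    (n + 1 : ℕ) * ∫⁻ z, (∫⁻ q, ENNReal.ofReal (amp Λ q) * ‖v (adjoin (q, z))‖ₑ ∂modeMeasure) ^ 2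
        ∂(sectorMeasure n)
      ≤ ENNReal.ofReal (2 * Λ / Real.pi) *
        ∫⁻ z, ENNReal.ofReal (fieldEnergy z.2) * ‖v z‖ₑ ^ 2 ∂(sectorMeasure (n + 1)) := by
  refine (mul_le_mul_right (lintegral_sq_lintegral_le hv (a := fun q => ENNReal.ofReal (ampDiv Λ q))
    (b := fun q => ENNReal.ofReal (Real.sqrt ‖q.1‖)) (measurable_ampDiv Λ).ennreal_ofReal
    (by fun_prop) fun q => ?_) _).trans (le_of_eq ?_)
  · rw [← ENNReal.ofReal_mul (ampDiv_nonneg Λ q), ampDiv_mul_sqrt]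
  · rw [mul_left_comm, lintegral_ampDiv_sq hΛ, ← lintegral_norm_adjoin hv hs]
    simp only [← ENNReal.ofReal_pow (Real.sqrt_nonneg _), Real.sq_sqrt (norm_nonneg _)]

/-- The standard bound ‖DΨ‖² ≤ ‖G/|k|^{1/2}‖² ‖H_f^{1/2}Ψ‖², with ∫ amp²/|k| = 2Λ/π. -/
theorem lintegral_annihFn_sq_le_energy (hε : IsPolarization ε) (hΛ : 0 < Λ) (j : Fin 3)
    {v : Point (n + 1) → ℂ} (hv : Measurable v) (hs : IsSymm v) :
    ∫⁻ z, ‖annihFn ε Λ j v z‖ₑ ^ 2 ∂(sectorMeasure n)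
      ≤ ENNReal.ofReal (2 * Λ / Real.pi) *
        ∫⁻ z, ENNReal.ofReal (fieldEnergy z.2) * ‖v z‖ₑ ^ 2 ∂(sectorMeasure (n + 1)) := by
  refine (lintegral_annihFn_sq_le hε j hv (a := fun q => ENNReal.ofReal (ampDiv Λ q))
    (b := fun q => ENNReal.ofReal (Real.sqrt ‖q.1‖)) (measurable_ampDiv Λ).ennreal_ofReal
    (by fun_prop) fun q => ?_).trans (le_of_eq ?_)
  · rw [← ENNReal.ofReal_mul (ampDiv_nonneg Λ q), ampDiv_mul_sqrt]
  · rw [lintegral_ampDiv_sq hΛ, ← lintegral_norm_adjoin hv hs]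
    simp only [← ENNReal.ofReal_pow (Real.sqrt_nonneg _), Real.sq_sqrt (norm_nonneg _)]

theorem isWave_annihFn (hε : IsPolarization ε) (hΛ : 0 < Λ) (j : Fin 3) {v : Point (n + 1) → ℂ} (hv : IsWave v) :
    IsWave (annihFn ε Λ j v) := by
  have hm := measurable_annihFn (Λ := Λ) hε j hv.measurable
  refine ⟨hm, fun σ z => ?_, ?_⟩
  · have h := fun q => hv.symm.adjoin q σ z
    simp only at h
    simp only [annihFn, h]; rfl
  · rw [memLp_two_iff hm]
    refine (lintegral_annihFn_sq_le hε j hv.measurable (a := fun q => ENNReal.ofReal (amp Λ q))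
      (b := fun _ => 1) (measurable_amp Λ).ennreal_ofReal measurable_const
      fun q => by simp).trans_lt ?_
    rw [lintegral_amp_sq hΛ]
    simp only [one_pow, one_mul]
    refine ENNReal.mul_lt_top (by simp) (ENNReal.mul_lt_top (by simp) ?_)
    exact (memLp_two_iff (hv.measurable.comp measurable_adjoin)).1
      (hv.memLp.comp_measurePreserving measurePreserving_adjoin)

/-- Makes the annihilation integral a genuine one at almost every point, so that it can be split
into sums in `annihFn_creationFn`. -/
theorem ae_integrable_annih (hε : IsPolarization ε) (j : Fin 3) {v : Point (n + 1) → ℂ} (hv : IsWave v) :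
    ∀ᵐ z ∂(sectorMeasure n), Integrable
      (fun q => (coupling ε Λ j q : ℂ) * phase z.1 q * v (adjoin (q, z))) modeMeasure := by
  have h1 : MemLp (fun y => v (adjoin y)) 2 (modeMeasure.prod (sectorMeasure n)) :=
    hv.memLp.comp_measurePreserving measurePreserving_adjoin
  have hmv : Measurable fun y : Mode × Point n => v (adjoin y) :=
    hv.measurable.comp measurable_adjoin
  have h2 := (memLp_two_iff hmv).1 h1
  rw [← lintegral_adjoin_symm (hmv.enorm.pow_const 2)] at h2
  have h3 := ae_lt_top (hmv.enorm.pow_const 2).lintegral_prod_left' h2.ne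
  filter_upwards [h3] with z hz
  have hmz : Measurable fun q : Mode => v (adjoin (q, z)) :=
    hv.measurable.comp (measurable_adjoin.comp (measurable_id.prodMk measurable_const))
  have h4 : MemLp (fun q => v (adjoin (q, z))) 2 modeMeasure := (memLp_two_iff hmz).2 hz
  have hmp : Measurable fun q : Mode => (coupling ε Λ j q : ℂ) * phase z.1 q :=
    (measurable_coupling_comp hε j measurable_id).mul
      (measurable_phase_comp measurable_const measurable_id)
  have h5 : MemLp (fun q : Mode => (coupling ε Λ j q : ℂ) * phase z.1 q) 2 modeMeasure := by
    refine (memLp_coupling hε Λ j).mono hmp.aestronglyMeasurable (.of_forall fun q => le_of_eq ?_)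
    rw [norm_mul, norm_phase, mul_one]
  exact integrable_mul_of_memLp_two h5 h4

/-- Symmetry of v lets the sum over the created photon collapse to one term, and Fubini turns that
term into the annihilation integral. -/
theorem integral_conj_creationFn_mul (hε : IsPolarization ε) (j : Fin 3) {u : Point n → ℂ} {v : Point (n + 1) → ℂ}
    (hu : IsWave u) (hv : IsWave v) :
    ∫ z, conj (creationFn ε Λ j u z) * v z ∂(sectorMeasure (n + 1))
      = ∫ z, conj (u z) * annihFn ε Λ j v z ∂(sectorMeasure n) := by
  have hk := memLp_creationKernel (Λ := Λ) hε j hu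
  have hint : Integrable (fun y => conj (creationKernel ε Λ j u y) * v (adjoin y))
      (modeMeasure.prod (sectorMeasure n)) :=
    integrable_mul_of_memLp_two hk.star
      (hv.memLp.comp_measurePreserving measurePreserving_adjoin)
  rw [creationFn, integral_conj_symOne_mul hk hv, integral_prod_symm _ hint,
    ← integral_const_mul]
  refine integral_congr_ae (.of_forall fun z => ?_)
  simp only [annihFn, creationKernel]
  rw [mul_left_comm]
  congr 1
  rw [← integral_const_mul]
  refine integral_congr_ae (.of_forall fun q => ?_)
  simp only [map_mul, Complex.conj_conj, Complex.conj_ofReal]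
  ring

end Bounds

end

/-! ### Field operators on the sectors and the canonical commutation relation. -/

section

variable {n : ℕ}

theorem IsWave.add {u v : Point n → ℂ} (hu : IsWave u) (hv : IsWave v) :
    IsWave fun z => u z + v z :=
  ⟨hu.measurable.add hv.measurable, fun σ z => by simp only [hu.symm σ z, hv.symm σ z],
    hu.memLp.add hv.memLp⟩

theorem IsWave.const_mul {u : Point n → ℂ} (hu : IsWave u) (c : ℂ) : IsWave fun z => c * u z :=
  ⟨hu.measurable.const_mul c, fun σ z => by simp only [hu.symm σ z], hu.memLp.const_mul c⟩

theorem Represents.add {ψ ψ' : Sector n} {u v : Point n → ℂ} (h : Represents ψ u)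
    (h' : Represents ψ' v) : Represents (ψ + ψ') fun z => u z + v z := by
  refine ⟨h.wave.add h'.wave, ?_⟩
  have h1 : sectorFn (ψ + ψ') =ᵐ[sectorMeasure n] sectorFn ψ + sectorFn ψ' := Lp.coeFn_add _ _
  filter_upwards [h1, h.ae_eq, h'.ae_eq] with z h2 h3 h4
  rw [h2, Pi.add_apply, h3, h4]

theorem Represents.smul {ψ : Sector n} {u : Point n → ℂ} (h : Represents ψ u) (c : ℂ) :
    Represents (c • ψ) fun z => c * u z := by
  refine ⟨h.wave.const_mul c, ?_⟩
  have h1 : sectorFn (c • ψ) =ᵐ[sectorMeasure n] c • sectorFn ψ := Lp.coeFn_smul _ _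
  filter_upwards [h1, h.ae_eq] with z h2 h3
  rw [h2, Pi.smul_apply, h3, smul_eq_mul]

theorem Represents.sub {ψ ψ' : Sector n} {u v : Point n → ℂ} (h : Represents ψ u)
    (h' : Represents ψ' v) : Represents (ψ - ψ') fun z => u z - v z := by
  have h1 := h.add (h'.smul (-1))
  simpa only [neg_smul, one_smul, neg_mul, one_mul, ← sub_eq_add_neg] using h1

theorem Represents.zero : Represents (0 : Sector n) fun _ => 0 :=
  ⟨⟨measurable_const, fun _ _ => rfl, MemLp.zero'⟩, Lp.coeFn_zero _ _ _⟩

theorem Represents.congr {ψ : Sector n} {u v : Point n → ℂ} (h : Represents ψ u) (hv : IsWave v)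
    (huv : u =ᵐ[sectorMeasure n] v) : Represents ψ v :=
  ⟨hv, h.ae_eq.trans huv⟩

theorem Represents.ae_eq_of_eq {ψ : Sector n} {u v : Point n → ℂ} (h : Represents ψ u)
    (h' : Represents ψ v) : u =ᵐ[sectorMeasure n] v :=
  h.ae_eq.symm.trans h'.ae_eq

theorem Represents.norm_sq_le {m : ℕ} {u : Point n → ℂ} {v : Point m → ℂ} {ψ : Sector n}
    {ψ' : Sector m} (h : Represents ψ u) (h' : Represents ψ' v) {c : ℝ} (hc : 0 ≤ c)
    (hle : ∫⁻ z, ‖u z‖ₑ ^ 2 ∂(sectorMeasure n)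
      ≤ ENNReal.ofReal c * ∫⁻ z, ‖v z‖ₑ ^ 2 ∂(sectorMeasure m)) :
    ‖ψ‖ ^ 2 ≤ c * ‖ψ'‖ ^ 2 := by
  rw [← h.norm_sq_eq, ← h'.norm_sq_eq, ← ENNReal.ofReal_mul hc] at hle
  exact (ENNReal.ofReal_le_ofReal_iff (by positivity)).1 hle

section Operators

variable {ε : R3 → Fin 2 → R3}

theorem creationFn_add (ε : R3 → Fin 2 → R3) (Λ : ℝ) (j : Fin 3) (u v : Point n → ℂ) :
    creationFn ε Λ j (fun z => u z + v z) = fun z => creationFn ε Λ j u z + creationFn ε Λ j v z := by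
  funext z
  simp only [creationFn, symOne, creationKernel, mul_add, Finset.sum_add_distrib]

theorem creationFn_const_mul (ε : R3 → Fin 2 → R3) (Λ : ℝ) (j : Fin 3) (c : ℂ) (u : Point n → ℂ) :
    creationFn ε Λ j (fun z => c * u z) = fun z => c * creationFn ε Λ j u z := by
  funext z
  simp only [creationFn, symOne, creationKernel, Finset.mul_sum]
  exact Finset.sum_congr rfl fun i _ => by ring

/-- A linear operator between sectors given by an almost everywhere defined operation on wave
functions. -/
theorem exists_sector_map {n m : ℕ} (T : (Point n → ℂ) → Point m → ℂ)
    (hw : ∀ u, IsWave u → IsWave (T u))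
    (hc : ∀ u u', u =ᵐ[sectorMeasure n] u' → T u =ᵐ[sectorMeasure m] T u') :
    ∃ S : Sector n → Sector m, ∀ ψ u, Represents ψ u → Represents (S ψ) (T u) := by
  choose r hr using exists_represents (n := n)
  exact ⟨fun ψ => (hw _ (hr ψ).wave).toSector, fun ψ u h =>
    (hw _ (hr ψ).wave).represents.congr (hw _ h.wave) (hc _ _ ((hr ψ).ae_eq_of_eq h))⟩

theorem lintegral_creationKernel (hε : IsPolarization ε) (Λ : ℝ) (j : Fin 3) {u : Point n → ℂ}
    (hu : Measurable u) :
    ∫⁻ y, ‖creationKernel ε Λ j u y‖ₑ ^ 2 ∂(modeMeasure.prod (sectorMeasure n))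
      = (∫⁻ q, ‖(coupling ε Λ j q : ℂ)‖ₑ ^ 2 ∂modeMeasure)
        * ∫⁻ z, ‖u z‖ₑ ^ 2 ∂(sectorMeasure n) := by
  have h1 : Measurable fun q : Mode => (coupling ε Λ j q : ℂ) :=
    measurable_coupling_comp hε j measurable_id
  rw [← lintegral_prod_mul (h1.enorm.pow_const 2).aemeasurable (hu.enorm.pow_const 2).aemeasurable]
  refine lintegral_congr fun y => ?_
  have h2 : ‖conj (phase y.2.1 y.1)‖ₑ = 1 := by
    rw [← ofReal_norm, RCLike.norm_conj, norm_phase]; simp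
  rw [creationKernel, enorm_mul, enorm_mul, h2, mul_one, mul_pow]

theorem lintegral_coupling_sq (hε : IsPolarization ε) (Λ : ℝ) (j : Fin 3) :
    ∫⁻ q, ‖(coupling ε Λ j q : ℂ)‖ₑ ^ 2 ∂modeMeasure
      = ENNReal.ofReal (∫ q, coupling ε Λ j q ^ 2 ∂modeMeasure) := by
  rw [ofReal_integral_eq_lintegral_ofReal (integrable_coupling_sq hε Λ j)
    (.of_forall fun q => sq_nonneg _)]
  refine lintegral_congr fun q => ?_
  rw [← ofReal_norm, ← ENNReal.ofReal_pow (norm_nonneg _), Complex.norm_real, Real.norm_eq_abs,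
    sq_abs]

theorem exists_creation (hε : IsPolarization ε) (Λ : ℝ) (j : Fin 3) (n : ℕ) :
    ∃ T : Sector n →L[ℂ] Sector (n + 1), ∀ ψ u, Represents ψ u →
      Represents (T ψ) (creationFn ε Λ j u) := by
  obtain ⟨S, hS⟩ := exists_sector_map (creationFn ε Λ j (n := n))
    (fun u hu => isWave_creationFn hε j hu) fun u u' h => creationFn_congr_ae ε Λ j h
  let T : Sector n →ₗ[ℂ] Sector (n + 1) :=
    { toFun := S
      map_add' := fun ψ ψ' => by
        obtain ⟨u, hu⟩ := exists_represents ψ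
        obtain ⟨v, hv⟩ := exists_represents ψ'
        have h := hS _ _ (hu.add hv)
        rw [creationFn_add] at h
        exact h.eq ((hS _ _ hu).add (hS _ _ hv)) (.of_forall fun _ => rfl)
      map_smul' := fun c ψ => by
        obtain ⟨u, hu⟩ := exists_represents ψ
        have h := hS _ _ (hu.smul c)
        rw [creationFn_const_mul] at h
        exact h.eq ((hS _ _ hu).smul c) (.of_forall fun _ => rfl) }
  -- The bound grows with n; it only serves to have a bounded operator, with an adjoint, on each
  -- sector.
  have hb : ∀ ψ, ‖T ψ‖ ≤ Real.sqrt ((n + 1) * ∫ q, coupling ε Λ j q ^ 2 ∂modeMeasure) * ‖ψ‖ := by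
    intro ψ
    obtain ⟨u, hu⟩ := exists_represents ψ
    have h0 : 0 ≤ ∫ q, coupling ε Λ j q ^ 2 ∂modeMeasure := integral_nonneg fun q => sq_nonneg _
    have h1 : ‖T ψ‖ ^ 2 ≤ ((n + 1) * ∫ q, coupling ε Λ j q ^ 2 ∂modeMeasure) * ‖ψ‖ ^ 2 := by
      refine (hS ψ u hu).norm_sq_le hu (by positivity) ?_
      refine (lintegral_symOne_sq_le (measurable_creationKernel hε j hu.wave.measurable)).trans ?_
      rw [lintegral_creationKernel hε Λ j hu.wave.measurable, lintegral_coupling_sq hε,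
        ENNReal.ofReal_mul (by positivity), mul_assoc]
      gcongr
      rw [← ENNReal.ofReal_natCast]; push_cast; rfl
    rw [← Real.sqrt_sq (norm_nonneg (T ψ)), ← Real.sqrt_sq (norm_nonneg ψ),
      ← Real.sqrt_mul (by positivity)]
    exact Real.sqrt_le_sqrt h1
  exact ⟨T.mkContinuous _ hb, hS⟩

/-- `D_j^*` on `n` photons. -/
def creation (hε : IsPolarization ε) (Λ : ℝ) (j : Fin 3) (n : ℕ) : Sector n →L[ℂ] Sector (n + 1) :=
  (exists_creation hε Λ j n).choose

/-- `D_j` on `n + 1` photons. -/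
def annihilation (hε : IsPolarization ε) (Λ : ℝ) (j : Fin 3) (n : ℕ) :
    Sector (n + 1) →L[ℂ] Sector n :=
  ContinuousLinearMap.adjoint (creation hε Λ j n)

theorem Represents.creation (hε : IsPolarization ε) (Λ : ℝ) (j : Fin 3) {ψ : Sector n}
    {u : Point n → ℂ} (h : Represents ψ u) :
    Represents (creation hε Λ j n ψ) (creationFn ε Λ j u) :=
  (exists_creation hε Λ j n).choose_spec ψ u h

theorem inner_creation_left (hε : IsPolarization ε) (Λ : ℝ) (j : Fin 3) (ψ : Sector n)
    (ψ' : Sector (n + 1)) :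
    inner ℂ (creation hε Λ j n ψ) ψ' = inner ℂ ψ (annihilation hε Λ j n ψ') :=
  (ContinuousLinearMap.adjoint_inner_right _ _ _).symm

/-- The abstract adjoint is identified with the explicit integral by testing against all wave
functions. -/
theorem Represents.annihilation (hε : IsPolarization ε) {Λ : ℝ} (hΛ : 0 < Λ) (j : Fin 3)
    {ψ : Sector (n + 1)} {v : Point (n + 1) → ℂ} (h : Represents ψ v) :
    Represents (annihilation hε Λ j n ψ) (annihFn ε Λ j v) := by
  have hw := isWave_annihFn hε hΛ j h.wave
  have e : PauliFierz.annihilation hε Λ j n ψ = hw.toSector := by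
    refine ext_inner_left ℂ fun η => ?_
    obtain ⟨u, hu⟩ := exists_represents η
    rw [← inner_creation_left, (hu.creation hε Λ j).inner_eq h, hu.inner_eq hw.represents]
    exact integral_conj_creationFn_mul hε j hu.wave h.wave
  rw [e]
  exact hw.represents

theorem extract_succ_adjoin (l : Fin (n + 1)) (q : Mode) (z : Point (n + 1)) :
    extract l.succ (adjoin (q, z)) = ((extract l z).1, adjoin (q, (extract l z).2)) := by
  simp only [extract, adjoin, Fin.cons_succ, Prod.mk.injEq, true_and]
  funext i
  refine Fin.cases ?_ (fun m => ?_) i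
  · simp [Fin.removeNth]
  · simp [Fin.removeNth, Fin.succ_succAbove_succ]

theorem annihFn_creationFn_zero (ε : R3 → Fin 2 → R3) (Λ : ℝ) (j : Fin 3) (u : Point 0 → ℂ)
    (z : Point 0) :
    annihFn ε Λ j (creationFn ε Λ j u) z
      = (∫ q, coupling ε Λ j q ^ 2 ∂modeMeasure : ℝ) * u z := by
  have e : ∀ q, (coupling ε Λ j q : ℂ) * phase z.1 q * creationFn ε Λ j u (adjoin (q, z))
      = ((coupling ε Λ j q ^ 2 : ℝ) : ℂ) * u z := by
    intro q
    simp only [creationFn, symOne]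
    rw [Fin.sum_univ_succ, Finset.univ_eq_empty, Finset.sum_empty, add_zero]
    simp only [adjoin_eq_comp, creationKernel]
    have := conj_phase_mul_phase z.1 q
    simp only [Nat.cast_zero, zero_add, Real.sqrt_one, Complex.ofReal_one, inv_one, one_mul]
    push_cast
    linear_combination (coupling ε Λ j q : ℂ) ^ 2 * u z * this
  simp only [annihFn, e, integral_mul_const]
  rw [integral_complex_ofReal]
  simp

/-- The commutation relation D D^* = ‖G‖² + D^* D. If the photon created is the one integrated over,
the phases cancel and ∫ G_j² appears; otherwise creation and annihilation act on different photons.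
-/
theorem annihFn_creationFn (hε : IsPolarization ε) (Λ : ℝ) (j : Fin 3) {u : Point (n + 1) → ℂ}
    (hu : IsWave u) :
    ∀ᵐ z ∂(sectorMeasure (n + 1)), annihFn ε Λ j (creationFn ε Λ j u) z
      = (∫ q, coupling ε Λ j q ^ 2 ∂modeMeasure : ℝ) * u z
        + creationFn ε Λ j (annihFn ε Λ j u) z := by
  have h1 : ∀ᵐ z ∂(sectorMeasure (n + 1)), ∀ l : Fin (n + 1), Integrable
      (fun q => (coupling ε Λ j q : ℂ) * phase (extract l z).2.1 q
        * u (adjoin (q, (extract l z).2))) modeMeasure :=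
    ae_all_iff.2 fun l => ae_extract_snd (ae_integrable_annih hε j hu) l
  filter_upwards [h1] with z hz
  have hi0 : Integrable (fun q => ((coupling ε Λ j q ^ 2 : ℝ) : ℂ) * u z) modeMeasure :=
    (integrable_coupling_sq hε Λ j).ofReal.mul_const _
  have hi1 : ∀ l ∈ (Finset.univ : Finset (Fin (n + 1))), Integrable (fun q =>
      (coupling ε Λ j (extract l z).1 : ℂ) * conj (phase z.1 (extract l z).1) *
      ((coupling ε Λ j q : ℂ) * phase (extract l z).2.1 q * u (adjoin (q, (extract l z).2))))
      modeMeasure := fun l _ => (hz l).const_mul _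
  -- Index 0 of the sum over created photons is the integrated photon q; the indices l + 1 are the
  -- photons of z.
  have e : ∀ q, (coupling ε Λ j q : ℂ) * phase z.1 q * creationFn ε Λ j u (adjoin (q, z))
      = (Real.sqrt ((n + 1 : ℕ) + 1) : ℂ)⁻¹ * (((coupling ε Λ j q ^ 2 : ℝ) : ℂ) * u z
        + ∑ l, (coupling ε Λ j (extract l z).1 : ℂ) * conj (phase z.1 (extract l z).1) *
          ((coupling ε Λ j q : ℂ) * phase (extract l z).2.1 q
            * u (adjoin (q, (extract l z).2)))) := by
    intro q
    simp only [creationFn, symOne]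
    rw [Fin.sum_univ_succ]
    simp only [adjoin_eq_comp, extract_succ_adjoin, creationKernel]
    have := conj_phase_mul_phase z.1 q
    have h3 : ∀ l, (adjoin (q, (extract l z).2)).1 = z.1 := fun l => rfl
    have h4 : ∀ l, (extract l z).2.1 = z.1 := fun l => rfl
    simp only [h3, h4]
    rw [mul_left_comm, mul_add, Finset.mul_sum]
    congr 2
    · push_cast
      linear_combination (coupling ε Λ j q : ℂ) ^ 2 * u z * this
    · exact Finset.sum_congr rfl fun l _ => by ring
  simp only [annihFn, e]
  rw [integral_const_mul, mul_inv_cancel_left₀ (sqrt_succ_ne_zero (n + 1)),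
    integral_add hi0 (integrable_finsetSum _ hi1), integral_finsetSum _ hi1, integral_mul_const,
    integral_complex_ofReal]
  congr 1
  rw [creationFn, symOne, Finset.mul_sum]
  refine Finset.sum_congr rfl fun l _ => ?_
  rw [integral_const_mul, creationKernel]
  simp only [annihFn]
  rw [mul_left_comm (Real.sqrt (n + 1) : ℂ)⁻¹, inv_mul_cancel_left₀ (sqrt_succ_ne_zero n)]
  rfl

theorem Sector.inner_self (ψ : Sector n) : inner ℂ ψ ψ = ((‖ψ‖ ^ 2 : ℝ) : ℂ) := by
  refine (inner_self_eq_norm_sq_to_K (𝕜 := ℂ) ψ).trans ?_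
  push_cast; rfl

theorem Sector.inner_ofReal_smul_right (ψ : Sector n) (c : ℝ) :
    inner ℂ ψ ((c : ℂ) • ψ) = ((c * ‖ψ‖ ^ 2 : ℝ) : ℂ) := by
  have h := inner_smul_right (𝕜 := ℂ) ψ ψ (c : ℂ)
  refine h.trans ?_
  rw [Sector.inner_self]
  push_cast; rfl

theorem norm_creation_zero_sq (hε : IsPolarization ε) {Λ : ℝ} (hΛ : 0 < Λ) (j : Fin 3)
    (ψ : Sector 0) :
    ‖creation hε Λ j 0 ψ‖ ^ 2 = (∫ q, coupling ε Λ j q ^ 2 ∂modeMeasure) * ‖ψ‖ ^ 2 := by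
  obtain ⟨u, hu⟩ := exists_represents ψ
  have h1 : annihilation hε Λ j 0 (creation hε Λ j 0 ψ)
      = ((∫ q, coupling ε Λ j q ^ 2 ∂modeMeasure : ℝ) : ℂ) • ψ :=
    ((hu.creation hε Λ j).annihilation hε hΛ j).eq (hu.smul _)
      (.of_forall fun z => annihFn_creationFn_zero ε Λ j u z)
  have h2 := inner_creation_left hε Λ j ψ (creation hε Λ j 0 ψ)
  rw [h1, Sector.inner_ofReal_smul_right, Sector.inner_self] at h2
  exact_mod_cast h2

theorem norm_creation_succ_sq (hε : IsPolarization ε) {Λ : ℝ} (hΛ : 0 < Λ) (j : Fin 3)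
    (ψ : Sector (n + 1)) :
    ‖creation hε Λ j (n + 1) ψ‖ ^ 2
      = (∫ q, coupling ε Λ j q ^ 2 ∂modeMeasure) * ‖ψ‖ ^ 2 + ‖annihilation hε Λ j n ψ‖ ^ 2 := by
  obtain ⟨u, hu⟩ := exists_represents ψ
  have h1 : annihilation hε Λ j (n + 1) (creation hε Λ j (n + 1) ψ)
      = ((∫ q, coupling ε Λ j q ^ 2 ∂modeMeasure : ℝ) : ℂ) • ψ
        + creation hε Λ j n (annihilation hε Λ j n ψ) :=
    ((hu.creation hε Λ j).annihilation hε hΛ j).eq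
      ((hu.smul _).add ((hu.annihilation hε hΛ j).creation hε Λ j))
      (annihFn_creationFn hε Λ j hu.wave)
  have h2 := inner_creation_left hε Λ j ψ (creation hε Λ j (n + 1) ψ)
  have h3 := inner_creation_left hε Λ j (annihilation hε Λ j n ψ) ψ
  rw [h1, inner_add_right, Sector.inner_ofReal_smul_right,
    ← inner_conj_symm ψ (creation hε Λ j n _), h3,
    Sector.inner_self, Sector.inner_self, Complex.conj_ofReal] at h2
  exact_mod_cast h2

/-- `√H_f ψ = f` on the `n`-photon sector. -/
def SqrtEnergy (ψ f : Sector n) : Prop :=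
  ∀ᵐ z ∂(sectorMeasure n), sectorFn f z = (Real.sqrt (fieldEnergy z.2) : ℂ) * sectorFn ψ z

theorem SqrtEnergy.ae_eq {ψ f : Sector n} (h : SqrtEnergy ψ f) {u v : Point n → ℂ}
    (hu : Represents ψ u) (hv : Represents f v) :
    ∀ᵐ z ∂(sectorMeasure n), v z = (Real.sqrt (fieldEnergy z.2) : ℂ) * u z := by
  filter_upwards [h, hu.ae_eq, hv.ae_eq] with z h1 h2 h3
  rw [← h2, ← h3, h1]

theorem SqrtEnergy.of_represents {ψ f : Sector n} {u v : Point n → ℂ}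
    (hu : Represents ψ u) (hv : Represents f v)
    (h : ∀ᵐ z ∂(sectorMeasure n), v z = (Real.sqrt (fieldEnergy z.2) : ℂ) * u z) :
    SqrtEnergy ψ f := by
  filter_upwards [h, hu.ae_eq, hv.ae_eq] with z h1 h2 h3
  rw [h2, h3, h1]

theorem SqrtEnergy.lintegral_eq {ψ f : Sector n} (h : SqrtEnergy ψ f) {u : Point n → ℂ}
    (hu : Represents ψ u) :
    ∫⁻ z, ENNReal.ofReal (fieldEnergy z.2) * ‖u z‖ₑ ^ 2 ∂(sectorMeasure n)
      = ENNReal.ofReal (‖f‖ ^ 2) := by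
  obtain ⟨v, hv⟩ := exists_represents f
  rw [hv.norm_sq_eq]
  refine lintegral_congr_ae ?_
  filter_upwards [h.ae_eq hu hv] with z hz
  rw [hz, enorm_mul, mul_pow, enorm_sqrt_sq _ (fieldEnergy_nonneg _)]

theorem norm_annihilation_sq_le (hε : IsPolarization ε) {Λ : ℝ} (hΛ : 0 < Λ) (j : Fin 3)
    {ψ f : Sector (n + 1)} (h : SqrtEnergy ψ f) :
    ‖annihilation hε Λ j n ψ‖ ^ 2 ≤ 2 * Λ / Real.pi * ‖f‖ ^ 2 := by
  obtain ⟨u, hu⟩ := exists_represents ψ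
  have h1 := lintegral_annihFn_sq_le_energy hε hΛ j hu.wave.measurable hu.wave.symm
  rw [h.lintegral_eq hu, ← (hu.annihilation hε hΛ j).norm_sq_eq,
    ← ENNReal.ofReal_mul (by positivity)] at h1
  exact (ENNReal.ofReal_le_ofReal_iff (by positivity)).1 h1

theorem SqrtEnergy.eq_zero {ψ f : Sector 0} (h : SqrtEnergy ψ f) : f = 0 := by
  refine Subtype.ext (Lp.ext ?_)
  filter_upwards [h, Lp.coeFn_zero ℂ 2 (sectorMeasure 0)] with z hz h0
  have h1 : sectorFn f z = 0 := by simp [hz, fieldEnergy]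
  exact h1.trans h0.symm

end Operators

end

/-! ### Hard pairs: creation of two photons harder than all others. -/

section

variable {n : ℕ}

/-- The photons `q` and `q'` are harder than all photons in `K`. -/
def Dominates (q q' : Mode) (K : Fin n → Mode) : Prop :=
  ∀ m, ‖(K m).1‖ < ‖q.1‖ ∧ ‖(K m).1‖ < ‖q'.1‖

open Classical in
/-- The indicator function of `Dominates`. -/
def domInd (q q' : Mode) (K : Fin n → Mode) : ℂ := if Dominates q q' K then 1 else 0

theorem domInd_norm_le (q q' : Mode) (K : Fin n → Mode) : ‖domInd q q' K‖ ≤ 1 := by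
  unfold domInd; split_ifs <;> simp

theorem domInd_permute (q q' : Mode) (σ : Equiv.Perm (Fin n)) (z : Point n) :
    domInd q q' (permute σ z).2 = domInd q q' z.2 := by
  have : Dominates q q' (permute σ z).2 ↔ Dominates q q' z.2 :=
    ⟨fun h m => by simpa [permute] using h (σ.symm m), fun h m => h (σ m)⟩
  unfold domInd
  split_ifs <;> tauto

theorem measurable_domInd :
    Measurable fun y : Mode × Mode × Point n => domInd y.1 y.2.1 y.2.2.2 := by
  unfold domInd
  refine Measurable.ite ?_ measurable_const measurable_const
  simp only [Dominates, Set.ofPred_forall]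
  refine MeasurableSet.iInter fun m => ?_
  have hm : Measurable fun y : Mode × Mode × Point n => ‖(y.2.2.2 m).1‖ :=
    ((measurable_pi_apply m).comp measurable_snd.snd.snd).fst.norm
  exact (measurableSet_lt hm measurable_fst.fst.norm).inter
    (measurableSet_lt hm measurable_snd.fst.fst.norm)

theorem Dominates.lt {p : Fin (n + 2) × Fin (n + 1)} {z : Point (n + 2)}
    (h : Dominates (extractPair p z).1 (extractPair p z).2.1 (extractPair p z).2.2.2)
    {m : Fin (n + 2)} (h1 : m ≠ p.1) (h2 : m ≠ p.1.succAbove p.2) :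
    ‖(z.2 m).1‖ < ‖(z.2 p.1).1‖ ∧ ‖(z.2 m).1‖ < ‖(z.2 (p.1.succAbove p.2)).1‖ := by
  obtain ⟨t, rfl⟩ := Fin.exists_succAbove_eq h1
  have h3 : t ≠ p.2 := fun e => h2 (by rw [e])
  obtain ⟨r, rfl⟩ := Fin.exists_succAbove_eq h3
  exact h r

/-- Two dominating pairs in one configuration consist of the same photons. A photon of the second
pair missing from the first is softer than both photons of the first; one of these is missing from
the second, hence softer than it, a contradiction. -/
theorem Dominates.mem {p p' : Fin (n + 2) × Fin (n + 1)} {z : Point (n + 2)}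
    (h : Dominates (extractPair p z).1 (extractPair p z).2.1 (extractPair p z).2.2.2)
    (h' : Dominates (extractPair p' z).1 (extractPair p' z).2.1 (extractPair p' z).2.2.2)
    {a : Fin (n + 2)} (ha : a = p'.1 ∨ a = p'.1.succAbove p'.2) :
    a = p.1 ∨ a = p.1.succAbove p.2 := by
  by_contra hn
  rw [not_or] at hn
  have h1 := h.lt hn.1 hn.2
  have hne : p.1 ≠ p.1.succAbove p.2 := (Fin.succAbove_ne _ _).symm
  by_cases h2 : p.1 = p'.1 ∨ p.1 = p'.1.succAbove p'.2
  · have h3 : p.1.succAbove p.2 ≠ p'.1 ∧ p.1.succAbove p.2 ≠ p'.1.succAbove p'.2 := by grind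
    have h4 := h'.lt h3.1 h3.2
    rcases ha with rfl | rfl
    · exact lt_asymm h1.2 h4.1
    · exact lt_asymm h1.2 h4.2
  · rw [not_or] at h2
    have h4 := h'.lt h2.1 h2.2
    rcases ha with rfl | rfl
    · exact lt_asymm h1.1 h4.1
    · exact lt_asymm h1.1 h4.2

/-- The only freedom is the order of the two photons; within the family an ordered pair is
determined by its first index. -/
theorem card_dominates_le (P : Fin (n + 2) × Fin (n + 1) → Prop) [DecidablePred P]
    (z : Point (n + 2)) (hP : ∀ p, P p →
      Dominates (extractPair p z).1 (extractPair p z).2.1 (extractPair p z).2.2.2) :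
    (Finset.univ.filter P).card ≤ 2 := by
  rcases (Finset.univ.filter P).eq_empty_or_nonempty with h | ⟨p, hp⟩
  · rw [h]; simp
  have hp' := hP p (Finset.mem_filter.1 hp).2
  refine (Finset.card_le_card_of_injOn (t := {p.1, p.1.succAbove p.2}) (fun x => x.1)
    (fun x hx => ?_) fun x hx y hy hxy => ?_).trans Finset.card_le_two
  · have hx' := hP x (Finset.mem_filter.1 hx).2
    have := hp'.mem hx' (.inl rfl)
    simpa using this
  · have hx' := hP x (Finset.mem_filter.1 hx).2
    have hy' := hP y (Finset.mem_filter.1 hy).2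
    have h1 := hx'.mem hy' (.inr rfl)
    simp only at hxy
    refine Prod.ext hxy ?_
    rcases h1 with h1 | h1
    · rw [hxy] at h1
      exact absurd h1 (Fin.succAbove_ne _ _)
    · rw [hxy] at h1
      exact ((Fin.succAbove_right_injective) h1).symm

/-- The kernel of the operator creating the pair amplitude `κ(q, q', H_f)`. -/
def pairKernel (κ : Mode × Mode × ℝ → ℝ) (u : Point n → ℂ) (y : Mode × Mode × Point n) : ℂ :=
  (κ (y.1, y.2.1, fieldEnergy y.2.2.2) : ℂ) * domInd y.1 y.2.1 y.2.2.2 *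
    (conj (phase y.2.2.1 y.1) * (conj (phase y.2.2.1 y.2.1) * u y.2.2))

/-- The wave function obtained by creating a pair of photons with amplitude `κ`, harder than all
photons present. -/
def pairFn (κ : Mode × Mode × ℝ → ℝ) (u : Point n → ℂ) : Point (n + 2) → ℂ :=
  symPair (pairKernel κ u)

/-- A measurable pair amplitude with a square integrable bound. -/
structure IsPairKernel (κ : Mode × Mode × ℝ → ℝ) (b : Mode × Mode → ℝ) : Prop where
  measurable : Measurable κ
  measurable_bound : Measurable b
  abs_le : ∀ q q' h, 0 ≤ h → |κ (q, q', h)| ≤ b (q, q')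
  integrable : Integrable (fun p => b p ^ 2) (modeMeasure.prod modeMeasure)

theorem ae_extractPair_snd {p : Point n → Prop} (h : ∀ᵐ z ∂(sectorMeasure n), p z)
    (i : Fin (n + 2) × Fin (n + 1)) : ∀ᵐ z ∂(sectorMeasure (n + 2)), p (extractPair i z).2.2 :=
  ae_extract_snd (p := fun y => p (extract i.2 y).2) (ae_extract_snd h i.2) i.1

theorem pairFn_congr_ae (κ : Mode × Mode × ℝ → ℝ) {u u' : Point n → ℂ}
    (h : u =ᵐ[sectorMeasure n] u') : pairFn κ u =ᵐ[sectorMeasure (n + 2)] pairFn κ u' := by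
  have h1 : ∀ᵐ z ∂(sectorMeasure (n + 2)), ∀ i, u (extractPair i z).2.2 = u' (extractPair i z).2.2 :=
    ae_all_iff.2 fun i => ae_extractPair_snd h i
  filter_upwards [h1] with z hz
  simp only [pairFn, symPair, pairKernel, hz]

theorem measurable_pairKernel {κ : Mode × Mode × ℝ → ℝ} (hκ : Measurable κ) {u : Point n → ℂ}
    (hu : Measurable u) : Measurable (pairKernel κ u) := by
  unfold pairKernel
  have h1 : Measurable fun y : Mode × Mode × Point n => κ (y.1, y.2.1, fieldEnergy y.2.2.2) :=
    hκ.comp (measurable_fst.prodMk (measurable_snd.fst.prodMk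
      (measurable_fieldEnergy.comp measurable_snd.snd.snd)))
  have h2 : Measurable fun y : Mode × Mode × Point n => phase y.2.2.1 y.1 :=
    measurable_phase_comp measurable_snd.snd.fst measurable_fst
  have h3 : Measurable fun y : Mode × Mode × Point n => phase y.2.2.1 y.2.1 :=
    measurable_phase_comp measurable_snd.snd.fst measurable_snd.fst
  have hc : Measurable (fun c : ℂ => conj c) := Complex.continuous_conj.measurable
  exact (h1.complex_ofReal.mul measurable_domInd).mul
    ((hc.comp h2).mul ((hc.comp h3).mul (hu.comp measurable_snd.snd)))

theorem norm_pairKernel_le {κ : Mode × Mode × ℝ → ℝ} {b : Mode × Mode → ℝ}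
    (hκ : IsPairKernel κ b) (u : Point n → ℂ) (y : Mode × Mode × Point n) :
    ‖pairKernel κ u y‖ ≤ b (y.1, y.2.1) * ‖u y.2.2‖ := by
  have h := hκ.abs_le y.1 y.2.1 _ (fieldEnergy_nonneg y.2.2.2)
  simp only [pairKernel, norm_mul, RCLike.norm_conj, norm_phase, one_mul, Complex.norm_real,
    Real.norm_eq_abs]
  gcongr
  have h1 := domInd_norm_le y.1 y.2.1 y.2.2.2
  calc _ ≤ |κ (y.1, y.2.1, fieldEnergy y.2.2.2)| * 1 := by gcongr
    _ ≤ _ := by rw [mul_one]; exact h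

theorem lintegral_pair_mul {b : Mode × Mode → ENNReal} (hb : Measurable b)
    {w : Point n → ENNReal} (hw : Measurable w) :
    ∫⁻ y, b (y.1, y.2.1) * w y.2.2 ∂(pairMeasure n)
      = (∫⁻ p, b p ∂(modeMeasure.prod modeMeasure)) * ∫⁻ z, w z ∂(sectorMeasure n) := by
  have h := (measurePreserving_prodAssoc modeMeasure modeMeasure (sectorMeasure n)).symm
  rw [← lintegral_prod_mul hb.aemeasurable hw.aemeasurable]
  exact h.lintegral_comp (f := fun x => b x.1 * w x.2) ((hb.comp measurable_fst).mul (hw.comp measurable_snd))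

theorem lintegral_sq_le_of_norm_le {b : Mode × Mode → ℝ} (hb : Measurable b)
    (hi : Integrable (fun p => b p ^ 2) (modeMeasure.prod modeMeasure)) {u : Point n → ℂ}
    (hu : Measurable u) {k : Mode × Mode × Point n → ℂ}
    (hk : ∀ y, ‖k y‖ ≤ b (y.1, y.2.1) * ‖u y.2.2‖) :
    ∫⁻ y, ‖k y‖ₑ ^ 2 ∂(pairMeasure n)
      ≤ ENNReal.ofReal (∫ p, b p ^ 2 ∂(modeMeasure.prod modeMeasure))
        * ∫⁻ z, ‖u z‖ₑ ^ 2 ∂(sectorMeasure n) := by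
  rw [ofReal_integral_eq_lintegral_ofReal hi (.of_forall fun q => sq_nonneg _),
    ← lintegral_pair_mul (hb.pow_const 2).ennreal_ofReal (hu.enorm.pow_const 2)]
  refine lintegral_mono fun y => ?_
  have h2 := pow_le_pow_left₀ (norm_nonneg _) (hk y) 2
  have h3 := ENNReal.ofReal_le_ofReal h2
  rw [mul_pow, ENNReal.ofReal_mul (sq_nonneg _)] at h3
  simpa only [ENNReal.ofReal_pow (norm_nonneg _), ofReal_norm] using h3

theorem lintegral_pairKernel_le {κ : Mode × Mode × ℝ → ℝ} {b : Mode × Mode → ℝ}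
    (hκ : IsPairKernel κ b) {u : Point n → ℂ} (hu : Measurable u) :
    ∫⁻ y, ‖pairKernel κ u y‖ₑ ^ 2 ∂(pairMeasure n)
      ≤ ENNReal.ofReal (∫ p, b p ^ 2 ∂(modeMeasure.prod modeMeasure))
        * ∫⁻ z, ‖u z‖ₑ ^ 2 ∂(sectorMeasure n) :=
  lintegral_sq_le_of_norm_le hκ.measurable_bound hκ.integrable hu (norm_pairKernel_le hκ u)

theorem memLp_pairKernel {κ : Mode × Mode × ℝ → ℝ} {b : Mode × Mode → ℝ}
    (hκ : IsPairKernel κ b) {u : Point n → ℂ} (hu : IsWave u) :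
    MemLp (pairKernel κ u) 2 (pairMeasure n) := by
  rw [memLp_two_iff (measurable_pairKernel hκ.measurable hu.measurable)]
  exact (lintegral_pairKernel_le hκ hu.measurable).trans_lt
    (ENNReal.mul_lt_top (by simp) ((memLp_two_iff hu.measurable).1 hu.memLp))

theorem fieldEnergy_permute (σ : Equiv.Perm (Fin n)) (z : Point n) :
    fieldEnergy (permute σ z).2 = fieldEnergy z.2 :=
  Equiv.sum_comp σ fun i => ‖(z.2 i).1‖

theorem isSymm_pairKernel (κ : Mode × Mode × ℝ → ℝ) {u : Point n → ℂ} (hu : IsSymm u)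
    (q q' : Mode) : IsSymm fun z => pairKernel κ u (q, q', z) := by
  intro σ z
  simp only [pairKernel, domInd_permute, fieldEnergy_permute, hu σ z]
  rfl

theorem isWave_pairFn {κ : Mode × Mode × ℝ → ℝ} {b : Mode × Mode → ℝ}
    (hκ : IsPairKernel κ b) {u : Point n → ℂ} (hu : IsWave u) : IsWave (pairFn κ u) :=
  isWave_symPair (measurable_pairKernel hκ.measurable hu.measurable)
    (isSymm_pairKernel κ hu.symm) (memLp_pairKernel hκ hu)

theorem exists_pairOp {κ : Mode × Mode × ℝ → ℝ} {b : Mode × Mode → ℝ} (hκ : IsPairKernel κ b)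
    (n : ℕ) : ∃ S : Sector n → Sector (n + 2), ∀ ψ u, Represents ψ u →
      Represents (S ψ) (pairFn κ u) :=
  exists_sector_map (pairFn κ) (fun _ hu => isWave_pairFn hκ hu) fun _ _ h => pairFn_congr_ae κ h

/-- The operator creating a hard pair of photons with amplitude `κ`. -/
def pairOp {κ : Mode × Mode × ℝ → ℝ} {b : Mode × Mode → ℝ} (hκ : IsPairKernel κ b)
    (ψ : Sector n) : Sector (n + 2) :=
  (exists_pairOp hκ n).choose ψ

theorem Represents.pairOp {κ : Mode × Mode × ℝ → ℝ} {b : Mode × Mode → ℝ}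
    (hκ : IsPairKernel κ b) {ψ : Sector n} {u : Point n → ℂ} (h : Represents ψ u) :
    Represents (pairOp hκ ψ) (pairFn κ u) :=
  (exists_pairOp hκ n).choose_spec ψ u h

/-- A created hard pair is visible in the final configuration up to its order, so at most two terms
of the symmetrization overlap. The constant is free of n; applied to the pieces of the free energy
it reproduces 𝓔₀ exactly. -/
theorem norm_pairOp_sq_le {κ : Mode × Mode × ℝ → ℝ} {b : Mode × Mode → ℝ}
    (hκ : IsPairKernel κ b) (ψ : Sector n) :
    ‖pairOp hκ ψ‖ ^ 2 ≤ 2 * (∫ p, b p ^ 2 ∂(modeMeasure.prod modeMeasure)) * ‖ψ‖ ^ 2 := by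
  obtain ⟨u, hu⟩ := exists_represents ψ
  have h0 : 0 ≤ ∫ p, b p ^ 2 ∂(modeMeasure.prod modeMeasure) := integral_nonneg fun _ => sq_nonneg _
  refine (hu.pairOp hκ).norm_sq_le hu (by positivity) ?_
  have h1 := lintegral_symPair_sq_le (measurable_pairKernel hκ.measurable hu.wave.measurable)
    fun z => card_dominates_le _ z fun p hp => by
      by_contra hn
      exact hp (by simp [pairKernel, domInd, hn])
  refine h1.trans ?_
  rw [ENNReal.ofReal_mul (by positivity), mul_assoc]
  simp only [ENNReal.ofReal_ofNat]
  exact mul_le_mul_right (lintegral_pairKernel_le hκ hu.wave.measurable) _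

theorem fieldEnergy_extractPair (p : Fin (n + 2) × Fin (n + 1)) (z : Point (n + 2)) :
    fieldEnergy z.2 = ‖(extractPair p z).1.1‖ + ‖(extractPair p z).2.1.1‖
      + fieldEnergy (extractPair p z).2.2.2 := by
  rw [fieldEnergy_extract p.1, fieldEnergy_extract p.2, ← add_assoc]
  rfl

theorem pairOp_add_of_eq {κ κ₁ κ₂ : Mode × Mode × ℝ → ℝ} {b b₁ b₂ : Mode × Mode → ℝ}
    (hκ : IsPairKernel κ b) (hκ₁ : IsPairKernel κ₁ b₁) (hκ₂ : IsPairKernel κ₂ b₂)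
    (h : ∀ q q' t, κ (q, q', t) = κ₁ (q, q', t) + κ₂ (q, q', t)) (ψ : Sector n) :
    pairOp hκ ψ = pairOp hκ₁ ψ + pairOp hκ₂ ψ := by
  obtain ⟨u, hu⟩ := exists_represents ψ
  refine (hu.pairOp hκ).eq ((hu.pairOp hκ₁).add (hu.pairOp hκ₂)) (.of_forall fun z => ?_)
  simp only [pairFn, symPair, pairKernel, ← mul_add, ← Finset.sum_add_distrib]
  congr 1
  refine Finset.sum_congr rfl fun p _ => ?_
  rw [h]; push_cast; ring

/-- The square root of the field energy of a state with an additional hard pair. -/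
theorem sqrtEnergy_pairOp {κ κ₁ κ₂ : Mode × Mode × ℝ → ℝ} {b b₁ b₂ : Mode × Mode → ℝ}
    (hκ : IsPairKernel κ b) (hκ₁ : IsPairKernel κ₁ b₁) (hκ₂ : IsPairKernel κ₂ b₂)
    (h : ∀ q q' t, 0 ≤ t → Real.sqrt (‖q.1‖ + ‖q'.1‖ + t) * κ (q, q', t)
      = κ₁ (q, q', t) + Real.sqrt t * κ₂ (q, q', t))
    {ψ f : Sector n} (hf : SqrtEnergy ψ f) :
    SqrtEnergy (pairOp hκ ψ) (pairOp hκ₁ ψ + pairOp hκ₂ f) := by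
  obtain ⟨u, hu⟩ := exists_represents ψ
  obtain ⟨v, hv⟩ := exists_represents f
  refine SqrtEnergy.of_represents (hu.pairOp hκ) ((hu.pairOp hκ₁).add (hv.pairOp hκ₂)) ?_
  -- The energy t of the old photons is the argument at which `v = √t u`, so the term with κ₂ may be
  -- read as acting on `f`.
  have h1 : ∀ᵐ z ∂(sectorMeasure (n + 2)), ∀ p, v (extractPair p z).2.2
      = (Real.sqrt (fieldEnergy (extractPair p z).2.2.2) : ℂ) * u (extractPair p z).2.2 :=
    ae_all_iff.2 fun p => ae_extractPair_snd (hf.ae_eq hu hv) p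
  filter_upwards [h1] with z hz
  simp only [pairFn, symPair]
  rw [mul_left_comm (Real.sqrt (fieldEnergy z.2) : ℂ), ← mul_add, ← Finset.sum_add_distrib]
  congr 1
  rw [Finset.mul_sum]
  refine Finset.sum_congr rfl fun p _ => ?_
  have h2 := h (extractPair p z).1 (extractPair p z).2.1 _
    (fieldEnergy_nonneg (extractPair p z).2.2.2)
  rw [← fieldEnergy_extractPair p z] at h2
  have h3 := congrArg (fun r : ℝ => (r : ℂ)) h2
  push_cast at h3
  simp only [pairKernel, hz]
  linear_combination (-(domInd (extractPair p z).1 (extractPair p z).2.1 (extractPair p z).2.2.2) *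
    (conj (phase (extractPair p z).2.2.1 (extractPair p z).1) *
      (conj (phase (extractPair p z).2.2.1 (extractPair p z).2.1) * u (extractPair p z).2.2))) * h3

/-- Half a power of the field energy can be moved to the other side. -/
theorem inner_pairOp_eq {κ κ₁ : Mode × Mode × ℝ → ℝ} {b b₁ : Mode × Mode → ℝ}
    (hκ : IsPairKernel κ b) (hκ₁ : IsPairKernel κ₁ b₁)
    (h : ∀ q q' t, 0 ≤ t → κ (q, q', t) = Real.sqrt (‖q.1‖ + ‖q'.1‖ + t) * κ₁ (q, q', t))
    (ψ : Sector n) {ψ' f' : Sector (n + 2)} (hf : SqrtEnergy ψ' f') :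
    inner ℂ (pairOp hκ ψ) ψ' = inner ℂ (pairOp hκ₁ ψ) f' := by
  obtain ⟨u, hu⟩ := exists_represents ψ
  obtain ⟨v, hv⟩ := exists_represents ψ'
  obtain ⟨w, hw⟩ := exists_represents f'
  rw [(hu.pairOp hκ).inner_eq hv, (hu.pairOp hκ₁).inner_eq hw]
  refine integral_congr_ae ?_
  filter_upwards [hf.ae_eq hv hw] with z hz
  rw [hz, ← mul_assoc]
  congr 1
  rw [mul_comm (conj _), ← Complex.conj_ofReal, ← map_mul]
  congr 1
  simp only [pairFn, symPair]
  rw [mul_left_comm]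
  congr 1
  rw [Finset.mul_sum]
  refine Finset.sum_congr rfl fun p _ => ?_
  have h2 := h (extractPair p z).1 (extractPair p z).2.1 _
    (fieldEnergy_nonneg (extractPair p z).2.2.2)
  rw [← fieldEnergy_extractPair p z] at h2
  simp only [pairKernel]
  rw [h2]; push_cast; ring

end

/-! ### Momentum on the sectors and its commutation with photon creation. -/

section

variable {n : ℕ}

/-- `p_j u = m` in the weak sense, for wave functions. -/
def WaveMomentum (j : Fin 3) (u m : Point n → ℂ) : Prop :=
  ∀ᵐ K ∂(photonMeasure n), WeakMomentum j (fun x => u (x, K)) (fun x => m (x, K))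

/-- `p_j ψ = m` on the `n`-photon sector. -/
def SectorMomentum (j : Fin 3) (ψ m : Sector n) : Prop :=
  WaveMomentum j (sectorFn ψ) (sectorFn m)

theorem ae_ae_photon {p : Point n → Prop} (h : ∀ᵐ z ∂(sectorMeasure n), p z) :
    ∀ᵐ K ∂(photonMeasure n), ∀ᵐ x ∂(volume : Measure R3), p (x, K) := by
  have h2 := (Measure.measurePreserving_swap (μ := photonMeasure n)
    (ν := (volume : Measure R3))).quasiMeasurePreserving.ae h
  exact Measure.ae_ae_of_ae_prod h2

theorem WaveMomentum.congr_ae {j : Fin 3} {u m u' m' : Point n → ℂ} (h : WaveMomentum j u m)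
    (hu : u =ᵐ[sectorMeasure n] u') (hm : m =ᵐ[sectorMeasure n] m') : WaveMomentum j u' m' := by
  filter_upwards [h, ae_ae_photon hu, ae_ae_photon hm] with K h1 h2 h3
  exact h1.congr_ae h2 h3

theorem sectorMomentum_iff {j : Fin 3} {ψ m : Sector n} {u v : Point n → ℂ}
    (hu : Represents ψ u) (hv : Represents m v) : SectorMomentum j ψ m ↔ WaveMomentum j u v :=
  ⟨fun h => h.congr_ae hu.ae_eq hv.ae_eq, fun h => h.congr_ae hu.ae_eq.symm hv.ae_eq.symm⟩

theorem ae_memLp_slice {u : Point n → ℂ} (hu : Measurable u) (h : MemLp u 2 (sectorMeasure n)) :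
    ∀ᵐ K ∂(photonMeasure n), MemLp (fun x => u (x, K)) 2 (volume : Measure R3) := by
  have h1 := (memLp_two_iff hu).1 h
  have hm : Measurable fun z => ‖u z‖ₑ ^ 2 := hu.enorm.pow_const 2
  rw [sectorMeasure, lintegral_prod_symm' _ hm] at h1
  filter_upwards [ae_lt_top hm.lintegral_prod_left' h1.ne] with K hK
  exact (memLp_two_iff (hu.comp (measurable_id.prodMk measurable_const))).2 hK

theorem ae_photon_extract {p : Mode × (Fin n → Mode) → Prop}
    (h : ∀ᵐ y ∂(modeMeasure.prod (photonMeasure n)), p y) (i : Fin (n + 1)) :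
    ∀ᵐ K ∂(photonMeasure (n + 1)), p (K i, i.removeNth K) :=
  (measurePreserving_piFinSuccAbove (fun _ : Fin (n + 1) => modeMeasure)
    i).quasiMeasurePreserving.ae h

theorem ae_photon_extract_snd {p : (Fin n → Mode) → Prop}
    (h : ∀ᵐ K ∂(photonMeasure n), p K) (i : Fin (n + 1)) :
    ∀ᵐ K ∂(photonMeasure (n + 1)), p (i.removeNth K) :=
  ae_photon_extract (p := fun y => p y.2) (Measure.quasiMeasurePreserving_snd.ae h) i

theorem memLp_conj_phase_mul {f : R3 → ℂ} (hf : MemLp f 2 volume) (q : Mode) :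
    MemLp (fun x => conj (phase x q) * f x) 2 volume := by
  have hc : Measurable fun x => conj (phase x q) :=
    Complex.continuous_conj.measurable.comp (measurable_phase_comp measurable_id measurable_const)
  refine hf.mono (hc.aestronglyMeasurable.mul hf.aestronglyMeasurable) (.of_forall fun x => ?_)
  rw [norm_mul, RCLike.norm_conj, norm_phase, one_mul]

theorem WaveMomentum.integral_symm {j : Fin 3} {u m u' m' : Point n → ℂ}
    (h : WaveMomentum j u m) (h' : WaveMomentum j u' m') (hu : IsWave u) (hm : IsWave m)
    (hu' : IsWave u') (hm' : IsWave m') :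
    ∫ z, conj (u' z) * m z ∂(sectorMeasure n) = ∫ z, conj (m' z) * u z ∂(sectorMeasure n) := by
  have i1 : Integrable (fun z => conj (u' z) * m z)
      ((volume : Measure R3).prod (photonMeasure n)) :=
    integrable_mul_of_memLp_two hu'.memLp.star hm.memLp
  have i2 : Integrable (fun z => conj (m' z) * u z)
      ((volume : Measure R3).prod (photonMeasure n)) :=
    integrable_mul_of_memLp_two hm'.memLp.star hu.memLp
  rw [sectorMeasure, integral_prod_symm _ i1, integral_prod_symm _ i2]
  refine integral_congr_ae ?_
  filter_upwards [h, h', ae_memLp_slice hu.measurable hu.memLp,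
    ae_memLp_slice hm.measurable hm.memLp, ae_memLp_slice hu'.measurable hu'.memLp,
    ae_memLp_slice hm'.measurable hm'.memLp] with K h1 h2 h3 h4 h5 h6
  exact h1.integral_symm h2 h3 h4 h5 h6

theorem SectorMomentum.inner_symm {j : Fin 3} {ψ m ψ' m' : Sector n}
    (h : SectorMomentum j ψ m) (h' : SectorMomentum j ψ' m') :
    inner ℂ ψ' m = inner ℂ m' ψ := by
  obtain ⟨u, hu⟩ := exists_represents ψ
  obtain ⟨v, hv⟩ := exists_represents m
  obtain ⟨u', hu'⟩ := exists_represents ψ'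
  obtain ⟨v', hv'⟩ := exists_represents m'
  rw [hu'.inner_eq hv, hv'.inner_eq hu]
  exact ((sectorMomentum_iff hu hv).1 h).integral_symm ((sectorMomentum_iff hu' hv').1 h')
    hu.wave hv.wave hu'.wave hv'.wave

/-- Commutation of `p_j` with the creation of one photon of amplitude `c`. -/
theorem WaveMomentum.symOne {j : Fin 3} {u m : Point n → ℂ} (h : WaveMomentum j u m)
    (hu : IsWave u) (hm : IsWave m) (c : Mode → ℂ) :
    WaveMomentum j (symOne fun y => c y.1 * conj (phase y.2.1 y.1) * u y.2)
      (PauliFierz.symOne fun y => c y.1 * conj (phase y.2.1 y.1) * (m y.2 - y.1.1 j * u y.2)) := by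
  have h1 := ae_all_iff.2 fun i : Fin (n + 1) => ae_photon_extract_snd h i
  have h2 := ae_all_iff.2 fun i : Fin (n + 1) =>
    ae_photon_extract_snd (ae_memLp_slice hu.measurable hu.memLp) i
  have h3 := ae_all_iff.2 fun i : Fin (n + 1) =>
    ae_photon_extract_snd (ae_memLp_slice hm.measurable hm.memLp) i
  filter_upwards [h1, h2, h3] with K k1 k2 k3
  simp only [PauliFierz.symOne, extract, mul_assoc]
  have hb : ∀ i : Fin (n + 1), MemLp (fun x => m (x, i.removeNth K)
      - (K i).1 j * u (x, i.removeNth K)) 2 volume := fun i => (k3 i).sub ((k2 i).const_mul _)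
  exact (WeakMomentum.sum Finset.univ
    (fun i _ => ((k1 i).conj_phase_mul (k2 i) (k3 i) (K i)).const_mul (c (K i)))
    (fun i _ => (memLp_conj_phase_mul (k2 i) (K i)).const_mul _)
    (fun i _ => (memLp_conj_phase_mul (hb i) (K i)).const_mul _)).const_mul _

/-- Commutation of `p_j` with the creation of a hard pair. -/
theorem WaveMomentum.pairFn {j : Fin 3} {u m : Point n → ℂ} (h : WaveMomentum j u m)
    (hu : IsWave u) (hm : IsWave m) {κ κ' : Mode × Mode × ℝ → ℝ}
    (hκ : ∀ q q' t, κ' (q, q', t) = κ (q, q', t) * (q.1 j + q'.1 j)) :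
    WaveMomentum j (pairFn κ u) fun z => PauliFierz.pairFn κ m z - PauliFierz.pairFn κ' u z := by
  have h1 := ae_all_iff.2 fun i : Fin (n + 2) × Fin (n + 1) =>
    ae_photon_extract_snd (ae_photon_extract_snd h i.2) i.1
  have h2 := ae_all_iff.2 fun i : Fin (n + 2) × Fin (n + 1) =>
    ae_photon_extract_snd (ae_photon_extract_snd (ae_memLp_slice hu.measurable hu.memLp) i.2) i.1
  have h3 := ae_all_iff.2 fun i : Fin (n + 2) × Fin (n + 1) =>
    ae_photon_extract_snd (ae_photon_extract_snd (ae_memLp_slice hm.measurable hm.memLp) i.2) i.1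
  filter_upwards [h1, h2, h3] with K k1 k2 k3
  have hb : ∀ i : Fin (n + 2) × Fin (n + 1), MemLp (fun x =>
      m (x, i.2.removeNth (i.1.removeNth K))
      - ((i.1.removeNth K) i.2).1 j * u (x, i.2.removeNth (i.1.removeNth K))) 2 volume :=
    fun i => (k3 i).sub ((k2 i).const_mul _)
  have hw := fun i : Fin (n + 2) × Fin (n + 1) =>
    (k1 i).conj_phase_mul (k2 i) (k3 i) ((i.1.removeNth K) i.2)
  have hwf := fun i : Fin (n + 2) × Fin (n + 1) =>
    memLp_conj_phase_mul (k2 i) ((i.1.removeNth K) i.2)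
  have hwg := fun i : Fin (n + 2) × Fin (n + 1) =>
    memLp_conj_phase_mul (hb i) ((i.1.removeNth K) i.2)
  have hc := fun i : Fin (n + 2) × Fin (n + 1) =>
    (hwg i).sub ((hwf i).const_mul ((K i.1).1 j : ℂ))
  have key := (WeakMomentum.sum Finset.univ
    (fun i _ => ((hw i).conj_phase_mul (hwf i) (hwg i) (K i.1)).const_mul
      ((κ (K i.1, (i.1.removeNth K) i.2, fieldEnergy (i.2.removeNth (i.1.removeNth K))) : ℂ)
        * domInd (K i.1) ((i.1.removeNth K) i.2) (i.2.removeNth (i.1.removeNth K))))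
    (fun i _ => (memLp_conj_phase_mul (hwf i) (K i.1)).const_mul _)
    (fun i _ => (memLp_conj_phase_mul (hc i) (K i.1)).const_mul _)).const_mul
      ((Real.sqrt (n + 1) : ℂ) * (Real.sqrt (n + 2) : ℂ))⁻¹
  refine key.congr_ae (.of_forall fun x => rfl) (.of_forall fun x => ?_)
  simp only [PauliFierz.pairFn, symPair, pairKernel, extractPair, extract, ← mul_sub,
    ← Finset.sum_sub_distrib]
  congr 1
  refine Finset.sum_congr rfl fun p _ => ?_
  rw [hκ]; push_cast; ring

theorem SectorMomentum.pairOp {j : Fin 3} {ψ m : Sector n} (h : SectorMomentum j ψ m)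
    {κ κ' : Mode × Mode × ℝ → ℝ} {b b' : Mode × Mode → ℝ} (hκ : IsPairKernel κ b)
    (hκ' : IsPairKernel κ' b')
    (e : ∀ q q' t, κ' (q, q', t) = κ (q, q', t) * (q.1 j + q'.1 j)) :
    SectorMomentum j (pairOp hκ ψ) (PauliFierz.pairOp hκ m - PauliFierz.pairOp hκ' ψ) := by
  obtain ⟨u, hu⟩ := exists_represents ψ
  obtain ⟨v, hv⟩ := exists_represents m
  rw [sectorMomentum_iff (hu.pairOp hκ) ((hv.pairOp hκ).sub (hu.pairOp hκ'))]
  exact ((sectorMomentum_iff hu hv).1 h).pairFn hu.wave hv.wave e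

theorem isWave_symOne_amp {c : Mode → ℂ} (hcm : Measurable c) (hc : MemLp c 2 modeMeasure)
    {u : Point n → ℂ} (hu : IsWave u) :
    IsWave (symOne fun y => c y.1 * conj (phase y.2.1 y.1) * u y.2) := by
  have hm : Measurable fun y : Mode × Point n => c y.1 * conj (phase y.2.1 y.1) * u y.2 :=
    ((hcm.comp measurable_fst).mul (Complex.continuous_conj.measurable.comp
      (measurable_phase_comp measurable_snd.fst measurable_fst))).mul
      (hu.measurable.comp measurable_snd)
  refine isWave_symOne hm (fun q σ z => ?_) ?_
  · simp only [hu.symm σ z]; rfl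
  · refine (memLp_mul_prod hcm hu.measurable hc hu.memLp).mono hm.aestronglyMeasurable
      (.of_forall fun y => le_of_eq ?_)
    simp only [norm_mul, RCLike.norm_conj, norm_phase, mul_one]

/-- The commutator of `p` and `D^*` vanishes after contraction, by transversality. -/
theorem sum_inner_creation_momentum {ε : R3 → Fin 2 → R3} (hε : IsPolarization ε) (Λ : ℝ)
    {ψ : Sector n} {m : Fin 3 → Sector n} (h : ∀ j, SectorMomentum j ψ (m j))
    {ψ' : Sector (n + 1)} {m' : Fin 3 → Sector (n + 1)} (h' : ∀ j, SectorMomentum j ψ' (m' j)) :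
    ∑ j, inner ℂ (creation hε Λ j n ψ) (m' j)
      = ∑ j, inner ℂ (m j) (annihilation hε Λ j n ψ') := by
  obtain ⟨u, hu⟩ := exists_represents ψ
  obtain ⟨v, hv⟩ := exists_represents ψ'
  choose w hw using fun j => exists_represents (m j)
  choose w' hw' using fun j => exists_represents (m' j)
  have hcm : ∀ j, Measurable fun q : Mode => ((coupling ε Λ j q * q.1 j : ℝ) : ℂ) := fun j =>
    ((measurable_coupling hε Λ j).mul (by fun_prop)).complex_ofReal
  have hc : ∀ j, MemLp (fun q : Mode => ((coupling ε Λ j q * q.1 j : ℝ) : ℂ)) 2 modeMeasure := by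
    intro j
    refine ((memLp_coupling hε Λ j).const_mul ((|Λ| : ℝ) : ℂ)).mono (hcm j).aestronglyMeasurable
      (.of_forall fun q => ?_)
    rw [norm_mul, Complex.norm_real, Complex.norm_real, Complex.norm_real, norm_mul, mul_comm]
    -- Inside the cutoff |q_j| ≤ Λ; outside it the coupling vanishes.
    by_cases hq : ‖q.1‖ ≤ Λ
    · gcongr
      exact (PiLp.norm_apply_le q.1 j).trans
        (hq.trans ((le_abs_self Λ).trans (by rw [Real.norm_eq_abs, abs_abs])))
    · simp [coupling, hq]
  have hS := fun j => isWave_symOne_amp (hcm j) (hc j) hu.wave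
  -- Creation of a photon q shifts the particle momentum by -q. The commutator is the creation
  -- operator with amplitude G_j q_j, and its sum over j is zero.
  have key : ∀ j, inner ℂ (creation hε Λ j n ψ) (m' j)
      = inner ℂ (m j) (annihilation hε Λ j n ψ') - inner ℂ (hS j).toSector ψ' := by
    intro j
    have hmom := ((sectorMomentum_iff hu (hw j)).1 (h j)).symOne hu.wave (hw j).wave
      (fun q => (coupling ε Λ j q : ℂ))
    have e1 : (symOne fun y : Mode × Point n => (coupling ε Λ j y.1 : ℂ) *
        conj (phase y.2.1 y.1) * (w j y.2 - y.1.1 j * u y.2))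
        = fun z => creationFn ε Λ j (w j) z - symOne (fun y : Mode × Point n =>
          ((coupling ε Λ j y.1 * y.1.1 j : ℝ) : ℂ) * conj (phase y.2.1 y.1) * u y.2) z := by
      funext z
      simp only [creationFn, symOne, creationKernel, ← mul_sub, ← Finset.sum_sub_distrib]
      congr 1
      refine Finset.sum_congr rfl fun i _ => ?_
      push_cast; ring
    rw [e1] at hmom
    have hr := ((hw j).creation hε Λ j).sub (hS j).represents
    have e2 := ((sectorMomentum_iff (hu.creation hε Λ j) hr).2 hmom).inner_symm (h' j)
    rw [← inner_conj_symm (creation hε Λ j n ψ) (m' j), ← e2]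
    refine (inner_conj_symm _ ψ').trans ?_
    rw [inner_sub_left, inner_creation_left]
  rw [Finset.sum_congr rfl fun j _ => key j, Finset.sum_sub_distrib, sub_eq_self,
    ← sum_inner Finset.univ (fun j => (hS j).toSector) ψ']
  have hz : ∑ j, (hS j).toSector = 0 := by
    have hr : Represents (∑ j, (hS j).toSector) fun z => ∑ j, symOne (fun y : Mode × Point n =>
        ((coupling ε Λ j y.1 * y.1.1 j : ℝ) : ℂ) * conj (phase y.2.1 y.1) * u y.2) z := by
      simp only [Fin.sum_univ_three]
      exact ((hS 0).represents.add (hS 1).represents).add (hS 2).represents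
    refine hr.eq Represents.zero (.of_forall fun z => ?_)
    simp only [symOne, ← Finset.mul_sum]
    rw [Finset.sum_comm]
    refine mul_eq_zero_of_right _ (Finset.sum_eq_zero fun i _ => ?_)
    rw [← Finset.sum_mul, ← Finset.sum_mul, ← Complex.ofReal_sum, transverse_coupling hε]
    simp
  rw [hz, inner_zero_left]

end

/-! ### Soft pairs: the remainder of `D^* · D^*` is form bounded by the field energy. -/

section

variable {n : ℕ}

/-- The restriction to soft photons. -/
def softInd (h : ℝ) (q : Mode) : ℝ := if ‖q.1‖ ≤ h then 1 else 0

theorem softInd_nonneg (h : ℝ) (q : Mode) : 0 ≤ softInd h q := by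
  unfold softInd; split_ifs <;> simp

theorem measurable_softInd (h : ℝ) : Measurable (softInd h) := by
  unfold softInd
  exact Measurable.ite (measurableSet_le (by fun_prop) measurable_const) measurable_const
    measurable_const

theorem ampDiv_sq_mul_norm (Λ : ℝ) (q : Mode) : ampDiv Λ q ^ 2 * ‖q.1‖ = amp Λ q ^ 2 := by
  rw [← ampDiv_mul_sqrt, mul_pow, Real.sq_sqrt (norm_nonneg _)]

/-- Restricted to |k| ≤ h, the weight is dominated by the same weight with cutoff h in place of Λ,
whose integral is 2h/π. -/
theorem lintegral_soft_le {Λ h : ℝ} (hh : 0 ≤ h) :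
    ∫⁻ q, ENNReal.ofReal (softInd h q * ampDiv Λ q ^ 2) ∂modeMeasure
      ≤ ENNReal.ofReal (2 * h / Real.pi) := by
  rcases hh.eq_or_lt with rfl | hh
  · have e : ∀ q : Mode, ENNReal.ofReal (softInd 0 q * ampDiv Λ q ^ 2) = 0 := by
      intro q
      unfold softInd
      split_ifs with h
      · have h0 : ‖q.1‖ = 0 := le_antisymm h (norm_nonneg _)
        simp [ampDiv, h0]
      · simp
    simp [e]
  · rw [← lintegral_ampDiv_sq hh]
    refine lintegral_mono fun q => ?_
    rw [← ENNReal.ofReal_pow (ampDiv_nonneg _ _)]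
    refine ENNReal.ofReal_le_ofReal ?_
    unfold softInd ampDiv amp
    split_ifs with h1 h2
    · simp
    · simp only [zero_div, ne_eq, OfNat.ofNat_ne_zero, not_false_eq_true, zero_pow, mul_zero]
      positivity
    · simp
    · simp

/-- Smallness is gained from the soft photon: either the factor h is explicit, or the soft photon
integrates to 2h/π while the other frequency turns `ampDiv²` into `amp²`, with integral Λ²/π. -/
theorem lintegral_soft_pair_le {Λ h : ℝ} (hΛ : 0 < Λ) (hh : 0 ≤ h) :
    ∫⁻ p : Mode × Mode, ENNReal.ofReal (ampDiv Λ p.1 ^ 2 * ampDiv Λ p.2 ^ 2 *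
        (‖p.1.1‖ + ‖p.2.1‖ + h) * max (softInd h p.1) (softInd h p.2))
        ∂(modeMeasure.prod modeMeasure)
      ≤ ENNReal.ofReal (4 * Λ ^ 2 * h) := by
  have hA : Measurable fun q => ENNReal.ofReal (ampDiv Λ q ^ 2) :=
    ((measurable_ampDiv Λ).pow_const 2).ennreal_ofReal
  have hB : Measurable fun q => ENNReal.ofReal (amp Λ q ^ 2) :=
    ((measurable_amp Λ).pow_const 2).ennreal_ofReal
  have hS : Measurable fun q => ENNReal.ofReal (softInd h q * ampDiv Λ q ^ 2) :=
    ((measurable_softInd h).mul ((measurable_ampDiv Λ).pow_const 2)).ennreal_ofReal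
  have iA : ∫⁻ q, ENNReal.ofReal (ampDiv Λ q ^ 2) ∂modeMeasure = ENNReal.ofReal (2 * Λ / Real.pi) := by
    rw [← lintegral_ampDiv_sq hΛ]; simp only [ENNReal.ofReal_pow (ampDiv_nonneg Λ _)]
  have iB : ∫⁻ q, ENNReal.ofReal (amp Λ q ^ 2) ∂modeMeasure = ENNReal.ofReal (Λ ^ 2 / Real.pi) := by
    rw [← lintegral_amp_sq hΛ]; simp only [ENNReal.ofReal_pow (amp_nonneg Λ _)]
  have hle : ∀ p : Mode × Mode, ENNReal.ofReal (ampDiv Λ p.1 ^ 2 * ampDiv Λ p.2 ^ 2 *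
        (‖p.1.1‖ + ‖p.2.1‖ + h) * max (softInd h p.1) (softInd h p.2))
      ≤ ENNReal.ofReal (4 * h) * (ENNReal.ofReal (ampDiv Λ p.1 ^ 2) *
          ENNReal.ofReal (ampDiv Λ p.2 ^ 2))
        + (ENNReal.ofReal (softInd h p.1 * ampDiv Λ p.1 ^ 2) * ENNReal.ofReal (amp Λ p.2 ^ 2)
        + ENNReal.ofReal (amp Λ p.1 ^ 2) * ENNReal.ofReal (softInd h p.2 * ampDiv Λ p.2 ^ 2)) := by
    intro p
    have s1 := softInd_nonneg h p.1
    have s2 := softInd_nonneg h p.2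
    have k1 := amp_nonneg Λ p.1
    have k2 := amp_nonneg Λ p.2
    rw [← ENNReal.ofReal_mul (by positivity), ← ENNReal.ofReal_mul (by positivity),
      ← ENNReal.ofReal_mul (by positivity), ← ENNReal.ofReal_mul (by positivity),
      ← ENNReal.ofReal_add (by positivity) (by positivity),
      ← ENNReal.ofReal_add (by positivity) (by positivity)]
    refine ENNReal.ofReal_le_ofReal ?_
    rw [← ampDiv_sq_mul_norm Λ p.1, ← ampDiv_sq_mul_norm Λ p.2]
    -- If q is soft then |q| ≤ h, so at most 2h plus the other frequency remains; if both are soft,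
    -- 3h.
    have key : (‖p.1.1‖ + ‖p.2.1‖ + h) * max (softInd h p.1) (softInd h p.2)
        ≤ 4 * h + softInd h p.1 * ‖p.2.1‖ + softInd h p.2 * ‖p.1.1‖ := by
      have n1 := norm_nonneg p.1.1
      have n2 := norm_nonneg p.2.1
      unfold softInd
      split_ifs <;> simp <;> linarith
    calc _ = ampDiv Λ p.1 ^ 2 * ampDiv Λ p.2 ^ 2 *
          ((‖p.1.1‖ + ‖p.2.1‖ + h) * max (softInd h p.1) (softInd h p.2)) := by ring
      _ ≤ ampDiv Λ p.1 ^ 2 * ampDiv Λ p.2 ^ 2 *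
          (4 * h + softInd h p.1 * ‖p.2.1‖ + softInd h p.2 * ‖p.1.1‖) := by gcongr
      _ = _ := by ring
  refine (lintegral_mono hle).trans ?_
  have m2 : Measurable fun p : Mode × Mode => ENNReal.ofReal (softInd h p.1 * ampDiv Λ p.1 ^ 2)
      * ENNReal.ofReal (amp Λ p.2 ^ 2) := (hS.comp measurable_fst).mul (hB.comp measurable_snd)
  have m3 : Measurable fun p : Mode × Mode => ENNReal.ofReal (amp Λ p.1 ^ 2)
      * ENNReal.ofReal (softInd h p.2 * ampDiv Λ p.2 ^ 2) :=
    (hB.comp measurable_fst).mul (hS.comp measurable_snd)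
  have m23 : Measurable fun p : Mode × Mode => ENNReal.ofReal (softInd h p.1 * ampDiv Λ p.1 ^ 2)
      * ENNReal.ofReal (amp Λ p.2 ^ 2) + ENNReal.ofReal (amp Λ p.1 ^ 2)
      * ENNReal.ofReal (softInd h p.2 * ampDiv Λ p.2 ^ 2) := m2.add m3
  rw [lintegral_add_right _ m23, lintegral_add_left m2,
    lintegral_const_mul' _ _ ENNReal.ofReal_ne_top, lintegral_prod_mul hA.aemeasurable hA.aemeasurable,
    lintegral_prod_mul hS.aemeasurable hB.aemeasurable,
    lintegral_prod_mul hB.aemeasurable hS.aemeasurable, iA, iB]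
  have h3 := lintegral_soft_le (Λ := Λ) hh
  have hp := Real.pi_gt_three
  calc _ ≤ ENNReal.ofReal (4 * h) * (ENNReal.ofReal (2 * Λ / Real.pi) *
        ENNReal.ofReal (2 * Λ / Real.pi)) + (ENNReal.ofReal (2 * h / Real.pi) *
        ENNReal.ofReal (Λ ^ 2 / Real.pi) + ENNReal.ofReal (Λ ^ 2 / Real.pi) *
        ENNReal.ofReal (2 * h / Real.pi)) := by gcongr
    -- 20 = 4 · 2² + 2 · 2, and 20/π² < 4.
    _ = ENNReal.ofReal (20 / Real.pi ^ 2 * (Λ ^ 2 * h)) := by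
        rw [← ENNReal.ofReal_mul (by positivity), ← ENNReal.ofReal_mul (by positivity),
          ← ENNReal.ofReal_mul (by positivity), ← ENNReal.ofReal_mul (by positivity),
          ← ENNReal.ofReal_add (by positivity) (by positivity),
          ← ENNReal.ofReal_add (by positivity) (by positivity)]
        congr 1
        field_simp
        ring
    _ ≤ _ := by
        refine ENNReal.ofReal_le_ofReal ?_
        rw [mul_assoc 4]
        gcongr
        rw [div_le_iff₀ (by positivity)]
        nlinarith

theorem measurable_pairAmp_comp {ε : R3 → Fin 2 → R3} (hε : IsPolarization ε) (Λ : ℝ)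
    {X : Type*} [MeasurableSpace X] {f g : X → Mode} (hf : Measurable f) (hg : Measurable g) :
    Measurable fun y => pairAmp ε Λ (f y) (g y) := by
  have h := (measurable_pairAmp hε Λ).comp (hf.prodMk hg)
  exact h

theorem measurable_amp_mul_amp (Λ : ℝ) : Measurable fun p : Mode × Mode => amp Λ p.1 * amp Λ p.2 := by
  have h1 : Measurable fun p : Mode × Mode => amp Λ p.1 := (measurable_amp Λ).comp measurable_fst
  have h2 : Measurable fun p : Mode × Mode => amp Λ p.2 := (measurable_amp Λ).comp measurable_snd
  exact h1.mul h2

theorem integrable_amp_mul_amp_sq (Λ : ℝ) : Integrable (fun p : Mode × Mode =>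
    (amp Λ p.1 * amp Λ p.2) ^ 2) (modeMeasure.prod modeMeasure) := by
  simp only [mul_pow]
  exact (integrable_amp_sq Λ).mul_prod (integrable_amp_sq Λ)

theorem isPairKernel_pairAmp {ε : R3 → Fin 2 → R3} (hε : IsPolarization ε) (Λ : ℝ) :
    IsPairKernel (fun y => pairAmp ε Λ y.1 y.2.1) fun p => amp Λ p.1 * amp Λ p.2 where
  measurable := measurable_pairAmp_comp hε Λ measurable_fst measurable_snd.fst
  measurable_bound := measurable_amp_mul_amp Λ
  abs_le := fun q q' _ _ => abs_pairAmp_le hε Λ q q'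
  integrable := integrable_amp_mul_amp_sq Λ

theorem lintegral_pairMeasure {F : Mode × Mode × Point n → ENNReal} (hF : Measurable F) :
    ∫⁻ y, F y ∂(pairMeasure n)
      = ∫⁻ z, ∫⁻ p : Mode × Mode, F (p.1, p.2, z) ∂(modeMeasure.prod modeMeasure)
        ∂(sectorMeasure n) := by
  have h := (measurePreserving_prodAssoc modeMeasure modeMeasure (sectorMeasure n))
  have hm : Measurable fun x : (Mode × Mode) × Point n => F (x.1.1, x.1.2, x.2) :=
    hF.comp (measurable_fst.fst.prodMk (measurable_fst.snd.prodMk measurable_snd))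
  rw [pairMeasure, ← h.lintegral_comp hF, ← lintegral_prod_symm' _ hm]
  rfl

/-- Two photons are created by `D^* · D^*`. -/
theorem sum_creationFn_creationFn (ε : R3 → Fin 2 → R3) (Λ : ℝ) (u : Point n → ℂ)
    (z : Point (n + 2)) :
    ∑ j, creationFn ε Λ j (creationFn ε Λ j u) z
      = symPair (fun y => (pairAmp ε Λ y.1 y.2.1 : ℂ) *
        (conj (phase y.2.2.1 y.1) * (conj (phase y.2.2.1 y.2.1) * u y.2.2))) z := by
  simp only [creationFn, symOne, symPair, creationKernel, Fintype.sum_prod_type, mul_inv]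
  rw [← Finset.mul_sum]
  have e : (Real.sqrt ((n + 1 : ℕ) + 1) : ℂ) = (Real.sqrt (n + 2) : ℂ) := by
    push_cast; norm_num [add_assoc]
  rw [e, mul_comm (Real.sqrt (n + 1) : ℂ)⁻¹, mul_assoc]
  congr 1
  rw [Finset.sum_comm, Finset.mul_sum]
  refine Finset.sum_congr rfl fun i _ => ?_
  simp only [Finset.mul_sum]
  rw [Finset.sum_comm]
  refine Finset.sum_congr rfl fun l _ => ?_
  simp only [extractPair, pairAmp, Complex.ofReal_sum, Complex.ofReal_mul, Finset.sum_mul,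
    Finset.mul_sum]
  refine Finset.sum_congr rfl fun j _ => ?_
  have h3 : (extract l (extract i z).2).2.1 = (extract i z).2.1 := rfl
  simp only [h3]
  have h4 : (extract i z).1 = z.2 i := rfl
  rw [h4]
  ring

/-- If the pair is not dominating, some other photon is at least as hard as one of its members, and
the frequency of that photon is at most the field energy of K. -/
theorem one_sub_domInd_le (q q' : Mode) (K : Fin n → Mode) :
    ‖1 - domInd q q' K‖ ≤ max (softInd (fieldEnergy K) q) (softInd (fieldEnergy K) q') := by
  unfold domInd
  split_ifs with h
  · simp [softInd_nonneg]
  · simp only [Dominates, not_forall, not_and_or, not_lt] at h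
    obtain ⟨m, hm⟩ := h
    have h1 : ‖(K m).1‖ ≤ fieldEnergy K :=
      Finset.single_le_sum (f := fun i => ‖(K i).1‖) (fun _ _ => norm_nonneg _) (Finset.mem_univ m)
    rcases hm with hm | hm
    · simp [softInd, hm.trans h1]
    · simp [softInd, hm.trans h1]

/-- The one-photon weight `|q| |q'| / H_f` on two photons. -/
theorem lintegral_pairWeight_le {v : Point (n + 2) → ℂ} (hv : Measurable v) (hs : IsSymm v) :
    ((n + 1 : ℕ) * (n + 2 : ℕ) : ENNReal) * ∫⁻ y : Mode × Mode × Point n,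
        ENNReal.ofReal (‖y.1.1‖ * ‖y.2.1.1‖ / (‖y.1.1‖ + ‖y.2.1.1‖ + fieldEnergy y.2.2.2))
        * ‖v (adjoinPair y)‖ₑ ^ 2 ∂(pairMeasure n)
      ≤ ∫⁻ z, ENNReal.ofReal (fieldEnergy z.2) * ‖v z‖ₑ ^ 2 ∂(sectorMeasure (n + 2)) := by
  have hw : Measurable fun y : Mode × Mode × Point n =>
      ENNReal.ofReal (‖y.1.1‖ * ‖y.2.1.1‖ / (‖y.1.1‖ + ‖y.2.1.1‖ + fieldEnergy y.2.2.2)) := by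
    have h1 : Measurable fun y : Mode × Mode × Point n => fieldEnergy y.2.2.2 :=
      measurable_fieldEnergy.comp measurable_snd.snd.snd
    exact Measurable.ennreal_ofReal (by fun_prop)
  have h := lintegral_sum_comp (measurePreserving_extractPair (n := n))
    (hw.mul ((hv.comp measurePreserving_adjoinPair.measurable).enorm.pow_const 2))
  have hcard : ((Fintype.card (Fin (n + 2) × Fin (n + 1)) : ℕ) : ENNReal)
      = (n + 1 : ℕ) * (n + 2 : ℕ) := by
    rw [Fintype.card_prod, Fintype.card_fin, Fintype.card_fin]; push_cast; ring
  rw [hcard] at h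
  refine (le_of_eq h.symm).trans (lintegral_mono fun z => ?_)
  simp only [Pi.mul_apply, Function.comp, hs.adjoinPair_extractPair, ← fieldEnergy_extractPair]
  rw [← Finset.sum_mul, ← ENNReal.ofReal_sum_of_nonneg fun p _ =>
    div_nonneg (mul_nonneg (norm_nonneg _) (norm_nonneg _)) (fieldEnergy_nonneg _)]
  refine mul_le_mul_left (ENNReal.ofReal_le_ofReal ?_) _
  -- The sum of |k_i||k_l| over i ≠ l is at most (∑|k_i|)², and one of these powers of H_f is
  -- cancelled by the denominator.
  rw [← Finset.sum_div]
  refine div_le_of_le_mul₀ (fieldEnergy_nonneg _) (fieldEnergy_nonneg _) ?_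
  rw [Fintype.sum_prod_type]
  conv_rhs => rw [fieldEnergy, Finset.sum_mul]
  refine Finset.sum_le_sum fun i _ => ?_
  change ∑ l, ‖(z.2 i).1‖ * ‖(z.2 (i.succAbove l)).1‖ ≤ _
  rw [← Finset.mul_sum]
  refine mul_le_mul_of_nonneg_left ?_ (norm_nonneg _)
  rw [Fin.sum_univ_succAbove _ i]
  exact le_add_of_nonneg_left (norm_nonneg _)

/-- The part of `D^* · D^*` that does not create hard pairs. -/
def softKernel (ε : R3 → Fin 2 → R3) (Λ : ℝ) (u : Point n → ℂ) (y : Mode × Mode × Point n) : ℂ :=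
  (pairAmp ε Λ y.1 y.2.1 : ℂ) * (1 - domInd y.1 y.2.1 y.2.2.2) *
    (conj (phase y.2.2.1 y.1) * (conj (phase y.2.2.1 y.2.1) * u y.2.2))

theorem measurable_softKernel {ε : R3 → Fin 2 → R3} (hε : IsPolarization ε) (Λ : ℝ)
    {u : Point n → ℂ} (hu : Measurable u) : Measurable (softKernel ε Λ u) := by
  unfold softKernel
  have h1 : Measurable fun y : Mode × Mode × Point n => pairAmp ε Λ y.1 y.2.1 :=
    measurable_pairAmp_comp hε Λ measurable_fst measurable_snd.fst
  have h2 : Measurable fun y : Mode × Mode × Point n => phase y.2.2.1 y.1 :=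
    measurable_phase_comp measurable_snd.snd.fst measurable_fst
  have h3 : Measurable fun y : Mode × Mode × Point n => phase y.2.2.1 y.2.1 :=
    measurable_phase_comp measurable_snd.snd.fst measurable_snd.fst
  have hc : Measurable (fun c : ℂ => conj c) := Complex.continuous_conj.measurable
  exact (h1.complex_ofReal.mul (measurable_const.sub measurable_domInd)).mul
    ((hc.comp h2).mul ((hc.comp h3).mul (hu.comp measurable_snd.snd)))

theorem norm_softKernel_le {ε : R3 → Fin 2 → R3} (hε : IsPolarization ε) (Λ : ℝ)
    (u : Point n → ℂ) (y : Mode × Mode × Point n) :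
    ‖softKernel ε Λ u y‖ ≤ amp Λ y.1 * amp Λ y.2.1 *
      max (softInd (fieldEnergy y.2.2.2) y.1) (softInd (fieldEnergy y.2.2.2) y.2.1)
      * ‖u y.2.2‖ := by
  simp only [softKernel, norm_mul, RCLike.norm_conj, norm_phase, one_mul, Complex.norm_real,
    Real.norm_eq_abs]
  gcongr
  · exact mul_nonneg (amp_nonneg _ _) (amp_nonneg _ _)
  · exact abs_pairAmp_le hε Λ _ _
  · exact one_sub_domInd_le _ _ _

theorem softInd_le_one (h : ℝ) (q : Mode) : softInd h q ≤ 1 := by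
  unfold softInd; split_ifs <;> simp

theorem memLp_softKernel {ε : R3 → Fin 2 → R3} (hε : IsPolarization ε) (Λ : ℝ)
    {u : Point n → ℂ} (hu : IsWave u) : MemLp (softKernel ε Λ u) 2 (pairMeasure n) := by
  rw [memLp_two_iff (measurable_softKernel hε Λ hu.measurable)]
  refine (lintegral_sq_le_of_norm_le (measurable_amp_mul_amp Λ) (integrable_amp_mul_amp_sq Λ)
    hu.measurable fun y => (norm_softKernel_le hε Λ u y).trans ?_).trans_lt
    (ENNReal.mul_lt_top (by simp) ((memLp_two_iff hu.measurable).1 hu.memLp))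
  refine mul_le_mul_of_nonneg_right (mul_le_of_le_one_right
    (mul_nonneg (amp_nonneg _ _) (amp_nonneg _ _)) ?_) (norm_nonneg _)
  exact max_le (softInd_le_one _ _) (softInd_le_one _ _)

theorem sum_inner_creation_annihilation_sub {ε : R3 → Fin 2 → R3} (hε : IsPolarization ε)
    {Λ : ℝ} {ψ : Sector n} {ψ' : Sector (n + 2)} {u : Point n → ℂ}
    {v : Point (n + 2) → ℂ} (hu : Represents ψ u) (hv : Represents ψ' v) :
    ∑ j, inner ℂ (creation hε Λ j n ψ) (annihilation hε Λ j (n + 1) ψ')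
      - inner ℂ (pairOp (isPairKernel_pairAmp hε Λ) ψ) ψ'
      = ∫ z, conj (symPair (softKernel ε Λ u) z) * v z ∂(sectorMeasure (n + 2)) := by
  have hr : Represents (∑ j, creation hε Λ j (n + 1) (creation hε Λ j n ψ)
      - pairOp (isPairKernel_pairAmp hε Λ) ψ) fun z =>
      ((creationFn ε Λ 0 (creationFn ε Λ 0 u) z + creationFn ε Λ 1 (creationFn ε Λ 1 u) z)
        + creationFn ε Λ 2 (creationFn ε Λ 2 u) z)
        - pairFn (fun y => pairAmp ε Λ y.1 y.2.1) u z := by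
    simp only [Fin.sum_univ_three]
    have hc := fun j => (hu.creation hε Λ j).creation hε Λ j
    exact (((hc 0).add (hc 1)).add (hc 2)).sub (hu.pairOp _)
  have e2 : ∑ j, inner ℂ (creation hε Λ j n ψ) (annihilation hε Λ j (n + 1) ψ')
      - inner ℂ (pairOp (isPairKernel_pairAmp hε Λ) ψ) ψ'
      = inner ℂ (∑ j, creation hε Λ j (n + 1) (creation hε Λ j n ψ)
        - pairOp (isPairKernel_pairAmp hε Λ) ψ) ψ' := by
    rw [inner_sub_left, sum_inner Finset.univ
      (fun j => creation hε Λ j (n + 1) (creation hε Λ j n ψ)) ψ']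
    simp only [inner_creation_left]
  rw [e2, hr.inner_eq hv]
  refine integral_congr_ae (.of_forall fun z => ?_)
  simp only
  rw [← Fin.sum_univ_three fun j => creationFn ε Λ j (creationFn ε Λ j u) z,
    sum_creationFn_creationFn]
  simp only [pairFn, symPair, ← mul_sub, ← Finset.sum_sub_distrib]
  congr 3
  refine Finset.sum_congr rfl fun p _ => ?_
  simp only [softKernel, pairKernel]; ring

/-- The one-photon weight `|q| |q'| / H_f` on two photons. -/
def pairWeight (y : Mode × Mode × Point n) : ℝ :=
  ‖y.1.1‖ * ‖y.2.1.1‖ / (‖y.1.1‖ + ‖y.2.1.1‖ + fieldEnergy y.2.2.2)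

/-- Cauchy–Schwarz with the weight |q||q'|/H_f: on the side of v it will sum to H_f, and its inverse
on the side of u integrates, over soft pairs, to at most 4Λ² times the energy of the old photons. -/
theorem lintegral_softKernel_mul_sq_le {ε : R3 → Fin 2 → R3} (hε : IsPolarization ε) {Λ : ℝ}
    (hΛ : 0 < Λ) {u : Point n → ℂ} {v : Point (n + 2) → ℂ} (hu : Measurable u)
    (hv : Measurable v) :
    (∫⁻ y, ‖softKernel ε Λ u y‖ₑ * ‖v (adjoinPair y)‖ₑ ∂(pairMeasure n)) ^ 2
      ≤ (ENNReal.ofReal (4 * Λ ^ 2)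
        * ∫⁻ z, ENNReal.ofReal (fieldEnergy z.2) * ‖u z‖ₑ ^ 2 ∂(sectorMeasure n)) *
        ∫⁻ y, ENNReal.ofReal (pairWeight y) * ‖v (adjoinPair y)‖ₑ ^ 2 ∂(pairMeasure n) := by
  have hH : Measurable fun y : Mode × Mode × Point n => fieldEnergy y.2.2.2 :=
    measurable_fieldEnergy.comp measurable_snd.snd.snd
  have hwm : Measurable fun y : Mode × Mode × Point n => Real.sqrt (pairWeight y) := by
    unfold pairWeight
    fun_prop
  have hmax : Measurable fun y : Mode × Mode × Point n =>
      max (softInd (fieldEnergy y.2.2.2) y.1) (softInd (fieldEnergy y.2.2.2) y.2.1) := by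
    unfold softInd
    exact (Measurable.ite (measurableSet_le (by fun_prop) hH) measurable_const
      measurable_const).max (Measurable.ite (measurableSet_le (by fun_prop) hH) measurable_const
      measurable_const)
  have hd1 : Measurable fun y : Mode × Mode × Point n => ampDiv Λ y.1 :=
    (measurable_ampDiv Λ).comp measurable_fst
  have hd2 : Measurable fun y : Mode × Mode × Point n => ampDiv Λ y.2.1 :=
    (measurable_ampDiv Λ).comp measurable_snd.fst
  -- The square of the bound on the soft kernel, apart from |u|², divided by `pairWeight`.
  set a : Mode × Mode × Point n → ℝ := fun y => ampDiv Λ y.1 ^ 2 * ampDiv Λ y.2.1 ^ 2 *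
      (‖y.1.1‖ + ‖y.2.1.1‖ + fieldEnergy y.2.2.2) *
      max (softInd (fieldEnergy y.2.2.2) y.1) (softInd (fieldEnergy y.2.2.2) y.2.1) with ha
  have ham : Measurable a := by
    have h1 : Measurable fun y : Mode × Mode × Point n =>
      ‖y.1.1‖ + ‖y.2.1.1‖ + fieldEnergy y.2.2.2 := by fun_prop
    exact (((hd1.pow_const 2).mul (hd2.pow_const 2)).mul h1).mul hmax
  have hmax0 : ∀ y : Mode × Mode × Point n, 0 ≤
      max (softInd (fieldEnergy y.2.2.2) y.1) (softInd (fieldEnergy y.2.2.2) y.2.1) :=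
    fun y => le_max_of_le_left (softInd_nonneg _ _)
  have hs0 : ∀ y : Mode × Mode × Point n, 0 ≤ ‖y.1.1‖ + ‖y.2.1.1‖ + fieldEnergy y.2.2.2 :=
    fun y => add_nonneg (by positivity) (fieldEnergy_nonneg _)
  have ha0 : ∀ y, 0 ≤ a y := fun y =>
    mul_nonneg (mul_nonneg (by positivity) (hs0 y)) (hmax0 y)
  have hw0 : ∀ y : Mode × Mode × Point n, 0 ≤ pairWeight y := fun y =>
    div_nonneg (by positivity) (hs0 y)
  have hle : ∀ y, ‖softKernel ε Λ u y‖ₑ * ‖v (adjoinPair y)‖ₑ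
      ≤ (ENNReal.ofReal (Real.sqrt (a y)) * ‖u y.2.2‖ₑ) *
        (ENNReal.ofReal (Real.sqrt (pairWeight y)) * ‖v (adjoinPair y)‖ₑ) := by
    intro y
    rw [← mul_assoc]
    refine mul_le_mul_left ?_ _
    rw [mul_right_comm, ← ENNReal.ofReal_mul (Real.sqrt_nonneg _), ← Real.sqrt_mul (ha0 y),
      ← ofReal_norm, ← ofReal_norm, ← ENNReal.ofReal_mul (Real.sqrt_nonneg _)]
    refine ENNReal.ofReal_le_ofReal ((norm_softKernel_le hε Λ u y).trans ?_)
    refine mul_le_mul_of_nonneg_right (Real.le_sqrt_of_sq_le ?_) (norm_nonneg _)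
    have hmsq : max (softInd (fieldEnergy y.2.2.2) y.1) (softInd (fieldEnergy y.2.2.2) y.2.1) ^ 2
        = max (softInd (fieldEnergy y.2.2.2) y.1) (softInd (fieldEnergy y.2.2.2) y.2.1) := by
      unfold softInd
      split_ifs <;> simp
    rw [mul_pow, mul_pow, hmsq, ← ampDiv_sq_mul_norm Λ y.1, ← ampDiv_sq_mul_norm Λ y.2.1]
    simp only [ha, pairWeight]
    rcases (hs0 y).eq_or_lt with h0 | h0
    · have h1 : ‖y.1.1‖ = 0 := by
        have := norm_nonneg y.1.1
        have := norm_nonneg y.2.1.1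
        have := fieldEnergy_nonneg y.2.2.2
        linarith
      rw [h1]; simp
    · refine le_of_eq ?_
      field_simp
  refine (pow_le_pow_left₀ (by simp) (lintegral_mono hle) 2).trans ?_
  refine (lintegral_mul_sq_le ?_ ?_).trans ?_
  · exact (ham.sqrt.ennreal_ofReal.mul (hu.comp measurable_snd.snd).enorm).aemeasurable
  · exact (hwm.ennreal_ofReal.mul
      (hv.comp measurePreserving_adjoinPair.measurable).enorm).aemeasurable
  simp only [mul_pow, ← ENNReal.ofReal_pow (Real.sqrt_nonneg _), Real.sq_sqrt (ha0 _),
    Real.sq_sqrt (hw0 _)]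
  refine mul_le_mul_left ?_ _
  rw [lintegral_pairMeasure (F := fun y => ENNReal.ofReal (a y) * ‖u y.2.2‖ₑ ^ 2)
    (ham.ennreal_ofReal.mul ((hu.comp measurable_snd.snd).enorm.pow_const 2)),
    ← lintegral_const_mul' _ _ ENNReal.ofReal_ne_top]
  refine lintegral_mono fun z => ?_
  have hza : Measurable fun p : Mode × Mode => a (p.1, p.2, z) :=
    ham.comp (measurable_fst.prodMk (measurable_snd.prodMk measurable_const))
  simp only
  rw [lintegral_mul_const _ hza.ennreal_ofReal, ← mul_assoc,
    ← ENNReal.ofReal_mul (by positivity)]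
  exact mul_le_mul_left (lintegral_soft_pair_le hΛ (fieldEnergy_nonneg z.2)) _

/-- `D^* · D^*` is given, up to a form bounded error, by the creation of hard pairs. -/
theorem norm_sum_inner_creation_annihilation_sub_le {ε : R3 → Fin 2 → R3} (hε : IsPolarization ε)
    {Λ : ℝ} (hΛ : 0 < Λ) {ψ f : Sector n} (hf : SqrtEnergy ψ f) {ψ' f' : Sector (n + 2)}
    (hf' : SqrtEnergy ψ' f') :
    ‖∑ j, inner ℂ (creation hε Λ j n ψ) (annihilation hε Λ j (n + 1) ψ')
      - inner ℂ (pairOp (isPairKernel_pairAmp hε Λ) ψ) ψ'‖ ≤ 2 * Λ * (‖f‖ * ‖f'‖) := by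
  obtain ⟨u, hu⟩ := exists_represents ψ
  obtain ⟨v, hv⟩ := exists_represents ψ'
  rw [sum_inner_creation_annihilation_sub hε hu hv,
    integral_conj_symPair_mul (memLp_softKernel hε Λ hu.wave) hv.wave]
  refine abs_le_of_sq_le_sq' ?_ (by positivity) |>.2
  rw [← ENNReal.ofReal_le_ofReal_iff (by positivity), ENNReal.ofReal_pow (norm_nonneg _),
    ofReal_norm, enorm_mul, mul_pow]
  have h1 := enorm_integral_le_lintegral_enorm (μ := pairMeasure n) fun y =>
    conj (softKernel ε Λ u y) * v (adjoinPair y)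
  have h2 : ∀ y, ‖conj (softKernel ε Λ u y) * v (adjoinPair y)‖ₑ
      = ‖softKernel ε Λ u y‖ₑ * ‖v (adjoinPair y)‖ₑ := by
    intro y
    rw [enorm_mul]
    congr 1
    rw [← ofReal_norm, RCLike.norm_conj, ofReal_norm]
  simp only [h2] at h1
  have h3 := (pow_le_pow_left₀ (by simp) h1 2).trans
    (lintegral_softKernel_mul_sq_le hε hΛ hu.wave.measurable hv.wave.measurable)
  rw [hf.lintegral_eq hu] at h3
  have h4 := lintegral_pairWeight_le hv.wave.measurable hv.wave.symm
  rw [hf'.lintegral_eq hv] at h4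
  -- The factor (n+1)(n+2) is exactly the one absorbed by `lintegral_pairWeight_le`.
  have h5 : ‖(Real.sqrt (n + 1) : ℂ) * (Real.sqrt (n + 2) : ℂ)‖ₑ ^ 2
      = ((n + 1 : ℕ) * (n + 2 : ℕ) : ENNReal) := by
    rw [enorm_mul, mul_pow, enorm_sqrt_sq _ (by positivity), enorm_sqrt_sq _ (by positivity),
      ← ENNReal.ofReal_natCast, ← ENNReal.ofReal_natCast]
    push_cast; rfl
  rw [h5]
  refine (mul_le_mul_right h3 _).trans ?_
  rw [mul_left_comm]
  refine (mul_le_mul_right h4 _).trans (le_of_eq ?_)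
  rw [← ENNReal.ofReal_mul (by positivity), ← ENNReal.ofReal_mul (by positivity)]
  congr 1
  ring

end

/-! ### Annihilation of one photon between two hard pair states. -/

section

variable {n : ℕ}

/-- A symmetric bound `b` such that `∫ b(q, q') amp(q') dq' ≤ M amp(q)`. -/
structure HasRowBound (Λ : ℝ) (b : Mode × Mode → ℝ) (M : ℝ) : Prop where
  symm : ∀ q q', b (q, q') = b (q', q)
  lintegral_le : ∀ q, ∫⁻ q', ENNReal.ofReal (b (q, q')) * ENNReal.ofReal (amp Λ q') ∂modeMeasure
    ≤ ENNReal.ofReal M * ENNReal.ofReal (amp Λ q)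

/-- Labels: 0 is q₀, 1 and 2 are q₁ and q₂, and m + 3 are the photons of z. A pair containing a
photon of z leaves out q₁ or q₂, which is harder than that photon. -/
theorem not_dominates_of_mem {q₁ q₂ : Mode} {z : Point n} (h : Dominates q₁ q₂ z.2) (q₀ : Mode)
    {p : Fin (n + 3) × Fin (n + 2)}
    (hp : (∃ m : Fin n, p.1 = m.succ.succ.succ) ∨
      ∃ m : Fin n, p.1.succAbove p.2 = m.succ.succ.succ) :
    ¬ Dominates (extractPair p (adjoin (q₀, adjoinPair (q₁, q₂, z)))).1
      (extractPair p (adjoin (q₀, adjoinPair (q₁, q₂, z)))).2.1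
      (extractPair p (adjoin (q₀, adjoinPair (q₁, q₂, z)))).2.2.2 := by
  intro hd
  have k1 : (adjoin (q₀, adjoinPair (q₁, q₂, z))).2 (Fin.succ 0) = q₁ := by
    simp [adjoin, adjoinPair]
  have k2 : (adjoin (q₀, adjoinPair (q₁, q₂, z))).2 (Fin.succ (Fin.succ 0)) = q₂ := by
    simp only [adjoin, adjoinPair, Fin.cons_succ, Fin.cons_zero]
  have k3 : ∀ m : Fin n, (adjoin (q₀, adjoinPair (q₁, q₂, z))).2 m.succ.succ.succ = z.2 m := by
    intro m
    simp only [adjoin, adjoinPair, Fin.cons_succ]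
  have hne : (Fin.succ 0 : Fin (n + 3)) ≠ Fin.succ (Fin.succ 0) :=
    fun e => (Fin.succ_ne_zero 0).symm (Fin.succ_injective _ e)
  have hm1 : ∀ m : Fin n, (Fin.succ 0 : Fin (n + 3)) ≠ m.succ.succ.succ :=
    fun m e => (Fin.succ_ne_zero _).symm (Fin.succ_injective _ e)
  have hm2 : ∀ m : Fin n, (Fin.succ (Fin.succ 0) : Fin (n + 3)) ≠ m.succ.succ.succ :=
    fun m e => (Fin.succ_ne_zero _).symm (Fin.succ_injective _ (Fin.succ_injective _ e))
  rcases hp with ⟨m, hm⟩ | ⟨m, hm⟩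
  · have hmd := h m
    by_cases h1 : (Fin.succ 0 : Fin (n + 3)) = p.1.succAbove p.2
    · have := (hd.lt (m := Fin.succ (Fin.succ 0)) (by rw [hm]; exact hm2 m)
        (by rw [← h1]; exact hne.symm)).1
      rw [hm, k2, k3] at this
      exact lt_asymm this hmd.2
    · have := (hd.lt (m := Fin.succ 0) (by rw [hm]; exact hm1 m) h1).1
      rw [hm, k1, k3] at this
      exact lt_asymm this hmd.1
  · have hmd := h m
    by_cases h1 : (Fin.succ 0 : Fin (n + 3)) = p.1
    · have := (hd.lt (m := Fin.succ (Fin.succ 0)) (by rw [← h1]; exact hne.symm)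
        (by rw [hm]; exact hm2 m)).2
      rw [hm, k2, k3] at this
      exact lt_asymm this hmd.2
    · have := (hd.lt (m := Fin.succ 0) h1 (by rw [hm]; exact hm1 m)).2
      rw [hm, k1, k3] at this
      exact lt_asymm this hmd.1

/-- Because q₁ and q₂ already dominate z, only the six ordered pairs among q₀, q₁, q₂ survive, two
orders for each of the three terms. This keeps the bound independent of n. -/
theorem sum_pairKernel_adjoin_le {κ : Mode × Mode × ℝ → ℝ} {b : Mode × Mode → ℝ}
    (hκ : IsPairKernel κ b) (hs : ∀ q q', b (q, q') = b (q', q)) (u : Point (n + 1) → ℂ)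
    {q₁ q₂ : Mode} {z : Point n} (h : Dominates q₁ q₂ z.2) (q₀ : Mode) :
    ∑ p, ‖pairKernel κ u (extractPair p (adjoin (q₀, adjoinPair (q₁, q₂, z))))‖
      ≤ 2 * (b (q₀, q₁) * ‖u (adjoin (q₂, z))‖ + b (q₀, q₂) * ‖u (adjoin (q₁, z))‖
        + b (q₁, q₂) * ‖u (adjoin (q₀, z))‖) := by
  have hz : ∀ p : Fin (n + 3) × Fin (n + 2), ((∃ m : Fin n, p.1 = m.succ.succ.succ) ∨
      ∃ m : Fin n, p.1.succAbove p.2 = m.succ.succ.succ) →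
      ‖pairKernel κ u (extractPair p (adjoin (q₀, adjoinPair (q₁, q₂, z))))‖ = 0 := by
    intro p hp
    simp [pairKernel, domInd, not_dominates_of_mem h q₀ hp]
  have e1 : ∀ (l : Fin n), (0 : Fin (n + 3)).succAbove l.succ.succ = l.succ.succ.succ := fun l => by
    simp
  have e2 : ∀ (l : Fin n), (Fin.succ 0 : Fin (n + 3)).succAbove l.succ.succ = l.succ.succ.succ :=
    fun l => by rw [Fin.succ_succAbove_succ]; simp
  have e3 : ∀ (l : Fin n), (Fin.succ (Fin.succ 0) : Fin (n + 3)).succAbove l.succ.succ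
      = l.succ.succ.succ := fun l => by
    rw [Fin.succ_succAbove_succ, Fin.succ_succAbove_succ]; simp
  have s3 : ∀ f : Fin (n + 3) → ℝ, ∑ i, f i = f 0 + (f (Fin.succ 0) + (f (Fin.succ (Fin.succ 0))
      + ∑ i : Fin n, f i.succ.succ.succ)) := fun f => by
    rw [Fin.sum_univ_succ, Fin.sum_univ_succ, Fin.sum_univ_succ]
  have s2 : ∀ f : Fin (n + 2) → ℝ, ∑ i, f i = f 0 + (f (Fin.succ 0)
      + ∑ i : Fin n, f i.succ.succ) := fun f => by
    rw [Fin.sum_univ_succ, Fin.sum_univ_succ]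
  rw [Fintype.sum_prod_type, s3]
  rw [Finset.sum_eq_zero fun i _ => Finset.sum_eq_zero fun l _ => hz (i.succ.succ.succ, l)
    (.inl ⟨i, rfl⟩)]
  simp only [s2]
  rw [Finset.sum_eq_zero fun l _ => hz (0, l.succ.succ) (.inr ⟨l, e1 l⟩),
    Finset.sum_eq_zero fun l _ => hz (Fin.succ 0, l.succ.succ) (.inr ⟨l, e2 l⟩),
    Finset.sum_eq_zero fun l _ => hz (Fin.succ (Fin.succ 0), l.succ.succ) (.inr ⟨l, e3 l⟩)]
  have hb := fun p => norm_pairKernel_le hκ u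
    (extractPair p (adjoin (q₀, adjoinPair (q₁, q₂, z))))
  have t0 : (adjoin (q₀, adjoin (q₁, adjoin (q₂, z)))).2 0 = q₀ := rfl
  have t1 : (adjoin (q₀, adjoin (q₁, adjoin (q₂, z)))).2 (Fin.succ 0) = q₁ := rfl
  have t2 : (adjoin (q₀, adjoin (q₁, adjoin (q₂, z)))).2 (Fin.succ (Fin.succ 0)) = q₂ := rfl
  have b1 := hb (0, 0)
  have b2 := hb (0, Fin.succ 0)
  have b3 := hb (Fin.succ 0, 0)
  have b4 := hb (Fin.succ 0, Fin.succ 0)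
  have b5 := hb (Fin.succ (Fin.succ 0), 0)
  have b6 := hb (Fin.succ (Fin.succ 0), Fin.succ 0)
  simp only [extractPair, t0, t1, t2, adjoinPair, adjoin_eq_comp, extract_succ_adjoin]
    at b1 b2 b3 b4 b5 b6
  simp only [extractPair, t0, t1, t2, adjoinPair, adjoin_eq_comp, extract_succ_adjoin]
  rw [hs q₁ q₀] at b3
  rw [hs q₂ q₀] at b5
  rw [hs q₂ q₁] at b6
  linarith

theorem enorm_pairFn_adjoin_le {κ : Mode × Mode × ℝ → ℝ} {b : Mode × Mode → ℝ}
    (hκ : IsPairKernel κ b) (hs : ∀ q q', b (q, q') = b (q', q)) (u : Point (n + 1) → ℂ)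
    {q₁ q₂ : Mode} {z : Point n} (h : Dominates q₁ q₂ z.2) (q₀ : Mode) :
    ‖pairFn κ u (adjoin (q₀, adjoinPair (q₁, q₂, z)))‖ₑ
      ≤ ‖((Real.sqrt (n + 2) : ℂ) * (Real.sqrt (n + 3) : ℂ))⁻¹‖ₑ * (2 *
        (ENNReal.ofReal (b (q₀, q₁)) * ‖u (adjoin (q₂, z))‖ₑ
        + ENNReal.ofReal (b (q₀, q₂)) * ‖u (adjoin (q₁, z))‖ₑ
        + ENNReal.ofReal (b (q₁, q₂)) * ‖u (adjoin (q₀, z))‖ₑ)) := by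
  have hb0 : ∀ q q', 0 ≤ b (q, q') := fun q q' =>
    (abs_nonneg _).trans (hκ.abs_le q q' 0 le_rfl)
  have h1 := (norm_sum_le Finset.univ fun p =>
    pairKernel κ u (extractPair p (adjoin (q₀, adjoinPair (q₁, q₂, z))))).trans
    (sum_pairKernel_adjoin_le hκ hs u h q₀)
  have h2 := ENNReal.ofReal_le_ofReal h1
  rw [ofReal_norm, ENNReal.ofReal_mul (by norm_num),
    ENNReal.ofReal_add (by have := hb0 q₀ q₁; have := hb0 q₀ q₂; positivity)
      (by have := hb0 q₁ q₂; positivity),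
    ENNReal.ofReal_add (by have := hb0 q₀ q₁; positivity) (by have := hb0 q₀ q₂; positivity),
    ENNReal.ofReal_mul (hb0 _ _), ENNReal.ofReal_mul (hb0 _ _), ENNReal.ofReal_mul (hb0 _ _),
    ofReal_norm, ofReal_norm, ofReal_norm, ENNReal.ofReal_ofNat] at h2
  have e : ((Real.sqrt ((n + 1 : ℕ) + 1) : ℂ) * (Real.sqrt ((n + 1 : ℕ) + 2) : ℂ))
      = (Real.sqrt (n + 2) : ℂ) * (Real.sqrt (n + 3) : ℂ) := by
    push_cast; norm_num [add_assoc]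
  rw [pairFn, symPair, enorm_mul, e]
  exact mul_le_mul_right h2 _

/-- One photon of the pair created by `φ`, or a further photon, is annihilated. -/
theorem lintegral_pairKernel_mul_annihFn_le {ε : R3 → Fin 2 → R3} (hε : IsPolarization ε) {Λ : ℝ}
    (j : Fin 3) {κ φ : Mode × Mode × ℝ → ℝ} {b b' : Mode × Mode → ℝ}
    (hκ : IsPairKernel κ b) (hφ : IsPairKernel φ b') {M M' : ℝ} (hM : HasRowBound Λ b M)
    (hM' : HasRowBound Λ b' M') {w : Point n → ℂ} (hw : Measurable w)
    {u : Point (n + 1) → ℂ} (hu : Measurable u) :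
    ‖(Real.sqrt (n + 1) : ℂ) * (Real.sqrt (n + 2) : ℂ)‖ₑ *
      ∫⁻ y, ‖pairKernel κ w y‖ₑ * ‖annihFn ε Λ j (pairFn φ u) (adjoinPair y)‖ₑ ∂(pairMeasure n)
    ≤ 2 * (∫⁻ p, ENNReal.ofReal (b p) * ENNReal.ofReal (b' p) ∂(modeMeasure.prod modeMeasure)
        + 2 * ENNReal.ofReal M * ENNReal.ofReal M') *
      (‖(Real.sqrt (n + 1) : ℂ)‖ₑ * ∫⁻ z, ‖w z‖ₑ *
        ∫⁻ q, ENNReal.ofReal (amp Λ q) * ‖u (adjoin (q, z))‖ₑ ∂modeMeasure ∂(sectorMeasure n)) := by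
  set a : Mode → ENNReal := fun q => ENNReal.ofReal (amp Λ q) with ha
  set B : Mode × Mode → ENNReal := fun p => ENNReal.ofReal (b p) with hB
  set B' : Mode × Mode → ENNReal := fun p => ENNReal.ofReal (b' p) with hB'
  set V : Point n → ENNReal := fun z => ∫⁻ q, a q * ‖u (adjoin (q, z))‖ₑ ∂modeMeasure with hV
  have ham : Measurable a := (measurable_amp Λ).ennreal_ofReal
  have hBm : Measurable B := hκ.measurable_bound.ennreal_ofReal
  have hBm' : Measurable B' := hφ.measurable_bound.ennreal_ofReal
  have hum : Measurable fun y : Mode × Point n => ‖u (adjoin y)‖ₑ := (hu.comp measurable_adjoin).enorm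
  have huz : ∀ z : Point n, Measurable fun q : Mode => ‖u (adjoin (q, z))‖ₑ := fun z =>
    hum.comp (measurable_id.prodMk measurable_const)
  have hVm : Measurable V := by
    have : Measurable fun y : Mode × Point n => a y.1 * ‖u (adjoin y)‖ₑ :=
      (ham.comp measurable_fst).mul hum
    exact this.lintegral_prod_left'
  -- In the first two terms the annihilated photon belongs to the pair created by φ and is
  -- integrated out with the row bound; in the third it comes from u, and the φ-pair is the pair
  -- (q₁, q₂) itself.
  set S : Mode × Mode × Point n → ENNReal := fun y =>
    ENNReal.ofReal M' * (a y.2.1 * ‖u (adjoin (y.1, y.2.2))‖ₑ)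
      + ENNReal.ofReal M' * (a y.1 * ‖u (adjoin (y.2.1, y.2.2))‖ₑ) + B' (y.1, y.2.1) * V y.2.2 with hS
  have hc : ‖(Real.sqrt (n + 3) : ℂ)‖ₑ * (‖((Real.sqrt (n + 2) : ℂ) *
      (Real.sqrt (n + 3) : ℂ))⁻¹‖ₑ * 2) = 2 * ‖(Real.sqrt (n + 2) : ℂ)⁻¹‖ₑ := by
    have h3 : (Real.sqrt (n + 3) : ℂ) ≠ 0 := by rw [Complex.ofReal_ne_zero]; positivity
    rw [← mul_assoc, ← enorm_mul, mul_inv, mul_left_comm, mul_inv_cancel₀ h3, mul_one, mul_comm]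
  have hann : ∀ (q₁ q₂ : Mode) (z : Point n), Dominates q₁ q₂ z.2 →
      ‖annihFn ε Λ j (pairFn φ u) (adjoinPair (q₁, q₂, z))‖ₑ
        ≤ 2 * ‖(Real.sqrt (n + 2) : ℂ)⁻¹‖ₑ * S (q₁, q₂, z) := by
    intro q₁ q₂ z hd
    refine (enorm_annihFn_le hε j _ _).trans ?_
    have hm1 : ∀ q : Mode, Measurable fun q₀ : Mode => a q₀ * B' (q₀, q) := fun q =>
      ham.mul (hBm'.comp (measurable_id.prodMk measurable_const))
    have hmV : Measurable fun q₀ : Mode => a q₀ * ‖u (adjoin (q₀, z))‖ₑ := ham.mul (huz z)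
    have hrow : ∀ q, ∫⁻ q₀, a q₀ * B' (q₀, q) ∂modeMeasure ≤ ENNReal.ofReal M' * a q := by
      intro q
      refine le_trans (le_of_eq ?_) (hM'.lintegral_le q)
      refine lintegral_congr fun q₀ => ?_
      simp only [hB', ha]
      rw [hM'.symm q₀ q, mul_comm]
    have e : ((n + 2 : ℕ) : ℝ) + 1 = (n : ℝ) + 3 := by push_cast; ring
    rw [e]
    calc ‖(Real.sqrt (n + 3) : ℂ)‖ₑ * ∫⁻ q₀, ENNReal.ofReal (amp Λ q₀) *
          ‖pairFn φ u (adjoin (q₀, adjoinPair (q₁, q₂, z)))‖ₑ ∂modeMeasure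
        ≤ ‖(Real.sqrt (n + 3) : ℂ)‖ₑ * ∫⁻ q₀, (‖((Real.sqrt (n + 2) : ℂ) *
          (Real.sqrt (n + 3) : ℂ))⁻¹‖ₑ * 2) * ((a q₀ * B' (q₀, q₁)) * ‖u (adjoin (q₂, z))‖ₑ
            + ((a q₀ * B' (q₀, q₂)) * ‖u (adjoin (q₁, z))‖ₑ
            + (a q₀ * ‖u (adjoin (q₀, z))‖ₑ) * B' (q₁, q₂))) ∂modeMeasure := by
          refine mul_le_mul_right (lintegral_mono fun q₀ => ?_) _
          refine (mul_le_mul_right (enorm_pairFn_adjoin_le hφ hM'.symm u hd q₀) _).trans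
            (le_of_eq ?_)
          simp only [ha, hB']
          ring
      _ = 2 * ‖(Real.sqrt (n + 2) : ℂ)⁻¹‖ₑ *
          ((∫⁻ q₀, a q₀ * B' (q₀, q₁) ∂modeMeasure) * ‖u (adjoin (q₂, z))‖ₑ
            + ((∫⁻ q₀, a q₀ * B' (q₀, q₂) ∂modeMeasure) * ‖u (adjoin (q₁, z))‖ₑ
            + V z * B' (q₁, q₂))) := by
          have m3 : Measurable fun q₀ : Mode => (a q₀ * ‖u (adjoin (q₀, z))‖ₑ) * B' (q₁, q₂) :=
            hmV.mul_const _
          have m2 : Measurable fun q₀ : Mode => (a q₀ * B' (q₀, q₂)) * ‖u (adjoin (q₁, z))‖ₑ :=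
            (hm1 q₂).mul_const _
          have m23 : Measurable fun q₀ : Mode => (a q₀ * B' (q₀, q₂)) * ‖u (adjoin (q₁, z))‖ₑ
            + (a q₀ * ‖u (adjoin (q₀, z))‖ₑ) * B' (q₁, q₂) := m2.add m3
          rw [lintegral_const_mul' _ _ (by simp [ENNReal.mul_eq_top]), ← mul_assoc, hc,
            lintegral_add_right _ m23, lintegral_add_left m2, lintegral_mul_const _ (hm1 _),
            lintegral_mul_const _ (hm1 _), lintegral_mul_const _ hmV]
      _ ≤ _ := by
          refine mul_le_mul_right ?_ _
          simp only [hS]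
          calc _ ≤ (ENNReal.ofReal M' * a q₁) * ‖u (adjoin (q₂, z))‖ₑ
                + ((ENNReal.ofReal M' * a q₂) * ‖u (adjoin (q₁, z))‖ₑ + V z * B' (q₁, q₂)) := by
                gcongr
                · exact hrow q₁
                · exact hrow q₂
            _ = _ := by ring
  have hle : ∀ y : Mode × Mode × Point n, ‖pairKernel κ w y‖ₑ *
      ‖annihFn ε Λ j (pairFn φ u) (adjoinPair y)‖ₑ
      ≤ 2 * ‖(Real.sqrt (n + 2) : ℂ)⁻¹‖ₑ * (B (y.1, y.2.1) * ‖w y.2.2‖ₑ * S y) := by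
    intro y
    by_cases hd : Dominates y.1 y.2.1 y.2.2.2
    · have h1 : ‖pairKernel κ w y‖ₑ ≤ B (y.1, y.2.1) * ‖w y.2.2‖ₑ := by
        have h2 := ENNReal.ofReal_le_ofReal (norm_pairKernel_le hκ w y)
        rwa [ENNReal.ofReal_mul ((abs_nonneg _).trans (hκ.abs_le y.1 y.2.1 0 le_rfl)),
          ofReal_norm, ofReal_norm] at h2
      calc _ ≤ (B (y.1, y.2.1) * ‖w y.2.2‖ₑ) * (2 * ‖(Real.sqrt (n + 2) : ℂ)⁻¹‖ₑ * S y) := by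
            gcongr
            exact hann y.1 y.2.1 y.2.2 hd
        _ = _ := by ring
    · have : pairKernel κ w y = 0 := by simp [pairKernel, domInd, hd]
      rw [this]; simp
  have hwz : Measurable fun z => ‖w z‖ₑ := hw.enorm
  have hSm : Measurable S := by
    have h1 : Measurable fun y : Mode × Mode × Point n => ‖u (adjoin (y.1, y.2.2))‖ₑ :=
      hum.comp (measurable_fst.prodMk measurable_snd.snd)
    have h2 : Measurable fun y : Mode × Mode × Point n => ‖u (adjoin (y.2.1, y.2.2))‖ₑ :=
      hum.comp (measurable_snd.fst.prodMk measurable_snd.snd)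
    have h3 : Measurable fun y : Mode × Mode × Point n => B' (y.1, y.2.1) :=
      hBm'.comp (measurable_fst.prodMk measurable_snd.fst)
    exact ((((ham.comp measurable_snd.fst).mul h1).const_mul _).add
      (((ham.comp measurable_fst).mul h2).const_mul _)).add (h3.mul (hVm.comp measurable_snd.snd))
  have hFm : Measurable fun y : Mode × Mode × Point n => B (y.1, y.2.1) * ‖w y.2.2‖ₑ * S y :=
    ((hBm.comp (measurable_fst.prodMk measurable_snd.fst)).mul
      (hwz.comp measurable_snd.snd)).mul hSm
  have hrowB : ∀ q, ∫⁻ q', B (q, q') * a q' ∂modeMeasure ≤ ENNReal.ofReal M * a q := fun q =>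
    hM.lintegral_le q
  -- The first two terms meet the row bound of b and give M M' each; the third gives ∫ b b'. What is
  -- left is annihilation in u.
  have hz : ∀ z : Point n, ∫⁻ p : Mode × Mode, B (p.1, p.2) * ‖w z‖ₑ * S (p.1, p.2, z)
      ∂(modeMeasure.prod modeMeasure)
      ≤ (∫⁻ p, B p * B' p ∂(modeMeasure.prod modeMeasure)
        + 2 * ENNReal.ofReal M * ENNReal.ofReal M') * (‖w z‖ₑ * V z) := by
    intro z
    have m1 : Measurable fun p : Mode × Mode => B p * a p.2 * ‖u (adjoin (p.1, z))‖ₑ :=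
      (hBm.mul (ham.comp measurable_snd)).mul ((huz z).comp measurable_fst)
    have m2 : Measurable fun p : Mode × Mode => B p * a p.1 * ‖u (adjoin (p.2, z))‖ₑ :=
      (hBm.mul (ham.comp measurable_fst)).mul ((huz z).comp measurable_snd)
    have m3 : Measurable fun p : Mode × Mode => B p * B' p := hBm.mul hBm'
    have i1 : ∫⁻ p : Mode × Mode, B p * a p.2 * ‖u (adjoin (p.1, z))‖ₑ
        ∂(modeMeasure.prod modeMeasure) ≤ ENNReal.ofReal M * V z := by
      rw [lintegral_prod _ m1.aemeasurable, hV, ← lintegral_const_mul' _ _ ENNReal.ofReal_ne_top]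
      refine lintegral_mono fun q => ?_
      simp only
      have hmq : Measurable fun q' : Mode => B (q, q') * a q' :=
        (hBm.comp (measurable_const.prodMk measurable_id)).mul ham
      rw [lintegral_mul_const _ hmq, ← mul_assoc]
      exact mul_le_mul_left (hrowB q) _
    have i2 : ∫⁻ p : Mode × Mode, B p * a p.1 * ‖u (adjoin (p.2, z))‖ₑ
        ∂(modeMeasure.prod modeMeasure) ≤ ENNReal.ofReal M * V z := by
      rw [lintegral_prod_symm' _ m2, hV, ← lintegral_const_mul' _ _ ENNReal.ofReal_ne_top]
      refine lintegral_mono fun q => ?_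
      simp only
      have hmq : Measurable fun q' : Mode => B (q', q) * a q' :=
        (hBm.comp (measurable_id.prodMk measurable_const)).mul ham
      rw [lintegral_mul_const _ hmq, ← mul_assoc]
      refine mul_le_mul_left (le_trans (le_of_eq ?_) (hrowB q)) _
      refine lintegral_congr fun q' => ?_
      simp only [hB]
      rw [hM.symm q' q]
    have e : ∀ p : Mode × Mode, B (p.1, p.2) * ‖w z‖ₑ * S (p.1, p.2, z)
        = ‖w z‖ₑ * (ENNReal.ofReal M' * (B p * a p.2 * ‖u (adjoin (p.1, z))‖ₑ)
          + (ENNReal.ofReal M' * (B p * a p.1 * ‖u (adjoin (p.2, z))‖ₑ) + B p * B' p * V z)) := by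
      intro p
      simp only [hS, Prod.mk.eta]
      ring
    simp only [e]
    have k3 : Measurable fun p : Mode × Mode => B p * B' p * V z := m3.mul_const _
    have k2 : Measurable fun p : Mode × Mode =>
      ENNReal.ofReal M' * (B p * a p.1 * ‖u (adjoin (p.2, z))‖ₑ) := m2.const_mul _
    have k23 : Measurable fun p : Mode × Mode =>
      ENNReal.ofReal M' * (B p * a p.1 * ‖u (adjoin (p.2, z))‖ₑ) + B p * B' p * V z := k2.add k3
    rw [lintegral_const_mul' _ _ (by simp), lintegral_add_right _ k23, lintegral_add_left k2,
      lintegral_const_mul' _ _ ENNReal.ofReal_ne_top,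
      lintegral_const_mul' _ _ ENNReal.ofReal_ne_top, lintegral_mul_const _ m3]
    calc _ ≤ ‖w z‖ₑ * (ENNReal.ofReal M' * (ENNReal.ofReal M * V z)
          + (ENNReal.ofReal M' * (ENNReal.ofReal M * V z)
          + (∫⁻ p, B p * B' p ∂(modeMeasure.prod modeMeasure)) * V z)) := by gcongr
      _ = _ := by ring
  -- The normalizations of the pairs cancel, leaving the √(n+1) that belongs to the annihilation in
  -- u.
  have hc2 : ‖(Real.sqrt (n + 1) : ℂ) * (Real.sqrt (n + 2) : ℂ)‖ₑ *
      (2 * ‖(Real.sqrt (n + 2) : ℂ)⁻¹‖ₑ) = 2 * ‖(Real.sqrt (n + 1) : ℂ)‖ₑ := by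
    rw [mul_left_comm, ← enorm_mul, mul_assoc, mul_inv_cancel₀ (sqrt_succ_succ_ne_zero n), mul_one]
  have hWV : Measurable fun z => ‖w z‖ₑ * V z := hwz.mul hVm
  calc _ ≤ ‖(Real.sqrt (n + 1) : ℂ) * (Real.sqrt (n + 2) : ℂ)‖ₑ *
        ∫⁻ y, 2 * ‖(Real.sqrt (n + 2) : ℂ)⁻¹‖ₑ * (B (y.1, y.2.1) * ‖w y.2.2‖ₑ * S y)
          ∂(pairMeasure n) := mul_le_mul_right (lintegral_mono hle) _
    _ = 2 * ‖(Real.sqrt (n + 1) : ℂ)‖ₑ * ∫⁻ z, ∫⁻ p : Mode × Mode,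
          B (p.1, p.2) * ‖w z‖ₑ * S (p.1, p.2, z)
          ∂(modeMeasure.prod modeMeasure) ∂(sectorMeasure n) := by
        rw [lintegral_const_mul _ hFm, ← mul_assoc, hc2, lintegral_pairMeasure hFm]
    _ ≤ 2 * ‖(Real.sqrt (n + 1) : ℂ)‖ₑ * ∫⁻ z,
          (∫⁻ p, B p * B' p ∂(modeMeasure.prod modeMeasure)
          + 2 * ENNReal.ofReal M * ENNReal.ofReal M') * (‖w z‖ₑ * V z) ∂(sectorMeasure n) :=
        mul_le_mul_right (lintegral_mono hz) _
    _ = _ := by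
        rw [lintegral_const_mul _ hWV]
        ring

/-- N N' arises when both sides contain the same pair, 2 M M' when one photon is exchanged between
pair and state. The factor √Λ‖f'‖ is the energy bound for the remaining annihilation, with 2/π ≤ 1.
-/
theorem norm_inner_pairOp_annihilation_le {ε : R3 → Fin 2 → R3} (hε : IsPolarization ε) {Λ : ℝ}
    (hΛ : 0 < Λ) (j : Fin 3) {κ φ : Mode × Mode × ℝ → ℝ} {b b' : Mode × Mode → ℝ}
    (hκ : IsPairKernel κ b) (hφ : IsPairKernel φ b') {M M' N N' : ℝ} (hM : HasRowBound Λ b M)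
    (hM' : HasRowBound Λ b' M') (h0 : 0 ≤ M) (h0' : 0 ≤ M') (hN0 : 0 ≤ N) (hN0' : 0 ≤ N')
    (hN : ∫ p, b p ^ 2 ∂(modeMeasure.prod modeMeasure) ≤ N ^ 2)
    (hN' : ∫ p, b' p ^ 2 ∂(modeMeasure.prod modeMeasure) ≤ N' ^ 2)
    (ψ : Sector n) {ψ' f' : Sector (n + 1)} (hf : SqrtEnergy ψ' f') :
    ‖inner ℂ (pairOp hκ ψ) (annihilation hε Λ j (n + 2) (pairOp hφ ψ'))‖
      ≤ 2 * (N * N' + 2 * M * M') * Real.sqrt Λ * (‖ψ‖ * ‖f'‖) := by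
  obtain ⟨w, hw⟩ := exists_represents ψ
  obtain ⟨u, hu⟩ := exists_represents ψ'
  have hr := (hu.pairOp hφ).annihilation hε hΛ j
  have e1 : inner ℂ (pairOp hκ ψ) (annihilation hε Λ j (n + 2) (pairOp hφ ψ'))
      = (Real.sqrt (n + 1) : ℂ) * (Real.sqrt (n + 2) : ℂ) *
        ∫ y, conj (pairKernel κ w y) * annihFn ε Λ j (pairFn φ u) (adjoinPair y)
          ∂(pairMeasure n) := by
    rw [(hw.pairOp hκ).inner_eq hr]
    exact integral_conj_symPair_mul (memLp_pairKernel hκ hw.wave) hr.wave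
  rw [e1, ← ENNReal.ofReal_le_ofReal_iff (by positivity), ofReal_norm, enorm_mul]
  have h1 := enorm_integral_le_lintegral_enorm (μ := pairMeasure n) fun y =>
    conj (pairKernel κ w y) * annihFn ε Λ j (pairFn φ u) (adjoinPair y)
  have h2 : ∀ y, ‖conj (pairKernel κ w y) * annihFn ε Λ j (pairFn φ u) (adjoinPair y)‖ₑ
      = ‖pairKernel κ w y‖ₑ * ‖annihFn ε Λ j (pairFn φ u) (adjoinPair y)‖ₑ := by
    intro y
    rw [enorm_mul]
    congr 1
    rw [← ofReal_norm, RCLike.norm_conj, ofReal_norm]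
  simp only [h2] at h1
  refine (mul_le_mul_right h1 _).trans ((lintegral_pairKernel_mul_annihFn_le hε j hκ hφ hM hM'
    hw.wave.measurable hu.wave.measurable).trans ?_)
  have hb0 : ∀ p, 0 ≤ b p := fun p => (abs_nonneg _).trans (hκ.abs_le p.1 p.2 0 le_rfl)
  have hb0' : ∀ p, 0 ≤ b' p := fun p => (abs_nonneg _).trans (hφ.abs_le p.1 p.2 0 le_rfl)
  have hBB : ∫⁻ p, ENNReal.ofReal (b p) * ENNReal.ofReal (b' p) ∂(modeMeasure.prod modeMeasure)
      ≤ ENNReal.ofReal (N * N') := by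
    have h3 := lintegral_mul_sq_le (μ := modeMeasure.prod modeMeasure)
      hκ.measurable_bound.ennreal_ofReal.aemeasurable
      hφ.measurable_bound.ennreal_ofReal.aemeasurable
    simp only [← ENNReal.ofReal_pow (hb0 _), ← ENNReal.ofReal_pow (hb0' _)] at h3
    rw [← ofReal_integral_eq_lintegral_ofReal hκ.integrable (.of_forall fun q => sq_nonneg _),
      ← ofReal_integral_eq_lintegral_ofReal hφ.integrable (.of_forall fun q => sq_nonneg _)] at h3
    refine (ENNReal.pow_le_pow_left_iff two_ne_zero).1 (h3.trans ?_)
    rw [ENNReal.ofReal_mul hN0, mul_pow, ← ENNReal.ofReal_pow hN0, ← ENNReal.ofReal_pow hN0']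
    gcongr
  have hVb : ‖(Real.sqrt (n + 1) : ℂ)‖ₑ * ∫⁻ z, ‖w z‖ₑ *
        ∫⁻ q, ENNReal.ofReal (amp Λ q) * ‖u (adjoin (q, z))‖ₑ ∂modeMeasure ∂(sectorMeasure n)
      ≤ ENNReal.ofReal (Real.sqrt Λ * (‖ψ‖ * ‖f'‖)) := by
    have hVm : Measurable fun z : Point n =>
        ∫⁻ q, ENNReal.ofReal (amp Λ q) * ‖u (adjoin (q, z))‖ₑ ∂modeMeasure := by
      have : Measurable fun y : Mode × Point n => ENNReal.ofReal (amp Λ y.1) * ‖u (adjoin y)‖ₑ :=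
        ((measurable_amp Λ).ennreal_ofReal.comp measurable_fst).mul
          (hu.wave.measurable.comp measurable_adjoin).enorm
      exact this.lintegral_prod_left'
    have h3 := lintegral_mul_sq_le (μ := sectorMeasure n) hw.wave.measurable.enorm.aemeasurable
      hVm.aemeasurable
    have h4 := lintegral_sq_lintegral_amp_le hΛ hu.wave.measurable hu.wave.symm
    rw [hf.lintegral_eq hu] at h4
    refine (ENNReal.pow_le_pow_left_iff two_ne_zero).1 ?_
    rw [mul_pow, enorm_sqrt_sq _ (by positivity)]
    have e4 : ENNReal.ofReal ((n : ℝ) + 1) = ((n + 1 : ℕ) : ENNReal) := by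
      rw [← ENNReal.ofReal_natCast]; push_cast; rfl
    rw [e4]
    refine (mul_le_mul_right h3 _).trans ?_
    rw [mul_left_comm, ← hw.norm_sq_eq]
    refine (mul_le_mul_right h4 _).trans ?_
    rw [← ENNReal.ofReal_mul (by positivity), ← ENNReal.ofReal_mul (by positivity),
      ← ENNReal.ofReal_pow (by positivity)]
    refine ENNReal.ofReal_le_ofReal ?_
    rw [mul_pow, Real.sq_sqrt hΛ.le, mul_pow, mul_left_comm]
    refine mul_le_mul_of_nonneg_right ?_ (by positivity)
    rw [div_le_iff₀ Real.pi_pos]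
    nlinarith [Real.pi_gt_three]
  calc _ ≤ 2 * (ENNReal.ofReal (N * N') + 2 * ENNReal.ofReal M * ENNReal.ofReal M') *
        ENNReal.ofReal (Real.sqrt Λ * (‖ψ‖ * ‖f'‖)) := by gcongr
    _ = _ := by
        have e2 : ∀ x : ℝ, 2 * ENNReal.ofReal x = ENNReal.ofReal (2 * x) := fun x => by
          rw [ENNReal.ofReal_mul (by norm_num), ENNReal.ofReal_ofNat]
        rw [e2 M, ← ENNReal.ofReal_mul (by positivity),
          ← ENNReal.ofReal_add (by positivity) (by positivity), e2, ← ENNReal.ofReal_mul (by positivity)]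
        congr 1
        ring

end

/-! ### The pair amplitude φ: pointwise bounds. -/

section

variable {n : ℕ}

theorem IsPairKernel.of_sq_le {κ : Mode × Mode × ℝ → ℝ} {b : Mode × Mode → ℝ}
    (hκ : Measurable κ) (hb : Measurable b)
    (habs : ∀ q q' h, 0 ≤ h → |κ (q, q', h)| ≤ b (q, q')) {D D' : Mode → ℝ}
    (hD : Integrable D modeMeasure) (hD' : Integrable D' modeMeasure)
    (hle : ∀ q q', b (q, q') ^ 2 ≤ D q * D' q') : IsPairKernel κ b where
  measurable := hκ
  measurable_bound := hb
  abs_le := habs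
  integrable := (hD.mul_prod hD').mono' (hb.pow_const 2).aestronglyMeasurable
    (.of_forall fun p => by
      rw [Real.norm_of_nonneg (sq_nonneg _)]
      exact hle p.1 p.2)

theorem integral_sq_le_of_sq_le {b : Mode × Mode → ℝ} {D D' : Mode → ℝ} {c c' : ℝ}
    (hD : Integrable D modeMeasure) (hD' : Integrable D' modeMeasure)
    (hc : ∫ q, D q ∂modeMeasure = c) (hc' : ∫ q, D' q ∂modeMeasure = c')
    (hle : ∀ q q', b (q, q') ^ 2 ≤ D q * D' q') :
    ∫ p, b p ^ 2 ∂(modeMeasure.prod modeMeasure) ≤ c * c' := by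
  rw [← hc, ← hc', ← integral_prod_mul]
  exact integral_mono_of_nonneg (.of_forall fun p => sq_nonneg _) (hD.mul_prod hD')
    (.of_forall fun p => hle p.1 p.2)

/-- `|q| + |q'|`. -/
def pairEnergy (q q' : Mode) : ℝ := ‖q.1‖ + ‖q'.1‖

/-- `|q + q'|² + |q| + |q'|`. -/
def pairDenom (q q' : Mode) : ℝ := ‖q.1 + q'.1‖ ^ 2 + pairEnergy q q'

/-- The wave function of the hard pair, in momentum space. -/
def pairPhi (ε : R3 → Fin 2 → R3) (Λ : ℝ) (q q' : Mode) : ℝ :=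
  pairAmp ε Λ q q' / pairDenom q q'

theorem pairEnergy_nonneg (q q' : Mode) : 0 ≤ pairEnergy q q' := by
  unfold pairEnergy; positivity

theorem pairDenom_nonneg (q q' : Mode) : 0 ≤ pairDenom q q' :=
  add_nonneg (sq_nonneg _) (pairEnergy_nonneg q q')

theorem pairEnergy_comm (q q' : Mode) : pairEnergy q q' = pairEnergy q' q := add_comm _ _

theorem pairDenom_comm (q q' : Mode) : pairDenom q q' = pairDenom q' q := by
  rw [pairDenom, pairDenom, pairEnergy_comm, add_comm q.1]

theorem pairAmp_comm (ε : R3 → Fin 2 → R3) (Λ : ℝ) (q q' : Mode) :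
    pairAmp ε Λ q q' = pairAmp ε Λ q' q :=
  Finset.sum_congr rfl fun _ _ => mul_comm _ _

theorem pairPhi_comm (ε : R3 → Fin 2 → R3) (Λ : ℝ) (q q' : Mode) :
    pairPhi ε Λ q q' = pairPhi ε Λ q' q := by
  rw [pairPhi, pairPhi, pairAmp_comm, pairDenom_comm]

theorem measurable_pairEnergy_comp {X : Type*} [MeasurableSpace X] {f g : X → Mode}
    (hf : Measurable f) (hg : Measurable g) : Measurable fun y => pairEnergy (f y) (g y) :=
  hf.fst.norm.add hg.fst.norm

theorem measurable_pairPhi_comp {ε : R3 → Fin 2 → R3} (hε : IsPolarization ε) (Λ : ℝ)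
    {X : Type*} [MeasurableSpace X] {f g : X → Mode} (hf : Measurable f) (hg : Measurable g) :
    Measurable fun y => pairPhi ε Λ (f y) (g y) := by
  have h2 : Measurable fun y => pairDenom (f y) (g y) :=
    ((hf.fst.add hg.fst).norm.pow_const 2).add (measurable_pairEnergy_comp hf hg)
  exact (measurable_pairAmp_comp hε Λ hf hg).div h2

section Estimates

variable {ε : R3 → Fin 2 → R3} {Λ : ℝ}

theorem abs_pairPhi_mul_denom_le (hε : IsPolarization ε) (q q' : Mode) :
    |pairPhi ε Λ q q'| * pairDenom q q' ≤ amp Λ q * amp Λ q' := by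
  rcases (pairDenom_nonneg q q').eq_or_lt with h | h
  · rw [← h, mul_zero]
    exact mul_nonneg (amp_nonneg _ _) (amp_nonneg _ _)
  · rw [pairPhi, abs_div, abs_of_pos h, div_mul_cancel₀ _ h.ne']
    exact abs_pairAmp_le hε Λ q q'

/-- φ solves the equation of [P_f² + H_f]⁻¹ also where the denominator vanishes: there q = 0, and
the coupling is zero. -/
theorem pairPhi_mul_denom (ε : R3 → Fin 2 → R3) (Λ : ℝ) (q q' : Mode) :
    pairPhi ε Λ q q' * pairDenom q q' = pairAmp ε Λ q q' := by
  by_cases h : pairDenom q q' = 0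
  · have h1 : ‖q.1‖ = 0 := by
      have h2 := sq_nonneg ‖q.1 + q'.1‖
      have h3 := norm_nonneg q.1
      have h4 := norm_nonneg q'.1
      unfold pairDenom pairEnergy at h
      linarith
    have h5 : pairAmp ε Λ q q' = 0 := by
      have h6 : q.1 = 0 := norm_eq_zero.1 h1
      simp [pairAmp, coupling, h6]
    rw [h5, h, mul_zero]
  · rw [pairPhi, div_mul_cancel₀ _ h]

/-- `|φ| ≤ amp amp' / X` for every `X` below the denominator. -/
theorem abs_pairPhi_mul_le (hε : IsPolarization ε) (q q' : Mode) {X : ℝ}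
    (hX : X ≤ pairDenom q q') : |pairPhi ε Λ q q'| * X ≤ amp Λ q * amp Λ q' :=
  (mul_le_mul_of_nonneg_left hX (abs_nonneg _)).trans (abs_pairPhi_mul_denom_le hε q q')

theorem pairEnergy_le_denom (q q' : Mode) : pairEnergy q q' ≤ pairDenom q q' :=
  le_add_of_nonneg_left (sq_nonneg _)

theorem abs_coord_le (q q' : Mode) (j : Fin 3) : |q.1 j + q'.1 j| ≤ ‖q.1 + q'.1‖ :=
  PiLp.norm_apply_le (q.1 + q'.1) j

/-- The inequality 2ab ≤ a² + b² with a = |q + q'| and b² = |q| + |q'|. -/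
theorem coord_mul_sqrt_le_denom (q q' : Mode) (j : Fin 3) :
    |q.1 j + q'.1 j| * Real.sqrt (pairEnergy q q') ≤ pairDenom q q' := by
  have h1 := abs_coord_le q q' j
  have h2 := Real.sqrt_nonneg (pairEnergy q q')
  have h3 := Real.sq_sqrt (pairEnergy_nonneg q q')
  have h4 : |q.1 j + q'.1 j| * Real.sqrt (pairEnergy q q')
      ≤ ‖q.1 + q'.1‖ * Real.sqrt (pairEnergy q q') := by gcongr
  unfold pairDenom
  nlinarith [sq_nonneg (‖q.1 + q'.1‖ - Real.sqrt (pairEnergy q q')), norm_nonneg (q.1 + q'.1)]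

theorem coord_sq_le_denom (q q' : Mode) (j : Fin 3) :
    |q.1 j + q'.1 j| ^ 2 ≤ pairDenom q q' :=
  (pow_le_pow_left₀ (abs_nonneg _) (abs_coord_le q q' j) 2).trans
    (le_add_of_nonneg_right (pairEnergy_nonneg q q'))

theorem sqrt_mul_sqrt_le_energy (q q' : Mode) :
    Real.sqrt ‖q.1‖ * Real.sqrt ‖q'.1‖ ≤ pairEnergy q q' := by
  have h1 := Real.sq_sqrt (norm_nonneg q.1)
  have h2 := Real.sq_sqrt (norm_nonneg q'.1)
  unfold pairEnergy
  nlinarith [sq_nonneg (Real.sqrt ‖q.1‖ - Real.sqrt ‖q'.1‖), Real.sqrt_nonneg ‖q.1‖,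
    Real.sqrt_nonneg ‖q'.1‖]

/-- Division by the square root of a frequency where the amplitude does not vanish. -/
theorem le_ampDiv_mul {x c : ℝ} {q : Mode} (hc : 0 ≤ c) (hx : x * Real.sqrt ‖q.1‖ ≤ amp Λ q * c)
    (h0 : ‖q.1‖ = 0 → x ≤ 0) : x ≤ ampDiv Λ q * c := by
  by_cases h : ‖q.1‖ = 0
  · exact (h0 h).trans (mul_nonneg (ampDiv_nonneg _ _) hc)
  · have h1 : 0 < Real.sqrt ‖q.1‖ := Real.sqrt_pos.2 (lt_of_le_of_ne (norm_nonneg _) (Ne.symm h))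
    rw [← ampDiv_mul_sqrt, mul_right_comm] at hx
    exact le_of_mul_le_mul_right hx h1

theorem pairPhi_eq_zero_left {q q' : Mode} (h : ‖q.1‖ = 0) : pairPhi ε Λ q q' = 0 := by
  have h1 : q.1 = 0 := norm_eq_zero.1 h
  simp [pairPhi, pairAmp, coupling, h1]

theorem pairPhi_eq_zero_right {q q' : Mode} (h : ‖q'.1‖ = 0) : pairPhi ε Λ q q' = 0 := by
  rw [pairPhi_comm, pairPhi_eq_zero_left h]

/-- The denominator is at least |q|^{1/2}|q'|^{1/2}, so one half power is divided out of each
amplitude. The square integral of φ is therefore of order Λ². -/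
theorem abs_pairPhi_le (hε : IsPolarization ε) (q q' : Mode) :
    |pairPhi ε Λ q q'| ≤ ampDiv Λ q * ampDiv Λ q' := by
  refine le_ampDiv_mul (ampDiv_nonneg _ _) ?_ fun h => by rw [pairPhi_eq_zero_left h, abs_zero]
  rw [mul_comm (amp Λ q)]
  refine le_ampDiv_mul (amp_nonneg _ _) ?_ fun h => by
    rw [pairPhi_eq_zero_right h, abs_zero, zero_mul]
  rw [mul_assoc, mul_comm (amp Λ q')]
  exact abs_pairPhi_mul_le hε q q' ((sqrt_mul_sqrt_le_energy q q').trans (pairEnergy_le_denom q q'))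

theorem norm_le_energy_right (q q' : Mode) : ‖q'.1‖ ≤ pairEnergy q q' :=
  le_add_of_nonneg_left (norm_nonneg _)

/-- Multiplication by the square root of the energy leaves only |q'|^{1/2} to be gained from the
denominator; all of it is spent on one photon. -/
theorem abs_pairPhi_mul_sqrt_le (hε : IsPolarization ε) (q q' : Mode) :
    |pairPhi ε Λ q q'| * Real.sqrt (pairEnergy q q') ≤ amp Λ q * ampDiv Λ q' := by
  rw [mul_comm (amp Λ q)]
  refine le_ampDiv_mul (amp_nonneg _ _) ?_ fun h => by
    rw [pairPhi_eq_zero_right h, abs_zero, zero_mul]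
  rw [mul_assoc, mul_comm (amp Λ q')]
  refine abs_pairPhi_mul_le hε q q' (le_trans ?_ (pairEnergy_le_denom q q'))
  calc _ ≤ Real.sqrt (pairEnergy q q') * Real.sqrt (pairEnergy q q') := by
        gcongr
        exact norm_le_energy_right q q'
    _ = _ := Real.mul_self_sqrt (pairEnergy_nonneg q q')

theorem abs_pairPhi_mul_coord_le (hε : IsPolarization ε) (j : Fin 3) (q q' : Mode) :
    |pairPhi ε Λ q q' * (q.1 j + q'.1 j)| ≤ amp Λ q * ampDiv Λ q' := by
  rw [mul_comm (amp Λ q)]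
  refine le_ampDiv_mul (amp_nonneg _ _) ?_ fun h => by
    rw [pairPhi_eq_zero_right h, zero_mul, abs_zero]
  rw [abs_mul, mul_assoc, mul_comm (amp Λ q')]
  refine abs_pairPhi_mul_le hε q q' (le_trans ?_ (coord_mul_sqrt_le_denom q q' j))
  gcongr
  exact norm_le_energy_right q q'

/-- P_j divided by the square root of the energy costs nothing: |P_j| √E is below the denominator,
and E is at least |q|^{1/2}|q'|^{1/2}. -/
theorem abs_pairPhi_coord_div_le (hε : IsPolarization ε) (j : Fin 3) (q q' : Mode) :
    |pairPhi ε Λ q q' * (q.1 j + q'.1 j)| / Real.sqrt (pairEnergy q q')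
      ≤ ampDiv Λ q * ampDiv Λ q' := by
  refine le_trans ?_ (le_ampDiv_mul (x := |pairPhi ε Λ q q'| * |q.1 j + q'.1 j|
    / Real.sqrt (pairEnergy q q')) (ampDiv_nonneg _ _) ?_ fun h => by
      rw [pairPhi_eq_zero_left h]; simp)
  · rw [abs_mul]
  rw [mul_comm (amp Λ q)]
  refine le_ampDiv_mul (amp_nonneg _ _) ?_ fun h => by
    rw [pairPhi_eq_zero_right h]; simp
  rcases (pairEnergy_nonneg q q').eq_or_lt with h | h
  · rw [← h]
    simp only [Real.sqrt_zero, div_zero, zero_mul]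
    exact mul_nonneg (amp_nonneg _ _) (amp_nonneg _ _)
  · rw [div_mul_eq_mul_div, div_mul_eq_mul_div, div_le_iff₀ (Real.sqrt_pos.2 h), mul_comm (amp Λ q')]
    have h1 := abs_pairPhi_mul_le (Λ := Λ) hε q q' (coord_mul_sqrt_le_denom q q' j)
    have h2 := sqrt_mul_sqrt_le_energy q q'
    calc |pairPhi ε Λ q q'| * |q.1 j + q'.1 j| * Real.sqrt ‖q.1‖ * Real.sqrt ‖q'.1‖
        = |pairPhi ε Λ q q'| * |q.1 j + q'.1 j| * (Real.sqrt ‖q.1‖ * Real.sqrt ‖q'.1‖) := by ring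
      _ ≤ |pairPhi ε Λ q q'| * |q.1 j + q'.1 j| * pairEnergy q q' := by gcongr
      _ = |pairPhi ε Λ q q'| * (|q.1 j + q'.1 j| * Real.sqrt (pairEnergy q q'))
          * Real.sqrt (pairEnergy q q') := by
          rw [mul_assoc |pairPhi ε Λ q q'| (_ * _), mul_assoc |q.1 j + q'.1 j|,
            Real.mul_self_sqrt h.le, mul_assoc]
      _ ≤ _ := by gcongr

theorem integrable_ampDiv_sq (Λ : ℝ) : Integrable (fun q => ampDiv Λ q ^ 2) modeMeasure := by
  simpa only [ampDiv_sq] using integrable_amp_sq_div Λ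

theorem integral_ampDiv_sq (hΛ : 0 < Λ) : ∫ q, ampDiv Λ q ^ 2 ∂modeMeasure = 2 * Λ / Real.pi := by
  simpa only [ampDiv_sq] using integral_amp_sq_div hΛ

theorem isPairKernel_phi (hε : IsPolarization ε) (Λ : ℝ) :
    IsPairKernel (fun y => pairPhi ε Λ y.1 y.2.1) fun p => |pairPhi ε Λ p.1 p.2| :=
  .of_sq_le (measurable_pairPhi_comp hε Λ measurable_fst measurable_snd.fst)
    (measurable_pairPhi_comp hε Λ measurable_fst measurable_snd).abs (fun _ _ _ _ => le_rfl)
    (integrable_ampDiv_sq Λ) (integrable_ampDiv_sq Λ) fun q q' => by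
      rw [← mul_pow]
      exact pow_le_pow_left₀ (abs_nonneg _) (abs_pairPhi_le hε q q') 2

theorem measurable_coord_comp (j : Fin 3) {X : Type*} [MeasurableSpace X] {f g : X → Mode}
    (hf : Measurable f) (hg : Measurable g) : Measurable fun y => (f y).1 j + (g y).1 j := by
  fun_prop

theorem isPairKernel_phi_coord (hε : IsPolarization ε) (Λ : ℝ) (j : Fin 3) :
    IsPairKernel (fun y => pairPhi ε Λ y.1 y.2.1 * (y.1.1 j + y.2.1.1 j))
      fun p => |pairPhi ε Λ p.1 p.2 * (p.1.1 j + p.2.1 j)| :=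
  .of_sq_le ((measurable_pairPhi_comp hε Λ measurable_fst measurable_snd.fst).mul
      (measurable_coord_comp j measurable_fst measurable_snd.fst))
    ((measurable_pairPhi_comp hε Λ measurable_fst measurable_snd).mul
      (measurable_coord_comp j measurable_fst measurable_snd)).abs (fun _ _ _ _ => le_rfl)
    (integrable_amp_sq Λ) (integrable_ampDiv_sq Λ) fun q q' => by
      rw [← mul_pow]
      exact pow_le_pow_left₀ (abs_nonneg _) (abs_pairPhi_mul_coord_le hε j q q') 2

theorem isPairKernel_phi_coord_sq (hε : IsPolarization ε) (Λ : ℝ) (j : Fin 3) :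
    IsPairKernel (fun y => pairPhi ε Λ y.1 y.2.1 * (y.1.1 j + y.2.1.1 j) * (y.1.1 j + y.2.1.1 j))
      fun p => |pairPhi ε Λ p.1 p.2 * (p.1.1 j + p.2.1 j) * (p.1.1 j + p.2.1 j)| :=
  .of_sq_le (((measurable_pairPhi_comp hε Λ measurable_fst measurable_snd.fst).mul
      (measurable_coord_comp j measurable_fst measurable_snd.fst)).mul
      (measurable_coord_comp j measurable_fst measurable_snd.fst))
    (((measurable_pairPhi_comp hε Λ measurable_fst measurable_snd).mul
      (measurable_coord_comp j measurable_fst measurable_snd)).mul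
      (measurable_coord_comp j measurable_fst measurable_snd)).abs (fun _ _ _ _ => le_rfl)
    (integrable_amp_sq Λ) (integrable_amp_sq Λ) fun q q' => by
      rw [← mul_pow]
      refine pow_le_pow_left₀ (abs_nonneg _) ?_ 2
      rw [mul_assoc, abs_mul, abs_mul, ← sq]
      exact abs_pairPhi_mul_le hε q q' (coord_sq_le_denom q q' j)

theorem isPairKernel_phi_energy (hε : IsPolarization ε) (Λ : ℝ) :
    IsPairKernel (fun y => pairPhi ε Λ y.1 y.2.1 * pairEnergy y.1 y.2.1)
      fun p => |pairPhi ε Λ p.1 p.2 * pairEnergy p.1 p.2| :=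
  .of_sq_le ((measurable_pairPhi_comp hε Λ measurable_fst measurable_snd.fst).mul
      (measurable_pairEnergy_comp measurable_fst measurable_snd.fst))
    ((measurable_pairPhi_comp hε Λ measurable_fst measurable_snd).mul
      (measurable_pairEnergy_comp measurable_fst measurable_snd)).abs (fun _ _ _ _ => le_rfl)
    (integrable_amp_sq Λ) (integrable_amp_sq Λ) fun q q' => by
      rw [← mul_pow]
      refine pow_le_pow_left₀ (abs_nonneg _) ?_ 2
      rw [abs_mul, abs_of_nonneg (pairEnergy_nonneg q q')]
      exact abs_pairPhi_mul_le hε q q' (pairEnergy_le_denom q q')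

theorem measurable_sqrt_total : Measurable fun y : Mode × Mode × ℝ =>
    Real.sqrt (pairEnergy y.1 y.2.1 + y.2.2) :=
  ((measurable_pairEnergy_comp measurable_fst measurable_snd.fst).add measurable_snd.snd).sqrt

/-- With E the energy of the pair and t that of the old photons, √(E+t) φ = φE/√(E+t) + √t ·
φ√t/√(E+t). The first piece acts on Ψ and is bounded by φ√E uniformly in t; the second,
`isPairKernel_phi_ratio`, acts on H_f^{1/2}Ψ and is bounded by φ. -/
theorem isPairKernel_phi_sqrt (hε : IsPolarization ε) (Λ : ℝ) :
    IsPairKernel (fun y => pairPhi ε Λ y.1 y.2.1 * pairEnergy y.1 y.2.1 /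
        Real.sqrt (pairEnergy y.1 y.2.1 + y.2.2))
      fun p => |pairPhi ε Λ p.1 p.2| * Real.sqrt (pairEnergy p.1 p.2) :=
  .of_sq_le (((measurable_pairPhi_comp hε Λ measurable_fst measurable_snd.fst).mul
      (measurable_pairEnergy_comp measurable_fst measurable_snd.fst)).div measurable_sqrt_total)
    ((measurable_pairPhi_comp hε Λ measurable_fst measurable_snd).abs.mul
      (measurable_pairEnergy_comp measurable_fst measurable_snd).sqrt)
    (fun q q' h hh => by
      rw [abs_div, abs_mul, abs_of_nonneg (pairEnergy_nonneg q q'),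
        abs_of_nonneg (Real.sqrt_nonneg _)]
      refine div_le_of_le_mul₀ (Real.sqrt_nonneg _) (by positivity) ?_
      rw [mul_assoc]
      gcongr
      calc pairEnergy q q' = Real.sqrt (pairEnergy q q') * Real.sqrt (pairEnergy q q') :=
            (Real.mul_self_sqrt (pairEnergy_nonneg q q')).symm
        _ ≤ _ := by gcongr; linarith)
    (integrable_amp_sq Λ) (integrable_ampDiv_sq Λ) fun q q' => by
      rw [← mul_pow]
      exact pow_le_pow_left₀ (by positivity) (abs_pairPhi_mul_sqrt_le hε q q') 2

theorem isPairKernel_phi_ratio (hε : IsPolarization ε) (Λ : ℝ) :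
    IsPairKernel (fun y => pairPhi ε Λ y.1 y.2.1 * Real.sqrt y.2.2 /
        Real.sqrt (pairEnergy y.1 y.2.1 + y.2.2))
      fun p => |pairPhi ε Λ p.1 p.2| :=
  .of_sq_le (((measurable_pairPhi_comp hε Λ measurable_fst measurable_snd.fst).mul
      measurable_snd.snd.sqrt).div measurable_sqrt_total)
    (measurable_pairPhi_comp hε Λ measurable_fst measurable_snd).abs
    (fun q q' h hh => by
      rw [abs_div, abs_mul, abs_of_nonneg (Real.sqrt_nonneg _),
        abs_of_nonneg (Real.sqrt_nonneg _)]
      refine div_le_of_le_mul₀ (Real.sqrt_nonneg _) (by positivity) ?_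
      gcongr
      exact le_add_of_nonneg_left (pairEnergy_nonneg q q'))
    (integrable_ampDiv_sq Λ) (integrable_ampDiv_sq Λ) fun q q' => by
      rw [← mul_pow]
      exact pow_le_pow_left₀ (abs_nonneg _) (abs_pairPhi_le hε q q') 2

/-- The division by √(E+t) allows half a power of H_f to be moved to the other factor of an inner
product. -/
theorem isPairKernel_phi_coord_div (hε : IsPolarization ε) (Λ : ℝ) (j : Fin 3) :
    IsPairKernel (fun y => pairPhi ε Λ y.1 y.2.1 * (y.1.1 j + y.2.1.1 j) /
        Real.sqrt (pairEnergy y.1 y.2.1 + y.2.2))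
      fun p => |pairPhi ε Λ p.1 p.2 * (p.1.1 j + p.2.1 j)| / Real.sqrt (pairEnergy p.1 p.2) :=
  .of_sq_le (((measurable_pairPhi_comp hε Λ measurable_fst measurable_snd.fst).mul
      (measurable_coord_comp j measurable_fst measurable_snd.fst)).div measurable_sqrt_total)
    (((measurable_pairPhi_comp hε Λ measurable_fst measurable_snd).mul
      (measurable_coord_comp j measurable_fst measurable_snd)).abs.div
      (measurable_pairEnergy_comp measurable_fst measurable_snd).sqrt)
    (fun q q' h hh => by
      rw [abs_div, abs_of_nonneg (Real.sqrt_nonneg _)]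
      rcases (pairEnergy_nonneg q q').eq_or_lt with h0 | h0
      · have h1 : ‖q.1‖ = 0 := by
          have := norm_nonneg q.1
          have := norm_nonneg q'.1
          unfold pairEnergy at h0
          linarith
        rw [pairPhi_eq_zero_left h1]; simp
      · have := Real.sqrt_pos.2 h0
        gcongr
        linarith)
    (integrable_ampDiv_sq Λ) (integrable_ampDiv_sq Λ) fun q q' => by
      rw [← mul_pow]
      exact pow_le_pow_left₀ (by positivity) (abs_pairPhi_coord_div_le hε j q q') 2

end Estimates

end

/-! ### Norms and row bounds of φ; identification of 𝓔₀. -/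

section

variable {n : ℕ}

section Estimates

variable {ε : R3 → Fin 2 → R3} {Λ : ℝ}

theorem two_mul_div_pi_le (hΛ : 0 < Λ) : 2 * Λ / Real.pi ≤ Λ := by
  rw [div_le_iff₀ Real.pi_pos]
  nlinarith [Real.pi_gt_three]

theorem sq_div_pi_le (Λ : ℝ) : Λ ^ 2 / Real.pi ≤ Λ ^ 2 :=
  div_le_self (sq_nonneg _) (by linarith [Real.pi_gt_three])

theorem integral_phi_sq_le (hε : IsPolarization ε) (hΛ : 0 < Λ) :
    ∫ p : Mode × Mode, |pairPhi ε Λ p.1 p.2| ^ 2 ∂(modeMeasure.prod modeMeasure) ≤ Λ ^ 2 := by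
  refine (integral_sq_le_of_sq_le (b := fun p => |pairPhi ε Λ p.1 p.2|) (integrable_ampDiv_sq Λ)
    (integrable_ampDiv_sq Λ) (integral_ampDiv_sq hΛ) (integral_ampDiv_sq hΛ) fun q q' => ?_).trans ?_
  · rw [← mul_pow]
    exact pow_le_pow_left₀ (abs_nonneg _) (abs_pairPhi_le hε q q') 2
  · rw [sq]
    have := two_mul_div_pi_le hΛ
    gcongr

theorem integral_phi_coord_sq_le (hε : IsPolarization ε) (hΛ : 0 < Λ) (j : Fin 3) :
    ∫ p : Mode × Mode, |pairPhi ε Λ p.1 p.2 * (p.1.1 j + p.2.1 j)| ^ 2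
      ∂(modeMeasure.prod modeMeasure) ≤ (Λ * Real.sqrt Λ) ^ 2 := by
  refine (integral_sq_le_of_sq_le (b := fun p => |pairPhi ε Λ p.1 p.2 * (p.1.1 j + p.2.1 j)|)
    (integrable_amp_sq Λ) (integrable_ampDiv_sq Λ) (integral_amp_sq hΛ) (integral_ampDiv_sq hΛ)
    fun q q' => ?_).trans ?_
  · rw [← mul_pow]
    exact pow_le_pow_left₀ (abs_nonneg _) (abs_pairPhi_mul_coord_le hε j q q') 2
  · rw [mul_pow, Real.sq_sqrt hΛ.le]
    have := two_mul_div_pi_le hΛ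
    have := sq_div_pi_le Λ
    gcongr

theorem integral_phi_coord_div_sq_le (hε : IsPolarization ε) (hΛ : 0 < Λ) (j : Fin 3) :
    ∫ p : Mode × Mode, (|pairPhi ε Λ p.1 p.2 * (p.1.1 j + p.2.1 j)|
      / Real.sqrt (pairEnergy p.1 p.2)) ^ 2 ∂(modeMeasure.prod modeMeasure) ≤ Λ ^ 2 := by
  refine (integral_sq_le_of_sq_le (b := fun p => |pairPhi ε Λ p.1 p.2 * (p.1.1 j + p.2.1 j)|
      / Real.sqrt (pairEnergy p.1 p.2)) (integrable_ampDiv_sq Λ)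
    (integrable_ampDiv_sq Λ) (integral_ampDiv_sq hΛ) (integral_ampDiv_sq hΛ) fun q q' => ?_).trans ?_
  · rw [← mul_pow]
    exact pow_le_pow_left₀ (by positivity) (abs_pairPhi_coord_div_le hε j q q') 2
  · rw [sq]
    have := two_mul_div_pi_le hΛ
    gcongr

theorem HasRowBound.of_le {b : Mode × Mode → ℝ} (hs : ∀ q q', b (q, q') = b (q', q))
    {D : Mode → ℝ} (hD : Measurable D)
    (hle : ∀ q q', b (q, q') ≤ amp Λ q * D q')
    {M : ℝ} (hM : ∫⁻ q', ENNReal.ofReal (D q') * ENNReal.ofReal (amp Λ q') ∂modeMeasure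
      ≤ ENNReal.ofReal M) : HasRowBound Λ b M := by
  refine ⟨hs, fun q => ?_⟩
  rw [mul_comm (ENNReal.ofReal M)]
  refine le_trans ?_ (mul_le_mul_right hM _)
  have hm : Measurable fun q => ENNReal.ofReal (D q) * ENNReal.ofReal (amp Λ q) :=
    hD.ennreal_ofReal.mul (measurable_amp Λ).ennreal_ofReal
  rw [← lintegral_const_mul _ hm]
  refine lintegral_mono fun q' => ?_
  rw [← mul_assoc, ← ENNReal.ofReal_mul (amp_nonneg _ _)]
  exact mul_le_mul_left (ENNReal.ofReal_le_ofReal (hle q q')) _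

/-- The denominator is at least |q'|, so φ is at most amp(q) · amp(q')/|q'|, and ∫ amp²/|q'| = 2Λ/π
≤ Λ. -/
theorem hasRowBound_phi (hε : IsPolarization ε) (hΛ : 0 < Λ) :
    HasRowBound Λ (fun p => |pairPhi ε Λ p.1 p.2|) Λ := by
  have hm : Measurable fun q => amp Λ q / ‖q.1‖ := (measurable_amp Λ).div (by fun_prop)
  refine HasRowBound.of_le (fun q q' => by rw [pairPhi_comm]) hm (fun q q' => ?_) ?_
  · simp only
    by_cases h : ‖q'.1‖ = 0
    · rw [pairPhi_eq_zero_right h, h]; simp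
    · rw [← mul_div_assoc, le_div_iff₀ (lt_of_le_of_ne (norm_nonneg _) (Ne.symm h))]
      exact abs_pairPhi_mul_le hε q q'
        ((norm_le_energy_right q q').trans (pairEnergy_le_denom q q'))
  · refine le_trans (le_of_eq ?_)
      ((lintegral_ampDiv_sq hΛ).le.trans (ENNReal.ofReal_le_ofReal (two_mul_div_pi_le hΛ)))
    refine lintegral_congr fun q => ?_
    rw [← ENNReal.ofReal_mul (div_nonneg (amp_nonneg _ _) (norm_nonneg _)),
      ← ENNReal.ofReal_pow (ampDiv_nonneg _ _), ampDiv_sq]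
    congr 1
    ring

/-- Here the row integral is ∫ amp²/|q'|^{1/2}, estimated by Cauchy–Schwarz between ∫ amp² and ∫
amp²/|q'|. -/
theorem hasRowBound_phi_coord (hε : IsPolarization ε) (hΛ : 0 < Λ) (j : Fin 3) :
    HasRowBound Λ (fun p => |pairPhi ε Λ p.1 p.2 * (p.1.1 j + p.2.1 j)|) (Λ * Real.sqrt Λ) := by
  refine HasRowBound.of_le (fun q q' => by
    simp only; rw [pairPhi_comm, add_comm (q'.1 j)]) (measurable_ampDiv Λ)
    (fun q q' => abs_pairPhi_mul_coord_le hε j q q') ?_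
  rw [← ENNReal.pow_le_pow_left_iff two_ne_zero]
  refine (lintegral_mul_sq_le (measurable_ampDiv Λ).ennreal_ofReal.aemeasurable
    (measurable_amp Λ).ennreal_ofReal.aemeasurable).trans ?_
  rw [lintegral_ampDiv_sq hΛ, lintegral_amp_sq hΛ, ← ENNReal.ofReal_mul (by positivity),
    ← ENNReal.ofReal_pow (by positivity)]
  refine ENNReal.ofReal_le_ofReal ?_
  rw [mul_pow, Real.sq_sqrt hΛ.le, mul_comm]
  have := two_mul_div_pi_le hΛ
  have := sq_div_pi_le Λ
  gcongr

/-- The second order energy as a real integral. -/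
def pairSelfEnergy (ε : R3 → Fin 2 → R3) (Λ : ℝ) : ℝ :=
  2 * ∫ p : Mode × Mode, pairPhi ε Λ p.1 p.2 ^ 2 * pairDenom p.1 p.2
    ∂(modeMeasure.prod modeMeasure)

theorem pairSelfEnergy_nonneg (ε : R3 → Fin 2 → R3) (Λ : ℝ) : 0 ≤ pairSelfEnergy ε Λ :=
  mul_nonneg (by norm_num)
    (integral_nonneg fun p => mul_nonneg (sq_nonneg _) (pairDenom_nonneg _ _))

theorem pairPhi_sq_mul_denom_le (hε : IsPolarization ε) (q q' : Mode) :
    pairPhi ε Λ q q' ^ 2 * pairDenom q q' ≤ amp Λ q ^ 2 * ampDiv Λ q' ^ 2 := by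
  have h1 := abs_pairPhi_mul_denom_le (Λ := Λ) hε q q'
  by_cases h : ‖q'.1‖ = 0
  · rw [pairPhi_eq_zero_right h]; simp [ampDiv, h]
  · have hpos : 0 < ‖q'.1‖ := lt_of_le_of_ne (norm_nonneg _) (Ne.symm h)
    rw [ampDiv_sq, ← mul_div_assoc, le_div_iff₀ hpos, ← sq_abs]
    have h2 := (norm_le_energy_right q q').trans (pairEnergy_le_denom q q')
    have h3 := pairDenom_nonneg q q'
    have h4 := abs_nonneg (pairPhi ε Λ q q')
    calc |pairPhi ε Λ q q'| ^ 2 * pairDenom q q' * ‖q'.1‖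
        ≤ |pairPhi ε Λ q q'| ^ 2 * pairDenom q q' * pairDenom q q' := by gcongr
      _ = (|pairPhi ε Λ q q'| * pairDenom q q') ^ 2 := by ring
      _ ≤ (amp Λ q * amp Λ q') ^ 2 := by gcongr
      _ = _ := by ring

theorem measurable_pairDenom : Measurable fun p : Mode × Mode => pairDenom p.1 p.2 := by
  have h := measurable_pairEnergy_comp (X := Mode × Mode) measurable_fst measurable_snd
  exact ((measurable_fst.fst.add measurable_snd.fst).norm.pow_const 2).add h

theorem integrable_pairPhi_sq_mul_denom (hε : IsPolarization ε) (Λ : ℝ) :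
    Integrable (fun p : Mode × Mode => pairPhi ε Λ p.1 p.2 ^ 2 * pairDenom p.1 p.2)
      (modeMeasure.prod modeMeasure) := by
  refine ((integrable_amp_sq Λ).mul_prod (integrable_ampDiv_sq Λ)).mono'
    (((measurable_pairPhi_comp hε Λ measurable_fst measurable_snd).pow_const 2).mul
      measurable_pairDenom).aestronglyMeasurable (.of_forall fun p => ?_)
  rw [Real.norm_of_nonneg (mul_nonneg (sq_nonneg _) (pairDenom_nonneg _ _))]
  exact pairPhi_sq_mul_denom_le hε p.1 p.2

/-- Gives α²𝓔₀ · αΛ ≤ α³Λ⁴, by which relative errors αΛ of the second order term are harmless. -/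
theorem pairSelfEnergy_le (hε : IsPolarization ε) (hΛ : 0 < Λ) : pairSelfEnergy ε Λ ≤ Λ ^ 3 := by
  have h1 : ∫ p : Mode × Mode, pairPhi ε Λ p.1 p.2 ^ 2 * pairDenom p.1 p.2
      ∂(modeMeasure.prod modeMeasure) ≤ Λ ^ 2 / Real.pi * (2 * Λ / Real.pi) := by
    rw [← integral_amp_sq hΛ, ← integral_ampDiv_sq hΛ, ← integral_prod_mul]
    exact integral_mono (integrable_pairPhi_sq_mul_denom hε Λ)
      ((integrable_amp_sq Λ).mul_prod (integrable_ampDiv_sq Λ))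
      fun p => pairPhi_sq_mul_denom_le hε p.1 p.2
  have h2 : 2 * (Λ ^ 2 / Real.pi * (2 * Λ / Real.pi)) = 4 / Real.pi ^ 2 * Λ ^ 3 := by
    field_simp; ring
  have h3 : 4 / Real.pi ^ 2 ≤ 1 := by
    rw [div_le_one (by positivity)]
    nlinarith [Real.pi_gt_three]
  have h4 : 0 < Λ ^ 3 := by positivity
  unfold pairSelfEnergy
  nlinarith

/-- The constants in the bounds for the hard pair add up to the second order energy. -/
theorem sum_integral_sq_eq (hε : IsPolarization ε) (Λ : ℝ) :
    ∑ j : Fin 3, 2 * ∫ p : Mode × Mode, |pairPhi ε Λ p.1 p.2 * (p.1.1 j + p.2.1 j)| ^ 2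
        ∂(modeMeasure.prod modeMeasure)
      + 2 * ∫ p : Mode × Mode, (|pairPhi ε Λ p.1 p.2| * Real.sqrt (pairEnergy p.1 p.2)) ^ 2
        ∂(modeMeasure.prod modeMeasure) = pairSelfEnergy ε Λ := by
  have hj : ∀ j ∈ (Finset.univ : Finset (Fin 3)), Integrable (fun p : Mode × Mode =>
      |pairPhi ε Λ p.1 p.2 * (p.1.1 j + p.2.1 j)| ^ 2) (modeMeasure.prod modeMeasure) :=
    fun j _ => (isPairKernel_phi_coord hε Λ j).integrable
  rw [← Finset.mul_sum, ← integral_finsetSum _ hj, ← mul_add,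
    ← integral_add (integrable_finsetSum _ hj) (isPairKernel_phi_sqrt hε Λ).integrable]
  unfold pairSelfEnergy
  congr 1
  refine integral_congr_ae (.of_forall fun p => ?_)
  simp only [sq_abs, mul_pow, Real.sq_sqrt (pairEnergy_nonneg p.1 p.2), ← Finset.mul_sum]
  rw [pairDenom, EuclideanSpace.real_norm_sq_eq, mul_add]
  rfl

theorem pairAmp_mul_phi (ε : R3 → Fin 2 → R3) (Λ : ℝ) (q q' : Mode) :
    pairAmp ε Λ q q' * pairPhi ε Λ q q' = pairPhi ε Λ q q' ^ 2 * pairDenom q q' := by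
  rw [← pairPhi_mul_denom]; ring

/-- On the vacuum, the creation of hard pairs produces the second order energy. -/
theorem inner_pairOp_pairOp_zero (hε : IsPolarization ε) (Λ : ℝ) (ψ : Sector 0) :
    inner ℂ (pairOp (isPairKernel_pairAmp hε Λ) ψ) (pairOp (isPairKernel_phi hε Λ) ψ)
      = ((pairSelfEnergy ε Λ * ‖ψ‖ ^ 2 : ℝ) : ℂ) := by
  obtain ⟨u, hu⟩ := exists_represents ψ
  rw [(hu.pairOp (isPairKernel_pairAmp hε Λ)).inner_eq (hu.pairOp (isPairKernel_phi hε Λ)),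
    pairFn, integral_conj_symPair_mul (memLp_pairKernel (isPairKernel_pairAmp hε Λ) hu.wave)
      (hu.pairOp (isPairKernel_phi hε Λ)).wave, ← integral_const_mul]
  -- Without other photons every pair dominates.
  have hd : ∀ (q q' : Mode) (K : Fin 0 → Mode), domInd q q' K = 1 := fun q q' K => by
    have hd0 : Dominates q q' K := fun m => m.elim0
    exact if_pos hd0
  have e : ∀ y : Mode × Mode × Point 0, (Real.sqrt ((0 : ℕ) + 1) : ℂ) * (Real.sqrt ((0 : ℕ) + 2) : ℂ)
      * (conj (pairKernel (fun y => pairAmp ε Λ y.1 y.2.1) u y) *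
        pairFn (fun y => pairPhi ε Λ y.1 y.2.1) u (adjoinPair y))
      = ((2 * (pairPhi ε Λ y.1 y.2.1 ^ 2 * pairDenom y.1 y.2.1) : ℝ) : ℂ)
        * (conj (u y.2.2) * u y.2.2) := by
    rintro ⟨q, q', z⟩
    simp only [pairFn, symPair, Fintype.sum_prod_type]
    rw [mul_left_comm, mul_inv_cancel_left₀
      (mul_ne_zero (sqrt_succ_ne_zero 0) (sqrt_succ_succ_ne_zero 0)), Fin.sum_univ_two,
      Fin.sum_univ_one, Fin.sum_univ_one]
    have t0 : extractPair (0, 0) (adjoinPair (q, q', z)) = (q, q', z) := by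
      have h0 : (adjoin (q, adjoin (q', z))).2 0 = q := rfl
      simp only [extractPair, adjoinPair, adjoin_eq_comp, h0]
    have t1 : extractPair (1, 0) (adjoinPair (q, q', z)) = (q', q, z) := by
      have h0 : (adjoin (q, adjoin (q', z))).2 (Fin.succ 0) = q' := rfl
      have h1 : (1 : Fin 2) = Fin.succ 0 := rfl
      simp only [h1, extractPair, adjoinPair, extract_succ_adjoin, adjoin_eq_comp, h0]
    rw [t0, t1]
    simp only [pairKernel, hd, map_mul, Complex.conj_conj, Complex.conj_ofReal, mul_one]
    rw [pairPhi_comm ε Λ q' q, ← pairAmp_mul_phi]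
    have k1 := conj_phase_mul_phase z.1 q
    have k2 := conj_phase_mul_phase z.1 q'
    push_cast
    linear_combination (2 * (pairAmp ε Λ q q' : ℂ) * pairPhi ε Λ q q' * conj (u z) * u z)
      * (k1 * (conj (phase z.1 q') * phase z.1 q') + k2)
  rw [integral_congr_ae (.of_forall e)]
  have h := (measurePreserving_prodAssoc modeMeasure modeMeasure (sectorMeasure 0)).symm
  have h1 := integral_prod_mul (μ := modeMeasure.prod modeMeasure) (ν := sectorMeasure 0)
    (fun p : Mode × Mode => ((2 * (pairPhi ε Λ p.1 p.2 ^ 2 * pairDenom p.1 p.2) : ℝ) : ℂ))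
    (fun z => conj (u z) * u z)
  rw [integral_complex_ofReal, integral_const_mul, ← hu.inner_eq hu, Sector.inner_self,
    ← h.integral_comp (MeasurableEquiv.measurableEmbedding _)] at h1
  rw [Complex.ofReal_mul]
  exact h1

theorem phase_zero (q : Mode) : phase 0 q = 1 := by simp [phase]

/-- Both orders of the pair contribute equally, against the normalization 1/√2. -/
theorem pairState_eq (ε : R3 → Fin 2 → R3) (Λ : ℝ) (K : Fin 2 → Mode) :
    pairState ε Λ K = (Real.sqrt 2 : ℂ) * (pairAmp ε Λ (K 0) (K 1) : ℂ) := by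
  have h := sum_creationFn_creationFn ε Λ (n := 0) (fun _ => 1) (0, K)
  have h1 : pairState ε Λ K
      = ∑ j, creationFn ε Λ j (creationFn ε Λ j fun _ : Point 0 => 1) (0, K) := rfl
  rw [h1, h, symPair, Fintype.sum_prod_type, Fin.sum_univ_two, Fin.sum_univ_one,
    Fin.sum_univ_one]
  have t0 : ((extractPair (0, 0) ((0 : R3), K)).1, (extractPair (0, 0) ((0 : R3), K)).2.1)
    = (K 0, K 1) := rfl
  have t1 : ((extractPair (1, 0) ((0 : R3), K)).1, (extractPair (1, 0) ((0 : R3), K)).2.1)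
    = (K 1, K 0) := rfl
  have x0 : ∀ p : Fin 2 × Fin 1, (extractPair p ((0 : R3), K)).2.2.1 = 0 := fun p => rfl
  rw [Prod.mk.injEq] at t0 t1
  simp only [t0.1, t0.2, t1.1, t1.2, x0, phase_zero, map_one, mul_one]
  rw [pairAmp_comm ε Λ (K 1) (K 0)]
  have h2 : (Real.sqrt 2 : ℂ) * (Real.sqrt 2 : ℂ) = 2 := by
    rw [← Complex.ofReal_mul, Real.mul_self_sqrt (by norm_num)]; norm_num
  have h3 : (Real.sqrt 2 : ℂ) ≠ 0 := by
    rw [Complex.ofReal_ne_zero]; positivity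
  simp only [Nat.cast_zero, zero_add, Real.sqrt_one, Complex.ofReal_one, one_mul]
  rw [inv_mul_eq_iff_eq_mul₀ h3, ← mul_assoc, h2]
  ring

/-- The factor 2 is √2 from the pair state times √2 from annihilating the first of two photons; the
sum over j of G_j G_j rebuilds the pair amplitude, and one factor φ remains from the resolvent. -/
theorem secondOrderEnergy_eq (hε : IsPolarization ε) (Λ : ℝ) :
    secondOrderEnergy ε Λ = (pairSelfEnergy ε Λ : ℂ) := by
  have h2 : (Real.sqrt 2 : ℂ) * (Real.sqrt 2 : ℂ) = 2 := by
    rw [← Complex.ofReal_mul, Real.mul_self_sqrt (by norm_num)]; norm_num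
  have hc := measurable_coupling hε Λ
  have hint : ∀ j ∈ (Finset.univ : Finset (Fin 3)), Integrable (fun p : Mode × Mode =>
      coupling ε Λ j p.1 * (coupling ε Λ j p.2 * pairPhi ε Λ p.1 p.2))
      (modeMeasure.prod modeMeasure) := by
    intro j _
    have hm1 : Measurable fun p : Mode × Mode => coupling ε Λ j p.1 := (hc j).comp measurable_fst
    have hm2 : Measurable fun p : Mode × Mode => coupling ε Λ j p.2 := (hc j).comp measurable_snd
    have hI : Integrable (fun q => amp Λ q * ampDiv Λ q) modeMeasure := by
      have m1 : MemLp (amp Λ) 2 modeMeasure :=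
        (memLp_two_iff_integrable_sq (measurable_amp Λ).aestronglyMeasurable).2
          (integrable_amp_sq Λ)
      have m2 : MemLp (ampDiv Λ) 2 modeMeasure :=
        (memLp_two_iff_integrable_sq (measurable_ampDiv Λ).aestronglyMeasurable).2
          (integrable_ampDiv_sq Λ)
      exact MemLp.integrable_mul m1 m2
    refine (hI.mul_prod hI).mono' (hm1.mul (hm2.mul
      (measurable_pairPhi_comp hε Λ measurable_fst measurable_snd))).aestronglyMeasurable
      (.of_forall fun p => ?_)
    rw [Real.norm_eq_abs, abs_mul, abs_mul]
    have k1 := abs_coupling_le hε Λ j p.1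
    have k2 := abs_coupling_le hε Λ j p.2
    have k3 := abs_pairPhi_le (Λ := Λ) hε p.1 p.2
    calc _ ≤ amp Λ p.1 * (amp Λ p.2 * (ampDiv Λ p.1 * ampDiv Λ p.2)) := by
          gcongr
          · exact amp_nonneg _ _
          · exact amp_nonneg _ _
      _ = _ := by ring
  have hj : ∀ j, annihilate ε Λ j 0 (annihilate ε Λ j 0 (freeResolvent (pairState ε Λ))) Fin.elim0
      = ((2 * ∫ p : Mode × Mode, coupling ε Λ j p.1 * (coupling ε Λ j p.2 * pairPhi ε Λ p.1 p.2)
        ∂(modeMeasure.prod modeMeasure) : ℝ) : ℂ) := by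
    intro j
    have inner_eq : ∀ q : Mode, (coupling ε Λ j q : ℂ) * phase 0 q *
        annihilate ε Λ j 0 (freeResolvent (pairState ε Λ)) (Fin.cons q Fin.elim0)
        = ((2 * ∫ q', coupling ε Λ j q * (coupling ε Λ j q' * pairPhi ε Λ q q') ∂modeMeasure : ℝ)
          : ℂ) := by
      intro q
      have e : ∀ q' : Mode, (coupling ε Λ j q' : ℂ) * phase 0 q' *
          freeResolvent (pairState ε Λ) (Fin.cons q' (Fin.cons q Fin.elim0))
          = (Real.sqrt 2 : ℂ) * ((coupling ε Λ j q' * pairPhi ε Λ q q' : ℝ) : ℂ) := by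
        intro q'
        have d1 : ‖fieldMomentum (Fin.cons q' (Fin.cons q Fin.elim0) : Fin 2 → Mode)‖ ^ 2
            + fieldEnergy (Fin.cons q' (Fin.cons q Fin.elim0) : Fin 2 → Mode)
            = pairDenom q q' := by
          simp [fieldMomentum, fieldEnergy, Fin.sum_univ_two, pairDenom, pairEnergy, add_comm]
        rw [freeResolvent, d1, pairState_eq, phase_zero]
        simp only [Fin.cons_zero, Fin.cons_one, pairPhi, pairAmp_comm ε Λ q q']
        push_cast
        ring
      simp only [annihilate, e]
      rw [integral_const_mul, integral_complex_ofReal, phase_zero]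
      have c2 : (Real.sqrt ((1 : ℕ) + 1) : ℂ) = (Real.sqrt 2 : ℂ) := by norm_num
      rw [c2, ← mul_assoc (Real.sqrt 2 : ℂ), h2, integral_const_mul]
      push_cast
      ring
    rw [annihilate, integral_congr_ae (.of_forall inner_eq), integral_complex_ofReal,
      integral_const_mul, integral_prod _ (hint j (Finset.mem_univ j))]
    simp
  simp only [secondOrderEnergy, hj]
  rw [← Complex.ofReal_sum, ← Finset.mul_sum, ← integral_finsetSum _ hint, pairSelfEnergy]
  congr 3
  funext p
  rw [← pairAmp_mul_phi, pairAmp, Finset.sum_mul]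
  exact Finset.sum_congr rfl fun j _ => by ring

end Estimates

end

/-! ### From sectors to states of the full Hilbert space. -/

section

variable {n : ℕ}

section States

theorem hasSum_norm_sq (Ψ : StateSpace) : HasSum (fun n => ‖Ψ n‖ ^ 2) (‖Ψ‖ ^ 2) := by
  have h := lp.hasSum_norm (p := 2) (by norm_num) Ψ
  have e : ((2 : ENNReal).toReal) = ((2 : ℕ) : ℝ) := by norm_num
  rw [e] at h
  simpa only [Real.rpow_natCast] using h

theorem sum_norm_sq_le (Ψ : StateSpace) (s : Finset ℕ) (k : ℕ) :
    ∑ n ∈ s, ‖Ψ (n + k)‖ ^ 2 ≤ ‖Ψ‖ ^ 2 := by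
  have h := sum_le_hasSum (s.map (addRightEmbedding k)) (fun i _ => sq_nonneg ‖Ψ i‖)
    (hasSum_norm_sq Ψ)
  rwa [Finset.sum_map] at h

/-- The state with given components. -/
theorem exists_state {x : ∀ n, Sector n} (h : Summable fun n => ‖x n‖ ^ 2) :
    ∃ X : StateSpace, ∀ n, X n = x n := by
  have hm : Memℓp x 2 := memℓp_gen (by
    have e : ((2 : ENNReal).toReal) = ((2 : ℕ) : ℝ) := by norm_num
    rw [e]
    simpa only [Real.rpow_natCast] using h)
  exact ⟨⟨x, hm⟩, fun n => rfl⟩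

theorem summable_norm_sq_shift {x : ∀ n, Sector n} {c : ℝ} (Ψ : StateSpace) (k l : ℕ)
    (h : ∀ n, ‖x (n + l)‖ ^ 2 ≤ c * ‖Ψ (n + k)‖ ^ 2) : Summable fun n => ‖x n‖ ^ 2 := by
  refine (summable_nat_add_iff l).1 (Summable.of_nonneg_of_le (fun _ => sq_nonneg _) h ?_)
  exact ((summable_nat_add_iff k).2 (hasSum_norm_sq Ψ).summable).mul_left c

theorem inner_congr_comp {X Y X' Y' : StateSpace}
    (h : ∀ n, inner ℂ (X n) (Y n) = inner ℂ (X' n) (Y' n)) : inner ℂ X Y = inner ℂ X' Y' := by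
  rw [lp.inner_eq_tsum, lp.inner_eq_tsum]
  exact tsum_congr h

/-- Cauchy–Schwarz over the photon number, for estimates that hold sector by sector with constants
independent of the sector. -/
theorem norm_le_of_hasSum {z : ℕ → ℂ} {S : ℂ} (hz : HasSum z S) {x y : ℕ → ℝ} {c X Y : ℝ}
    (hc : 0 ≤ c) (hX : 0 ≤ X) (hx : ∀ s : Finset ℕ, ∑ n ∈ s, x n ^ 2 ≤ X ^ 2)
    (hY : 0 ≤ Y) (hy : ∀ s : Finset ℕ, ∑ n ∈ s, y n ^ 2 ≤ Y ^ 2)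
    (hle : ∀ n, ‖z n‖ ≤ c * (x n * y n)) : ‖S‖ ≤ c * (X * Y) := by
  refine le_of_tendsto hz.norm (.of_forall fun s => ?_)
  refine (norm_sum_le _ _).trans ((Finset.sum_le_sum fun n _ => hle n).trans ?_)
  rw [← Finset.mul_sum]
  refine mul_le_mul_of_nonneg_left ?_ hc
  refine (Real.sum_mul_le_sqrt_mul_sqrt s x y).trans ?_
  refine mul_le_mul ?_ ?_ (Real.sqrt_nonneg _) hX
  · exact Real.sqrt_le_iff.2 ⟨hX, hx s⟩
  · exact Real.sqrt_le_iff.2 ⟨hY, hy s⟩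

theorem SqrtEnergy.add {ψ f ψ' f' : Sector n} (h : SqrtEnergy ψ f) (h' : SqrtEnergy ψ' f') :
    SqrtEnergy (ψ + ψ') (f + f') := by
  obtain ⟨u, hu⟩ := exists_represents ψ
  obtain ⟨u', hu'⟩ := exists_represents ψ'
  obtain ⟨v, hv⟩ := exists_represents f
  obtain ⟨v', hv'⟩ := exists_represents f'
  refine SqrtEnergy.of_represents (hu.add hu') (hv.add hv') ?_
  filter_upwards [h.ae_eq hu hv, h'.ae_eq hu' hv'] with z h1 h2
  rw [h1, h2, mul_add]

theorem SqrtEnergy.smul {ψ f : Sector n} (h : SqrtEnergy ψ f) (c : ℂ) :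
    SqrtEnergy (c • ψ) (c • f) := by
  obtain ⟨u, hu⟩ := exists_represents ψ
  obtain ⟨v, hv⟩ := exists_represents f
  refine SqrtEnergy.of_represents (hu.smul c) (hv.smul c) ?_
  filter_upwards [h.ae_eq hu hv] with z h1
  rw [h1, mul_left_comm]

theorem SqrtEnergy.zero : SqrtEnergy (0 : Sector n) 0 :=
  SqrtEnergy.of_represents Represents.zero Represents.zero (.of_forall fun z => by simp)

theorem WaveMomentum.add {j : Fin 3} {u m u' m' : Point n → ℂ} (h : WaveMomentum j u m)
    (h' : WaveMomentum j u' m') (hu : IsWave u) (hm : IsWave m) (hu' : IsWave u')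
    (hm' : IsWave m') : WaveMomentum j (fun z => u z + u' z) fun z => m z + m' z := by
  filter_upwards [h, h', ae_memLp_slice hu.measurable hu.memLp,
    ae_memLp_slice hm.measurable hm.memLp, ae_memLp_slice hu'.measurable hu'.memLp,
    ae_memLp_slice hm'.measurable hm'.memLp] with K h1 h2 h3 h4 h5 h6
  exact WeakMomentum.add h1 h2 h3 h4 h5 h6

theorem WaveMomentum.const_mul {j : Fin 3} {u m : Point n → ℂ} (h : WaveMomentum j u m) (c : ℂ) :
    WaveMomentum j (fun z => c * u z) fun z => c * m z := by
  filter_upwards [h] with K h1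
  exact WeakMomentum.const_mul h1 c

theorem SectorMomentum.add {j : Fin 3} {ψ m ψ' m' : Sector n} (h : SectorMomentum j ψ m)
    (h' : SectorMomentum j ψ' m') : SectorMomentum j (ψ + ψ') (m + m') := by
  obtain ⟨u, hu⟩ := exists_represents ψ
  obtain ⟨u', hu'⟩ := exists_represents ψ'
  obtain ⟨v, hv⟩ := exists_represents m
  obtain ⟨v', hv'⟩ := exists_represents m'
  rw [sectorMomentum_iff (hu.add hu') (hv.add hv')]
  exact ((sectorMomentum_iff hu hv).1 h).add ((sectorMomentum_iff hu' hv').1 h') hu.wave hv.wave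
    hu'.wave hv'.wave

theorem SectorMomentum.smul {j : Fin 3} {ψ m : Sector n} (h : SectorMomentum j ψ m) (c : ℂ) :
    SectorMomentum j (c • ψ) (c • m) := by
  obtain ⟨u, hu⟩ := exists_represents ψ
  obtain ⟨v, hv⟩ := exists_represents m
  rw [sectorMomentum_iff (hu.smul c) (hv.smul c)]
  exact ((sectorMomentum_iff hu hv).1 h).const_mul c

theorem SectorMomentum.zero {j : Fin 3} : SectorMomentum j (0 : Sector n) 0 := by
  rw [sectorMomentum_iff Represents.zero Represents.zero]
  refine .of_forall fun K φ _ _ => ?_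
  simp

theorem isSqrtFieldEnergy_iff {Ψ F : StateSpace} :
    IsSqrtFieldEnergy Ψ F ↔ ∀ n, SqrtEnergy (Ψ n) (F n) := Iff.rfl

theorem isMomentum_iff {j : Fin 3} {Ψ M : StateSpace} :
    IsMomentum j Ψ M ↔ ∀ n, SectorMomentum j (Ψ n) (M n) := Iff.rfl

theorem IsSqrtFieldEnergy.add {Ψ F Ψ' F' : StateSpace} (h : IsSqrtFieldEnergy Ψ F)
    (h' : IsSqrtFieldEnergy Ψ' F') : IsSqrtFieldEnergy (Ψ + Ψ') (F + F') :=
  fun n => SqrtEnergy.add (isSqrtFieldEnergy_iff.1 h n) (isSqrtFieldEnergy_iff.1 h' n)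

theorem IsSqrtFieldEnergy.smul {Ψ F : StateSpace} (h : IsSqrtFieldEnergy Ψ F) (c : ℂ) :
    IsSqrtFieldEnergy (c • Ψ) (c • F) :=
  fun n => SqrtEnergy.smul (isSqrtFieldEnergy_iff.1 h n) c

theorem IsMomentum.add {j : Fin 3} {Ψ M Ψ' M' : StateSpace} (h : IsMomentum j Ψ M)
    (h' : IsMomentum j Ψ' M') : IsMomentum j (Ψ + Ψ') (M + M') :=
  fun n => SectorMomentum.add (isMomentum_iff.1 h n) (isMomentum_iff.1 h' n)

theorem IsMomentum.smul {j : Fin 3} {Ψ M : StateSpace} (h : IsMomentum j Ψ M) (c : ℂ) :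
    IsMomentum j (c • Ψ) (c • M) :=
  fun n => SectorMomentum.smul (isMomentum_iff.1 h n) c

theorem IsMomentum.inner_symm {j : Fin 3} {Ψ M Ψ' M' : StateSpace} (h : IsMomentum j Ψ M)
    (h' : IsMomentum j Ψ' M') : inner ℂ Ψ' M = inner ℂ M' Ψ :=
  inner_congr_comp fun n => SectorMomentum.inner_symm (isMomentum_iff.1 h n)
    (isMomentum_iff.1 h' n)

end States

/-! ### Creation of hard pairs on full states. -/

section PairLift

variable {κ κ₁ κ₂ : Mode × Mode × ℝ → ℝ} {b b₁ b₂ : Mode × Mode → ℝ}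

/-- The components of the state obtained by creating a pair. -/
def pairComponents (hκ : IsPairKernel κ b) (Ψ : StateSpace) : ∀ n, Sector n
  | 0 => 0
  | 1 => 0
  | n + 2 => pairOp hκ (Ψ n)

theorem exists_pairLift (hκ : IsPairKernel κ b) (Ψ : StateSpace) :
    ∃ X : StateSpace, ∀ n, X n = pairComponents hκ Ψ n :=
  exists_state (summable_norm_sq_shift Ψ 0 2 fun n => norm_pairOp_sq_le hκ (Ψ n))

/-- The creation of a pair of photons with amplitude `κ`, harder than those already present. -/
def pairLift (hκ : IsPairKernel κ b) (Ψ : StateSpace) : StateSpace := (exists_pairLift hκ Ψ).choose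

theorem pairLift_zero (hκ : IsPairKernel κ b) (Ψ : StateSpace) : pairLift hκ Ψ 0 = 0 :=
  (exists_pairLift hκ Ψ).choose_spec 0

theorem pairLift_one (hκ : IsPairKernel κ b) (Ψ : StateSpace) : pairLift hκ Ψ 1 = 0 :=
  (exists_pairLift hκ Ψ).choose_spec 1

theorem pairLift_add_two (hκ : IsPairKernel κ b) (Ψ : StateSpace) (n : ℕ) :
    pairLift hκ Ψ (n + 2) = pairOp hκ (Ψ n) :=
  (exists_pairLift hκ Ψ).choose_spec (n + 2)

theorem norm_pairLift_sq_le (hκ : IsPairKernel κ b) (Ψ : StateSpace) :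
    ‖pairLift hκ Ψ‖ ^ 2 ≤ 2 * (∫ p, b p ^ 2 ∂(modeMeasure.prod modeMeasure)) * ‖Ψ‖ ^ 2 := by
  have h := (hasSum_nat_add_iff' 2).2 (hasSum_norm_sq (pairLift hκ Ψ))
  have e : ∑ i ∈ Finset.range 2, ‖pairLift hκ Ψ i‖ ^ 2 = 0 := by
    simp [Finset.sum_range_succ, pairLift_zero, pairLift_one]
  rw [e, sub_zero] at h
  refine hasSum_le (fun n => ?_) h ((hasSum_norm_sq Ψ).mul_left _)
  rw [pairLift_add_two]
  exact norm_pairOp_sq_le hκ (Ψ n)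

theorem norm_pairLift_le (hκ : IsPairKernel κ b) {N : ℝ} (hN0 : 0 ≤ N)
    (hN : ∫ p, b p ^ 2 ∂(modeMeasure.prod modeMeasure) ≤ N ^ 2) (Ψ : StateSpace) :
    ‖pairLift hκ Ψ‖ ≤ 2 * N * ‖Ψ‖ := by
  refine le_of_sq_le_sq ((norm_pairLift_sq_le hκ Ψ).trans ?_) (by positivity)
  -- √2 is rounded up to 2; the sharp constant is kept in `norm_pairLift_sq_le`.
  rw [mul_pow, mul_pow]
  gcongr
  norm_num

theorem pairLift_add_of_eq (hκ : IsPairKernel κ b) (hκ₁ : IsPairKernel κ₁ b₁)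
    (hκ₂ : IsPairKernel κ₂ b₂) (h : ∀ q q' t, κ (q, q', t) = κ₁ (q, q', t) + κ₂ (q, q', t))
    (Ψ : StateSpace) : pairLift hκ Ψ = pairLift hκ₁ Ψ + pairLift hκ₂ Ψ := by
  refine lp.ext (funext fun n => ?_)
  rw [lp.coeFn_add, Pi.add_apply]
  match n with
  | 0 => simp only [pairLift_zero, add_zero]
  | 1 => simp only [pairLift_one, add_zero]
  | n + 2 => simp only [pairLift_add_two]; exact pairOp_add_of_eq hκ hκ₁ hκ₂ h (Ψ n)

theorem IsSqrtFieldEnergy.pairLift (hκ : IsPairKernel κ b) (hκ₁ : IsPairKernel κ₁ b₁)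
    (hκ₂ : IsPairKernel κ₂ b₂)
    (h : ∀ q q' t, 0 ≤ t → Real.sqrt (‖q.1‖ + ‖q'.1‖ + t) * κ (q, q', t)
      = κ₁ (q, q', t) + Real.sqrt t * κ₂ (q, q', t))
    {Ψ F : StateSpace} (hF : IsSqrtFieldEnergy Ψ F) :
    IsSqrtFieldEnergy (pairLift hκ Ψ)
      (PauliFierz.pairLift hκ₁ Ψ + PauliFierz.pairLift hκ₂ F) := by
  rw [isSqrtFieldEnergy_iff] at hF ⊢
  intro n
  rw [lp.coeFn_add, Pi.add_apply]
  match n with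
  | 0 => simp only [pairLift_zero, add_zero]; exact SqrtEnergy.zero
  | 1 => simp only [pairLift_one, add_zero]; exact SqrtEnergy.zero
  | n + 2 => simp only [pairLift_add_two]; exact sqrtEnergy_pairOp hκ hκ₁ hκ₂ h (hF n)

theorem IsMomentum.pairLift {j : Fin 3} {Ψ M : StateSpace} (hM : IsMomentum j Ψ M)
    (hκ : IsPairKernel κ b) (hκ₁ : IsPairKernel κ₁ b₁)
    (h : ∀ q q' t, κ₁ (q, q', t) = κ (q, q', t) * (q.1 j + q'.1 j)) :
    IsMomentum j (pairLift hκ Ψ) (PauliFierz.pairLift hκ M - PauliFierz.pairLift hκ₁ Ψ) := by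
  rw [isMomentum_iff] at hM ⊢
  intro n
  rw [lp.coeFn_sub, Pi.sub_apply]
  match n with
  | 0 => simp only [pairLift_zero, sub_zero]; exact SectorMomentum.zero
  | 1 => simp only [pairLift_one, sub_zero]; exact SectorMomentum.zero
  | n + 2 => simp only [pairLift_add_two]; exact (hM n).pairOp hκ hκ₁ h

theorem inner_pairLift_eq (hκ : IsPairKernel κ b) (hκ₁ : IsPairKernel κ₁ b₁)
    (h : ∀ q q' t, 0 ≤ t → κ (q, q', t) = Real.sqrt (‖q.1‖ + ‖q'.1‖ + t) * κ₁ (q, q', t))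
    (Ψ : StateSpace) {Ψ' F' : StateSpace} (hF : IsSqrtFieldEnergy Ψ' F') :
    inner ℂ (pairLift hκ Ψ) Ψ' = inner ℂ (pairLift hκ₁ Ψ) F' := by
  rw [isSqrtFieldEnergy_iff] at hF
  refine inner_congr_comp fun n => ?_
  match n with
  | 0 => simp only [pairLift_zero, inner_zero_left]
  | 1 => simp only [pairLift_one, inner_zero_left]
  | n + 2 => simp only [pairLift_add_two]; exact inner_pairOp_eq hκ hκ₁ h (Ψ n) (hF (n + 2))

theorem hasSum_inner_pairLift (hκ : IsPairKernel κ b) (Ψ Ψ' : StateSpace) :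
    HasSum (fun n => inner ℂ (pairOp hκ (Ψ n)) (Ψ' (n + 2))) (inner ℂ (pairLift hκ Ψ) Ψ') := by
  have h := (hasSum_nat_add_iff' 2).2 (lp.hasSum_inner (𝕜 := ℂ) (pairLift hκ Ψ) Ψ')
  have e : ∑ i ∈ Finset.range 2, inner ℂ (pairLift hκ Ψ i) (Ψ' i) = 0 := by
    simp [Finset.sum_range_succ, pairLift_zero, pairLift_one]
  rw [e, sub_zero] at h
  simpa only [pairLift_add_two] using h

end PairLift

/-! ### Annihilation and creation parts of the vector potential on full states. -/

section FieldOperators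

variable {ε : R3 → Fin 2 → R3} {Λ : ℝ}

/-- `D_j Ψ = X`, in terms of components. -/
def IsAnnihilation (hε : IsPolarization ε) (Λ : ℝ) (j : Fin 3) (Ψ X : StateSpace) : Prop :=
  ∀ n, X n = annihilation hε Λ j n (Ψ (n + 1))

/-- `D_j^* Ψ = X`, in terms of components. -/
def IsCreation (hε : IsPolarization ε) (Λ : ℝ) (j : Fin 3) (Ψ X : StateSpace) : Prop :=
  X 0 = 0 ∧ ∀ n, X (n + 1) = creation hε Λ j n (Ψ n)

theorem IsAnnihilation.add {hε : IsPolarization ε} {j : Fin 3} {Ψ X Ψ' X' : StateSpace}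
    (h : IsAnnihilation hε Λ j Ψ X) (h' : IsAnnihilation hε Λ j Ψ' X') :
    IsAnnihilation hε Λ j (Ψ + Ψ') (X + X') := fun n => by
  simp only [lp.coeFn_add, Pi.add_apply, map_add, h n, h' n]

theorem IsAnnihilation.smul {hε : IsPolarization ε} {j : Fin 3} {Ψ X : StateSpace}
    (h : IsAnnihilation hε Λ j Ψ X) (c : ℂ) : IsAnnihilation hε Λ j (c • Ψ) (c • X) := fun n => by
  simp only [lp.coeFn_smul, Pi.smul_apply, map_smul, h n]

theorem exists_isAnnihilation (hε : IsPolarization ε) (hΛ : 0 < Λ) (j : Fin 3)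
    {Ψ F : StateSpace} (h : IsSqrtFieldEnergy Ψ F) : ∃ X, IsAnnihilation hε Λ j Ψ X :=
  exists_state (summable_norm_sq_shift F 1 0 fun n =>
    norm_annihilation_sq_le hε hΛ j (isSqrtFieldEnergy_iff.1 h (n + 1)))

theorem IsAnnihilation.norm_sq_le {hε : IsPolarization ε} (hΛ : 0 < Λ) {j : Fin 3}
    {Ψ F X : StateSpace} (hX : IsAnnihilation hε Λ j Ψ X) (h : IsSqrtFieldEnergy Ψ F) :
    ‖X‖ ^ 2 ≤ Λ * ‖F‖ ^ 2 := by
  have h1 := (hasSum_nat_add_iff' 1).2 ((hasSum_norm_sq F).mul_left (2 * Λ / Real.pi))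
  have h2 : ‖X‖ ^ 2 ≤ _ := hasSum_le (fun n => ?_) (hasSum_norm_sq X) h1
  · refine h2.trans ?_
    rw [Finset.sum_range_one, isSqrtFieldEnergy_iff.1 h 0 |>.eq_zero, norm_zero]
    have := two_mul_div_pi_le hΛ
    have h3 : 0 ≤ ‖F‖ ^ 2 := sq_nonneg _
    nlinarith
  · simp only
    rw [hX n]
    exact norm_annihilation_sq_le hε hΛ j (isSqrtFieldEnergy_iff.1 h (n + 1))

/-- The components of `D_j^* Ψ`. -/
def creationComponents (hε : IsPolarization ε) (Λ : ℝ) (j : Fin 3) (Ψ : StateSpace) :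
    ∀ n, Sector n
  | 0 => 0
  | n + 1 => creation hε Λ j n (Ψ n)

/-- By the commutation relation the norms of D^*Ψ are those of DΨ plus a multiple of those of Ψ, so
summability of DΨ suffices. -/
theorem exists_isCreation (hε : IsPolarization ε) (hΛ : 0 < Λ) (j : Fin 3) {Ψ Y : StateSpace}
    (hY : IsAnnihilation hε Λ j Ψ Y) : ∃ X, IsCreation hε Λ j Ψ X := by
  have hs : Summable fun n => ‖creationComponents hε Λ j Ψ n‖ ^ 2 := by
    refine (summable_nat_add_iff 2).1 ?_
    have h1 := ((summable_nat_add_iff 1).2 (hasSum_norm_sq Ψ).summable).mul_left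
      (∫ q, coupling ε Λ j q ^ 2 ∂modeMeasure)
    refine (h1.add (hasSum_norm_sq Y).summable).congr fun n => ?_
    rw [hY n]
    exact (norm_creation_succ_sq hε hΛ j (Ψ (n + 1))).symm
  obtain ⟨X, hX⟩ := exists_state hs
  exact ⟨X, hX 0, fun n => hX (n + 1)⟩

theorem IsCreation.norm_sq_eq {hε : IsPolarization ε} (hΛ : 0 < Λ) {j : Fin 3}
    {Ψ X Y : StateSpace} (hX : IsCreation hε Λ j Ψ X) (hY : IsAnnihilation hε Λ j Ψ Y) :
    ‖X‖ ^ 2 = (∫ q, coupling ε Λ j q ^ 2 ∂modeMeasure) * ‖Ψ‖ ^ 2 + ‖Y‖ ^ 2 := by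
  have h1 := (hasSum_nat_add_iff' 1).2 (hasSum_norm_sq X)
  rw [Finset.sum_range_one, hX.1, norm_zero] at h1
  simp only [hX.2] at h1
  have h2 : HasSum (fun n => ‖creation hε Λ j n (Ψ n)‖ ^ 2
      - (∫ q, coupling ε Λ j q ^ 2 ∂modeMeasure) * ‖Ψ n‖ ^ 2) _ :=
    h1.sub ((hasSum_norm_sq Ψ).mul_left (∫ q, coupling ε Λ j q ^ 2 ∂modeMeasure))
  have h3 := (hasSum_nat_add_iff' 1).2 h2
  rw [Finset.sum_range_one, norm_creation_zero_sq hε hΛ j (Ψ 0)] at h3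
  have e : ∀ n, ‖creation hε Λ j (n + 1) (Ψ (n + 1))‖ ^ 2
      - (∫ q, coupling ε Λ j q ^ 2 ∂modeMeasure) * ‖Ψ (n + 1)‖ ^ 2 = ‖Y n‖ ^ 2 := fun n => by
    rw [norm_creation_succ_sq hε hΛ j (Ψ (n + 1)), hY n]; ring
  simp only [e] at h3
  have h4 := h3.unique (hasSum_norm_sq Y)
  linarith

theorem hasSum_inner_creation {hε : IsPolarization ε} {j : Fin 3} {Ψ X : StateSpace}
    (hX : IsCreation hε Λ j Ψ X) (M : StateSpace) :
    HasSum (fun n => inner ℂ (creation hε Λ j n (Ψ n)) (M (n + 1))) (inner ℂ X M) := by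
  have h := (hasSum_nat_add_iff' 1).2 (lp.hasSum_inner (𝕜 := ℂ) X M)
  rw [Finset.sum_range_one, hX.1, inner_zero_left, sub_zero] at h
  simpa only [hX.2] using h

/-- Commutation of the momentum with the transverse vector potential, in the weak sense. -/
theorem sum_inner_isCreation_momentum (hε : IsPolarization ε) {Ψ : StateSpace}
    {M X Y : Fin 3 → StateSpace} (hM : ∀ j, IsMomentum j Ψ (M j))
    (hX : ∀ j, IsCreation hε Λ j Ψ (X j)) (hY : ∀ j, IsAnnihilation hε Λ j Ψ (Y j)) :
    ∑ j, inner ℂ (X j) (M j) = ∑ j, inner ℂ (M j) (Y j) := by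
  have h1 := hasSum_sum (s := Finset.univ) fun j (_ : j ∈ Finset.univ) =>
    hasSum_inner_creation (hX j) (M j)
  have h2 := hasSum_sum (s := Finset.univ) fun j (_ : j ∈ Finset.univ) =>
    lp.hasSum_inner (𝕜 := ℂ) (M j) (Y j)
  refine h1.unique ?_
  refine Eq.subst (motive := fun f => HasSum f _) (funext fun n => ?_) h2
  simp only [hY _ n]
  exact Eq.symm <| sum_inner_creation_momentum hε Λ (fun j => isMomentum_iff.1 (hM j) n)
    (fun j => isMomentum_iff.1 (hM j) (n + 1))

theorem norm_sum_inner_isCreation_sub_le (hε : IsPolarization ε) (hΛ : 0 < Λ) {Ψ F : StateSpace}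
    (hF : IsSqrtFieldEnergy Ψ F) {X Y : Fin 3 → StateSpace}
    (hX : ∀ j, IsCreation hε Λ j Ψ (X j)) (hY : ∀ j, IsAnnihilation hε Λ j Ψ (Y j)) :
    ‖∑ j, inner ℂ (X j) (Y j) - inner ℂ (pairLift (isPairKernel_pairAmp hε Λ) Ψ) Ψ‖
      ≤ 2 * Λ * (‖F‖ * ‖F‖) := by
  have h1 := hasSum_sum (s := Finset.univ) fun j (_ : j ∈ Finset.univ) =>
    hasSum_inner_creation (hX j) (Y j)
  have h2 := h1.sub (hasSum_inner_pairLift (isPairKernel_pairAmp hε Λ) Ψ Ψ)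
  refine norm_le_of_hasSum (x := fun n => ‖F n‖) (y := fun n => ‖F (n + 2)‖) h2 (by positivity)
    (norm_nonneg _) (fun s => sum_norm_sq_le F s 0) (norm_nonneg _)
    (fun s => sum_norm_sq_le F s 2) fun n => ?_
  simp only [hY _ (n + 1)]
  exact norm_sum_inner_creation_annihilation_sub_le hε hΛ (isSqrtFieldEnergy_iff.1 hF n)
    (isSqrtFieldEnergy_iff.1 hF (n + 2))

theorem norm_inner_pairLift_annihilation_le (hε : IsPolarization ε) (hΛ : 0 < Λ) (j : Fin 3)
    {κ φ : Mode × Mode × ℝ → ℝ} {b b' : Mode × Mode → ℝ}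
    (hκ : IsPairKernel κ b) (hφ : IsPairKernel φ b') {M M' N N' : ℝ} (hM : HasRowBound Λ b M)
    (hM' : HasRowBound Λ b' M') (h0 : 0 ≤ M) (h0' : 0 ≤ M') (hN0 : 0 ≤ N) (hN0' : 0 ≤ N')
    (hN : ∫ p, b p ^ 2 ∂(modeMeasure.prod modeMeasure) ≤ N ^ 2)
    (hN' : ∫ p, b' p ^ 2 ∂(modeMeasure.prod modeMeasure) ≤ N' ^ 2)
    (Ψ : StateSpace) {Ψ' F' Y : StateSpace} (hF : IsSqrtFieldEnergy Ψ' F')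
    (hY : IsAnnihilation hε Λ j (pairLift hφ Ψ') Y) :
    ‖inner ℂ (pairLift hκ Ψ) Y‖ ≤ 2 * (N * N' + 2 * M * M') * Real.sqrt Λ * (‖Ψ‖ * ‖F'‖) := by
  refine norm_le_of_hasSum (x := fun n => ‖Ψ n‖) (y := fun n => ‖F' (n + 1)‖)
    (hasSum_inner_pairLift hκ Ψ Y) (by positivity) (norm_nonneg _)
    (fun s => sum_norm_sq_le Ψ s 0) (norm_nonneg _) (fun s => sum_norm_sq_le F' s 1) fun n => ?_
  rw [hY (n + 2), pairLift_add_two]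
  exact norm_inner_pairOp_annihilation_le hε hΛ j hκ hφ hM hM' h0 h0' hN0 hN0' hN hN' (Ψ n)
    (isSqrtFieldEnergy_iff.1 hF (n + 1))

theorem sectorFn_annihilation (hε : IsPolarization ε) (hΛ : 0 < Λ) (j : Fin 3)
    (ψ : Sector (n + 1)) :
    sectorFn (annihilation hε Λ j n ψ) =ᵐ[sectorMeasure n] annihFn ε Λ j (sectorFn ψ) := by
  obtain ⟨u, hu⟩ := exists_represents ψ
  exact (hu.annihilation hε hΛ j).ae_eq.trans (annihFn_congr_ae ε Λ j hu.ae_eq).symm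

theorem sectorFn_creation (hε : IsPolarization ε) (Λ : ℝ) (j : Fin 3) (ψ : Sector n) :
    sectorFn (creation hε Λ j n ψ) =ᵐ[sectorMeasure (n + 1)] creationFn ε Λ j (sectorFn ψ) := by
  obtain ⟨u, hu⟩ := exists_represents ψ
  exact (hu.creation hε Λ j).ae_eq.trans (creationFn_congr_ae ε Λ j hu.ae_eq).symm

theorem sectorFn_ae_eq_iff {ψ φ : Sector n} {u : Point n → ℂ}
    (h : sectorFn φ =ᵐ[sectorMeasure n] u) :
    (∀ᵐ z ∂(sectorMeasure n), sectorFn ψ z = u z) ↔ ψ = φ := by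
  constructor
  · intro h1
    exact Subtype.ext (Lp.ext (Filter.EventuallyEq.trans h1 h.symm))
  · rintro rfl
    exact h

theorem sectorFn_add (ψ φ : Sector n) :
    sectorFn (ψ + φ) =ᵐ[sectorMeasure n] fun z => sectorFn ψ z + sectorFn φ z :=
  Lp.coeFn_add (ψ : Lp ℂ 2 (sectorMeasure n)) φ

/-- The vector potential is the sum of its annihilation and creation parts. -/
theorem isVectorPotential_iff {hε : IsPolarization ε} (hΛ : 0 < Λ) {j : Fin 3} {Ψ X Y : StateSpace}
    (hX : IsCreation hε Λ j Ψ X) (hY : IsAnnihilation hε Λ j Ψ Y) (B : StateSpace) :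
    IsVectorPotential ε Λ j Ψ B ↔ B = Y + X := by
  have key : ∀ n, (∀ᵐ q ∂(sectorMeasure n), PauliFierz.comp B n q.1 q.2
      = vectorPotential ε Λ j q.1 (fun m => PauliFierz.comp Ψ m q.1) n q.2)
      ↔ B n = (Y + X) n := fun n => by
    rw [lp.coeFn_add, Pi.add_apply]
    match n with
    | 0 =>
      rw [hX.1, add_zero, hY 0]
      exact sectorFn_ae_eq_iff (sectorFn_annihilation hε hΛ j (Ψ 1))
    | n + 1 =>
      refine sectorFn_ae_eq_iff ((sectorFn_add _ _).trans ?_)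
      rw [hY (n + 1), hX.2 n]
      filter_upwards [sectorFn_annihilation hε hΛ j (Ψ (n + 2)),
        sectorFn_creation hε Λ j (Ψ n)] with z h1 h2
      rw [h1, h2]
      rfl
  constructor
  · intro h
    exact lp.ext (funext fun n => (key n).1 (h n))
  · rintro rfl n
    exact (key n).2 rfl

end FieldOperators

end

/-! ### Expansion of the energy and the corrector state. -/

section

section Hilbert

variable {H : Type*} [NormedAddCommGroup H] [InnerProductSpace ℂ H]

theorem re_inner_comm (x y : H) : (inner ℂ x y).re = (inner ℂ y x).re := by
  rw [← inner_conj_symm, Complex.conj_re]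

theorem norm_sq_add (x y : H) : ‖x + y‖ ^ 2 = ‖x‖ ^ 2 + 2 * (inner ℂ x y).re + ‖y‖ ^ 2 :=
  norm_add_sq (𝕜 := ℂ) x y

theorem inner_real_smul_right (r : ℝ) (x y : H) :
    (inner ℂ x ((r : ℂ) • y)).re = r * (inner ℂ x y).re := by
  rw [inner_smul_right, Complex.re_ofReal_mul]

theorem norm_real_smul_sq (r : ℝ) (x : H) : ‖(r : ℂ) • x‖ ^ 2 = r ^ 2 * ‖x‖ ^ 2 := by
  rw [norm_smul, mul_pow, Complex.norm_real, Real.norm_eq_abs, sq_abs]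

theorem re_inner_le (x y : H) : (inner ℂ x y).re ≤ ‖x‖ * ‖y‖ :=
  (Complex.re_le_norm _).trans (norm_inner_le_norm x y)

theorem neg_re_inner_le (x y : H) : -(inner ℂ x y).re ≤ ‖x‖ * ‖y‖ :=
  (neg_le_abs _).trans ((Complex.abs_re_le_norm _).trans (norm_inner_le_norm x y))

/-- Expansion of the kinetic energy `‖(p + √α (D + D^*)) Ψ‖²`. -/
theorem sum_norm_kinetic_sq {M X Y : Fin 3 → H} {x : ℝ} {c : Fin 3 → ℝ} {α : ℝ} (hα : 0 ≤ α)
    (h1 : ∀ j, ‖X j‖ ^ 2 = c j * x + ‖Y j‖ ^ 2)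
    (h2 : ∑ j, inner ℂ (X j) (M j) = ∑ j, inner ℂ (M j) (Y j)) :
    ∑ j, ‖M j + (Real.sqrt α : ℂ) • (Y j + X j)‖ ^ 2
      = ∑ j, ‖M j‖ ^ 2 + α * (2 * ∑ j, ‖Y j‖ ^ 2 + (∑ j, c j) * x
        + 2 * (∑ j, inner ℂ (X j) (Y j)).re) + 4 * Real.sqrt α * (∑ j, inner ℂ (M j) (Y j)).re := by
  have e : ∀ j, ‖M j + (Real.sqrt α : ℂ) • (Y j + X j)‖ ^ 2 = ‖M j‖ ^ 2
      + 2 * Real.sqrt α * ((inner ℂ (M j) (Y j)).re + (inner ℂ (X j) (M j)).re)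
      + α * (2 * ‖Y j‖ ^ 2 + c j * x + 2 * (inner ℂ (X j) (Y j)).re) := fun j => by
    rw [norm_sq_add, inner_real_smul_right, norm_real_smul_sq, norm_sq_add, inner_add_right,
      Complex.add_re, re_inner_comm (M j) (X j), re_inner_comm (Y j) (X j), h1, Real.sq_sqrt hα]
    ring
  have h3 := congrArg Complex.re h2
  simp only [Fin.sum_univ_three, Complex.add_re] at h3 ⊢
  rw [e, e, e]
  linear_combination (2 * Real.sqrt α) * h3

/-- `‖x + y‖² ≤ (1 + τ) ‖x‖² + (1 + 1/τ) ‖y‖²`. -/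
theorem norm_add_sq_le (x y : H) {τ : ℝ} (hτ : 0 < τ) :
    ‖x + y‖ ^ 2 ≤ (1 + τ) * ‖x‖ ^ 2 + (1 + τ⁻¹) * ‖y‖ ^ 2 := by
  have h1 : 2 * (‖x‖ * ‖y‖) ≤ τ * ‖x‖ ^ 2 + τ⁻¹ * ‖y‖ ^ 2 := by
    have h := mul_nonneg (inv_nonneg.2 hτ.le) (sq_nonneg (τ * ‖x‖ - ‖y‖))
    have e : τ⁻¹ * (τ * ‖x‖ - ‖y‖) ^ 2
        = τ * ‖x‖ ^ 2 - 2 * (‖x‖ * ‖y‖) + τ⁻¹ * ‖y‖ ^ 2 := by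
      field_simp
      ring
    linarith
  have h2 := re_inner_le x y
  rw [norm_sq_add]
  linarith

end Hilbert

theorem IsPairKernel.add {κ κ' : Mode × Mode × ℝ → ℝ} {b b' : Mode × Mode → ℝ}
    (h : IsPairKernel κ b) (h' : IsPairKernel κ' b') :
    IsPairKernel (fun y => κ y + κ' y) fun p => b p + b' p where
  measurable := h.measurable.add h'.measurable
  measurable_bound := h.measurable_bound.add h'.measurable_bound
  abs_le q q' t ht := (abs_add_le _ _).trans (add_le_add (h.abs_le q q' t ht) (h'.abs_le q q' t ht))
  integrable := by
    have h1 := (memLp_two_iff_integrable_sq h.measurable_bound.aestronglyMeasurable).2 h.integrable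
    have h2 := (memLp_two_iff_integrable_sq
      h'.measurable_bound.aestronglyMeasurable).2 h'.integrable
    exact (h1.add h2).integrable_sq

section HardPair

variable {ε : R3 → Fin 2 → R3} {Λ : ℝ}

/-- The amplitude is φ times its denominator, written as energy plus three squared momenta, so that
each term can be matched with one part of the free form. -/
theorem pairAmp_eq_add (ε : R3 → Fin 2 → R3) (Λ : ℝ) (q q' : Mode) :
    pairAmp ε Λ q q' = pairPhi ε Λ q q' * pairEnergy q q'
      + pairPhi ε Λ q q' * (q.1 0 + q'.1 0) * (q.1 0 + q'.1 0)
      + pairPhi ε Λ q q' * (q.1 1 + q'.1 1) * (q.1 1 + q'.1 1)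
      + pairPhi ε Λ q q' * (q.1 2 + q'.1 2) * (q.1 2 + q'.1 2) := by
  rw [← pairPhi_mul_denom, pairDenom, EuclideanSpace.real_norm_sq_eq, Fin.sum_univ_three]
  simp only [PiLp.add_apply]
  ring

theorem pairLift_pairAmp (hε : IsPolarization ε) (Λ : ℝ) (Ψ : StateSpace) :
    pairLift (isPairKernel_pairAmp hε Λ) Ψ = pairLift (isPairKernel_phi_energy hε Λ) Ψ
      + ∑ j, pairLift (isPairKernel_phi_coord_sq hε Λ j) Ψ := by
  have k1 := (isPairKernel_phi_energy hε Λ).add (isPairKernel_phi_coord_sq hε Λ 0)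
  have k2 := k1.add (isPairKernel_phi_coord_sq hε Λ 1)
  rw [pairLift_add_of_eq (isPairKernel_pairAmp hε Λ) k2 (isPairKernel_phi_coord_sq hε Λ 2)
      (fun q q' t => pairAmp_eq_add ε Λ q q'),
    pairLift_add_of_eq k2 k1 (isPairKernel_phi_coord_sq hε Λ 1) (fun q q' t => rfl),
    pairLift_add_of_eq k1 (isPairKernel_phi_energy hε Λ) (isPairKernel_phi_coord_sq hε Λ 0)
      (fun q q' t => rfl), Fin.sum_univ_three]
  abel

theorem pairEnergy_eq_zero_left {q q' : Mode} {t : ℝ} (ht : 0 ≤ t)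
    (h : Real.sqrt (pairEnergy q q' + t) = 0) : ‖q.1‖ = 0 ∧ pairEnergy q q' = 0 := by
  have h0 := (Real.sqrt_eq_zero (add_nonneg (pairEnergy_nonneg q q') ht)).1 h
  have h1 := pairEnergy_nonneg q q'
  have h2 : pairEnergy q q' = 0 := by linarith
  have h3 := norm_nonneg q.1
  have h4 := norm_nonneg q'.1
  refine ⟨?_, h2⟩
  unfold pairEnergy at h2
  linarith

/-- The square root of the field energy of the hard pair state. -/
def pairSqrtEnergy (hε : IsPolarization ε) (Λ : ℝ) (Ψ F : StateSpace) : StateSpace :=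
  pairLift (isPairKernel_phi_sqrt hε Λ) Ψ + pairLift (isPairKernel_phi_ratio hε Λ) F

/-- The momentum of the hard pair state. -/
def pairMomentum (hε : IsPolarization ε) (Λ : ℝ) (j : Fin 3) (Ψ M : StateSpace) : StateSpace :=
  pairLift (isPairKernel_phi hε Λ) M - pairLift (isPairKernel_phi_coord hε Λ j) Ψ

theorem isSqrtFieldEnergy_pairLift (hε : IsPolarization ε) (Λ : ℝ) {Ψ F : StateSpace}
    (hF : IsSqrtFieldEnergy Ψ F) :
    IsSqrtFieldEnergy (pairLift (isPairKernel_phi hε Λ) Ψ) (pairSqrtEnergy hε Λ Ψ F) := by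
  refine hF.pairLift _ _ _ fun q q' t ht => ?_
  change Real.sqrt (pairEnergy q q' + t) * pairPhi ε Λ q q'
    = pairPhi ε Λ q q' * pairEnergy q q' / Real.sqrt (pairEnergy q q' + t)
      + Real.sqrt t * (pairPhi ε Λ q q' * Real.sqrt t / Real.sqrt (pairEnergy q q' + t))
  by_cases h : Real.sqrt (pairEnergy q q' + t) = 0
  · rw [h]; simp
  · field_simp
    rw [Real.sq_sqrt (add_nonneg (pairEnergy_nonneg q q') ht), Real.sq_sqrt ht]
    ring

theorem isMomentum_pairLift (hε : IsPolarization ε) (Λ : ℝ) {j : Fin 3} {Ψ M : StateSpace}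
    (hM : IsMomentum j Ψ M) :
    IsMomentum j (pairLift (isPairKernel_phi hε Λ) Ψ) (pairMomentum hε Λ j Ψ M) :=
  hM.pairLift _ _ fun _ _ _ => rfl

theorem norm_pairLift_phi_le (hε : IsPolarization ε) (hΛ : 0 < Λ) (Ψ : StateSpace) :
    ‖pairLift (isPairKernel_phi hε Λ) Ψ‖ ≤ 2 * Λ * ‖Ψ‖ :=
  norm_pairLift_le _ hΛ.le (integral_phi_sq_le hε hΛ) Ψ

theorem norm_pairLift_ratio_le (hε : IsPolarization ε) (hΛ : 0 < Λ) (Ψ : StateSpace) :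
    ‖pairLift (isPairKernel_phi_ratio hε Λ) Ψ‖ ≤ 2 * Λ * ‖Ψ‖ :=
  norm_pairLift_le _ hΛ.le (integral_phi_sq_le hε hΛ) Ψ

theorem norm_pairLift_coord_div_le (hε : IsPolarization ε) (hΛ : 0 < Λ) (j : Fin 3)
    (Ψ : StateSpace) :
    ‖pairLift (isPairKernel_phi_coord_div hε Λ j) Ψ‖ ≤ 2 * Λ * ‖Ψ‖ :=
  norm_pairLift_le _ hΛ.le (integral_phi_coord_div_sq_le hε hΛ j) Ψ

/-- Half a power of H_f is carried from F back to Ψ, so that the φE part of D^*·D^* appears; only a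
term quadratic in F is left over. -/
theorem inner_pairSqrtEnergy (hε : IsPolarization ε) (Λ : ℝ) {Ψ F : StateSpace}
    (hF : IsSqrtFieldEnergy Ψ F) :
    inner ℂ (pairSqrtEnergy hε Λ Ψ F) F = inner ℂ (pairLift (isPairKernel_phi_energy hε Λ) Ψ) Ψ
      + inner ℂ (pairLift (isPairKernel_phi_ratio hε Λ) F) F := by
  rw [pairSqrtEnergy, inner_add_left]
  congr 1
  refine (inner_pairLift_eq _ _ (fun q q' t ht => ?_) Ψ hF).symm
  change pairPhi ε Λ q q' * pairEnergy q q' = Real.sqrt (pairEnergy q q' + t) *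
    (pairPhi ε Λ q q' * pairEnergy q q' / Real.sqrt (pairEnergy q q' + t))
  by_cases h : Real.sqrt (pairEnergy q q' + t) = 0
  · rw [(pairEnergy_eq_zero_left ht h).2]; simp
  · field_simp

/-- Symmetry of p_j produces the φP_j² part of D^*·D^*. In the cross term of M with Ψ half a power
of H_f is moved to Ψ: it becomes a pairing of M with F and is quadratic in small quantities. -/
theorem inner_pairMomentum (hε : IsPolarization ε) (Λ : ℝ) {j : Fin 3} {Ψ F M : StateSpace}
    (hF : IsSqrtFieldEnergy Ψ F) (hM : IsMomentum j Ψ M) :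
    inner ℂ (pairMomentum hε Λ j Ψ M) M
      = inner ℂ (pairLift (isPairKernel_phi_coord_sq hε Λ j) Ψ) Ψ
        + inner ℂ (pairLift (isPairKernel_phi hε Λ) M) M
        - inner ℂ (pairLift (isPairKernel_phi_coord_div hε Λ j) M) F := by
  have h1 := hM.inner_symm (hM.pairLift (isPairKernel_phi_coord hε Λ j)
    (isPairKernel_phi_coord_sq hε Λ j) fun _ _ _ => rfl)
  have h2 : inner ℂ (pairLift (isPairKernel_phi_coord hε Λ j) M) Ψ
      = inner ℂ (pairLift (isPairKernel_phi_coord_div hε Λ j) M) F := by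
    refine inner_pairLift_eq _ _ (fun q q' t ht => ?_) M hF
    change pairPhi ε Λ q q' * (q.1 j + q'.1 j) = Real.sqrt (pairEnergy q q' + t) *
      (pairPhi ε Λ q q' * (q.1 j + q'.1 j) / Real.sqrt (pairEnergy q q' + t))
    by_cases h : Real.sqrt (pairEnergy q q' + t) = 0
    · rw [pairPhi_eq_zero_left (pairEnergy_eq_zero_left ht h).1]; simp
    · field_simp
  rw [inner_sub_left] at h1
  rw [pairMomentum, inner_sub_left, h1, h2]
  ring

/-- The pairing with `D^* · D^* Ψ` is, up to small terms, the pairing with the hard pair state in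
the free form. -/
theorem norm_inner_pairAmp_sub_le (hε : IsPolarization ε) (hΛ : 0 < Λ) {Ψ F : StateSpace}
    {M : Fin 3 → StateSpace} (hF : IsSqrtFieldEnergy Ψ F) (hM : ∀ j, IsMomentum j Ψ (M j)) :
    ‖inner ℂ (pairLift (isPairKernel_pairAmp hε Λ) Ψ) Ψ
      - (∑ j, inner ℂ (pairMomentum hε Λ j Ψ (M j)) (M j)
        + inner ℂ (pairSqrtEnergy hε Λ Ψ F) F)‖ ≤ 5 * Λ * (∑ j, ‖M j‖ ^ 2 + ‖F‖ ^ 2) := by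
  have e : inner ℂ (pairLift (isPairKernel_pairAmp hε Λ) Ψ) Ψ
      - (∑ j, inner ℂ (pairMomentum hε Λ j Ψ (M j)) (M j)
        + inner ℂ (pairSqrtEnergy hε Λ Ψ F) F)
      = ∑ j, (inner ℂ (pairLift (isPairKernel_phi_coord_div hε Λ j) (M j)) F
          - inner ℂ (pairLift (isPairKernel_phi hε Λ) (M j)) (M j))
        - inner ℂ (pairLift (isPairKernel_phi_ratio hε Λ) F) F := by
    have e1 := fun j => inner_pairMomentum hε Λ hF (hM j)
    rw [inner_pairSqrtEnergy hε Λ hF, pairLift_pairAmp hε Λ Ψ, inner_add_left]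
    simp only [e1]
    simp only [Fin.sum_univ_three, inner_add_left]
    ring
  rw [e]
  have b1 : ∀ j, ‖inner ℂ (pairLift (isPairKernel_phi_coord_div hε Λ j) (M j)) F
      - inner ℂ (pairLift (isPairKernel_phi hε Λ) (M j)) (M j)‖
      ≤ Λ * (3 * ‖M j‖ ^ 2 + ‖F‖ ^ 2) := fun j => by
    have h1 := (norm_inner_le_norm (𝕜 := ℂ) (pairLift (isPairKernel_phi_coord_div hε Λ j) (M j))
      F).trans (mul_le_mul_of_nonneg_right (norm_pairLift_coord_div_le hε hΛ j (M j))
        (norm_nonneg F))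
    have h2 := (norm_inner_le_norm (𝕜 := ℂ) (pairLift (isPairKernel_phi hε Λ) (M j))
      (M j)).trans (mul_le_mul_of_nonneg_right (norm_pairLift_phi_le hε hΛ (M j))
        (norm_nonneg (M j)))
    refine (norm_sub_le _ _).trans ((add_le_add h1 h2).trans ?_)
    have h3 : 0 ≤ Λ * (‖M j‖ - ‖F‖) ^ 2 := by positivity
    nlinarith
  have b2 : ‖inner ℂ (pairLift (isPairKernel_phi_ratio hε Λ) F) F‖ ≤ 2 * Λ * ‖F‖ * ‖F‖ :=
    (norm_inner_le_norm (𝕜 := ℂ) _ F).trans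
      (mul_le_mul_of_nonneg_right (norm_pairLift_ratio_le hε hΛ F) (norm_nonneg F))
  refine (norm_sub_le _ _).trans ((add_le_add ((norm_sum_le _ _).trans
    (Finset.sum_le_sum fun j _ => b1 j)) b2).trans ?_)
  simp only [Fin.sum_univ_three]
  have h : 0 ≤ Λ * (‖M 0‖ ^ 2 + ‖M 1‖ ^ 2 + ‖M 2‖ ^ 2) := by positivity
  nlinarith

/-- The free energy of the hard pair state. -/
theorem pair_free_energy_le (hε : IsPolarization ε) (hΛ : 0 < Λ) (Ψ F : StateSpace)
    (M : Fin 3 → StateSpace) {τ : ℝ} (hτ : 0 < τ) :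
    ∑ j, ‖pairMomentum hε Λ j Ψ (M j)‖ ^ 2 + ‖pairSqrtEnergy hε Λ Ψ F‖ ^ 2
      ≤ (1 + τ) * (pairSelfEnergy ε Λ * ‖Ψ‖ ^ 2)
        + (1 + τ⁻¹) * (4 * Λ ^ 2 * (∑ j, ‖M j‖ ^ 2 + ‖F‖ ^ 2)) := by
  have hτ1 : 0 ≤ 1 + τ := by positivity
  have hτ2 : 0 ≤ 1 + τ⁻¹ := by positivity
  have b1 : ∀ j, ‖pairMomentum hε Λ j Ψ (M j)‖ ^ 2
      ≤ (1 + τ) * ((2 * ∫ p : Mode × Mode, |pairPhi ε Λ p.1 p.2 * (p.1.1 j + p.2.1 j)| ^ 2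
        ∂(modeMeasure.prod modeMeasure)) * ‖Ψ‖ ^ 2)
        + (1 + τ⁻¹) * (4 * Λ ^ 2 * ‖M j‖ ^ 2) := fun j => by
    rw [pairMomentum, sub_eq_neg_add]
    refine (norm_add_sq_le _ _ hτ).trans ?_
    rw [norm_neg]
    refine add_le_add (mul_le_mul_of_nonneg_left (norm_pairLift_sq_le _ _) hτ1)
      (mul_le_mul_of_nonneg_left ?_ hτ2)
    refine (pow_le_pow_left₀ (norm_nonneg _) (norm_pairLift_phi_le hε hΛ (M j)) 2).trans_eq ?_
    ring
  have b2 : ‖pairSqrtEnergy hε Λ Ψ F‖ ^ 2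
      ≤ (1 + τ) * ((2 * ∫ p : Mode × Mode, (|pairPhi ε Λ p.1 p.2|
        * Real.sqrt (pairEnergy p.1 p.2)) ^ 2 ∂(modeMeasure.prod modeMeasure)) * ‖Ψ‖ ^ 2)
        + (1 + τ⁻¹) * (4 * Λ ^ 2 * ‖F‖ ^ 2) := by
    rw [pairSqrtEnergy]
    refine (norm_add_sq_le _ _ hτ).trans ?_
    refine add_le_add (mul_le_mul_of_nonneg_left (norm_pairLift_sq_le _ _) hτ1)
      (mul_le_mul_of_nonneg_left ?_ hτ2)
    refine (pow_le_pow_left₀ (norm_nonneg _) (norm_pairLift_ratio_le hε hΛ F) 2).trans_eq ?_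
    ring
  refine (add_le_add (Finset.sum_le_sum fun j _ => b1 j) b2).trans_eq ?_
  -- The constants of the three momentum parts and of the energy part add up to `pairSelfEnergy`: no
  -- loss besides the factor 1 + τ.
  rw [← sum_integral_sq_eq hε Λ]
  simp only [Fin.sum_univ_three]
  ring

/-- pΘ consists of Θ built on M, which costs Λ^{5/2}‖M‖‖F‖, and of the pair with amplitude φP_j
built on Ψ, which costs Λ³‖Ψ‖‖F‖. Each j contributes the constant 6 = 2(1 + 2). -/
theorem norm_sum_inner_pairMomentum_le (hε : IsPolarization ε) (hΛ : 0 < Λ) {Ψ F : StateSpace}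
    (M Y : Fin 3 → StateSpace) (hF : IsSqrtFieldEnergy Ψ F)
    (hY : ∀ j, IsAnnihilation hε Λ j (pairLift (isPairKernel_phi hε Λ) Ψ) (Y j)) :
    ‖∑ j, inner ℂ (pairMomentum hε Λ j Ψ (M j)) (Y j)‖
      ≤ 18 * Λ ^ 3 * (‖Ψ‖ * ‖F‖)
        + 9 * (Λ ^ 2 * Real.sqrt Λ) * (∑ j, ‖M j‖ ^ 2 + ‖F‖ ^ 2) := by
  have hs := Real.mul_self_sqrt hΛ.le
  have b1 : ∀ j, ‖inner ℂ (pairMomentum hε Λ j Ψ (M j)) (Y j)‖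
      ≤ 6 * Λ ^ 3 * (‖Ψ‖ * ‖F‖) + 3 * (Λ ^ 2 * Real.sqrt Λ) * (‖M j‖ ^ 2 + ‖F‖ ^ 2) := fun j => by
    rw [pairMomentum, inner_sub_left]
    have h1 := norm_inner_pairLift_annihilation_le hε hΛ j (isPairKernel_phi hε Λ)
      (isPairKernel_phi hε Λ) (hasRowBound_phi hε hΛ) (hasRowBound_phi hε hΛ) hΛ.le hΛ.le hΛ.le
      hΛ.le (integral_phi_sq_le hε hΛ) (integral_phi_sq_le hε hΛ) (M j) hF (hY j)
    have hc : 0 ≤ Λ * Real.sqrt Λ := by positivity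
    have h2 := norm_inner_pairLift_annihilation_le hε hΛ j (isPairKernel_phi_coord hε Λ j)
      (isPairKernel_phi hε Λ) (hasRowBound_phi_coord hε hΛ j) (hasRowBound_phi hε hΛ) hc hΛ.le hc
      hΛ.le (integral_phi_coord_sq_le hε hΛ j) (integral_phi_sq_le hε hΛ) Ψ hF (hY j)
    have e2 : 2 * (Λ * Real.sqrt Λ * Λ + 2 * (Λ * Real.sqrt Λ) * Λ) * Real.sqrt Λ
        * (‖Ψ‖ * ‖F‖) = 6 * Λ ^ 3 * (‖Ψ‖ * ‖F‖) := by
      linear_combination (6 * Λ ^ 2 * (‖Ψ‖ * ‖F‖)) * hs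
    have h3 : 0 ≤ 3 * (Λ ^ 2 * Real.sqrt Λ) * (‖M j‖ - ‖F‖) ^ 2 := by positivity
    refine (norm_sub_le _ _).trans ((add_le_add h1 (h2.trans_eq e2)).trans ?_)
    nlinarith
  refine (norm_sum_le _ _).trans ((Finset.sum_le_sum fun j _ => b1 j).trans ?_)
  simp only [Fin.sum_univ_three]
  have h : 0 ≤ Λ ^ 2 * Real.sqrt Λ * (‖M 0‖ ^ 2 + ‖M 1‖ ^ 2 + ‖M 2‖ ^ 2) := by positivity
  nlinarith

end HardPair

end

/-! ### The lower bound. -/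

section

section Reals

/-- Young's inequality for the interaction of the momentum with the field. -/
theorem young_add_le {r a c x y : ℝ} (hc : 0 < c) :
    4 * (r * (x * (a * y))) ≤ c * x ^ 2 + 4 * c⁻¹ * (r ^ 2 * a ^ 2) * y ^ 2 := by
  have h := mul_nonneg (inv_nonneg.2 hc.le) (sq_nonneg (c * x - 2 * (r * a * y)))
  have e : c⁻¹ * (c * x - 2 * (r * a * y)) ^ 2
      = c * x ^ 2 + 4 * c⁻¹ * (r ^ 2 * a ^ 2) * y ^ 2 - 4 * (r * (x * (a * y))) := by
    field_simp
    ring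
  linarith

/-- The final step of the lower bound: `τ = αΛ` is small, `y = α³Λ⁴‖Ψ‖²`, `e = α²𝓔₀‖Ψ‖²`. -/
theorem lower_bound_of_estimates {t n N m f a e y g τ w : ℝ} (hτ : 0 < τ) (hτ1 : τ ≤ 1 / 1000)
    (hn : 0 ≤ n) (hm : 0 ≤ m) (hf : 0 ≤ f) (hN : N = m + f)
    (hy : 0 ≤ y) (hey : τ * e ≤ y) (ha : a ≤ e + y + (4 * τ ^ 2 + 4 * τ) * n)
    (hnN : n ≤ 2 * N + 2 * a) (ht : N - a + g - 14 * τ * n - w ≤ t)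
    (hw : w ≤ m / 2 + 48 * τ * f + f / 8 + 144 * τ * a + 36 * τ * n + 36 * (y + τ ^ 2 * n)) :
    g - e - 500 * y ≤ t := by
  -- Here n is the free energy of Ψ, N = m + f that of Ψ + αΘ, a that of αΘ, and w bounds the
  -- interaction of momentum and field. The errors carry τn and τa, where n ≤ 2N + 2a and τa is at
  -- most of order y + τn/200; with τ ≤ 1/1000 the part proportional to N, m and f is absorbed.
  have hN0 : 0 ≤ N := by rw [hN]; positivity
  have hτn : 0 ≤ τ * n := by positivity
  have h2 : τ ^ 2 * n ≤ τ * n / 1000 := by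
    have := mul_le_mul_of_nonneg_right hτ1 hτn
    nlinarith
  have h3 : τ * y ≤ y / 1000 := by
    have := mul_le_mul_of_nonneg_right hτ1 hy
    linarith
  have ha' : a ≤ e + y + 5 * (τ * n) := by linarith
  have h4 : τ * a ≤ y + y / 1000 + 5 * (τ * n / 1000) := by
    have := mul_le_mul_of_nonneg_left ha' hτ.le
    have e1 : τ * (e + y + 5 * (τ * n)) = τ * e + τ * y + 5 * (τ ^ 2 * n) := by ring
    linarith
  have h5 : τ * n ≤ 2 * (τ * N) + 2 * (τ * a) := by
    have := mul_le_mul_of_nonneg_left hnN hτ.le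
    linarith
  have h6 : τ * N ≤ N / 1000 := by
    have := mul_le_mul_of_nonneg_right hτ1 hN0
    linarith
  have h7 : τ * f ≤ f / 1000 := by
    have := mul_le_mul_of_nonneg_right hτ1 hf
    linarith
  have ht' : N - a + g - 14 * (τ * n) - w ≤ t := by linarith
  have hw' : w ≤ m / 2 + 48 * (τ * f) + f / 8 + 144 * (τ * a) + 36 * (τ * n)
      + 36 * (y + τ ^ 2 * n) := by linarith
  linarith

end Reals

section Abstract

variable {H : Type*} [NormedAddCommGroup H] [InnerProductSpace ℂ H]

theorem norm_sq_le_two_mul (α : ℝ) (x y : H) :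
    ‖x‖ ^ 2 ≤ 2 * ‖x + (α : ℂ) • y‖ ^ 2 + 2 * (α ^ 2 * ‖y‖ ^ 2) := by
  have h := norm_add_sq_le (x + (α : ℂ) • y) (-((α : ℂ) • y)) one_pos
  rw [add_neg_cancel_right, norm_neg, norm_real_smul_sq, inv_one, one_add_one_eq_two] at h
  exact h

/-- The interaction of the momentum with the field, in terms of the corrected state. -/
theorem neg_re_inner_interaction_le {Λ α r u v : ℝ} (hΛ : 0 < Λ) (hα : 0 < α) (hr0 : 0 ≤ r)
    (hr2 : r ^ 2 = α) {m m' y y' : H} (b : ‖y + (α : ℂ) • y'‖ ^ 2 ≤ Λ * u)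
    (b' : ‖y'‖ ^ 2 ≤ Λ * v) :
    -(4 * r * (inner ℂ m y).re) ≤ ‖m + (α : ℂ) • m'‖ ^ 2 / 2
      + 16 * (α * Λ) * u + u / 24 + 16 * (α * Λ) * (α ^ 2 * v)
      + 96 * (α * Λ) * (α ^ 2 * ‖m'‖ ^ 2) - 4 * r * α ^ 2 * (inner ℂ m' y').re := by
  -- Expansion around the corrected vectors m + αm' and y + αy', which are controlled by the
  -- corrected energy. The last term, of order α², is kept for the overlap estimate.
  have e1 : inner ℂ m y = inner ℂ (m + (α : ℂ) • m') (y + (α : ℂ) • y')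
      - (α : ℂ) * inner ℂ (m + (α : ℂ) • m') y'
      - (α : ℂ) * inner ℂ m' (y + (α : ℂ) • y') + (α : ℂ) ^ 2 * inner ℂ m' y' := by
    simp only [inner_add_left, inner_add_right, inner_smul_left, inner_smul_right,
      Complex.conj_ofReal]
    ring
  have y1 := young_add_le (r := r) (a := 1) (c := 1 / 4) (x := ‖m + (α : ℂ) • m'‖)
    (y := ‖y + (α : ℂ) • y'‖) (by norm_num)
  have y2 := young_add_le (r := r) (a := α) (c := 1 / 4) (x := ‖m + (α : ℂ) • m'‖)
    (y := ‖y'‖) (by norm_num)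
  -- The weight is chosen so that ‖y + αy'‖² ≤ Λu costs only u/24, that is u/8 for three
  -- coordinates.
  have y3 := young_add_le (r := r) (a := α) (c := 1 / (24 * Λ)) (x := ‖y + (α : ℂ) • y'‖)
    (y := ‖m'‖) (by positivity)
  rw [hr2] at y1 y2 y3
  have z1 := mul_le_mul_of_nonneg_left (neg_re_inner_le (m + (α : ℂ) • m')
    (y + (α : ℂ) • y')) hr0
  have z2 := mul_le_mul_of_nonneg_left (re_inner_le (m + (α : ℂ) • m') y')
    (mul_nonneg hr0 hα.le)
  have z3 := mul_le_mul_of_nonneg_left (re_inner_le m' (y + (α : ℂ) • y'))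
    (mul_nonneg hr0 hα.le)
  rw [mul_comm ‖m'‖] at z3
  have w1 := mul_le_mul_of_nonneg_left b hα.le
  have w2 := mul_le_mul_of_nonneg_left b' (pow_nonneg hα.le 3)
  have w3 : 1 / (24 * Λ) * ‖y + (α : ℂ) • y'‖ ^ 2 ≤ u / 24 := by
    refine (mul_le_mul_of_nonneg_left b (by positivity)).trans_eq ?_
    field_simp
  have i1 : (1 / 4 : ℝ)⁻¹ = 4 := by norm_num
  have i2 : (1 / (24 * Λ))⁻¹ = 24 * Λ := by rw [one_div, inv_inv]
  rw [i1] at y1 y2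
  rw [i2] at y3
  rw [e1, Complex.add_re, Complex.sub_re, Complex.sub_re, Complex.re_ofReal_mul,
    Complex.re_ofReal_mul, ← Complex.ofReal_pow, Complex.re_ofReal_mul]
  linarith

/-- The critical power α^{5/2}Λ³ splits as α^{3/2}Λ² times αΛ: the square of the first, with p², is
the allowed error α³Λ⁴p², and the square of the second is absorbed by the free energy. -/
theorem neg_mul_le_of_norm_le {Λ α r p f n : ℝ} {z : ℂ} (hΛ : 0 < Λ) (hα : 0 < α)
    (hr : r = Real.sqrt α) (hsmall : α * Λ ≤ 1 / 1000) (hfn : f ^ 2 ≤ n)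
    (hz : ‖z‖ ≤ 18 * Λ ^ 3 * (p * f) + 9 * (Λ ^ 2 * Real.sqrt Λ) * n) :
    -(4 * r * α ^ 2 * z.re)
      ≤ 36 * (α * Λ) * n + 36 * (α ^ 3 * Λ ^ 4 * p ^ 2 + (α * Λ) ^ 2 * n) := by
  have hr2 : r ^ 2 = α := by rw [hr, Real.sq_sqrt hα.le]
  have hr0 : 0 ≤ r := by rw [hr]; exact Real.sqrt_nonneg _
  have hn : 0 ≤ n := (sq_nonneg f).trans hfn
  have h1 := (neg_le_abs _).trans ((Complex.abs_re_le_norm _).trans hz)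
  have h2 := mul_le_mul_of_nonneg_left h1 (show 0 ≤ 4 * r * α ^ 2 by positivity)
  have h3 : r * Real.sqrt Λ ≤ 1 := by
    rw [hr, ← Real.sqrt_mul hα.le]
    exact Real.sqrt_le_one.2 (by linarith)
  have h4 : 4 * r * α ^ 2 * (9 * (Λ ^ 2 * Real.sqrt Λ) * n) ≤ 36 * (α * Λ) * n := by
    have h5 : 4 * r * α ^ 2 * (9 * (Λ ^ 2 * Real.sqrt Λ) * n)
        = 36 * (α * Λ) * n * ((α * Λ) * (r * Real.sqrt Λ)) := by ring
    rw [h5]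
    refine mul_le_of_le_one_right (by positivity) ?_
    exact mul_le_one₀ (by linarith) (by positivity) h3
  have h7 := sq_nonneg (r * α * Λ ^ 2 * p - α * Λ * f)
  have h8 : (r * α * Λ ^ 2 * p - α * Λ * f) ^ 2 = r ^ 2 * α ^ 2 * Λ ^ 4 * p ^ 2
    - 2 * (r * α ^ 2 * Λ ^ 3 * (p * f)) + (α * Λ) ^ 2 * f ^ 2 := by ring
  rw [h8, hr2] at h7
  have h9 := mul_le_mul_of_nonneg_left hfn (sq_nonneg (α * Λ))
  linarith

/-- The lower bound from the estimates on the corrected state. -/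
theorem lower_bound_abstract {Λ α p E g : ℝ} (hΛ : 0 < Λ) (hα : 0 < α)
    (hsmall : α * Λ ≤ 1 / 1000) {M Y M' Y' : Fin 3 → H} {F F' : H} {s : ℝ} (hE : E ≤ Λ ^ 3)
    (b : ∀ j, ‖Y j + (α : ℂ) • Y' j‖ ^ 2 ≤ Λ * ‖F + (α : ℂ) • F'‖ ^ 2)
    (b' : ∀ j, ‖Y' j‖ ^ 2 ≤ Λ * ‖F'‖ ^ 2)
    (hS : (∑ j, inner ℂ (M' j) (M j)).re + (inner ℂ F' F).re
      - 7 * Λ * (∑ j, ‖M j‖ ^ 2 + ‖F‖ ^ 2) ≤ s)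
    (hz : ‖∑ j, inner ℂ (M' j) (Y' j)‖ ≤ 18 * Λ ^ 3 * (p * ‖F‖)
      + 9 * (Λ ^ 2 * Real.sqrt Λ) * (∑ j, ‖M j‖ ^ 2 + ‖F‖ ^ 2))
    (hfree : ∑ j, ‖M' j‖ ^ 2 + ‖F'‖ ^ 2 ≤ (1 + α * Λ) * (E * p ^ 2)
      + (1 + (α * Λ)⁻¹) * (4 * Λ ^ 2 * (∑ j, ‖M j‖ ^ 2 + ‖F‖ ^ 2))) :
    (α * g - α ^ 2 * E - 500 * (α ^ 3 * Λ ^ 4)) * p ^ 2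
      ≤ ∑ j, ‖M j‖ ^ 2 + α * (2 * ∑ j, ‖Y j‖ ^ 2 + g * p ^ 2 + 2 * s)
        + 4 * Real.sqrt α * (∑ j, inner ℂ (M j) (Y j)).re + ‖F‖ ^ 2 := by
  obtain ⟨r, hr⟩ : ∃ r, r = Real.sqrt α := ⟨_, rfl⟩
  rw [← hr]
  have hr2 : r ^ 2 = α := by rw [hr, Real.sq_sqrt hα.le]
  have hr0 : 0 ≤ r := by rw [hr]; exact Real.sqrt_nonneg _
  have hτ : 0 < α * Λ := by positivity
  have hM0 : 0 ≤ ∑ j, ‖M j‖ ^ 2 := by positivity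
  have e3 := neg_mul_le_of_norm_le hΛ hα hr hsmall (le_add_of_nonneg_left hM0) hz
  have e2 := fun j => neg_re_inner_interaction_le (m := M j) (m' := M' j) hΛ hα hr0 hr2
    (b j) (b' j)
  have h2 := mul_le_mul_of_nonneg_left hE (show 0 ≤ α ^ 3 * Λ * p ^ 2 by positivity)
  have hey : α * Λ * (α ^ 2 * E * p ^ 2) ≤ α ^ 3 * Λ ^ 4 * p ^ 2 := by linarith
  have ha : α ^ 2 * (∑ j, ‖M' j‖ ^ 2 + ‖F'‖ ^ 2) ≤ α ^ 2 * E * p ^ 2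
      + α ^ 3 * Λ ^ 4 * p ^ 2
      + (4 * (α * Λ) ^ 2 + 4 * (α * Λ)) * (∑ j, ‖M j‖ ^ 2 + ‖F‖ ^ 2) := by
    have h1 := mul_le_mul_of_nonneg_left hfree (sq_nonneg α)
    have e4 : α ^ 2 * ((1 + α * Λ) * (E * p ^ 2) + (1 + (α * Λ)⁻¹)
        * (4 * Λ ^ 2 * (∑ j, ‖M j‖ ^ 2 + ‖F‖ ^ 2)))
        = α ^ 2 * E * p ^ 2 + α ^ 3 * Λ * p ^ 2 * E
          + (4 * (α * Λ) ^ 2 + 4 * (α * Λ)) * (∑ j, ‖M j‖ ^ 2 + ‖F‖ ^ 2) := by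
      field_simp
    rw [e4] at h1
    linarith
  -- Completing the square: the cross term is the one supplied by D^*·D^*, and α² times the free
  -- energy of Θ has to be subtracted.
  have eN : ∑ j, ‖M j + (α : ℂ) • M' j‖ ^ 2 + ‖F + (α : ℂ) • F'‖ ^ 2
      = ∑ j, ‖M j‖ ^ 2 + ‖F‖ ^ 2
        + 2 * α * ((∑ j, inner ℂ (M' j) (M j)).re + (inner ℂ F' F).re)
        + α ^ 2 * (∑ j, ‖M' j‖ ^ 2 + ‖F'‖ ^ 2) := by
    simp only [norm_sq_add, inner_real_smul_right, norm_real_smul_sq, Fin.sum_univ_three,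
      Complex.add_re, re_inner_comm (M _) (M' _), re_inner_comm F F']
    ring
  have hnN : ∑ j, ‖M j‖ ^ 2 + ‖F‖ ^ 2
      ≤ 2 * (∑ j, ‖M j + (α : ℂ) • M' j‖ ^ 2 + ‖F + (α : ℂ) • F'‖ ^ 2)
        + 2 * (α ^ 2 * (∑ j, ‖M' j‖ ^ 2 + ‖F'‖ ^ 2)) := by
    have h1 := Finset.sum_le_sum fun j (_ : j ∈ Finset.univ) => norm_sq_le_two_mul α (M j) (M' j)
    have h2 := norm_sq_le_two_mul α F F'
    rw [Finset.sum_add_distrib, ← Finset.mul_sum, ← Finset.mul_sum, ← Finset.mul_sum] at h1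
    linarith
  have hw : -(4 * r * (∑ j, inner ℂ (M j) (Y j)).re)
      ≤ (∑ j, ‖M j + (α : ℂ) • M' j‖ ^ 2) / 2 + 48 * (α * Λ) * ‖F + (α : ℂ) • F'‖ ^ 2
        + ‖F + (α : ℂ) • F'‖ ^ 2 / 8
        + 144 * (α * Λ) * (α ^ 2 * (∑ j, ‖M' j‖ ^ 2 + ‖F'‖ ^ 2))
        + 36 * (α * Λ) * (∑ j, ‖M j‖ ^ 2 + ‖F‖ ^ 2) + 36 * (α ^ 3 * Λ ^ 4 * p ^ 2
        + (α * Λ) ^ 2 * (∑ j, ‖M j‖ ^ 2 + ‖F‖ ^ 2)) := by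
    have h0 := e2 0
    have h1 := e2 1
    have h2 := e2 2
    have h3 : 0 ≤ α * Λ * (α ^ 2 * (‖M' 0‖ ^ 2 + ‖M' 1‖ ^ 2 + ‖M' 2‖ ^ 2)) := by positivity
    have h4 : 0 ≤ α * Λ * (α ^ 2 * ‖F'‖ ^ 2) := by positivity
    simp only [Fin.sum_univ_three, Complex.add_re] at e3 ⊢
    linarith
  -- The nonnegative term 2α‖DΨ‖² is dropped.
  have hYY : 0 ≤ α * ∑ j, ‖Y j‖ ^ 2 := by positivity
  have hSα := mul_le_mul_of_nonneg_left hS hα.le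
  have := lower_bound_of_estimates (g := α * g * p ^ 2) hτ hsmall
    (n := ∑ j, ‖M j‖ ^ 2 + ‖F‖ ^ 2) (m := ∑ j, ‖M j + (α : ℂ) • M' j‖ ^ 2)
    (f := ‖F + (α : ℂ) • F'‖ ^ 2)
    (by positivity) (by positivity) (by positivity) rfl (by positivity) hey ha hnN
    (t := ∑ j, ‖M j‖ ^ 2 + α * (2 * ∑ j, ‖Y j‖ ^ 2 + g * p ^ 2 + 2 * s)
      + 4 * r * (∑ j, inner ℂ (M j) (Y j)).re + ‖F‖ ^ 2)
    (by rw [eN]; linarith) hw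
  linarith

end Abstract

section LowerBound

variable {ε : R3 → Fin 2 → R3} {Λ : ℝ}

/-- The lower bound on the energy for small `αΛ`. -/
theorem energy_lower_bound (hε : IsPolarization ε) (hΛ : 0 < Λ) {α : ℝ} (hα : 0 < α)
    (hsmall : α * Λ ≤ 1 / 1000) {Ψ F : StateSpace} {M X Y : Fin 3 → StateSpace}
    (hF : IsSqrtFieldEnergy Ψ F) (hM : ∀ j, IsMomentum j Ψ (M j))
    (hX : ∀ j, IsCreation hε Λ j Ψ (X j)) (hY : ∀ j, IsAnnihilation hε Λ j Ψ (Y j)) :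
    (α * (Λ ^ 2 / Real.pi) - α ^ 2 * pairSelfEnergy ε Λ - 500 * (α ^ 3 * Λ ^ 4)) * ‖Ψ‖ ^ 2
      ≤ ∑ j, ‖M j + (Real.sqrt α : ℂ) • (Y j + X j)‖ ^ 2 + ‖F‖ ^ 2 := by
  have hF' := isSqrtFieldEnergy_pairLift hε Λ hF
  choose Y' hY' using fun j => exists_isAnnihilation hε hΛ j hF'
  -- 7 = 2 + 5: soft pairs contribute 2Λ, passing from D^*·D^* to the free form 5Λ.
  have hS : (∑ j, inner ℂ (pairMomentum hε Λ j Ψ (M j)) (M j)).re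
      + (inner ℂ (pairSqrtEnergy hε Λ Ψ F) F).re
      - 7 * Λ * (∑ j, ‖M j‖ ^ 2 + ‖F‖ ^ 2) ≤ (∑ j, inner ℂ (X j) (Y j)).re := by
    have h1 := (Complex.abs_re_le_norm _).trans
      (norm_sum_inner_isCreation_sub_le hε hΛ hF hX hY)
    have h2 := (Complex.abs_re_le_norm _).trans (norm_inner_pairAmp_sub_le hε hΛ hF hM)
    rw [Complex.sub_re] at h1 h2
    rw [Complex.add_re] at h2
    have h3 : 0 ≤ Λ * ∑ j, ‖M j‖ ^ 2 := by positivity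
    have h4 := (abs_le.1 h1).1
    have h5 := (abs_le.1 h2).1
    linarith
  have hexp := sum_norm_kinetic_sq (M := M) hα.le (fun j => (hX j).norm_sq_eq hΛ (hY j))
    (sum_inner_isCreation_momentum hε hM hX hY)
  rw [sum_integral_coupling_sq hε hΛ] at hexp
  rw [hexp]
  exact lower_bound_abstract hΛ hα hsmall (pairSelfEnergy_le hε hΛ)
    (fun j => ((hY j).add ((hY' j).smul α)).norm_sq_le hΛ (hF.add (hF'.smul α)))
    (fun j => (hY' j).norm_sq_le hΛ hF') hS (norm_sum_inner_pairMomentum_le hε hΛ M Y' hF hY')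
    (pair_free_energy_le hε hΛ Ψ F M (by positivity))

end LowerBound

end

/-! ### Vacuum states and the corrector built on them. -/

section

section Vacuum

theorem isProbabilityMeasure_photonMeasure_zero : IsProbabilityMeasure (photonMeasure 0) := by
  unfold photonMeasure
  rw [Measure.pi_of_empty]
  infer_instance

theorem measurePreserving_fst_sector_zero :
    MeasurePreserving Prod.fst (sectorMeasure 0) (volume : Measure R3) :=
  have := isProbabilityMeasure_photonMeasure_zero
  measurePreserving_fst

theorem isWave_vacuum {f : R3 → ℂ} (hf : Measurable f) (h : MemLp f 2 volume) :
    IsWave fun z : Point 0 => f z.1 where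
  measurable := hf.comp measurable_fst
  symm _ _ := rfl
  memLp := h.comp_measurePreserving measurePreserving_fst_sector_zero

theorem norm_sq_vacuum {f : R3 → ℂ} (hf : Measurable f) (h : MemLp f 2 volume) {ψ : Sector 0}
    (hψ : Represents ψ fun z : Point 0 => f z.1) : ‖ψ‖ ^ 2 = ∫ x, ‖f x‖ ^ 2 := by
  have h1 := hψ.norm_sq_eq
  rw [measurePreserving_fst_sector_zero.lintegral_comp (f := fun x => ‖f x‖ₑ ^ 2)
    (hf.enorm.pow_const 2)] at h1
  have hi : Integrable fun x => ‖f x‖ ^ 2 :=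
    (memLp_two_iff_integrable_sq_norm hf.aestronglyMeasurable).1 h
  have h2 := ofReal_integral_eq_lintegral_ofReal hi (.of_forall fun x => sq_nonneg ‖f x‖)
  have e : ∀ x, ENNReal.ofReal (‖f x‖ ^ 2) = ‖f x‖ₑ ^ 2 := fun x => by
    rw [ENNReal.ofReal_pow (norm_nonneg _), ofReal_norm]
  simp only [e] at h2
  rw [← h2] at h1
  exact (ENNReal.ofReal_eq_ofReal_iff (sq_nonneg _)
    (integral_nonneg fun x => sq_nonneg ‖f x‖)).1 h1

/-- There are vacuum states of arbitrarily small relative kinetic energy. -/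
theorem exists_small_momentum {δ : ℝ} (hδ : 0 < δ) : ∃ (ψ : Sector 0) (m : Fin 3 → Sector 0),
    0 < ‖ψ‖ ∧ (∀ j, SectorMomentum j ψ (m j)) ∧ ∑ j, ‖m j‖ ^ 2 ≤ δ * ‖ψ‖ ^ 2 := by
  let b : ContDiffBump (0 : R3) := ⟨1, 2, one_pos, one_lt_two⟩
  let g : R3 → ℂ := fun x => (b x : ℂ)
  have hg : ContDiff ℝ ∞ g := Complex.ofRealCLM.contDiff.comp b.contDiff
  have hgc : HasCompactSupport g := b.hasCompactSupport.comp_left Complex.ofReal_zero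
  let d : Fin 3 → R3 → ℂ := fun j x => fderiv ℝ g x (EuclideanSpace.single j 1)
  have hgm := memLp_two_of_test hg hgc
  have hg0 : 0 < ∫ x, ‖g x‖ ^ 2 := by
    have hc : Continuous fun x => ‖g x‖ ^ 2 := (hg.continuous.norm).pow 2
    refine hc.integral_pos_of_hasCompactSupport_nonneg_nonzero
      (hgc.norm.comp_left (g := fun t : ℝ => t ^ 2) (by norm_num)) (fun x => by positivity)
      (x := 0) ?_
    have h1 : g 0 = 1 := by
      simp only [g]
      rw [b.one_of_mem_closedBall (Metric.mem_closedBall_self b.rIn_pos.le), Complex.ofReal_one]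
    simp [h1]
  -- Stretching the bump function by 1/t multiplies its relative kinetic energy by t².
  obtain ⟨t, ht0, ht⟩ : ∃ t : ℝ, 0 < t ∧ t ^ 2 * ∑ j, ∫ x, ‖d j x‖ ^ 2 ≤ δ * ∫ x, ‖g x‖ ^ 2 := by
    have hK : 0 ≤ ∑ j, ∫ x, ‖d j x‖ ^ 2 :=
      Finset.sum_nonneg fun j _ => integral_nonneg fun x => by positivity
    refine ⟨Real.sqrt (δ * (∫ x, ‖g x‖ ^ 2) / ((∑ j, ∫ x, ‖d j x‖ ^ 2) + 1)),
      Real.sqrt_pos.2 (by positivity), ?_⟩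
    rw [Real.sq_sqrt (by positivity), div_mul_eq_mul_div, div_le_iff₀ (by positivity)]
    refine mul_le_mul_of_nonneg_left (by linarith) (by positivity)
  have hft : ContDiff ℝ ∞ fun x => g (t • x) := hg.comp (contDiff_const_smul t)
  have hftc : HasCompactSupport fun x => g (t • x) := hgc.comp_smul ht0.ne'
  have hd : ∀ j x, fderiv ℝ (fun x => g (t • x)) x (EuclideanSpace.single j 1)
      = t * d j (t • x) := fun j x => by
    rw [fderiv_comp_smul]
    simp [d]
  have hftm := memLp_two_of_test hft hftc
  have hw := isWave_vacuum hft.continuous.measurable hftm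
  have hmom := fun j => WeakMomentum.of_contDiff j hft hftc
  have hdm : ∀ j, MemLp (fun x => -(Complex.I * fderiv ℝ (fun x => g (t • x)) x
      (EuclideanSpace.single j 1))) 2 volume := fun j =>
    ((memLp_two_fderiv_of_test hft hftc (EuclideanSpace.single j 1)).const_mul Complex.I).neg
  have hdc : ∀ j, Continuous fun x => -(Complex.I * fderiv ℝ (fun x => g (t • x)) x
      (EuclideanSpace.single j 1)) := fun j =>
    (continuous_const.mul ((hft.continuous_fderiv (by simp)).clm_apply continuous_const)).neg
  have hwm := fun j => isWave_vacuum (hdc j).measurable (hdm j)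
  have e1 := norm_sq_vacuum hft.continuous.measurable hftm hw.represents
  have e2 := fun j => norm_sq_vacuum (hdc j).measurable (hdm j) (hwm j).represents
  have s1 := Measure.integral_comp_smul (volume : Measure R3) (fun x => ‖g x‖ ^ 2) t
  have s2 := fun j => Measure.integral_comp_smul (volume : Measure R3) (fun x => ‖d j x‖ ^ 2) t
  have hc : 0 < |(t ^ Module.finrank ℝ R3)⁻¹| := by positivity
  rw [s1, smul_eq_mul] at e1
  refine ⟨hw.toSector, fun j => (hwm j).toSector, ?_, fun j => ?_, ?_⟩
  · refine lt_of_pow_lt_pow_left₀ 2 (norm_nonneg _) ?_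
    rw [e1, zero_pow two_ne_zero]
    positivity
  · rw [sectorMomentum_iff hw.represents (hwm j).represents]
    exact .of_forall fun K => hmom j
  · have e3 : ∀ j, ‖(hwm j).toSector‖ ^ 2
        = |(t ^ Module.finrank ℝ R3)⁻¹| * (t ^ 2 * ∫ x, ‖d j x‖ ^ 2) := fun j => by
      rw [e2 j]
      simp only [hd, norm_neg, norm_mul, Complex.norm_I, one_mul, Complex.norm_real, mul_pow,
        Real.norm_eq_abs, sq_abs, integral_const_mul]
      rw [s2 j, smul_eq_mul]
      ring
    simp only [e3]
    rw [← Finset.mul_sum, ← Finset.mul_sum, e1]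
    calc _ ≤ |(t ^ Module.finrank ℝ R3)⁻¹| * (δ * ∫ x, ‖g x‖ ^ 2) := by gcongr
      _ = _ := by ring

end Vacuum

section UpperBound

variable {ε : R3 → Fin 2 → R3} {Λ : ℝ}

/-- The state with only a vacuum component. -/
def vacuumComponents (ψ : Sector 0) : ∀ n, Sector n
  | 0 => ψ
  | _ + 1 => 0

theorem exists_vacuumState (ψ : Sector 0) : ∃ X : StateSpace, ∀ n, X n = vacuumComponents ψ n := by
  refine exists_state ((summable_nat_add_iff 1).1 ?_)
  simp only [vacuumComponents, norm_zero, ne_eq, two_ne_zero, not_false_eq_true, zero_pow]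
  exact summable_zero

/-- `ψ ⊗ |0⟩` as a state. -/
def vacuumState (ψ : Sector 0) : StateSpace := (exists_vacuumState ψ).choose

theorem vacuumState_zero (ψ : Sector 0) : vacuumState ψ 0 = ψ := (exists_vacuumState ψ).choose_spec 0

theorem vacuumState_succ (ψ : Sector 0) (n : ℕ) : vacuumState ψ (n + 1) = 0 :=
  (exists_vacuumState ψ).choose_spec (n + 1)

theorem norm_sq_vacuumState (ψ : Sector 0) : ‖vacuumState ψ‖ ^ 2 = ‖ψ‖ ^ 2 := by
  have h := hasSum_single (f := fun n => ‖vacuumState ψ n‖ ^ 2) 0 fun n hn => by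
    obtain ⟨m, rfl⟩ := Nat.exists_eq_succ_of_ne_zero hn
    simp only [Nat.succ_eq_add_one, vacuumState_succ, norm_zero]
    norm_num
  simp only [vacuumState_zero] at h
  exact (hasSum_norm_sq _).unique h

theorem isSqrtFieldEnergy_vacuumState (ψ : Sector 0) : IsSqrtFieldEnergy (vacuumState ψ) 0 := by
  rw [isSqrtFieldEnergy_iff]
  intro n
  match n with
  | 0 =>
    obtain ⟨u, hu⟩ := exists_represents (vacuumState ψ 0)
    exact SqrtEnergy.of_represents hu Represents.zero
      (.of_forall fun z => by simp [fieldEnergy])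
  | n + 1 => rw [vacuumState_succ]; exact SqrtEnergy.zero

theorem isMomentum_vacuumState {j : Fin 3} {ψ m : Sector 0} (h : SectorMomentum j ψ m) :
    IsMomentum j (vacuumState ψ) (vacuumState m) := by
  rw [isMomentum_iff]
  intro n
  match n with
  | 0 => rw [vacuumState_zero, vacuumState_zero]; exact h
  | n + 1 => rw [vacuumState_succ, vacuumState_succ]; exact SectorMomentum.zero

theorem isAnnihilation_vacuumState (hε : IsPolarization ε) (Λ : ℝ) (j : Fin 3) (ψ : Sector 0) :
    IsAnnihilation hε Λ j (vacuumState ψ) 0 := fun n => by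
  rw [vacuumState_succ, map_zero]
  rfl

theorem pairLift_vacuumState_add_three {κ : Mode × Mode × ℝ → ℝ} {b : Mode × Mode → ℝ}
    (hκ : IsPairKernel κ b) (ψ : Sector 0) (n : ℕ) : pairLift hκ (vacuumState ψ) (n + 3) = 0 := by
  rw [show n + 3 = (n + 1) + 2 from rfl, pairLift_add_two, vacuumState_succ]
  obtain h := norm_pairOp_sq_le hκ (0 : Sector (n + 1))
  rw [norm_zero, zero_pow two_ne_zero, mul_zero] at h
  exact norm_eq_zero.1 (pow_eq_zero_iff two_ne_zero |>.1 (le_antisymm h (sq_nonneg _)))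

theorem inner_eq_zero_of_comp {X Y : StateSpace} (h : ∀ n, inner ℂ (X n) (Y n) = 0) :
    inner ℂ X Y = 0 :=
  (lp.inner_eq_tsum X Y).trans ((tsum_congr h).trans tsum_zero)

/-- States with even photon number are orthogonal to states with one photon. -/
theorem inner_pairMomentum_annihilation (hε : IsPolarization ε) {j : Fin 3}
    (ψ m : Sector 0) {Y : StateSpace}
    (hY : IsAnnihilation hε Λ j (pairLift (isPairKernel_phi hε Λ) (vacuumState ψ)) Y) :
    inner ℂ (vacuumState m) Y = 0 ∧
      inner ℂ (pairMomentum hε Λ j (vacuumState ψ) (vacuumState m)) Y = 0 := by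
  have h0 : Y 0 = 0 := by rw [hY 0, pairLift_one, map_zero]
  have h2 : ∀ n, Y (n + 2) = 0 := fun n => by
    rw [hY (n + 2)]
    exact (congrArg _ (pairLift_vacuumState_add_three _ ψ n)).trans (map_zero _)
  constructor
  · refine inner_eq_zero_of_comp fun n => ?_
    match n with
    | 0 => rw [h0, inner_zero_right]
    | n + 1 => rw [vacuumState_succ, inner_zero_left]
  · refine inner_eq_zero_of_comp fun n => ?_
    match n with
    | 0 => rw [h0, inner_zero_right]
    | 1 =>
      rw [pairMomentum, lp.coeFn_sub, Pi.sub_apply, pairLift_one, pairLift_one, sub_zero,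
        inner_zero_left]
    | n + 2 => rw [h2, inner_zero_right]

theorem inner_vacuumState_pairMomentum (hε : IsPolarization ε) {j : Fin 3} (ψ m m' : Sector 0) :
    inner ℂ (vacuumState m') (pairMomentum hε Λ j (vacuumState ψ) (vacuumState m)) = 0 := by
  refine inner_eq_zero_of_comp fun n => ?_
  match n with
  | 0 =>
    rw [pairMomentum, lp.coeFn_sub, Pi.sub_apply, pairLift_zero, pairLift_zero, sub_zero,
      inner_zero_right]
  | n + 1 => rw [vacuumState_succ, inner_zero_left]

theorem inner_vacuumState_pairLift {κ : Mode × Mode × ℝ → ℝ} {b : Mode × Mode → ℝ}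
    (hκ : IsPairKernel κ b) (m : Sector 0) (Ψ : StateSpace) :
    inner ℂ (vacuumState m) (pairLift hκ Ψ) = 0 := by
  refine inner_eq_zero_of_comp fun n => ?_
  match n with
  | 0 => rw [pairLift_zero, inner_zero_right]
  | n + 1 => rw [vacuumState_succ, inner_zero_left]

/-- The pairing with `D^* · D^*` in the trial state. -/
theorem inner_pairAmp_trial (hε : IsPolarization ε) (Λ α : ℝ) (ψ : Sector 0) :
    inner ℂ (pairLift (isPairKernel_pairAmp hε Λ) (vacuumState ψ
        + ((-α : ℝ) : ℂ) • pairLift (isPairKernel_phi hε Λ) (vacuumState ψ)))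
      (vacuumState ψ + ((-α : ℝ) : ℂ) • pairLift (isPairKernel_phi hε Λ) (vacuumState ψ))
      = ((-α * (pairSelfEnergy ε Λ * ‖ψ‖ ^ 2) : ℝ) : ℂ) := by
  have h := hasSum_inner_pairLift (isPairKernel_pairAmp hε Λ)
    (vacuumState ψ + ((-α : ℝ) : ℂ) • pairLift (isPairKernel_phi hε Λ) (vacuumState ψ))
    (vacuumState ψ + ((-α : ℝ) : ℂ) • pairLift (isPairKernel_phi hε Λ) (vacuumState ψ))
  have e : ∀ n, (vacuumState ψ
      + ((-α : ℝ) : ℂ) • pairLift (isPairKernel_phi hε Λ) (vacuumState ψ)) (n + 2)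
      = ((-α : ℝ) : ℂ) • pairLift (isPairKernel_phi hε Λ) (vacuumState ψ) (n + 2) := fun n => by
    rw [lp.coeFn_add, Pi.add_apply, vacuumState_succ, zero_add]
    rfl
  refine h.unique ?_
  have e0 : (vacuumState ψ
      + ((-α : ℝ) : ℂ) • pairLift (isPairKernel_phi hε Λ) (vacuumState ψ)) 0 = ψ := by
    rw [lp.coeFn_add, Pi.add_apply, lp.coeFn_smul, Pi.smul_apply, pairLift_zero, smul_zero,
      add_zero, vacuumState_zero]
  have h1 : inner ℂ (pairOp (isPairKernel_pairAmp hε Λ) ((vacuumState ψ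
      + ((-α : ℝ) : ℂ) • pairLift (isPairKernel_phi hε Λ) (vacuumState ψ)) 0)) ((vacuumState ψ
      + ((-α : ℝ) : ℂ) • pairLift (isPairKernel_phi hε Λ) (vacuumState ψ)) (0 + 2))
      = ((-α * (pairSelfEnergy ε Λ * ‖ψ‖ ^ 2) : ℝ) : ℂ) := by
    rw [e, e0, pairLift_add_two, vacuumState_zero, Complex.ofReal_mul,
      ← inner_pairOp_pairOp_zero hε Λ ψ]
    exact inner_smul_right (pairOp (isPairKernel_pairAmp hε Λ) ψ)
      (pairOp (isPairKernel_phi hε Λ) ψ) ((-α : ℝ) : ℂ)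
  rw [← h1]
  -- The trial state has only zero and two photons, so only the passage from the vacuum to two
  -- photons counts.
  refine hasSum_single 0 fun n hn => ?_
  obtain ⟨m, rfl⟩ := Nat.exists_eq_succ_of_ne_zero hn
  rw [e]
  have h3 : pairLift (isPairKernel_phi hε Λ) (vacuumState ψ) (m.succ + 2) = 0 :=
    pairLift_vacuumState_add_three _ ψ m
  rw [h3, smul_zero, inner_zero_right]

end UpperBound

end

/-! ### The upper bound. -/

section

section Trial

variable {ε : R3 → Fin 2 → R3} {Λ : ℝ}

/-- The arithmetic of the upper bound: `P` is the norm of the trial state, `x` that of the vacuum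
part, `T` the free energy of the hard pair. -/
theorem upper_bound_of_estimates {Λ α E g P x n T f Y S t : ℝ} (hΛ : 0 < Λ) (hα : 0 < α)
    (hsmall : α * Λ ≤ 1) (hE0 : 0 ≤ E) (hE : E ≤ Λ ^ 3) (hx : 0 ≤ x) (hn : 0 ≤ n)
    (hf : f ≤ T) (hxP : x ≤ P) (hP : P ≤ x + α ^ 2 * (4 * Λ ^ 2 * x))
    (hfree : T ≤ (1 + α * Λ) * (E * x) + (1 + (α * Λ)⁻¹) * (4 * Λ ^ 2 * n))
    (hY : Y ≤ 3 * (α ^ 2 * (Λ * f)))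
    (hS : S ≤ -α * (E * x) + 2 * Λ * (α ^ 2 * f))
    (ht : t ≤ n + α ^ 2 * T + α * (2 * Y + g * P + 2 * S)) :
    t ≤ (α * g - α ^ 2 * E + 25 * (α ^ 3 * Λ ^ 4)) * P + 89 * n := by
  have hτ : 0 < α * Λ := by positivity
  have hy : 0 ≤ α ^ 3 * Λ ^ 4 * x := by positivity
  have hey : α * Λ * (α ^ 2 * E * x) ≤ α ^ 3 * Λ ^ 4 * x := by
    have h := mul_le_mul_of_nonneg_left hE (show 0 ≤ α ^ 3 * Λ * x by positivity)
    linarith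
  have hT1 : α ^ 2 * T ≤ α ^ 2 * E * x + α ^ 3 * Λ ^ 4 * x + 8 * n := by
    have h := mul_le_mul_of_nonneg_left hfree (sq_nonneg α)
    have e : α ^ 2 * ((1 + α * Λ) * (E * x) + (1 + (α * Λ)⁻¹) * (4 * Λ ^ 2 * n))
        = α ^ 2 * E * x + α * Λ * (α ^ 2 * E * x) + (4 * ((α * Λ) * (α * Λ)) + 4 * (α * Λ)) * n := by
      field_simp
    have h2 : (α * Λ) * (α * Λ) ≤ 1 := mul_le_one₀ hsmall hτ.le hsmall
    have h3 : (4 * ((α * Λ) * (α * Λ)) + 4 * (α * Λ)) * n ≤ 8 * n := by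
      gcongr
      linarith
    rw [e] at h
    linarith
  have hT2 : α * Λ * (α ^ 2 * T) ≤ 2 * (α ^ 3 * Λ ^ 4 * x) + 8 * n := by
    have h := mul_le_mul_of_nonneg_left hT1 hτ.le
    have h2 := mul_le_of_le_one_left hy hsmall
    have h3 := mul_le_of_le_one_left hn hsmall
    linarith
  have hf2 : α * Λ * (α ^ 2 * f) ≤ α * Λ * (α ^ 2 * T) := by gcongr
  have hY2 := mul_le_mul_of_nonneg_left hY hα.le
  have hS2 := mul_le_mul_of_nonneg_left hS hα.le
  have hEP : α ^ 2 * E * P ≤ α ^ 2 * E * x + 4 * (α ^ 3 * Λ ^ 4 * x) := by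
    have h := mul_le_mul_of_nonneg_left hP (show 0 ≤ α ^ 2 * E by positivity)
    have h2 := mul_le_mul_of_nonneg_left hey hτ.le
    have h3 := mul_le_of_le_one_left hy hsmall
    linarith
  have hyP : α ^ 3 * Λ ^ 4 * x ≤ α ^ 3 * Λ ^ 4 * P := by gcongr
  -- In terms of n and y = α³Λ⁴x: 89 = 1 + 8 + 6·8 + 4·8, from n, T, Y and S, and 25 = 1 + 6·2 + 4·2
  -- + 4, the last from replacing x by P in the second order term.
  linarith

/-- Different photon numbers make the cross terms vanish, including the interaction of momentum and
field. The free energy of the pair gives +α²E and the pairing with D^*·D^* gives -2α²E, in all -α²E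
up to errors. -/
theorem trial_energy_le {H : Type*} [NormedAddCommGroup H] [InnerProductSpace ℂ H] {Λ α E x : ℝ}
    (hΛ : 0 < Λ) (hα : 0 < α) (hsmall : α * Λ ≤ 1) (hE0 : 0 ≤ E) (hE : E ≤ Λ ^ 3) {c : ℂ}
    (hc : c = ((-α : ℝ) : ℂ)) {ψ θ F' : H} {m M' X Y' : Fin 3 → H} {γ : Fin 3 → ℝ}
    (hx : ‖ψ‖ ^ 2 = x) (hψθ : inner ℂ ψ θ = 0) (hm : ∀ j, inner ℂ (m j) (M' j) = 0)
    (hmY : ∀ j, inner ℂ (m j) (Y' j) = 0) (hMY : ∀ j, inner ℂ (M' j) (Y' j) = 0)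
    (hθ : ‖θ‖ ≤ 2 * Λ * ‖ψ‖) (hY : ∀ j, ‖Y' j‖ ^ 2 ≤ Λ * ‖F'‖ ^ 2)
    (hX : ∀ j, ‖X j‖ ^ 2 = γ j * ‖ψ + c • θ‖ ^ 2 + ‖0 + c • Y' j‖ ^ 2)
    (hXM : ∑ j, inner ℂ (X j) (m j + c • M' j) = ∑ j, inner ℂ (m j + c • M' j) (0 + c • Y' j))
    (hS : ‖∑ j, inner ℂ (X j) (0 + c • Y' j) - ((-α * (E * x) : ℝ) : ℂ)‖
      ≤ 2 * Λ * (‖0 + c • F'‖ * ‖0 + c • F'‖))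
    (hfree : ∑ j, ‖M' j‖ ^ 2 + ‖F'‖ ^ 2 ≤ (1 + α * Λ) * (E * ‖ψ‖ ^ 2)
      + (1 + (α * Λ)⁻¹) * (4 * Λ ^ 2 * (∑ j, ‖m j‖ ^ 2 + ‖(0 : H)‖ ^ 2))) :
    ∑ j, ‖(m j + c • M' j) + (Real.sqrt α : ℂ) • ((0 + c • Y' j) + X j)‖ ^ 2 + ‖0 + c • F'‖ ^ 2
      ≤ (α * ∑ j, γ j - α ^ 2 * E + 25 * (α ^ 3 * Λ ^ 4)) * ‖ψ + c • θ‖ ^ 2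
        + 89 * ∑ j, ‖m j‖ ^ 2 := by
  subst hc
  have hP : ‖ψ + ((-α : ℝ) : ℂ) • θ‖ ^ 2 = ‖ψ‖ ^ 2 + α ^ 2 * ‖θ‖ ^ 2 := by
    rw [norm_sq_add, inner_real_smul_right, hψθ, norm_real_smul_sq]
    simp
  have hMn : ∀ j, ‖m j + ((-α : ℝ) : ℂ) • M' j‖ ^ 2 = ‖m j‖ ^ 2 + α ^ 2 * ‖M' j‖ ^ 2 :=
    fun j => by
      rw [norm_sq_add, inner_real_smul_right, hm, norm_real_smul_sq]
      simp
  have hFn : ‖0 + ((-α : ℝ) : ℂ) • F'‖ ^ 2 = α ^ 2 * ‖F'‖ ^ 2 := by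
    rw [zero_add, norm_real_smul_sq, neg_sq]
  have hYn : ∀ j, ‖0 + ((-α : ℝ) : ℂ) • Y' j‖ ^ 2 ≤ α ^ 2 * (Λ * ‖F'‖ ^ 2) := fun j => by
    rw [zero_add, norm_real_smul_sq, neg_sq]
    exact mul_le_mul_of_nonneg_left (hY j) (sq_nonneg α)
  have hMY' : ∀ j, inner ℂ (m j + ((-α : ℝ) : ℂ) • M' j) (0 + ((-α : ℝ) : ℂ) • Y' j) = 0 :=
    fun j => by
      rw [zero_add, inner_smul_right, inner_add_left, inner_smul_left, hmY, hMY]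
      simp
  have hS' := (le_abs_self _).trans ((Complex.abs_re_le_norm _).trans hS)
  rw [Complex.sub_re, Complex.ofReal_re, ← sq, hFn] at hS'
  have hexp := sum_norm_kinetic_sq (M := fun j => m j + ((-α : ℝ) : ℂ) • M' j) hα.le hX hXM
  simp only [hMY', hMn] at hexp
  have hθ2 := pow_le_pow_left₀ (norm_nonneg _) hθ 2
  rw [mul_pow, mul_pow, hx] at hθ2
  rw [norm_zero, zero_pow two_ne_zero, add_zero, hx] at hfree
  rw [hx] at hP
  refine upper_bound_of_estimates hΛ hα hsmall hE0 hE (hx ▸ sq_nonneg ‖ψ‖)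
    (Finset.sum_nonneg fun j _ => sq_nonneg ‖m j‖)
    (T := ∑ j, ‖M' j‖ ^ 2 + ‖F'‖ ^ 2) (f := ‖F'‖ ^ 2)
    (le_add_of_nonneg_left (Finset.sum_nonneg fun j _ => sq_nonneg _)) ?_ ?_ hfree
    (Y := ∑ j, ‖0 + ((-α : ℝ) : ℂ) • Y' j‖ ^ 2) ?_
    (S := (∑ j, inner ℂ (X j) (0 + ((-α : ℝ) : ℂ) • Y' j)).re) (by linarith) ?_
  · rw [hP]
    exact le_add_of_nonneg_right (by positivity)
  · rw [hP]
    have := mul_le_mul_of_nonneg_left hθ2 (sq_nonneg α)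
    linarith
  · have h0 := hYn 0
    have h1 := hYn 1
    have h2 := hYn 2
    rw [Fin.sum_univ_three]
    linarith
  · rw [hFn, hexp, Finset.sum_add_distrib, ← Finset.mul_sum]
    simp only [Finset.sum_const_zero, Complex.zero_re, mul_zero, add_zero]
    linarith

/-- The trial states for the upper bound. -/
theorem exists_trial_state (hε : IsPolarization ε) (hΛ : 0 < Λ) {α : ℝ} (hα : 0 < α)
    (hsmall : α * Λ ≤ 1) {δ : ℝ} (hδ : 0 < δ) :
    ∃ (Ψ F : StateSpace) (M X Y : Fin 3 → StateSpace), 0 < ‖Ψ‖ ∧ IsSqrtFieldEnergy Ψ F ∧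
      (∀ j, IsMomentum j Ψ (M j)) ∧ (∀ j, IsCreation hε Λ j Ψ (X j)) ∧
      (∀ j, IsAnnihilation hε Λ j Ψ (Y j)) ∧
      ∑ j, ‖M j + (Real.sqrt α : ℂ) • (Y j + X j)‖ ^ 2 + ‖F‖ ^ 2
        ≤ (α * (Λ ^ 2 / Real.pi) - α ^ 2 * pairSelfEnergy ε Λ + 25 * (α ^ 3 * Λ ^ 4) + δ)
          * ‖Ψ‖ ^ 2 := by
  -- δ/89 compensates the factor 89 of the kinetic energy in `trial_energy_le`.
  obtain ⟨ψ, m, hψ, hm, hδm⟩ := exists_small_momentum (show 0 < δ / 89 by positivity)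
  have hF0 := isSqrtFieldEnergy_vacuumState ψ
  have hM0 := fun j => isMomentum_vacuumState (hm j)
  have hFΘ := isSqrtFieldEnergy_pairLift hε Λ hF0
  have hMΘ := fun j => isMomentum_pairLift hε Λ (hM0 j)
  choose YΘ hYΘ using fun j => exists_isAnnihilation hε hΛ j hFΘ
  obtain ⟨c, hc⟩ : ∃ c : ℂ, c = ((-α : ℝ) : ℂ) := ⟨_, rfl⟩
  have hF := hF0.add (hFΘ.smul c)
  have hM := fun j => (hM0 j).add ((hMΘ j).smul c)
  have hY := fun j => (isAnnihilation_vacuumState hε Λ j ψ).add ((hYΘ j).smul c)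
  choose X hX using fun j => exists_isCreation hε hΛ j (hY j)
  have hMY := fun j => inner_pairMomentum_annihilation hε ψ (m j) (hYΘ j)
  have hS := norm_sum_inner_isCreation_sub_le hε hΛ hF hX hY
  have hpair := inner_pairAmp_trial hε Λ α ψ
  rw [← hc] at hpair
  rw [hpair] at hS
  have key := trial_energy_le hΛ hα hsmall (pairSelfEnergy_nonneg ε Λ) (pairSelfEnergy_le hε hΛ) hc
    (norm_sq_vacuumState ψ) (inner_vacuumState_pairLift _ ψ _)
    (fun j => inner_vacuumState_pairMomentum hε ψ (m j) (m j)) (fun j => (hMY j).1)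
    (fun j => (hMY j).2) (norm_pairLift_phi_le hε hΛ (vacuumState ψ))
    (fun j => (hYΘ j).norm_sq_le hΛ hFΘ) (fun j => (hX j).norm_sq_eq hΛ (hY j))
    (sum_inner_isCreation_momentum hε hM hX hY) hS
    (pair_free_energy_le hε hΛ (vacuumState ψ) 0 (fun j => vacuumState (m j))
      (show 0 < α * Λ by positivity))
  rw [sum_integral_coupling_sq hε hΛ] at key
  simp only [norm_sq_vacuumState] at key
  have hPx : ‖ψ‖ ^ 2
      ≤ ‖vacuumState ψ + c • pairLift (isPairKernel_phi hε Λ) (vacuumState ψ)‖ ^ 2 := by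
    rw [norm_sq_add, norm_sq_vacuumState, inner_smul_right, inner_vacuumState_pairLift, mul_zero,
      Complex.zero_re, mul_zero, add_zero]
    exact le_add_of_nonneg_right (sq_nonneg _)
  refine ⟨_, _, _, X, _, ?_, hF, hM, hX, hY, key.trans ?_⟩
  · refine lt_of_pow_lt_pow_left₀ 2 (norm_nonneg _) ?_
    rw [zero_pow two_ne_zero]
    exact lt_of_lt_of_le (by positivity) hPx
  · have h := mul_le_mul_of_nonneg_left hPx hδ.le
    linarith

end Trial

end

/-! ### Closedness of the form. -/

section

variable {n : ℕ}

section Closed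

open Filter Topology

/-- Functions converging to zero in `L¹` converge to zero almost everywhere along a subsequence. -/
theorem exists_subseq_ae_tendsto_zero {X : Type*} [MeasurableSpace X] {μ : Measure X}
    {I : ℕ → X → ENNReal} (hm : ∀ k, Measurable (I k))
    (h : Tendsto (fun k => ∫⁻ x, I k x ∂μ) atTop (𝓝 0)) :
    ∃ φ : ℕ → ℕ, StrictMono φ ∧ ∀ᵐ x ∂μ, Tendsto (fun k => I (φ k) x) atTop (𝓝 0) := by
  -- Along a subsequence the integrals are below 2^{-k}, so the sum of the functions is integrable,
  -- and its terms tend to zero almost everywhere.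
  have h1 : ∀ k : ℕ, ∀ᶠ i in atTop, ∫⁻ x, I i x ∂μ ≤ (2⁻¹ : ENNReal) ^ k := fun k =>
    (h.eventually_lt_const (ENNReal.pow_pos (by simp) k)).mono fun i hi => hi.le
  obtain ⟨φ, hφ, h2⟩ := extraction_forall_of_eventually h1
  refine ⟨φ, hφ, ?_⟩
  have h3 : ∫⁻ x, ∑' k, I (φ k) x ∂μ ≠ ⊤ := by
    rw [lintegral_tsum fun k => (hm (φ k)).aemeasurable]
    refine ne_top_of_le_ne_top ?_ (ENNReal.tsum_le_tsum h2)
    rw [ENNReal.tsum_geometric]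
    simp
  filter_upwards [ae_lt_top (Measurable.tsum fun k => hm (φ k)) h3] with x hx
  exact ENNReal.tendsto_atTop_zero_of_tsum_ne_top hx.ne

theorem tendsto_lintegral_sub_sq {ψ : ℕ → Sector n} {ψ' : Sector n} {u : ℕ → Point n → ℂ}
    {u' : Point n → ℂ} (hu : ∀ k, Represents (ψ k) (u k)) (hu' : Represents ψ' u')
    (h : Tendsto ψ atTop (𝓝 ψ')) :
    Tendsto (fun k => ∫⁻ z, ‖u k z - u' z‖ₑ ^ 2 ∂(sectorMeasure n)) atTop (𝓝 0) := by
  have h1 : Tendsto (fun k => ENNReal.ofReal (‖ψ k - ψ'‖ ^ 2)) atTop (𝓝 0) := by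
    have h2 := (tendsto_iff_norm_sub_tendsto_zero.1 h).pow 2
    rw [zero_pow two_ne_zero] at h2
    simpa using ENNReal.tendsto_ofReal h2
  exact h1.congr fun k => ((hu k).sub hu').norm_sq_eq

theorem tendsto_zero_of_sq {x : ℕ → ENNReal} (h : Tendsto (fun k => x k ^ 2) atTop (𝓝 0)) :
    Tendsto x atTop (𝓝 0) := by
  have h1 := ((ENNReal.continuous_rpow_const (y := (1 / 2 : ℝ))).tendsto 0).comp h
  rw [ENNReal.zero_rpow_of_pos (by norm_num)] at h1
  refine h1.congr fun k => ?_
  rw [Function.comp_apply, ← ENNReal.rpow_natCast, ← ENNReal.rpow_mul]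
  norm_num

theorem tendsto_of_enorm_sub_sq {x : ℕ → ℂ} {y : ℂ}
    (h : Tendsto (fun k => ‖x k - y‖ₑ ^ 2) atTop (𝓝 0)) : Tendsto x atTop (𝓝 y) := by
  have h1 := tendsto_zero_of_sq h
  refine tendsto_iff_edist_tendsto_0.2 (h1.congr fun k => ?_)
  rw [edist_eq_enorm_sub]

/-- A pointwise relation survives L² limits along a subsequence on which both sequences converge
almost everywhere. -/
theorem SqrtEnergy.of_tendsto {ψ f : ℕ → Sector n} {ψ' f' : Sector n}
    (h : ∀ k, SqrtEnergy (ψ k) (f k)) (h1 : Tendsto ψ atTop (𝓝 ψ'))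
    (h2 : Tendsto f atTop (𝓝 f')) : SqrtEnergy ψ' f' := by
  choose u hu using fun k => exists_represents (ψ k)
  choose v hv using fun k => exists_represents (f k)
  obtain ⟨u', hu'⟩ := exists_represents ψ'
  obtain ⟨v', hv'⟩ := exists_represents f'
  have t1 := tendsto_lintegral_sub_sq hu hu' h1
  have t2 := tendsto_lintegral_sub_sq hv hv' h2
  have m1 : ∀ k, Measurable fun z => ‖u k z - u' z‖ₑ ^ 2 := fun k =>
    ((hu k).wave.measurable.sub hu'.wave.measurable).enorm.pow_const 2
  have m2 : ∀ k, Measurable fun z => ‖v k z - v' z‖ₑ ^ 2 := fun k =>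
    ((hv k).wave.measurable.sub hv'.wave.measurable).enorm.pow_const 2
  obtain ⟨φ, hφ, a1⟩ := exists_subseq_ae_tendsto_zero m1 t1
  obtain ⟨χ, hχ, a2⟩ := exists_subseq_ae_tendsto_zero (fun k => m2 (φ k))
    (t2.comp hφ.tendsto_atTop)
  have a3 := ae_all_iff.2 fun k => (h k).ae_eq (hu k) (hv k)
  refine SqrtEnergy.of_represents hu' hv' ?_
  filter_upwards [a1, a2, a3] with z b1 b2 b3
  have c1 := tendsto_of_enorm_sub_sq (b1.comp hχ.tendsto_atTop)
  have c2 := tendsto_of_enorm_sub_sq b2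
  refine tendsto_nhds_unique c2 ((c1.const_mul (Real.sqrt (fieldEnergy z.2) : ℂ)).congr fun k => ?_)
  exact (b3 _).symm

/-- Along a subsequence the slices at almost every photon configuration converge in L²(ℝ³), and the
weak derivative on slices is closed. -/
theorem SectorMomentum.of_tendsto {j : Fin 3} {ψ m : ℕ → Sector n} {ψ' m' : Sector n}
    (h : ∀ k, SectorMomentum j (ψ k) (m k)) (h1 : Tendsto ψ atTop (𝓝 ψ'))
    (h2 : Tendsto m atTop (𝓝 m')) : SectorMomentum j ψ' m' := by
  choose u hu using fun k => exists_represents (ψ k)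
  choose v hv using fun k => exists_represents (m k)
  obtain ⟨u', hu'⟩ := exists_represents ψ'
  obtain ⟨v', hv'⟩ := exists_represents m'
  have t1 := tendsto_lintegral_sub_sq hu hu' h1
  have t2 := tendsto_lintegral_sub_sq hv hv' h2
  have m1 : ∀ k, Measurable fun z => ‖u k z - u' z‖ₑ ^ 2 := fun k =>
    ((hu k).wave.measurable.sub hu'.wave.measurable).enorm.pow_const 2
  have m2 : ∀ k, Measurable fun z => ‖v k z - v' z‖ₑ ^ 2 := fun k =>
    ((hv k).wave.measurable.sub hv'.wave.measurable).enorm.pow_const 2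
  simp only [sectorMeasure, lintegral_prod_symm _ (m1 _).aemeasurable] at t1
  simp only [sectorMeasure, lintegral_prod_symm _ (m2 _).aemeasurable] at t2
  obtain ⟨φ, hφ, a1⟩ := exists_subseq_ae_tendsto_zero (fun k => (m1 k).lintegral_prod_left') t1
  obtain ⟨χ, hχ, a2⟩ := exists_subseq_ae_tendsto_zero (fun k => (m2 (φ k)).lintegral_prod_left')
    (t2.comp hφ.tendsto_atTop)
  have a3 := ae_all_iff.2 fun k => (sectorMomentum_iff (hu k) (hv k)).1 (h k)
  have l1 := ae_all_iff.2 fun k => ae_memLp_slice (hu k).wave.measurable (hu k).wave.memLp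
  have l2 := ae_all_iff.2 fun k => ae_memLp_slice (hv k).wave.measurable (hv k).wave.memLp
  refine (sectorMomentum_iff hu' hv').2 ?_
  filter_upwards [a1, a2, a3, l1, l2, ae_memLp_slice hu'.wave.measurable hu'.wave.memLp,
    ae_memLp_slice hv'.wave.measurable hv'.wave.memLp] with K b1 b2 b3 b4 b5 b6 b7
  refine WeakMomentum.of_tendsto (fun k => b3 (φ (χ k))) (fun k => b4 (φ (χ k)))
    (fun k => b5 (φ (χ k))) b6 b7 (tendsto_zero_of_sq ?_) (tendsto_zero_of_sq ?_)
  · refine (b1.comp hχ.tendsto_atTop).congr fun k => ?_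
    rw [eLpNorm_two_sq]
    rfl
  · refine b2.congr fun k => ?_
    rw [eLpNorm_two_sq]
    rfl

theorem tendsto_component {Ψ : ℕ → StateSpace} {Ψ' : StateSpace} (h : Tendsto Ψ atTop (𝓝 Ψ'))
    (n : ℕ) : Tendsto (fun k => Ψ k n) atTop (𝓝 (Ψ' n)) :=
  ((lp.lipschitzWith_one_eval 2 n).continuous.tendsto Ψ').comp h

theorem IsSqrtFieldEnergy.of_tendsto {Ψ F : ℕ → StateSpace} {Ψ' F' : StateSpace}
    (h : ∀ k, IsSqrtFieldEnergy (Ψ k) (F k)) (h1 : Tendsto Ψ atTop (𝓝 Ψ'))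
    (h2 : Tendsto F atTop (𝓝 F')) : IsSqrtFieldEnergy Ψ' F' :=
  isSqrtFieldEnergy_iff.2 fun n => SqrtEnergy.of_tendsto
    (fun k => isSqrtFieldEnergy_iff.1 (h k) n) (tendsto_component h1 n) (tendsto_component h2 n)

theorem IsMomentum.of_tendsto {j : Fin 3} {Ψ M : ℕ → StateSpace} {Ψ' M' : StateSpace}
    (h : ∀ k, IsMomentum j (Ψ k) (M k)) (h1 : Tendsto Ψ atTop (𝓝 Ψ'))
    (h2 : Tendsto M atTop (𝓝 M')) : IsMomentum j Ψ' M' :=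
  isMomentum_iff.2 fun n => SectorMomentum.of_tendsto
    (fun k => isMomentum_iff.1 (h k) n) (tendsto_component h1 n) (tendsto_component h2 n)

end Closed

/-! ### The form graph and the infimum of its Rayleigh quotients. -/

section FormGraph

open Filter Topology

variable {ε : R3 → Fin 2 → R3} {Λ : ℝ}

theorem IsCreation.add {hε : IsPolarization ε} {j : Fin 3} {Ψ X Ψ' X' : StateSpace}
    (h : IsCreation hε Λ j Ψ X) (h' : IsCreation hε Λ j Ψ' X') :
    IsCreation hε Λ j (Ψ + Ψ') (X + X') := by
  refine ⟨?_, fun n => ?_⟩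
  · simp only [lp.coeFn_add, Pi.add_apply, h.1, h'.1, add_zero]
  · simp only [lp.coeFn_add, Pi.add_apply, map_add, h.2 n, h'.2 n]

theorem IsCreation.smul {hε : IsPolarization ε} {j : Fin 3} {Ψ X : StateSpace}
    (h : IsCreation hε Λ j Ψ X) (c : ℂ) : IsCreation hε Λ j (c • Ψ) (c • X) := by
  refine ⟨?_, fun n => ?_⟩
  · simp only [lp.coeFn_smul, Pi.smul_apply, h.1, smul_zero]
  · simp only [lp.coeFn_smul, Pi.smul_apply, map_smul, h.2 n]

/-- The form data in terms of annihilation and creation parts of the vector potential. -/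
theorem isFormData_iff (hε : IsPolarization ε) (hΛ : 0 < Λ) {α : ℝ} {Ψ F : StateSpace}
    {V : Fin 3 → StateSpace} : IsFormData ε Λ α Ψ V F ↔ IsSqrtFieldEnergy Ψ F ∧
      ∃ M X Y : Fin 3 → StateSpace, (∀ j, IsMomentum j Ψ (M j)) ∧
        (∀ j, IsCreation hε Λ j Ψ (X j)) ∧ (∀ j, IsAnnihilation hε Λ j Ψ (Y j)) ∧
        ∀ j, V j = M j + (Real.sqrt α : ℂ) • (Y j + X j) := by
  constructor
  · rintro ⟨hF, hK⟩
    choose M B hM hB hV using hK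
    choose Y hY using fun j => exists_isAnnihilation hε hΛ j hF
    choose X hX using fun j => exists_isCreation hε hΛ j (hY j)
    refine ⟨hF, M, X, Y, hM, hX, hY, fun j => ?_⟩
    rw [hV j, (isVectorPotential_iff hΛ (hX j) (hY j) (B j)).1 (hB j)]
  · rintro ⟨hF, M, X, Y, hM, hX, hY, hV⟩
    exact ⟨hF, fun j => ⟨M j, Y j + X j, hM j,
      (isVectorPotential_iff hΛ (hX j) (hY j) _).2 rfl, hV j⟩⟩

theorem IsFormData.add (hε : IsPolarization ε) (hΛ : 0 < Λ) {α : ℝ} {Ψ F Ψ' F' : StateSpace}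
    {V V' : Fin 3 → StateSpace} (h : IsFormData ε Λ α Ψ V F) (h' : IsFormData ε Λ α Ψ' V' F') :
    IsFormData ε Λ α (Ψ + Ψ') (fun j => V j + V' j) (F + F') := by
  obtain ⟨hF, M, X, Y, hM, hX, hY, hV⟩ := (isFormData_iff hε hΛ).1 h
  obtain ⟨hF', M', X', Y', hM', hX', hY', hV'⟩ := (isFormData_iff hε hΛ).1 h'
  refine (isFormData_iff hε hΛ).2 ⟨hF.add hF', _, _, _, fun j => (hM j).add (hM' j),
    fun j => (hX j).add (hX' j), fun j => (hY j).add (hY' j), fun j => ?_⟩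
  rw [hV, hV']
  module

theorem IsFormData.smul (hε : IsPolarization ε) (hΛ : 0 < Λ) {α : ℝ} {Ψ F : StateSpace}
    {V : Fin 3 → StateSpace} (h : IsFormData ε Λ α Ψ V F) (c : ℂ) :
    IsFormData ε Λ α (c • Ψ) (fun j => c • V j) (c • F) := by
  obtain ⟨hF, M, X, Y, hM, hX, hY, hV⟩ := (isFormData_iff hε hΛ).1 h
  refine (isFormData_iff hε hΛ).2 ⟨hF.smul c, _, _, _, fun j => (hM j).smul c,
    fun j => (hX j).smul c, fun j => (hY j).smul c, fun j => ?_⟩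
  rw [hV]
  module

/-- Only the sum p Ψ + √α A Ψ is assumed to converge. The annihilation part is controlled by
H_f^{1/2}Ψ and the creation part by this and Ψ, so A Ψ converges, and with it pΨ as a difference. -/
theorem IsFormData.of_tendsto (hε : IsPolarization ε) (hΛ : 0 < Λ) {α : ℝ}
    {Ψ F : ℕ → StateSpace} {V : ℕ → Fin 3 → StateSpace} {Ψ' F' : StateSpace}
    {V' : Fin 3 → StateSpace} (h : ∀ k, IsFormData ε Λ α (Ψ k) (V k) (F k))
    (h1 : Tendsto Ψ atTop (𝓝 Ψ')) (h2 : ∀ j, Tendsto (fun k => V k j) atTop (𝓝 (V' j)))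
    (h3 : Tendsto F atTop (𝓝 F')) : IsFormData ε Λ α Ψ' V' F' := by
  choose hF M X Y hM hX hY hV using fun k => (isFormData_iff hε hΛ).1 (h k)
  have hF' : IsSqrtFieldEnergy Ψ' F' := .of_tendsto hF h1 h3
  choose Y' hY' using fun j => exists_isAnnihilation hε hΛ j hF'
  choose X' hX' using fun j => exists_isCreation hε hΛ j (hY' j)
  have e : ∀ a b : StateSpace, a - b = a + (-1 : ℂ) • b := fun a b => by module
  have t1 := (tendsto_iff_norm_sub_tendsto_zero.1 h1).pow 2
  have t3 := (tendsto_iff_norm_sub_tendsto_zero.1 h3).pow 2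
  rw [zero_pow two_ne_zero] at t1 t3
  have hYs : ∀ j k, IsAnnihilation hε Λ j (Ψ k - Ψ') (Y k j - Y' j) := fun j k => by
    rw [e, e]; exact (hY k j).add ((hY' j).smul _)
  have hXs : ∀ j k, IsCreation hε Λ j (Ψ k - Ψ') (X k j - X' j) := fun j k => by
    rw [e, e]; exact (hX k j).add ((hX' j).smul _)
  have hFs : ∀ k, IsSqrtFieldEnergy (Ψ k - Ψ') (F k - F') := fun k => by
    rw [e, e]; exact (hF k).add (hF'.smul _)
  have tY2 : ∀ j, Tendsto (fun k => ‖Y k j - Y' j‖ ^ 2) atTop (𝓝 0) := fun j => by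
    refine squeeze_zero (fun k => sq_nonneg _) (fun k => (hYs j k).norm_sq_le hΛ (hFs k)) ?_
    simpa using t3.const_mul Λ
  have tX2 : ∀ j, Tendsto (fun k => ‖X k j - X' j‖ ^ 2) atTop (𝓝 0) := fun j => by
    have t4 := (t1.const_mul (∫ q, coupling ε Λ j q ^ 2 ∂modeMeasure)).add (tY2 j)
    rw [mul_zero, add_zero] at t4
    exact t4.congr fun k => ((hXs j k).norm_sq_eq hΛ (hYs j k)).symm
  have sq : ∀ x : ℕ → StateSpace, ∀ x', Tendsto (fun k => ‖x k - x'‖ ^ 2) atTop (𝓝 0) →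
      Tendsto x atTop (𝓝 x') := fun x x' hx => by
    refine tendsto_iff_norm_sub_tendsto_zero.2 ?_
    have := hx.sqrt
    simpa only [Real.sqrt_sq (norm_nonneg _), Real.sqrt_zero] using this
  have tY := fun j => sq _ _ (tY2 j)
  have tX := fun j => sq _ _ (tX2 j)
  refine (isFormData_iff hε hΛ).2 ⟨hF', fun j => V' j - (Real.sqrt α : ℂ) • (Y' j + X' j), X', Y',
    fun j => IsMomentum.of_tendsto (fun k => hM k j) h1 ?_, hX', hY',
    fun j => (sub_add_cancel _ _).symm⟩
  refine ((h2 j).sub (((tY j).add (tX j)).const_smul (Real.sqrt α : ℂ))).congr fun k => ?_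
  rw [hV k j]
  exact add_sub_cancel_right _ _

/-- The values `((p + √α A) Ψ, H_f^{1/2} Ψ)`. -/
abbrev FormSpace : Type := WithLp 2 (PiLp 2 (fun _ : Fin 3 => StateSpace) × StateSpace)

/-- The graph of `Ψ ↦ ((p + √α A) Ψ, H_f^{1/2} Ψ)`. -/
def formGraph (hε : IsPolarization ε) (hΛ : 0 < Λ) (α : ℝ) :
    Submodule ℂ (WithLp 2 (StateSpace × FormSpace)) where
  carrier := {w | IsFormData ε Λ α w.fst (fun j => w.snd.fst j) w.snd.snd}
  add_mem' h h' := IsFormData.add hε hΛ h h'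
  zero_mem' := by
    have hF : IsSqrtFieldEnergy 0 0 := isSqrtFieldEnergy_iff.2 fun n => SqrtEnergy.zero
    have h : IsFormData ε Λ α 0 (fun _ => 0) 0 :=
      (isFormData_iff hε hΛ).2 ⟨hF, fun _ => 0, fun _ => 0, fun _ => 0,
        fun j => isMomentum_iff.2 fun n => SectorMomentum.zero,
        fun j => ⟨rfl, fun n => (map_zero _).symm⟩, fun j n => (map_zero _).symm, fun j => by simp⟩
    exact h
  smul_mem' c w h := IsFormData.smul hε hΛ h c

theorem isClosed_formGraph (hε : IsPolarization ε) (hΛ : 0 < Λ) (α : ℝ) :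
    IsClosed (formGraph hε hΛ α : Set (WithLp 2 (StateSpace × FormSpace))) := by
  refine isSeqClosed_iff_isClosed.1 fun w w' hw hlim => ?_
  have c1 : Continuous fun w : WithLp 2 (StateSpace × FormSpace) => w.fst := by fun_prop
  have c2 : Continuous fun w : WithLp 2 (StateSpace × FormSpace) => w.snd.snd := by fun_prop
  have c3 : ∀ j : Fin 3, Continuous fun w : WithLp 2 (StateSpace × FormSpace) => w.snd.fst j :=
    fun j => by fun_prop
  exact IsFormData.of_tendsto hε hΛ hw ((c1.tendsto w').comp hlim)
    (fun j => ((c3 j).tendsto w').comp hlim) ((c2.tendsto w').comp hlim)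

theorem inner_formSpace (w v : FormSpace) :
    inner ℂ w v = ∑ j, inner ℂ (w.fst j) (v.fst j) + inner ℂ w.snd v.snd := by
  rw [WithLp.prod_inner_apply]
  congr 1

theorem norm_sq_formSpace (v : FormSpace) : ‖v‖ ^ 2 = ∑ j, ‖v.fst j‖ ^ 2 + ‖v.snd‖ ^ 2 := by
  rw [WithLp.prod_norm_sq_eq_of_L2, PiLp.norm_sq_eq_of_L2]

/-- The vector in the form space with given components. -/
def formVector (V : Fin 3 → StateSpace) (F : StateSpace) : FormSpace :=
  WithLp.toLp 2 (WithLp.toLp 2 V, F)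

theorem formVector_mem (hε : IsPolarization ε) (hΛ : 0 < Λ) {α : ℝ} {Ψ F : StateSpace}
    {V : Fin 3 → StateSpace} :
    WithLp.toLp 2 (Ψ, formVector V F) ∈ formGraph hε hΛ α ↔ IsFormData ε Λ α Ψ V F := Iff.rfl

theorem mem_formGraph_iff (hε : IsPolarization ε) (hΛ : 0 < Λ) {α : ℝ} {Ψ : StateSpace}
    {v : FormSpace} : WithLp.toLp 2 (Ψ, v) ∈ formGraph hε hΛ α
      ↔ IsFormData ε Λ α Ψ (fun j => v.fst j) v.snd := Iff.rfl

theorem formOperator_formGraph (hε : IsPolarization ε) (hΛ : 0 < Λ) (α : ℝ) :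
    formOperator (formGraph hε hΛ α) = selfEnergyGraph ε Λ α := by
  ext ⟨Ψ, η⟩
  constructor
  · rintro ⟨v, hv, h⟩
    refine ⟨fun j => v.fst j, v.snd, (mem_formGraph_iff hε hΛ).1 hv, fun Φ W E hΦ => ?_⟩
    have h1 := h Φ (formVector W E) ((formVector_mem hε hΛ).2 hΦ)
    rw [inner_formSpace] at h1
    exact h1
  · rintro ⟨V, F, hv, h⟩
    refine ⟨formVector V F, (formVector_mem hε hΛ).2 hv, fun Φ w hw => ?_⟩
    rw [inner_formSpace]
    exact h Φ _ _ ((mem_formGraph_iff hε hΛ).1 hw)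

/-- The infimum of the spectrum is the infimum of the quadratic form. -/
theorem isGLB_selfEnergySpectrum (hε : IsPolarization ε) (hΛ : 0 < Λ) {α m : ℝ} (hm0 : 0 ≤ m)
    (hm : ∀ Ψ V F, IsFormData ε Λ α Ψ V F → m * ‖Ψ‖ ^ 2 ≤ ∑ j, ‖V j‖ ^ 2 + ‖F‖ ^ 2)
    (hm' : ∀ δ > 0, ∃ Ψ V F, IsFormData ε Λ α Ψ V F ∧ Ψ ≠ 0 ∧
      ∑ j, ‖V j‖ ^ 2 + ‖F‖ ^ 2 ≤ (m + δ) * ‖Ψ‖ ^ 2) :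
    IsGLB (selfEnergySpectrum ε Λ α) m := by
  have h := isGLB_formOperator_spectrum (formGraph hε hΛ α) (isClosed_formGraph hε hΛ α) m hm0
    (fun Ψ v hv => by
      rw [norm_sq_formSpace]
      exact hm Ψ _ _ ((mem_formGraph_iff hε hΛ).1 hv))
    (fun δ hδ => by
      obtain ⟨Ψ, V, F, h1, h2, h3⟩ := hm' δ hδ
      refine ⟨Ψ, formVector V F, (formVector_mem hε hΛ).2 h1, h2, ?_⟩
      rw [norm_sq_formSpace]
      exact h3)
  rw [formOperator_formGraph] at h
  exact h

/-- The infimum of the Rayleigh quotients `t / x`, `P x t`. -/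
theorem exists_rayleigh_inf {P : ℝ → ℝ → Prop} {l u : ℝ} (h0 : ∀ x t, P x t → 0 ≤ x ∧ 0 ≤ t)
    (hl : ∀ x t, P x t → l * x ≤ t) (hu : ∀ δ > 0, ∃ x t, P x t ∧ 0 < x ∧ t ≤ (u + δ) * x) :
    ∃ m, 0 ≤ m ∧ l ≤ m ∧ m ≤ u ∧ (∀ x t, P x t → m * x ≤ t) ∧
      ∀ δ > 0, ∃ x t, P x t ∧ 0 < x ∧ t ≤ (m + δ) * x := by
  let Q : Set ℝ := {E | ∃ x t, P x t ∧ 0 < x ∧ E = t / x}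
  have hQ0 : ∀ E ∈ Q, 0 ≤ E := by
    rintro _ ⟨x, t, h, _, rfl⟩
    exact div_nonneg (h0 x t h).2 (h0 x t h).1
  have hbdd : BddBelow Q := ⟨0, hQ0⟩
  have hmem : ∀ δ > 0, ∃ E ∈ Q, E ≤ u + δ := fun δ hδ => by
    obtain ⟨x, t, h1, h2, h3⟩ := hu δ hδ
    exact ⟨_, ⟨x, t, h1, h2, rfl⟩, (div_le_iff₀ h2).2 h3⟩
  have hne : Q.Nonempty := by
    obtain ⟨E, hE, _⟩ := hmem 1 one_pos
    exact ⟨E, hE⟩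
  refine ⟨sInf Q, le_csInf hne hQ0, le_csInf hne ?_, le_of_forall_pos_le_add fun δ hδ => ?_,
    fun x t h => ?_, fun δ hδ => ?_⟩
  · rintro _ ⟨x, t, h1, h2, rfl⟩
    exact (le_div_iff₀ h2).2 (hl x t h1)
  · obtain ⟨E, hE, hEu⟩ := hmem δ hδ
    exact (csInf_le hbdd hE).trans hEu
  · rcases eq_or_lt_of_le (h0 x t h).1 with hx | hx
    · rw [← hx, mul_zero]
      exact (h0 x t h).2
    · exact (le_div_iff₀ hx).1 (csInf_le hbdd ⟨x, t, h, hx, rfl⟩)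
  · obtain ⟨E, ⟨x, t, h1, h2, rfl⟩, hE⟩ := exists_lt_of_csInf_lt hne (lt_add_of_pos_right _ hδ)
    exact ⟨x, t, h1, h2, ((div_lt_iff₀ h2).1 hE).le⟩

/-- The infimum of the spectrum lies between a lower bound on the quadratic form and the energies
of trial states. -/
theorem exists_isGLB_selfEnergySpectrum (hε : IsPolarization ε) (hΛ : 0 < Λ) {α l u : ℝ}
    (hl : ∀ Ψ V F, IsFormData ε Λ α Ψ V F → l * ‖Ψ‖ ^ 2 ≤ ∑ j, ‖V j‖ ^ 2 + ‖F‖ ^ 2)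
    (hu : ∀ δ > 0, ∃ Ψ V F, IsFormData ε Λ α Ψ V F ∧ 0 < ‖Ψ‖ ∧
      ∑ j, ‖V j‖ ^ 2 + ‖F‖ ^ 2 ≤ (u + δ) * ‖Ψ‖ ^ 2) :
    ∃ m, IsGLB (selfEnergySpectrum ε Λ α) m ∧ l ≤ m ∧ m ≤ u := by
  obtain ⟨m, hm0, hlm, hmu, h1, h2⟩ := exists_rayleigh_inf (l := l) (u := u)
    (P := fun x t => ∃ Ψ V F, IsFormData ε Λ α Ψ V F ∧ ‖Ψ‖ ^ 2 = x ∧ ∑ j, ‖V j‖ ^ 2 + ‖F‖ ^ 2 = t)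
    (fun x t ⟨Ψ, V, F, _, hx, ht⟩ => ⟨hx ▸ sq_nonneg _,
      ht ▸ add_nonneg (Finset.sum_nonneg fun j _ => sq_nonneg _) (sq_nonneg _)⟩)
    (fun x t ⟨Ψ, V, F, h, hx, ht⟩ => hx ▸ ht ▸ hl Ψ V F h)
    (fun δ hδ => by
      obtain ⟨Ψ, V, F, h1, h2, h3⟩ := hu δ hδ
      exact ⟨_, _, ⟨Ψ, V, F, h1, rfl, rfl⟩, pow_pos h2 2, h3⟩)
  refine ⟨m, isGLB_selfEnergySpectrum hε hΛ hm0
    (fun Ψ V F h => h1 _ _ ⟨Ψ, V, F, h, rfl, rfl⟩) (fun δ hδ => ?_), hlm, hmu⟩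
  obtain ⟨x, t, ⟨Ψ, V, F, h, rfl, rfl⟩, hx, ht⟩ := h2 δ hδ
  refine ⟨Ψ, V, F, h, ?_, ht⟩
  rintro rfl
  rw [norm_zero, zero_pow two_ne_zero] at hx
  exact lt_irrefl _ hx

end FormGraph

/-! ### Conclusion, with a case distinction in αΛ. -/

section MainBound

variable {ε : R3 → Fin 2 → R3} {Λ : ℝ}

/-- Vacuum states, for the bound on the energy at large coupling. -/
theorem exists_vacuum_trial_state (hε : IsPolarization ε) (hΛ : 0 < Λ) {α : ℝ} (hα : 0 < α)
    {δ : ℝ} (hδ : 0 < δ) : ∃ Ψ V F, IsFormData ε Λ α Ψ V F ∧ 0 < ‖Ψ‖ ∧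
      ∑ j, ‖V j‖ ^ 2 + ‖F‖ ^ 2 ≤ (α * (Λ ^ 2 / Real.pi) + δ) * ‖Ψ‖ ^ 2 := by
  obtain ⟨ψ, m, hψ, hm, hδm⟩ := exists_small_momentum hδ
  have hM := fun j => isMomentum_vacuumState (hm j)
  have hY := fun j => isAnnihilation_vacuumState hε Λ j ψ
  choose X hX using fun j => exists_isCreation hε hΛ j (hY j)
  have hexp := sum_norm_kinetic_sq (M := fun j => vacuumState (m j)) hα.le
    (fun j => (hX j).norm_sq_eq hΛ (hY j)) (sum_inner_isCreation_momentum hε hM hX hY)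
  have hψ' : ‖vacuumState ψ‖ = ‖ψ‖ :=
    (sq_eq_sq₀ (norm_nonneg _) (norm_nonneg _)).1 (norm_sq_vacuumState ψ)
  refine ⟨vacuumState ψ, _, 0, (isFormData_iff hε hΛ).2 ⟨isSqrtFieldEnergy_vacuumState ψ, _, X, _,
    hM, hX, hY, fun j => rfl⟩, by rwa [hψ'], ?_⟩
  rw [hexp, sum_integral_coupling_sq hε hΛ]
  simp only [norm_sq_vacuumState, inner_zero_right, norm_zero, Finset.sum_const_zero,
    Complex.zero_re]
  linarith

/-- Two-sided bounds on the ground state energy. -/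
theorem exists_isGLB_and_abs_le (hε : IsPolarization ε) (hΛ : 0 < Λ) {α : ℝ} (hα : 0 < α) :
    ∃ m, IsGLB (selfEnergySpectrum ε Λ α) m ∧
      |m - α * (Λ ^ 2 / Real.pi) + α ^ 2 * pairSelfEnergy ε Λ| ≤ 10 ^ 6 * (α ^ 3 * Λ ^ 4) := by
  have hτ : 0 < α * Λ := by positivity
  have hy : 0 < α ^ 3 * Λ ^ 4 := by positivity
  rcases le_or_gt (α * Λ) (1 / 1000) with h | h
  · obtain ⟨m, hm, hl, hu⟩ := exists_isGLB_selfEnergySpectrum hε hΛ (α := α)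
      (l := α * (Λ ^ 2 / Real.pi) - α ^ 2 * pairSelfEnergy ε Λ - 500 * (α ^ 3 * Λ ^ 4))
      (u := α * (Λ ^ 2 / Real.pi) - α ^ 2 * pairSelfEnergy ε Λ + 25 * (α ^ 3 * Λ ^ 4))
      (fun Ψ V F hV => by
        obtain ⟨hF, M, X, Y, hM, hX, hY, hV⟩ := (isFormData_iff hε hΛ).1 hV
        simp only [hV]
        exact energy_lower_bound hε hΛ hα h hF hM hX hY)
      (fun δ hδ => by
        obtain ⟨Ψ, F, M, X, Y, h0, hF, hM, hX, hY, hle⟩ :=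
          exists_trial_state hε hΛ hα (by linarith) hδ
        exact ⟨Ψ, _, F, (isFormData_iff hε hΛ).2 ⟨hF, M, X, Y, hM, hX, hY, fun j => rfl⟩, h0, hle⟩)
    refine ⟨m, hm, abs_le.2 ⟨?_, ?_⟩⟩ <;> linarith
  -- For αΛ > 1/1000 the energy lies between 0 and αΛ²/π, and both αΛ² and α²Λ³ are at most 10⁶
  -- α³Λ⁴, where 10⁶ = 1000².
  · obtain ⟨m, hm, hl, hu⟩ := exists_isGLB_selfEnergySpectrum hε hΛ (α := α) (l := 0)
      (u := α * (Λ ^ 2 / Real.pi))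
      (fun Ψ V F _ => by rw [zero_mul]; positivity)
      (fun δ hδ => exists_vacuum_trial_state hε hΛ hα hδ)
    refine ⟨m, hm, ?_⟩
    have h1 : α * (Λ ^ 2 / Real.pi) ≤ 10 ^ 6 * (α ^ 3 * Λ ^ 4) := by
      have h2 : (1 : ℝ) ≤ (1000 * (α * Λ)) ^ 2 := one_le_pow₀ (by linarith)
      have h3 := mul_le_mul_of_nonneg_left (sq_div_pi_le Λ) hα.le
      have h4 := mul_le_mul_of_nonneg_left h2 (show 0 ≤ α * Λ ^ 2 by positivity)
      linarith
    have h5 : α ^ 2 * pairSelfEnergy ε Λ ≤ 10 ^ 6 * (α ^ 3 * Λ ^ 4) := by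
      have h2 : (1 : ℝ) ≤ 10 ^ 6 * (α * Λ) := by linarith
      have h3 := mul_le_mul_of_nonneg_left (pairSelfEnergy_le hε hΛ) (sq_nonneg α)
      have h4 := mul_le_mul_of_nonneg_left h2 (show 0 ≤ α ^ 2 * Λ ^ 3 by positivity)
      linarith
    have h6 : 0 ≤ α ^ 2 * pairSelfEnergy ε Λ :=
      mul_nonneg (sq_nonneg α) (pairSelfEnergy_nonneg ε Λ)
    exact abs_le.2 ⟨by linarith, by linarith⟩

end MainBound

end

end PauliFierz

end

theorem theorem1 :
    ∃ C : ℝ, 0 < C ∧ ∃ α₀ : ℝ, 0 < α₀ ∧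
      ∀ ε : PauliFierz.R3 → Fin 2 → PauliFierz.R3, PauliFierz.IsPolarization ε →
      ∀ Λ : ℝ, 0 < Λ → ∀ α : ℝ, 0 < α → α < α₀ →
        ∃ Sig : ℝ, IsGLB (PauliFierz.selfEnergySpectrum ε Λ α) Sig ∧
          ‖(Sig : ℂ) - α * (Real.pi : ℂ)⁻¹ * Λ ^ 2
              + α ^ 2 * PauliFierz.secondOrderEnergy ε Λ‖ ≤ C * α ^ 3 * Λ ^ 4 := by
  refine ⟨10 ^ 6, by norm_num, 1, one_pos, fun ε hε Λ hΛ α hα _ => ?_⟩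
  obtain ⟨m, hm, hle⟩ := PauliFierz.exists_isGLB_and_abs_le hε hΛ hα
  refine ⟨m, hm, ?_⟩
  have e : (m : ℂ) - α * (Real.pi : ℂ)⁻¹ * Λ ^ 2 + α ^ 2 * PauliFierz.secondOrderEnergy ε Λ
      = ((m - α * (Λ ^ 2 / Real.pi) + α ^ 2 * PauliFierz.pairSelfEnergy ε Λ : ℝ) : ℂ) := by
    rw [PauliFierz.secondOrderEnergy_eq hε]
    push_cast
    ring
  rw [e, Complex.norm_real, Real.norm_eq_abs]
  exact hle.trans_eq (by ring)
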